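/- Let $U\subseteq\mathbb R^d$ be open with a smooth real vielbein $e^a_\mu$, metric $g_{\mu\nu}=\eta_{ab}e^a_\mu e^b_\nu$ ($\eta=\mathrm{diag}(-,+,\dots,+)$), Levi-Civita connection $\nabla$, torsion-free spin connection $\omega_{\mu ab}$, and curvature $[\nabla_\mu,\nabla_\nu]V^\lambda=R_{\mu\nu}{}^\lambda{}_\rho V^\rho$, $R_{\mu\nu}=R_{\lambda\mu}{}^\lambda{}_\nu$, $R=R^\mu{}_\mu$. For flavors $i=1,\dots,\mathcal N/2$, let the wavefunctions be polynomials in odd variables $\psi^a_i,\theta_i,c$ and even variables $\gamma_i,\beta_i$ with coefficients in $C^\infty(U,\mathbb C)$. Set $\bar\psi^{a\,i}=\eta^{ab}\partial/\partial\psi^b_i$, $\bar\theta^i=\partial/\partial\theta_i$, $b=\partial/\partial c$, $\bar\gamma^i=-\partial/\partial\beta_i$, $\psi^\mu_i=e^\mu_a\psi^a_i$, $\bar\psi^{\mu i}=e^\mu_a\bar\psi^{a i}$; a dot denotes summation over the flavors. Put $$\hat\nabla_\mu=\partial_\mu+\omega_{\mu ab}\,\psi^a\cdot\bar\psi^b,\quad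 \nabla^2=g^{\mu\nu}(\hat\nabla_\mu\hat\nabla_\nu-\Gamma^\lambda_{\mu\nu}\hat\nabla_\lambda),\quad S^\mu=\bar\gamma\cdot\psi^\mu+\gamma\cdot\bar\psi^\mu,\quad \rho=\bar\gamma\cdot\theta+\gamma\cdot\bar\theta,$$ $$\mathfrak R=R_{\mu\nu\lambda\sigma}\,\psi^\mu\cdot\bar\psi^\nu\,\psi^\lambda\cdot\bar\psi^\sigma+\kappa R,\quad \mathcal D=\nabla^2-m^2+\mathfrak R,\quad \boldsymbol\nabla=-iS^\mu\hat\nabla_\mu+m\rho,\quad Q=c\,\mathcal D+\boldsymbol\nabla+\bar\gamma\cdot\gamma\,b,$$ with $m\in\mathbb R$. The constraints $\mathcal T_\alpha$ are: for each $i$, $N_{\psi_i}+N_{\theta_i}+N_{\gamma_i}+N_{\beta_i}-1$; and, for $\mathcal N=4$, also $\mathcal Y=\psi_1\!\cdot\!\frac{\partial}{\partial\psi_2}+\theta_1\frac{\partial}{\partial\theta_2}+\gamma_1\frac{\partial}{\partial\gamma_2}+\beta_1\frac{\partial}{\partial\beta_2}$ and $\mathrm{Tr}=\frac{\partial^2}{\partial\psi_1\cdot\partial\psi_2}+\frac{\partial^2}{\partial\theta_1\partial\theta_2}+\frac{\partial^2}{\partial\gamma_1\partial\beta_2}-\frac{\partial^2}{\partial\gamma_2\partial\beta_1}$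 (here the dot is contraction with $\eta$). The reduced space is $\mathcal H_{\rm red}=\ker\mathcal T_\alpha$. A model is called consistent if $[Q,\mathcal T_\alpha]=0$ and $Q^2=0$ on $\mathcal H_{\rm red}$. (1) *Massive $\mathcal N=4$ model* ($d=4$, $\kappa=\tfrac12$), on any background. One has $[Q,\mathcal T_\alpha]=0$ and $$Q^2=\boldsymbol\nabla^2+\bar\gamma\cdot\gamma\,\mathcal D+c\,[\mathcal D,\boldsymbol\nabla],\qquad \boldsymbol\nabla^2+\bar\gamma\cdot\gamma\,\mathcal D=-\tfrac12S^\mu S^\nu R_{\mu\nu\lambda\sigma}\psi^\lambda\cdot\bar\psi^\sigma+\bar\gamma\cdot\gamma\,\mathfrak R,$$ and $[\mathcal D,\boldsymbol\nabla]$ and $Q^2$ do not depend on $m$: the mass does not explicitly obstruct nilpotency. If $R_{\mu\nu}=\lambda g_{\mu\nu}$ with a constant $\lambda$, then on $\mathcal H_{\rm red}$ $$[\mathcal D,\boldsymbol\nabla]=0,\qquad Q^2=\boldsymbol\nabla^2+\bar\gamma\cdot\gamma\,\mathcal D=-\tfrac12\,\bar\gamma\cdot\gamma\,(\psi^\mu\cdot\bar\psi_\mu-1)R;$$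 in particular, $Q^2$ maps a sum of the states $\Psi$ and $\Lambda$ of (2) (with parameters $\zeta_\mu,\Phi$ in place of $\varepsilon_\mu,\Sigma$ in $\Lambda$) to $-\tfrac12R\,\phi\,(\theta_1\gamma_2-\theta_2\gamma_1)c-\tfrac12R\,\Phi\,(\theta_1\gamma_2-\theta_2\gamma_1)$. Moreover $Q^2=0$ on $\mathcal H_{\rm red}$ if and only if $R_{\mu\nu}=0$. (2) *Cohomology of the massive $\mathcal N=4$ model.* The states of $\mathcal H_{\rm red}$ of ghost number $N_c+N_\gamma-N_\beta=0$ are exactly $$\Psi=h_{\mu\nu}\psi^\mu_1\psi^\nu_2+\tfrac12h(\gamma_1\beta_2-\gamma_2\beta_1)-\tfrac i2v_\mu(\psi^\mu_1\beta_2-\psi^\mu_2\beta_1)c-iA_\mu(\theta_1\psi^\mu_2+\psi^\mu_1\theta_2)-\varphi(2\theta_1\theta_2+\gamma_1\beta_2-\gamma_2\beta_1)+\phi(\theta_1\beta_2-\theta_2\beta_1)c$$ with $h_{\mu\nu}$ symmetric and $h=h^\mu{}_\mu$, and those of ghost number $-1$ are exactly $\Lambda=i\varepsilon_\mu(\psi^\mu_1\beta_2-\psi^\mu_2\beta_1)+\Sigma(\theta_1\beta_2-\theta_2\beta_1)$.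 If $R_{\mu\nu}=0$, then $Q\Psi=0$ if and only if $v_\mu=2\nabla\cdot h_\mu-\nabla_\mu h+2mA_\mu+2\nabla_\mu\varphi$, $\phi=-\nabla\cdot A-m\varphi-\tfrac m2h$, and $$(\nabla^2-m^2)h_{\mu\nu}-2\nabla_{(\mu}\nabla\cdot h_{\nu)}+\nabla_\mu\nabla_\nu h+2R_{\mu\alpha\nu\beta}h^{\alpha\beta}=2m\nabla_{(\mu}A_{\nu)}+2\nabla_\mu\nabla_\nu\varphi,$$ $$(\nabla^2-m^2)h-\nabla^\mu\nabla^\nu h_{\mu\nu}=2m\nabla\cdot A+2\nabla^2\varphi,$$ $$\nabla^2A_\mu-\nabla_\mu\nabla\cdot A=m(\nabla_\mu h-\nabla\cdot h_\mu),\qquad \nabla^2\varphi+\tfrac{m^2}2h+m\nabla\cdot A=0.$$ This system is equivalent to its first and third equations together with $\nabla^2h-\nabla^\mu\nabla^\nu h_{\mu\nu}=0$ (the field equations of linearized massive gravity in Stückelberg form). The state $Q\Lambda$ is the state $\Psi$, with $v_\mu$ and $\phi$ as above, of the gauge transformation $$\delta h_{\mu\nu}=2\nabla_{(\mu}\varepsilon_{\nu)},\qquad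 \delta A_\mu=\nabla_\mu\Sigma-m\varepsilon_\mu,\qquad \delta\varphi=-m\Sigma,$$ which solves the field equations, and $(h_{\mu\nu},A_\mu,\varphi)\mapsto\Psi$ induces an isomorphism from the space of solutions modulo gauge transformations onto the BRST cohomology of $Q$ on $\mathcal H_{\rm red}$ at ghost number zero. (3) *Massless $\mathcal N=4$ model* ($d=4$, $\kappa=\tfrac12$, $m=0$, without $\theta_i$). If $R_{\mu\nu}=\lambda g_{\mu\nu}$ for a constant $\lambda$, the model is consistent. Conversely, if $U$ is connected and $Q^2=0$ on $\mathcal H_{\rm red}$, then $R_{\mu\nu}=\lambda g_{\mu\nu}$ for a constant $\lambda$. (4) *Massive $\mathcal N=2$ model* (any $d\ge1$, one flavor, $\kappa=0$). It is consistent on every background and for every $m$. -/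

import Mathlib

open scoped ContDiff
open TopologicalSpace (Opens)

namespace SpinningParticle

noncomputable section

/-! ### Smooth functions on an open subset of `ℝ^d` -/

/-- Extension by zero of a function on an open set. It is only ever used at points of that set. -/
def extendZero {d : ℕ} {U : Opens (Fin d → ℝ)} (f : U → ℂ) : (Fin d → ℝ) → ℂ :=
  Function.extend Subtype.val f 0

theorem extendZero_apply {d : ℕ} {U : Opens (Fin d → ℝ)} (f : U → ℂ) (x : U) :
    extendZero f x = f x :=
  Subtype.val_injective.extend_apply f 0 x

theorem extendZero_congr {d : ℕ} {U : Opens (Fin d → ℝ)} {f : U → ℂ} {F : (Fin d → ℝ) → ℂ}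
    (h : ∀ x : U, f x = F x) : Set.EqOn (extendZero f) F U := fun x hx => by
  rw [← h ⟨x, hx⟩]
  exact extendZero_apply f ⟨x, hx⟩

/-- The algebra `C^∞(U, ℂ)`. -/
def smoothFn {d : ℕ} (U : Opens (Fin d → ℝ)) : Subalgebra ℂ (U → ℂ) where
  carrier := {f | ContDiffOn ℝ ∞ (extendZero f) U}
  mul_mem' {f g} hf hg := by
    refine (ContDiffOn.mul hf hg).congr (extendZero_congr fun x => ?_)
    simp [extendZero_apply]
  add_mem' {f g} hf hg := by
    refine (ContDiffOn.add hf hg).congr (extendZero_congr fun x => ?_)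
    simp [extendZero_apply]
  algebraMap_mem' r := by
    refine (contDiffOn_const (c := r)).congr (extendZero_congr fun x => ?_)
    simp

/-- `C^∞(U, ℂ)` as a type. -/
def Fn {d : ℕ} (U : Opens (Fin d → ℝ)) : Type := smoothFn U

instance {d : ℕ} (U : Opens (Fin d → ℝ)) : CommRing (Fn U) :=
  inferInstanceAs (CommRing (smoothFn U))

instance {d : ℕ} (U : Opens (Fin d → ℝ)) : Algebra ℂ (Fn U) :=
  inferInstanceAs (Algebra ℂ (smoothFn U))

/-- The partial derivative `∂_μ` on `C^∞(U, ℂ)`. -/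
def partialD {d : ℕ} {U : Opens (Fin d → ℝ)} (μ : Fin d) : Module.End ℂ (Fn U) where
  toFun f := ⟨fun x : U => fderiv ℝ (extendZero f.1) x (Pi.single μ 1), by
    have h : ContDiffOn ℝ ∞
        (fun x : Fin d → ℝ => fderiv ℝ (extendZero f.1) x (Pi.single μ 1)) U :=
      (ContDiffOn.fderiv_of_isOpen f.2 U.isOpen (by simp)).clm_apply contDiffOn_const
    exact h.congr (extendZero_congr fun x => rfl)⟩
  map_add' f g := by
    refine Subtype.ext (funext fun x => ?_)
    have hf : DifferentiableAt ℝ (extendZero f.1) x :=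
      (ContDiffOn.contDiffAt f.2 (U.isOpen.mem_nhds x.2)).differentiableAt (by simp)
    have hg : DifferentiableAt ℝ (extendZero g.1) x :=
      (ContDiffOn.contDiffAt g.2 (U.isOpen.mem_nhds x.2)).differentiableAt (by simp)
    have h : extendZero (f + g).1 =ᶠ[nhds (x : Fin d → ℝ)] extendZero f.1 + extendZero g.1 :=
      Filter.eventuallyEq_of_mem (U.isOpen.mem_nhds x.2)
        (extendZero_congr fun y => by
          rw [Pi.add_apply, extendZero_apply, extendZero_apply]; rfl)
    change fderiv ℝ (extendZero (f + g).1) (x : Fin d → ℝ) _ =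
      fderiv ℝ _ (x : Fin d → ℝ) _ + fderiv ℝ _ (x : Fin d → ℝ) _
    rw [h.fderiv_eq, fderiv_add hf hg]
    rfl
  map_smul' r f := by
    refine Subtype.ext (funext fun x => ?_)
    have hf : DifferentiableAt ℝ (extendZero f.1) x :=
      (ContDiffOn.contDiffAt f.2 (U.isOpen.mem_nhds x.2)).differentiableAt (by simp)
    have h : extendZero (r • f).1 =ᶠ[nhds (x : Fin d → ℝ)] r • extendZero f.1 :=
      Filter.eventuallyEq_of_mem (U.isOpen.mem_nhds x.2)
        (extendZero_congr fun y => by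
          rw [Pi.smul_apply, extendZero_apply]; rfl)
    change fderiv ℝ (extendZero (r • f).1) (x : Fin d → ℝ) _ = r • fderiv ℝ _ (x : Fin d → ℝ) _
    rw [h.fderiv_eq, fderiv_const_smul hf]
    rfl

/-! ### Background geometry -/

/-- The Minkowski metric `diag(-1, 1, …, 1)`; it is its own inverse. -/
def eta {d : ℕ} (a : Fin d) : ℂ := if a.val = 0 then -1 else 1

/-- A background on `U`: a smooth real vielbein `e^a_μ` (`coframe a μ`) with inverse `e^μ_a`
(`frame μ a`). Every Lorentzian metric on a coordinate patch arises in this way locally. -/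
structure Background {d : ℕ} (U : Opens (Fin d → ℝ)) where
  coframe : Matrix (Fin d) (Fin d) (Fn U)
  frame : Matrix (Fin d) (Fin d) (Fn U)
  real : ∀ a μ (x : U), ((coframe a μ).1 x).im = 0
  inverse : frame * coframe = 1

namespace Background

variable {d : ℕ} {U : Opens (Fin d → ℝ)} (B : Background U)

/-- `g_{μν} = η_{ab} e^a_μ e^b_ν`. -/
def metric (μ ν : Fin d) : Fn U := ∑ a, eta a • (B.coframe a μ * B.coframe a ν)

/-- `g^{μν} = η^{ab} e^μ_a e^ν_b`. -/
def invMetric (μ ν : Fin d) : Fn U := ∑ a, eta a • (B.frame μ a * B.frame ν a)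

/-- The Christoffel symbol `Γ^ρ_{μν}` (`christoffel ρ μ ν`). -/
def christoffel (ρ μ ν : Fin d) : Fn U :=
  (1 / 2 : ℂ) • ∑ l, B.invMetric ρ l *
    (partialD μ (B.metric l ν) + partialD ν (B.metric l μ) - partialD l (B.metric μ ν))

/-- The torsion-free spin connection
`ω_{μ ab} = η_{ac} e^c_ν (∂_μ e^ν_b + Γ^ν_{μλ} e^λ_b)`. -/
def spinConnection (μ a b : Fin d) : Fn U :=
  eta a • ∑ ν, B.coframe a ν *
    (partialD μ (B.frame ν b) + ∑ l, B.christoffel ν μ l * B.frame l b)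

/-- `R_{μν}{}^ρ{}_σ`, defined by `[∇_μ, ∇_ν] V^ρ = R_{μν}{}^ρ{}_σ V^σ`. -/
def riemannUp (μ ν ρ σ : Fin d) : Fn U :=
  partialD μ (B.christoffel ρ ν σ) - partialD ν (B.christoffel ρ μ σ)
    + ∑ l, (B.christoffel ρ μ l * B.christoffel l ν σ
      - B.christoffel ρ ν l * B.christoffel l μ σ)

/-- `R_{μνλσ} = g_{λρ} R_{μν}{}^ρ{}_σ`. -/
def riemann (μ ν l σ : Fin d) : Fn U := ∑ ρ, B.metric l ρ * B.riemannUp μ ν ρ σ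

/-- `R_{μν} = R_{λμ}{}^λ{}_ν`. -/
def ricci (μ ν : Fin d) : Fn U := ∑ l, B.riemannUp l μ l ν

/-- `R = g^{μν} R_{μν}`. -/
def scalarCurvature : Fn U := ∑ μ, ∑ ν, B.invMetric μ ν * B.ricci μ ν

def IsRicciFlat : Prop := ∀ μ ν, B.ricci μ ν = 0

def IsEinstein : Prop := ∃ lam : ℝ, ∀ μ ν, B.ricci μ ν = (lam : ℂ) • B.metric μ ν

end Background

/-! ### The BRST-extended space of states -/

/-- The odd oscillators, for `n` flavors, spacetime dimension `d` and `k` internal directions: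
`ψ_i^a`, then `θ_{i}` (one for every internal direction), then the ghost `c`. -/
abbrev OddOsc (n d k : ℕ) : Type := (Fin n ×ₗ Fin d) ⊕ₗ ((Fin n ×ₗ Fin k) ⊕ₗ Unit)

def psiOsc {n d k : ℕ} (i : Fin n) (a : Fin d) : OddOsc n d k := Sum.inlₗ (toLex (i, a))

def thetaOsc {n d k : ℕ} (i : Fin n) (r : Fin k) : OddOsc n d k :=
  Sum.inrₗ (Sum.inlₗ (toLex (i, r)))

def cOsc {n d k : ℕ} : OddOsc n d k := Sum.inrₗ (Sum.inrₗ ())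

/-- The even oscillators `γ_i` (left summand) and `β_i` (right summand). -/
abbrev EvenOsc (n : ℕ) : Type := Fin n ⊕ Fin n

/-- Wavefunctions `Ψ(x, ψ, θ | c, γ, β)`: polynomials in the odd and the even oscillators with
coefficients in `C^∞(U, ℂ)`, given by the coefficient of each monomial. A monomial is the set of
odd oscillators in it, multiplied in increasing order, with the exponents of the even ones.
Infinitely many nonzero coefficients are allowed here; the constraints below exclude them. -/
abbrev Wave (n k : ℕ) {d : ℕ} (U : Opens (Fin d → ℝ)) : Type :=
  Finset (OddOsc n d k) × (EvenOsc n → ℕ) → Fn U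

/-- Linear operators on wavefunctions. -/
abbrev Op (n k : ℕ) {d : ℕ} (U : Opens (Fin d → ℝ)) : Type := Module.End ℂ (Wave n k U)

section Oscillators

variable {n k d : ℕ} {U : Opens (Fin d → ℝ)}

/-- The sign picked up by moving the oscillator `o` past those in `s` that precede it. -/
def oddSign (o : OddOsc n d k) (s : Finset (OddOsc n d k)) : ℂ :=
  (-1) ^ (s.filter (· < o)).card

/-- Multiplication from the left by an odd oscillator. -/
def oddMul (o : OddOsc n d k) : Op n k U where
  toFun Ψ p := if o ∈ p.1 then oddSign o p.1 • Ψ (p.1.erase o, p.2) else 0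
  map_add' Ψ Φ := by
    funext p
    by_cases h : o ∈ p.1 <;> simp [h]
  map_smul' r Ψ := by
    funext p
    by_cases h : o ∈ p.1 <;> simp [h, smul_comm r]

/-- The left derivative with respect to an odd oscillator. -/
def oddDer (o : OddOsc n d k) : Op n k U where
  toFun Ψ p := if o ∈ p.1 then 0 else oddSign o p.1 • Ψ (insert o p.1, p.2)
  map_add' Ψ Φ := by
    funext p
    by_cases h : o ∈ p.1 <;> simp [h]
  map_smul' r Ψ := by
    funext p
    by_cases h : o ∈ p.1 <;> simp [h, smul_comm r]

/-- Multiplication by an even oscillator. -/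
def evenMul (e : EvenOsc n) : Op n k U where
  toFun Ψ p := if p.2 e = 0 then 0 else Ψ (p.1, Function.update p.2 e (p.2 e - 1))
  map_add' Ψ Φ := by
    funext p
    by_cases h : p.2 e = 0 <;> simp [h]
  map_smul' r Ψ := by
    funext p
    by_cases h : p.2 e = 0 <;> simp [h]

/-- The derivative with respect to an even oscillator. -/
def evenDer (e : EvenOsc n) : Op n k U where
  toFun Ψ p := ((p.2 e + 1 : ℕ) : ℂ) • Ψ (p.1, Function.update p.2 e (p.2 e + 1))
  map_add' Ψ Φ := by
    funext p
    simp
  map_smul' r Ψ := by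
    funext p
    exact smul_comm _ r _

/-- Multiplication by a function of `x`. -/
def fn (f : Fn U) : Op n k U := (LinearMap.mulLeft ℂ f).compLeft _

/-- The partial derivative `∂_μ` of the coefficients. -/
def del (μ : Fin d) : Op n k U := (partialD μ).compLeft _

/-- The ghost vacuum, the constant wavefunction `1`. -/
def vacuum : Wave n k U := fun p => if p = (∅, 0) then 1 else 0

/-- `ψ_i^a`, with flat index `a`. -/
def psiFlat (i : Fin n) (a : Fin d) : Op n k U := oddMul (psiOsc i a)

/-- `∂/∂ψ_i^a`, with flat index `a`. -/
def psiDer (i : Fin n) (a : Fin d) : Op n k U := oddDer (psiOsc i a)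

/-- `ψ̄^{a i} = η^{ab} ∂/∂ψ_i^b`, with flat index `a`. -/
def psiBarFlat (i : Fin n) (a : Fin d) : Op n k U :=
  eta a • (psiDer i a : Op n k U)

def theta (i : Fin n) (r : Fin k) : Op n k U := oddMul (thetaOsc i r)

/-- `θ̄^i = ∂/∂θ_i`. -/
def thetaBar (i : Fin n) (r : Fin k) : Op n k U := oddDer (thetaOsc i r)

def cGhost : Op n k U := oddMul cOsc

/-- `b = ∂/∂c`. -/
def bGhost : Op n k U := oddDer cOsc

def gam (i : Fin n) : Op n k U := evenMul (Sum.inl i)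

def bet (i : Fin n) : Op n k U := evenMul (Sum.inr i)

/-- `γ̄^i = -∂/∂β_i`. -/
def gamBar (i : Fin n) : Op n k U := -evenDer (Sum.inr i)

/-- `β̄^i = ∂/∂γ_i`. -/
def betBar (i : Fin n) : Op n k U := evenDer (Sum.inl i)

/-- `γ̄·γ`. -/
def gamBarGam : Op n k U := ∑ i, gamBar i * gam i

/-- `ρ = γ̄·θ + γ·θ̄`. -/
def rho : Op n k U :=
  ∑ i, ∑ r, (gamBar i * theta i r + gam i * thetaBar i r)

/-! ### The `R`-symmetry constraints and the reduced space -/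

/-- `𝒥_i`, with the ordering constant `-(d + k - 2)/2`. -/
def numberJ (i : Fin n) : Op n k U :=
  ∑ a, psiFlat i a * psiDer i a + ∑ r, theta i r * thetaBar i r
    + gam i * betBar i + bet i * evenDer (Sum.inr i) - (((d : ℂ) + k - 2) / 2) • (1 : Op n k U)

/-- The `U(1)` charge `(4 - d - k)/2` of the physical states: `0` for the massless model in four
dimensions, `(3 - d)/2` for the massive models. -/
def physicalCharge (d k : ℕ) : ℂ := (4 - (d : ℂ) - k) / 2

/-- `𝒥̃_i`, the shifted `𝒥_i` that annihilates the physical states. -/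
def shiftedJ (i : Fin n) : Op n k U := numberJ i - physicalCharge d k • (1 : Op n k U)

/-- The Young operator `𝒥_i{}^j` for `i ≠ j`. -/
def young (i j : Fin n) : Op n k U :=
  ∑ a, psiFlat i a * psiDer j a + ∑ r, theta i r * thetaBar j r
    + gam i * betBar j + bet i * evenDer (Sum.inr j)

/-- The trace operator `∂²/∂ψ_i·∂ψ_j + ∂²/∂θ_i∂θ_j + ∂²/∂γ_i∂β_j - ∂²/∂γ_j∂β_i`. -/
def traceT (i j : Fin n) : Op n k U :=
  ∑ a, eta a • (psiDer i a * psiDer j a : Op n k U) + ∑ r, thetaBar i r * thetaBar j r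
    + evenDer (Sum.inl i) * evenDer (Sum.inr j) - evenDer (Sum.inl j) * evenDer (Sum.inr i)

variable (n k U) in
/-- The reduced space `ker 𝒯_α`. The Young and trace constraints are present only for two or more
flavors, that is, not for the `𝒩 = 2` model. -/
def reduced : Submodule ℂ (Wave n k U) :=
  (⨅ i, LinearMap.ker (shiftedJ i)) ⊓
    ⨅ (i : Fin n) (j : Fin n) (_ : i < j), LinearMap.ker (young i j) ⊓ LinearMap.ker (traceT i j)

/-- The ghost number operator. -/
def ghostNumber : Op n k U :=
  cGhost * bGhost + ∑ i, (gam i * betBar i - bet i * evenDer (Sum.inr i))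

variable (n k U) in
/-- The part of the reduced space whose oscillators have ghost number `s`. -/
def reducedGh (s : ℤ) : Submodule ℂ (Wave n k U) :=
  reduced n k U ⊓ LinearMap.ker (ghostNumber - (s : ℂ) • (1 : Op n k U))

/-! ### The BRST charge on a curved background -/

variable (B : Background U)

/-- `ψ_i^μ = e^μ_a ψ_i^a`. -/
def psi (i : Fin n) (μ : Fin d) : Op n k U :=
  ∑ a, fn (B.frame μ a) * psiFlat i a

/-- `ψ̄^{μ i} = e^μ_a ψ̄^{a i}`. -/
def psiBar (i : Fin n) (μ : Fin d) : Op n k U :=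
  ∑ a, fn (B.frame μ a) * psiBarFlat i a

/-- `ψ^μ·ψ̄^ν`. -/
def psiPsiBar (μ ν : Fin d) : Op n k U := ∑ i, psi B i μ * psiBar B i ν

/-- `∇̂_μ = ∂_μ + ω_{μ ab} ψ^a·ψ̄^b`. -/
def hatNabla (μ : Fin d) : Op n k U :=
  del μ + ∑ a, ∑ b, fn (B.spinConnection μ a b) * ∑ i, psiFlat i a * psiBarFlat i b

/-- `∇² = g^{μν} ∇̂_μ ∇̂_ν - g^{μν} Γ^λ_{μν} ∇̂_λ`. -/
def laplacian : Op n k U :=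
  ∑ μ, ∑ ν, fn (B.invMetric μ ν) *
    (hatNabla B μ * hatNabla B ν - ∑ l, fn (B.christoffel l μ ν) * hatNabla B l)

/-- `𝐑_{μν} = R_{μνλσ} ψ^λ·ψ̄^σ`. -/
def curvOp (μ ν : Fin d) : Op n k U :=
  ∑ l, ∑ σ, fn (B.riemann μ ν l σ) * psiPsiBar B l σ

/-- `ℜ = R_{μνλσ} ψ^μ·ψ̄^ν ψ^λ·ψ̄^σ + κ R`. -/
def curvCoupling (κ : ℂ) : Op n k U :=
  ∑ μ, ∑ ν, ∑ l, ∑ σ, fn (B.riemann μ ν l σ) * (psiPsiBar B μ ν * psiPsiBar B l σ)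
    + κ • (fn B.scalarCurvature : Op n k U)

/-- `S^μ = γ̄·ψ^μ + γ·ψ̄^μ`. -/
def superS (μ : Fin d) : Op n k U :=
  ∑ i, (gamBar i * psi B i μ + gam i * psiBar B i μ)

/-- `𝛁 = -i S^μ ∇̂_μ + m ρ`. -/
def boldNabla (m : ℝ) : Op n k U :=
  (-Complex.I) • (∑ μ, superS B μ * hatNabla B μ : Op n k U) + (m : ℂ) • (rho : Op n k U)

/-- `ψ^μ·ψ̄_μ`. -/
def psiNumber : Op n k U := ∑ μ, ∑ ν, fn (B.metric μ ν) * psiPsiBar B μ ν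

/-- The deformed Hamiltonian `𝒟 = ∇² - m² + ℜ`. -/
def hamiltonianD (κ : ℂ) (m : ℝ) : Op n k U :=
  laplacian B - ((m : ℂ) ^ 2) • (1 : Op n k U) + curvCoupling B κ

/-- The deformed BRST charge `Q = c 𝒟 + 𝛁 + γ̄·γ b`. -/
def brst (κ : ℂ) (m : ℝ) : Op n k U :=
  cGhost * hamiltonianD B κ m + boldNabla B m + gamBarGam * bGhost

end Oscillators

section Models

variable {d : ℕ} {U : Opens (Fin d → ℝ)} (B : Background U)

/-- The BRST charge of the massive `𝒩 = 4` model: two flavors, one internal direction, `κ = 1/2`. -/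
def massiveQ (m : ℝ) : Op 2 1 U := brst B (1 / 2) m

/-- The BRST charge of the massless `𝒩 = 4` model: two flavors, no internal direction,
`κ = 1/2`. -/
def masslessQ : Op 2 0 U := brst B (1 / 2) 0

/-- The BRST charge of the massive `𝒩 = 2` model: one flavor, one internal direction, `κ = 0`. -/
def massiveQ₂ (m : ℝ) : Op 1 1 U := brst B 0 m

variable {n k : ℕ}

/-- `[Q, 𝒯_α] = 0`. -/
def CommutesWithConstraints (Q : Op n k U) : Prop :=
  (∀ i, Commute Q (shiftedJ i)) ∧
    ∀ i j, i < j → Commute Q (young i j) ∧ Commute Q (traceT i j)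

/-- `Q² = 0` on `ker 𝒯_α`. -/
def NilpotentOnReduced (Q : Op n k U) : Prop :=
  ∀ Ψ ∈ reduced n k U, Q (Q Ψ) = 0

/-- The BRST system `(Q, 𝒯_α)` is consistent. -/
def IsConsistent (Q : Op n k U) : Prop :=
  CommutesWithConstraints Q ∧ NilpotentOnReduced Q

/-- The closed states of ghost number `s` in the reduced space. -/
def cocycles (Q : Op n k U) (s : ℤ) : Submodule ℂ (Wave n k U) :=
  reducedGh n k U s ⊓ LinearMap.ker Q

/-- The exact states `Q Λ` of ghost number `s`, with `Λ` in the reduced space. -/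
def coboundaries (Q : Op n k U) (s : ℤ) : Submodule ℂ (Wave n k U) :=
  (reducedGh n k U (s - 1)).map Q

/-- The BRST cohomology at ghost number `s` on the reduced space. -/
abbrev Cohomology (Q : Op n k U) (s : ℤ) : Type :=
  cocycles Q s ⧸ (coboundaries Q s).submoduleOf (cocycles Q s)

end Models

/-! ### Tensor calculus and linearized massive gravity -/

section Tensors

variable {d : ℕ} {U : Opens (Fin d → ℝ)}

/-- Components, in the coordinates of `U`, of a covariant tensor field of rank `r`. -/
abbrev Tensor (r : ℕ) {d : ℕ} (U : Opens (Fin d → ℝ)) : Type := (Fin r → Fin d) → Fn U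

variable (B : Background U)

/-- The Levi-Civita derivative, the new index being the first one:
`cov T ![μ, ν, …] = ∇_μ T_{ν …}`. -/
def cov {r : ℕ} : Tensor r U →ₗ[ℂ] Tensor (r + 1) U where
  toFun T I := partialD (I 0) (T (Fin.tail I)) - ∑ j, ∑ l,
    B.christoffel l (I 0) (Fin.tail I j) * T (Function.update (Fin.tail I) j l)
  map_add' S T := by
    funext I
    simp only [Pi.add_apply, map_add, mul_add, Finset.sum_add_distrib]
    abel
  map_smul' c T := by
    funext I
    simp only [Pi.smul_apply, map_smul, mul_smul_comm, ← Finset.smul_sum, ← smul_sub,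
      RingHom.id_apply]

/-- Contraction of the first two indices with `g^{αβ}`. -/
def contract {r : ℕ} : Tensor (r + 2) U →ₗ[ℂ] Tensor r U where
  toFun T I := ∑ α, ∑ β, B.invMetric α β * T (Matrix.vecCons α (Matrix.vecCons β I))
  map_add' S T := by
    funext I
    simp only [Pi.add_apply, mul_add, Finset.sum_add_distrib]
  map_smul' c T := by
    funext I
    simp only [Pi.smul_apply, mul_smul_comm, ← Finset.smul_sum, RingHom.id_apply]

/-- `T_{μν} + T_{νμ}`, that is, `2 T_{(μν)}`. -/
def symm2 : Tensor 2 U →ₗ[ℂ] Tensor 2 U where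
  toFun T I := T ![I 0, I 1] + T ![I 1, I 0]
  map_add' S T := by
    funext I
    simp only [Pi.add_apply]
    abel
  map_smul' c T := by
    funext I
    simp only [Pi.smul_apply, smul_add, RingHom.id_apply]

/-- `R_{μανβ} h^{αβ}`. -/
def riemannAct : Tensor 2 U →ₗ[ℂ] Tensor 2 U where
  toFun h I := ∑ α, ∑ β, ∑ α', ∑ β',
    B.riemann (I 0) α (I 1) β * B.invMetric α α' * B.invMetric β β' * h ![α', β']
  map_add' S T := by
    funext I
    simp only [Pi.add_apply, mul_add, Finset.sum_add_distrib]
  map_smul' c T := by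
    funext I
    simp only [Pi.smul_apply, mul_smul_comm, ← Finset.smul_sum, RingHom.id_apply]

/-- `∇²` on tensor fields. -/
def box {r : ℕ} : Tensor r U →ₗ[ℂ] Tensor r U := contract B ∘ₗ cov B ∘ₗ cov B

/-- The divergence `∇·T` on the first index. -/
def div {r : ℕ} : Tensor (r + 1) U →ₗ[ℂ] Tensor r U := contract B ∘ₗ cov B

/-- The trace `h = g^{μν} h_{μν}`. -/
def tr : Tensor 2 U →ₗ[ℂ] Tensor 0 U := contract B

def IsSymm (h : Tensor 2 U) : Prop := ∀ μ ν, h ![μ, ν] = h ![ν, μ]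

/-- The fields `(h_{μν}, A_μ, φ)`: graviton, Stückelberg vector and Stückelberg scalar. -/
abbrev Fields {d : ℕ} (U : Opens (Fin d → ℝ)) : Type := Tensor 2 U × Tensor 1 U × Tensor 0 U

/-- The equations of motion after the elimination of the auxiliary fields. -/
structure StuckelbergSystem (m : ℝ) (h : Tensor 2 U) (A : Tensor 1 U) (φ : Tensor 0 U) : Prop where
  graviton : box B h - (m : ℂ) ^ 2 • h - symm2 (cov B (div B h)) + cov B (cov B (tr B h))
    + (2 : ℂ) • riemannAct B h = (m : ℂ) • symm2 (cov B A) + (2 : ℂ) • cov B (cov B φ)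
  trace : box B (tr B h) - (m : ℂ) ^ 2 • tr B h - div B (div B h)
    = (2 * m : ℂ) • div B A + (2 : ℂ) • box B φ
  vector : box B A - cov B (div B A) = (m : ℂ) • (cov B (tr B h) - div B h)
  scalar : box B φ + ((m : ℂ) ^ 2 / 2) • tr B h + (m : ℂ) • div B A = 0

/-- The solutions of linearized massive gravity in the Stückelberg formulation. -/
def lmgSolutions (m : ℝ) : Submodule ℂ (Fields U) where
  carrier := {p | IsSymm p.1 ∧
    box B p.1 - (m : ℂ) ^ 2 • p.1 - symm2 (cov B (div B p.1)) + cov B (cov B (tr B p.1))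
        + (2 : ℂ) • riemannAct B p.1
      = (m : ℂ) • symm2 (cov B p.2.1) + (2 : ℂ) • cov B (cov B p.2.2) ∧
    box B p.2.1 - cov B (div B p.2.1) = (m : ℂ) • (cov B (tr B p.1) - div B p.1) ∧
    box B (tr B p.1) - div B (div B p.1) = 0}
  add_mem' {p q} hp hq := by
    obtain ⟨hp0, hp1, hp2, hp3⟩ := hp
    obtain ⟨hq0, hq1, hq2, hq3⟩ := hq
    refine ⟨fun μ ν => ?_, ?_, ?_, ?_⟩
    · simp only [Prod.fst_add, Pi.add_apply, hp0 μ ν, hq0 μ ν]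
    · simp only [Prod.fst_add, Prod.snd_add, map_add]
      linear_combination (norm := module) hp1 + hq1
    · simp only [Prod.fst_add, Prod.snd_add, map_add]
      linear_combination (norm := module) hp2 + hq2
    · simp only [Prod.fst_add, map_add]
      linear_combination (norm := module) hp3 + hq3
  zero_mem' := by
    refine ⟨fun μ ν => rfl, ?_, ?_, ?_⟩ <;> simp
  smul_mem' c p hp := by
    obtain ⟨hp0, hp1, hp2, hp3⟩ := hp
    refine ⟨fun μ ν => ?_, ?_, ?_, ?_⟩
    · simp only [Prod.smul_fst, Pi.smul_apply, hp0 μ ν]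
    · simp only [Prod.smul_fst, Prod.smul_snd, map_smul]
      linear_combination (norm := module) c • hp1
    · simp only [Prod.smul_fst, Prod.smul_snd, map_smul]
      linear_combination (norm := module) c • hp2
    · simp only [Prod.smul_fst, map_smul]
      linear_combination (norm := module) c • hp3

/-- The gauge transformation `δh_{μν} = 2∇_{(μ} ε_{ν)}`, `δA_μ = ∇_μ Σ - m ε_μ`, `δφ = -m Σ` with
parameters `(ε_μ, Σ)`. -/
def gauge (m : ℝ) : Tensor 1 U × Tensor 0 U →ₗ[ℂ] Fields U where
  toFun q := (symm2 (cov B q.1), cov B q.2 - (m : ℂ) • q.1, -((m : ℂ) • q.2))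
  map_add' p q := by
    refine Prod.ext ?_ (Prod.ext ?_ ?_)
    · simp
    · simp only [Prod.fst_add, Prod.snd_add, map_add, smul_add]
      abel
    · simp only [Prod.snd_add, smul_add]
      abel
  map_smul' c q := by
    refine Prod.ext ?_ (Prod.ext ?_ ?_)
    · simp
    · simp [smul_sub, smul_comm c]
    · simp [smul_comm c]

/-- The string field of ghost number zero with graviton `h_{μν}`, Stückelberg fields `A_μ` and `φ`,
and auxiliary fields `v_μ` and `ϕ` (`aux`):
`h_{μν} ψ_1^μ ψ_2^ν + ½ h (γ_1 β_2 - γ_2 β_1) - (i/2) v_μ (ψ_1^μ β_2 - ψ_2^μ β_1) c`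
`- i A_μ (θ_1 ψ_2^μ + ψ_1^μ θ_2) - φ (2 θ_1 θ_2 + γ_1 β_2 - γ_2 β_1) + ϕ (θ_1 β_2 - θ_2 β_1) c`. -/
def stringField (h : Tensor 2 U) (v A : Tensor 1 U) (φ aux : Tensor 0 U) :
    Wave 2 1 U :=
  (∑ μ, ∑ ν, fn (h ![μ, ν]) * psi B 0 μ * psi B 1 ν
    + (1 / 2 : ℂ) • (fn (tr B h ![]) * (gam 0 * bet 1 - gam 1 * bet 0) : Op 2 1 U)
    - (Complex.I / 2) •
      (∑ μ, fn (v ![μ]) * (psi B 0 μ * bet 1 - psi B 1 μ * bet 0) * cGhost : Op 2 1 U)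
    - Complex.I •
      (∑ μ, fn (A ![μ]) * (theta 0 0 * psi B 1 μ + psi B 0 μ * theta 1 0) : Op 2 1 U)
    - fn (φ ![]) *
      ((2 : ℂ) • (theta 0 0 * theta 1 0 : Op 2 1 U) + gam 0 * bet 1 - gam 1 * bet 0)
    + fn (aux ![]) * (theta 0 0 * bet 1 - theta 1 0 * bet 0) * cGhost : Op 2 1 U) vacuum

/-- The gauge parameter
`Λ = i ε_μ (ψ_1^μ β_2 - ψ_2^μ β_1) + Σ (θ_1 β_2 - θ_2 β_1)`. -/
def gaugeState (ε : Tensor 1 U) (Sg : Tensor 0 U) : Wave 2 1 U :=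
  (Complex.I • (∑ μ, fn (ε ![μ]) * (psi B 0 μ * bet 1 - psi B 1 μ * bet 0) : Op 2 1 U)
    + fn (Sg ![]) * (theta 0 0 * bet 1 - theta 1 0 * bet 0) : Op 2 1 U) vacuum

/-- The value `v_μ = 2∇·h_μ - ∇_μ h + 2m A_μ + 2∇_μ φ` of the auxiliary vector. -/
def auxVector (m : ℝ) (p : Fields U) : Tensor 1 U :=
  (2 : ℂ) • div B p.1 - cov B (tr B p.1) + (2 * m : ℂ) • p.2.1 + (2 : ℂ) • cov B p.2.2

/-- The value `ϕ = -∇·A - m φ - ½ m h` of the auxiliary scalar. -/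
def auxScalar (m : ℝ) (p : Fields U) : Tensor 0 U :=
  -div B p.2.1 - (m : ℂ) • p.2.2 - ((m : ℂ) / 2) • tr B p.1

/-- The string field of `(h_{μν}, A_μ, φ)` with the auxiliary fields eliminated. -/
def onShellField (m : ℝ) (p : Fields U) : Wave 2 1 U :=
  stringField B p.1 (auxVector B m p) p.2.1 p.2.2 (auxScalar B m p)

end Tensors

end

end SpinningParticle

namespace SpinningParticle

open Finset (sum_congr sum_comm mul_sum sum_mul sum_sub_distrib sum_add_distrib sum_neg_distrib sum_const_zero sum_ite_eq' sum_ite_eq sum_eq_zero mem_univ sum_eq_single smul_sum sum_mul_sum sum_smul)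
open Module.End (mul_apply)
open Matrix (transpose_apply transpose_mul cons_val_zero cons_val_one)

noncomputable section

/-! ### Smooth functions and their partial derivatives -/

section FnLemmas

variable {d : ℕ} {U : Opens (Fin d → ℝ)}

theorem extendZero_differentiableAt (f : Fn U) (x : U) :
    DifferentiableAt ℝ (extendZero f.1) x :=
  (ContDiffOn.contDiffAt f.2 (U.isOpen.mem_nhds x.2)).differentiableAt (by simp)

theorem extendZero_mul_eventuallyEq (f g : Fn U) (x : U) :
    extendZero (f * g).1 =ᶠ[nhds (x : Fin d → ℝ)] extendZero f.1 * extendZero g.1 :=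
  Filter.eventuallyEq_of_mem (U.isOpen.mem_nhds x.2)
    (extendZero_congr fun y => by
      rw [Pi.mul_apply, extendZero_apply, extendZero_apply]; rfl)

theorem partialD_apply (μ : Fin d) (f : Fn U) (x : U) :
    (partialD μ f).1 x = fderiv ℝ (extendZero f.1) x (Pi.single μ 1) := rfl

theorem Fn.coe_add (f g : Fn U) (x : U) : (f + g).1 x = f.1 x + g.1 x := rfl

theorem Fn.coe_mul (f g : Fn U) (x : U) : (f * g).1 x = f.1 x * g.1 x := rfl

theorem Fn.ext {f g : Fn U} (h : ∀ x, f.1 x = g.1 x) : f = g := Subtype.ext (funext h)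

/-- The Leibniz rule. -/
theorem partialD_mul (μ : Fin d) (f g : Fn U) :
    partialD μ (f * g) = partialD μ f * g + f * partialD μ g := by
  refine Fn.ext fun x => ?_
  rw [Fn.coe_add, Fn.coe_mul, Fn.coe_mul, partialD_apply, partialD_apply, partialD_apply,
    (extendZero_mul_eventuallyEq f g x).fderiv_eq,
    fderiv_mul (extendZero_differentiableAt f x) (extendZero_differentiableAt g x)]
  simp [extendZero_apply]
  ring

theorem partialD_one (μ : Fin d) : partialD μ (1 : Fn U) = 0 := by
  have h := partialD_mul μ (1 : Fn U) 1
  simpa using h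

/-- Partial derivatives commute. -/
theorem partialD_comm (μ ν : Fin d) (f : Fn U) :
    partialD μ (partialD ν f) = partialD ν (partialD μ f) := by
  refine Fn.ext fun x => ?_
  have key : ∀ α β : Fin d, (partialD α (partialD β f)).1 x =
      fderiv ℝ (fderiv ℝ (extendZero f.1)) x (Pi.single α 1) (Pi.single β 1) := by
    intro α β
    rw [partialD_apply]
    have h : extendZero (partialD β f).1 =ᶠ[nhds (x : Fin d → ℝ)]
        fun y => fderiv ℝ (extendZero f.1) y (Pi.single β 1) :=
      Filter.eventuallyEq_of_mem (U.isOpen.mem_nhds x.2)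
        (extendZero_congr fun y => rfl)
    have hd : DifferentiableAt ℝ (fderiv ℝ (extendZero f.1)) x :=
      ((ContDiffOn.fderiv_of_isOpen (m := ∞) f.2 U.isOpen (by simp)).contDiffAt
        (U.isOpen.mem_nhds x.2)).differentiableAt (by simp)
    rw [h.fderiv_eq, fderiv_clm_apply hd (differentiableAt_const _)]
    simp
  rw [key, key]
  have hs : IsSymmSndFDerivAt ℝ (extendZero f.1) (x : Fin d → ℝ) := by
    refine ContDiffAt.isSymmSndFDerivAt (n := ∞)
      (ContDiffOn.contDiffAt f.2 (U.isOpen.mem_nhds x.2)) ?_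
    simp only [minSmoothness_of_isRCLikeNormedField]
    exact WithTop.coe_le_coe.2 (le_top : (2 : ℕ∞) ≤ ⊤)
  exact hs _ _

end FnLemmas

/-! ### Canonical (anti)commutation relations -/

section Canonical

variable {n k d : ℕ} {U : Opens (Fin d → ℝ)}

instance instHasDistribNegOp : HasDistribNeg (Op n k U) :=
  @NonUnitalNonAssocRing.toHasDistribNeg (Op n k U) _

theorem oddMul_apply (o : OddOsc n d k) (Ψ : Wave n k U) (p) :
    oddMul o Ψ p = if o ∈ p.1 then oddSign o p.1 • Ψ (p.1.erase o, p.2) else 0 := rfl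

theorem oddDer_apply (o : OddOsc n d k) (Ψ : Wave n k U) (p) :
    oddDer o Ψ p = if o ∈ p.1 then 0 else oddSign o p.1 • Ψ (insert o p.1, p.2) := rfl

theorem evenMul_apply (e : EvenOsc n) (Ψ : Wave n k U) (p) :
    evenMul e Ψ p = if p.2 e = 0 then 0 else Ψ (p.1, Function.update p.2 e (p.2 e - 1)) := rfl

theorem evenDer_apply (e : EvenOsc n) (Ψ : Wave n k U) (p) :
    evenDer e Ψ p = ((p.2 e + 1 : ℕ) : ℂ) • Ψ (p.1, Function.update p.2 e (p.2 e + 1)) := rfl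

theorem fn_apply (f : Fn U) (Ψ : Wave n k U) (p) : fn f Ψ p = f * Ψ p := rfl

theorem del_apply (μ : Fin d) (Ψ : Wave n k U) (p) : del μ Ψ p = partialD μ (Ψ p) := rfl

theorem oddSign_insert (o o' : OddOsc n d k) (s : Finset (OddOsc n d k)) (h : o' ∉ s) :
    oddSign o (insert o' s) = if o' < o then -oddSign o s else oddSign o s := by
  unfold oddSign
  rw [Finset.filter_insert]
  split_ifs
  · rw [Finset.card_insert_of_notMem (by simp [h]), pow_succ]; ring
  · rfl

theorem oddSign_erase (o o' : OddOsc n d k) (s : Finset (OddOsc n d k)) (h : o' ∈ s) :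
    oddSign o (s.erase o') = if o' < o then -oddSign o s else oddSign o s := by
  have := oddSign_insert o o' (s.erase o') (by simp)
  rw [Finset.insert_erase h] at this
  rw [this]
  split_ifs <;> simp

theorem oddSign_mul_self (o : OddOsc n d k) (s : Finset (OddOsc n d k)) :
    oddSign o s * oddSign o s = 1 := by
  unfold oddSign
  rw [← pow_add, ← two_mul, pow_mul]; simp

theorem oddMul_mul_self (o : OddOsc n d k) : (oddMul o * oddMul o : Op n k U) = 0 := by
  ext1 Ψ; funext p
  simp [oddMul_apply]

theorem oddDer_mul_self (o : OddOsc n d k) : (oddDer o * oddDer o : Op n k U) = 0 := by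
  ext1 Ψ; funext p
  simp [oddDer_apply]

theorem oddMul_oddMul (o o' : OddOsc n d k) :
    (oddMul o * oddMul o' : Op n k U) = -(oddMul o' * oddMul o) := by
  rcases eq_or_ne o o' with rfl | h
  · simp [oddMul_mul_self]
  ext1 Ψ; funext p
  simp only [mul_apply, LinearMap.neg_apply, Pi.neg_apply, oddMul_apply,
    Finset.mem_erase, ne_eq, h, h.symm, not_false_eq_true, true_and]
  by_cases h1 : o ∈ p.1 <;> by_cases h2 : o' ∈ p.1 <;> simp only [h1, h2, if_true, if_false,
    smul_zero, neg_zero]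
  rw [oddSign_erase _ _ _ h1, oddSign_erase _ _ _ h2, Finset.erase_right_comm, smul_smul, smul_smul]
  rcases lt_or_gt_of_ne h with h3 | h3
  · rw [if_pos h3, if_neg (lt_asymm h3), ← neg_smul]; congr 1; ring
  · rw [if_pos h3, if_neg (lt_asymm h3), ← neg_smul]; congr 1; ring

theorem oddDer_oddDer (o o' : OddOsc n d k) :
    (oddDer o * oddDer o' : Op n k U) = -(oddDer o' * oddDer o) := by
  rcases eq_or_ne o o' with rfl | h
  · simp [oddDer_mul_self]
  ext1 Ψ; funext p
  simp only [mul_apply, LinearMap.neg_apply, Pi.neg_apply, oddDer_apply,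
    Finset.mem_insert, h, h.symm, false_or]
  by_cases h1 : o ∈ p.1 <;> by_cases h2 : o' ∈ p.1 <;> simp only [h1, h2, if_true, if_false,
    smul_zero, neg_zero]
  rw [oddSign_insert _ _ _ h1, oddSign_insert _ _ _ h2, Finset.insert_comm, smul_smul, smul_smul]
  rcases lt_or_gt_of_ne h with h3 | h3
  · rw [if_pos h3, if_neg (lt_asymm h3), ← neg_smul]; congr 1; ring
  · rw [if_pos h3, if_neg (lt_asymm h3), ← neg_smul]; congr 1; ring

theorem oddDer_oddMul (o o' : OddOsc n d k) :
    (oddDer o * oddMul o' : Op n k U) = (if o = o' then 1 else 0) - oddMul o' * oddDer o := by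
  rcases eq_or_ne o o' with rfl | h
  · ext1 Ψ; funext p
    simp only [mul_apply, LinearMap.sub_apply, Pi.sub_apply, oddDer_apply, oddMul_apply,
      if_true, Module.End.one_apply, Finset.mem_insert, Finset.mem_erase, true_or]
    by_cases h1 : o ∈ p.1
    · simp [h1, oddSign_erase, smul_smul, oddSign_mul_self]
    · simp [h1, oddSign_insert, smul_smul, oddSign_mul_self]
  · rw [if_neg h, zero_sub]
    ext1 Ψ; funext p
    simp only [mul_apply, LinearMap.neg_apply, Pi.neg_apply, oddDer_apply, oddMul_apply,
      Finset.mem_insert, Finset.mem_erase, h, h.symm, ne_eq, not_false_eq_true, true_and, false_or]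
    by_cases h1 : o ∈ p.1 <;> by_cases h2 : o' ∈ p.1 <;> simp only [h1, h2, if_true, if_false,
      smul_zero, neg_zero]
    rw [oddSign_insert _ _ _ h1, oddSign_erase _ _ _ h2, Finset.erase_insert_of_ne h, smul_smul,
      smul_smul]
    rcases lt_or_gt_of_ne h with h3 | h3
    · rw [if_pos h3, if_neg (lt_asymm h3), ← neg_smul]; congr 1; ring
    · rw [if_pos h3, if_neg (lt_asymm h3), ← neg_smul]; congr 1; ring

theorem evenMul_evenMul (e e' : EvenOsc n) :
    (evenMul e * evenMul e' : Op n k U) = evenMul e' * evenMul e := by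
  rcases eq_or_ne e e' with rfl | h
  · rfl
  ext1 Ψ; funext p
  simp only [mul_apply, evenMul_apply, Function.update_of_ne h,
    Function.update_of_ne h.symm]
  rw [Function.update_comm h]
  split_ifs <;> rfl

theorem evenDer_evenDer (e e' : EvenOsc n) :
    (evenDer e * evenDer e' : Op n k U) = evenDer e' * evenDer e := by
  rcases eq_or_ne e e' with rfl | h
  · rfl
  ext1 Ψ; funext p
  simp only [mul_apply, evenDer_apply, Function.update_of_ne h,
    Function.update_of_ne h.symm]
  rw [Function.update_comm h, smul_comm]

theorem evenDer_evenMul (e e' : EvenOsc n) :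
    (evenDer e * evenMul e' : Op n k U) = (if e = e' then 1 else 0) + evenMul e' * evenDer e := by
  rcases eq_or_ne e e' with rfl | h
  · ext1 Ψ; funext p
    simp only [mul_apply, LinearMap.add_apply, Pi.add_apply, evenDer_apply,
      evenMul_apply, if_true, Module.End.one_apply, Function.update_self, Function.update_idem]
    by_cases h0 : p.2 e = 0
    · have h1 : Function.update p.2 e 0 = p.2 := by
        rw [← h0, Function.update_eq_self]
      simp [h0, h1]
    · have h1 : p.2 e - 1 + 1 = p.2 e := Nat.succ_pred h0
      simp only [h0, if_false, h1, Nat.add_sub_cancel, Function.update_eq_self, Nat.succ_ne_zero]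
      push_cast
      rw [add_smul, one_smul, add_comm]
  · rw [if_neg h, zero_add]
    ext1 Ψ; funext p
    simp only [mul_apply, evenDer_apply, evenMul_apply, Function.update_of_ne h,
      Function.update_of_ne h.symm]
    rw [Function.update_comm h]
    split_ifs <;> simp

theorem oddMul_evenMul (o : OddOsc n d k) (e : EvenOsc n) :
    (oddMul o * evenMul e : Op n k U) = evenMul e * oddMul o := by
  ext1 Ψ; funext p
  simp only [mul_apply, oddMul_apply, evenMul_apply]
  split_ifs <;> simp

theorem oddMul_evenDer (o : OddOsc n d k) (e : EvenOsc n) :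
    (oddMul o * evenDer e : Op n k U) = evenDer e * oddMul o := by
  ext1 Ψ; funext p
  simp only [mul_apply, oddMul_apply, evenDer_apply]
  split_ifs
  · rw [smul_comm]
  · simp

theorem oddDer_evenMul (o : OddOsc n d k) (e : EvenOsc n) :
    (oddDer o * evenMul e : Op n k U) = evenMul e * oddDer o := by
  ext1 Ψ; funext p
  simp only [mul_apply, oddDer_apply, evenMul_apply]
  split_ifs <;> simp

theorem oddDer_evenDer (o : OddOsc n d k) (e : EvenOsc n) :
    (oddDer o * evenDer e : Op n k U) = evenDer e * oddDer o := by
  ext1 Ψ; funext p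
  simp only [mul_apply, oddDer_apply, evenDer_apply]
  split_ifs
  · simp
  · rw [smul_comm]

theorem fn_oddMul (f : Fn U) (o : OddOsc n d k) :
    (fn f * oddMul o : Op n k U) = oddMul o * fn f := by
  ext1 Ψ; funext p
  simp only [mul_apply, oddMul_apply, fn_apply]
  split_ifs <;> simp

theorem fn_oddDer (f : Fn U) (o : OddOsc n d k) :
    (fn f * oddDer o : Op n k U) = oddDer o * fn f := by
  ext1 Ψ; funext p
  simp only [mul_apply, oddDer_apply, fn_apply]
  split_ifs <;> simp

theorem fn_evenMul (f : Fn U) (e : EvenOsc n) :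
    (fn f * evenMul e : Op n k U) = evenMul e * fn f := by
  ext1 Ψ; funext p
  simp only [mul_apply, evenMul_apply, fn_apply]
  split_ifs <;> simp

theorem fn_evenDer (f : Fn U) (e : EvenOsc n) :
    (fn f * evenDer e : Op n k U) = evenDer e * fn f := by
  ext1 Ψ; funext p
  simp only [mul_apply, evenDer_apply, fn_apply, mul_smul_comm]

theorem del_oddMul (μ : Fin d) (o : OddOsc n d k) :
    (del μ * oddMul o : Op n k U) = oddMul o * del μ := by
  ext1 Ψ; funext p
  simp only [mul_apply, oddMul_apply, del_apply]
  split_ifs <;> simp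

theorem del_oddDer (μ : Fin d) (o : OddOsc n d k) :
    (del μ * oddDer o : Op n k U) = oddDer o * del μ := by
  ext1 Ψ; funext p
  simp only [mul_apply, oddDer_apply, del_apply]
  split_ifs <;> simp

theorem del_evenMul (μ : Fin d) (e : EvenOsc n) :
    (del μ * evenMul e : Op n k U) = evenMul e * del μ := by
  ext1 Ψ; funext p
  simp only [mul_apply, evenMul_apply, del_apply]
  split_ifs <;> simp

theorem del_evenDer (μ : Fin d) (e : EvenOsc n) :
    (del μ * evenDer e : Op n k U) = evenDer e * del μ := by
  ext1 Ψ; funext p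
  simp only [mul_apply, evenDer_apply, del_apply, map_smul]

theorem fn_mul (f g : Fn U) : (fn (f * g) : Op n k U) = fn f * fn g := by
  ext1 Ψ; funext p
  simp only [mul_apply, fn_apply, mul_assoc]

theorem fn_one : (fn 1 : Op n k U) = 1 := by
  ext1 Ψ; funext p
  simp [fn_apply]

theorem fn_zero : (fn 0 : Op n k U) = 0 := by
  ext1 Ψ; funext p
  simp [fn_apply]

theorem fn_add (f g : Fn U) : (fn (f + g) : Op n k U) = fn f + fn g := by
  ext1 Ψ; funext p
  simp [fn_apply, add_mul]

theorem fn_neg (f : Fn U) : (fn (-f) : Op n k U) = -fn f := by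
  ext1 Ψ; funext p
  simp [fn_apply]

theorem fn_sub (f g : Fn U) : (fn (f - g) : Op n k U) = fn f - fn g := by
  rw [sub_eq_add_neg, fn_add, fn_neg, sub_eq_add_neg]

theorem fn_smul (r : ℂ) (f : Fn U) : (fn (r • f) : Op n k U) = r • fn f := by
  ext1 Ψ; funext p
  simp [fn_apply]

theorem fn_sum {ι : Type*} (s : Finset ι) (f : ι → Fn U) :
    (fn (∑ i ∈ s, f i) : Op n k U) = ∑ i ∈ s, fn (f i) := by
  classical
  induction s using Finset.induction_on with
  | empty => simp [fn_zero]
  | insert a s h ih => rw [Finset.sum_insert h, Finset.sum_insert h, fn_add, ih]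

theorem fn_fn (f g : Fn U) : (fn f * fn g : Op n k U) = fn g * fn f := by
  rw [← fn_mul, mul_comm, fn_mul]

theorem del_fn (μ : Fin d) (f : Fn U) :
    (del μ * fn f : Op n k U) = fn (partialD μ f) + fn f * del μ := by
  ext1 Ψ; funext p
  simp [fn_apply, del_apply, partialD_mul]

theorem del_del (μ ν : Fin d) : (del μ * del ν : Op n k U) = del ν * del μ := by
  ext1 Ψ; funext p
  simp only [mul_apply, del_apply, partialD_comm μ ν]

end Canonical

/-! ### Curvature identities, in matrix notation -/

section Geometry

variable {d : ℕ} {U : Opens (Fin d → ℝ)}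

/-- The entrywise partial derivative of a matrix of functions. -/
def matD (μ : Fin d) (M : Matrix (Fin d) (Fin d) (Fn U)) : Matrix (Fin d) (Fin d) (Fn U) :=
  M.map (partialD μ)

theorem matD_mul (μ : Fin d) (M N : Matrix (Fin d) (Fin d) (Fn U)) :
    matD μ (M * N) = matD μ M * N + M * matD μ N := by
  ext i j
  simp [matD, Matrix.mul_apply, map_sum, partialD_mul, sum_add_distrib]

theorem matD_add (μ : Fin d) (M N : Matrix (Fin d) (Fin d) (Fn U)) :
    matD μ (M + N) = matD μ M + matD μ N := by
  ext i j; simp [matD]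

theorem matD_sub (μ : Fin d) (M N : Matrix (Fin d) (Fin d) (Fn U)) :
    matD μ (M - N) = matD μ M - matD μ N := by
  ext i j; simp [matD]

theorem matD_one (μ : Fin d) : matD μ (1 : Matrix (Fin d) (Fin d) (Fn U)) = 0 := by
  ext i j
  by_cases h : i = j <;> simp [matD, h, partialD_one]

theorem matD_transpose (μ : Fin d) (M : Matrix (Fin d) (Fin d) (Fn U)) :
    matD μ M.transpose = (matD μ M).transpose := rfl

theorem matD_comm (μ ν : Fin d) (M : Matrix (Fin d) (Fin d) (Fn U)) :
    matD μ (matD ν M) = matD ν (matD μ M) := by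
  ext i j; simp [matD, partialD_comm μ ν]

theorem eta_mul_self (a : Fin d) : eta a * eta a = 1 := by
  unfold eta; split_ifs <;> simp

theorem partialD_algebraMap (μ : Fin d) (r : ℂ) : partialD μ (algebraMap ℂ (Fn U) r) = 0 := by
  rw [Algebra.algebraMap_eq_smul_one, map_smul, partialD_one, smul_zero]

variable (U) in
/-- The Minkowski metric as a matrix of constant functions. -/
def etaMat : Matrix (Fin d) (Fin d) (Fn U) := Matrix.diagonal fun a => algebraMap ℂ (Fn U) (eta a)

theorem etaMat_mul_self : etaMat U * etaMat U = 1 := by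
  rw [etaMat, Matrix.diagonal_mul_diagonal, ← Matrix.diagonal_one]
  congr 1; funext a
  rw [← map_mul, eta_mul_self, map_one]

theorem matD_etaMat (μ : Fin d) : matD μ (etaMat U) = 0 := by
  ext i j
  by_cases h : i = j
  · subst h; simp [matD, etaMat, partialD_algebraMap]
  · simp [matD, etaMat, h]

namespace Background

variable (B : Background U)

theorem frame_mul_coframe : B.frame * B.coframe = 1 := B.inverse

theorem coframe_mul_frame : B.coframe * B.frame = 1 := mul_eq_one_comm.1 B.inverse

def metricMat : Matrix (Fin d) (Fin d) (Fn U) := Matrix.of B.metric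

def invMetricMat : Matrix (Fin d) (Fin d) (Fn U) := Matrix.of B.invMetric

/-- The connection matrix `(Γ_μ)^ρ_ν`. -/
def gammaMat (μ : Fin d) : Matrix (Fin d) (Fin d) (Fn U) :=
  Matrix.of fun ρ ν => B.christoffel ρ μ ν

/-- The curvature matrix `(R_{μν})^ρ_σ`. -/
def riemannMat (μ ν : Fin d) : Matrix (Fin d) (Fin d) (Fn U) := Matrix.of (B.riemannUp μ ν)

/-- The connection matrix of the spin connection, `E (∂F + Γ F)`. -/
def omegaMat (μ : Fin d) : Matrix (Fin d) (Fin d) (Fn U) :=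
  B.coframe * (matD μ B.frame + B.gammaMat μ * B.frame)

theorem metricMat_eq : B.metricMat = B.coframe.transpose * etaMat U * B.coframe := by
  ext μ ν
  rw [Matrix.mul_apply]
  simp only [metricMat, Matrix.of_apply, metric, etaMat, Matrix.mul_diagonal,
    transpose_apply]
  refine sum_congr rfl fun a _ => ?_
  rw [Algebra.smul_def]; ring

theorem invMetricMat_eq : B.invMetricMat = B.frame * etaMat U * B.frame.transpose := by
  ext μ ν
  rw [Matrix.mul_apply]
  simp only [invMetricMat, Matrix.of_apply, invMetric, etaMat,
    Matrix.mul_diagonal, transpose_apply]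
  refine sum_congr rfl fun a _ => ?_
  rw [Algebra.smul_def]; ring

theorem metric_symm (μ ν : Fin d) : B.metric μ ν = B.metric ν μ := by
  simp only [metric, mul_comm]

theorem invMetric_symm (μ ν : Fin d) : B.invMetric μ ν = B.invMetric ν μ := by
  simp only [invMetric, mul_comm]

theorem metricMat_transpose : B.metricMat.transpose = B.metricMat := by
  ext μ ν; exact B.metric_symm ν μ

theorem invMetricMat_mul_metricMat : B.invMetricMat * B.metricMat = 1 := by
  have h : B.frame.transpose * B.coframe.transpose = 1 := by
    rw [← transpose_mul, B.coframe_mul_frame, Matrix.transpose_one]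
  calc B.invMetricMat * B.metricMat
      = B.frame * etaMat U * (B.frame.transpose * B.coframe.transpose) * etaMat U * B.coframe := by
        rw [metricMat_eq, invMetricMat_eq]; simp only [Matrix.mul_assoc]
    _ = B.frame * (etaMat U * etaMat U) * B.coframe := by
        rw [h, Matrix.mul_one]; simp only [Matrix.mul_assoc]
    _ = 1 := by rw [etaMat_mul_self, Matrix.mul_one, B.frame_mul_coframe]

theorem metricMat_mul_invMetricMat : B.metricMat * B.invMetricMat = 1 :=
  mul_eq_one_comm.1 B.invMetricMat_mul_metricMat

theorem sum_invMetric_mul_metric (μ ν : Fin d) :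
    ∑ l, B.invMetric μ l * B.metric l ν = if μ = ν then 1 else 0 := by
  have h := congrFun (congrFun B.invMetricMat_mul_metricMat μ) ν
  simpa [Matrix.mul_apply, Matrix.one_apply, metricMat, invMetricMat] using h

theorem christoffel_symm (ρ μ ν : Fin d) : B.christoffel ρ μ ν = B.christoffel ρ ν μ := by
  simp only [christoffel]
  congr 1
  refine sum_congr rfl fun l _ => ?_
  rw [B.metric_symm μ ν]; ring

theorem metricMat_mul_gammaMat (μ l ν : Fin d) :
    (B.metricMat * B.gammaMat μ) l ν = (1 / 2 : ℂ) •
      (partialD μ (B.metric l ν) + partialD ν (B.metric l μ) - partialD l (B.metric μ ν)) := by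
  have h : B.gammaMat μ = (1 / 2 : ℂ) • (B.invMetricMat * Matrix.of fun l ν =>
      (partialD μ (B.metric l ν) + partialD ν (B.metric l μ) - partialD l (B.metric μ ν))) := by
    ext ρ ν
    simp [gammaMat, christoffel, Matrix.mul_apply, invMetricMat]
  rw [h, Matrix.mul_smul, ← Matrix.mul_assoc, metricMat_mul_invMetricMat, Matrix.one_mul]
  rfl

/-- Metric compatibility. -/
theorem matD_metricMat (μ : Fin d) : matD μ B.metricMat =
    B.metricMat * B.gammaMat μ + (B.gammaMat μ).transpose * B.metricMat := by
  have h : (B.gammaMat μ).transpose * B.metricMat = (B.metricMat * B.gammaMat μ).transpose := by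
    rw [transpose_mul, B.metricMat_transpose]
  rw [h]
  ext l ν
  rw [Matrix.add_apply, transpose_apply, metricMat_mul_gammaMat, metricMat_mul_gammaMat,
    B.metric_symm ν μ, B.metric_symm ν l, B.metric_symm μ l, ← smul_add]
  simp only [matD, metricMat, Matrix.map_apply, Matrix.of_apply]
  rw [show partialD μ (B.metric l ν) + partialD ν (B.metric l μ) - partialD l (B.metric μ ν) +
    (partialD μ (B.metric l ν) + partialD l (B.metric μ ν) - partialD ν (B.metric l μ))
    = (2 : ℂ) • partialD μ (B.metric l ν) by rw [two_smul]; ring, smul_smul]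
  norm_num

theorem matD_invMetricMat (μ : Fin d) : matD μ B.invMetricMat =
    -(B.gammaMat μ * B.invMetricMat) - B.invMetricMat * (B.gammaMat μ).transpose := by
  have h := congrArg (matD μ) B.metricMat_mul_invMetricMat
  rw [matD_mul, matD_one, matD_metricMat] at h
  have h1 := B.metricMat_mul_invMetricMat
  have h2 := B.invMetricMat_mul_metricMat
  calc matD μ B.invMetricMat
      = B.invMetricMat * B.metricMat * matD μ B.invMetricMat := by rw [h2, Matrix.one_mul]
    _ = B.invMetricMat * ((B.metricMat * B.gammaMat μ +
          (B.gammaMat μ).transpose * B.metricMat) * B.invMetricMat +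
          B.metricMat * matD μ B.invMetricMat)
        - (B.invMetricMat * B.metricMat) * B.gammaMat μ * B.invMetricMat
        - B.invMetricMat * (B.gammaMat μ).transpose * (B.metricMat * B.invMetricMat) := by
        noncomm_ring
    _ = _ := by rw [h, h1, h2]; noncomm_ring

theorem partialD_metric (μ ν l : Fin d) : partialD μ (B.metric ν l) =
    ∑ σ, B.christoffel σ μ l * B.metric ν σ + ∑ σ, B.christoffel σ μ ν * B.metric σ l := by
  have h := congrFun (congrFun (B.matD_metricMat μ) ν) l
  simpa [matD, metricMat, gammaMat, Matrix.mul_apply, mul_comm] using h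

theorem partialD_invMetric (μ ν ρ : Fin d) : partialD μ (B.invMetric ν ρ) =
    -∑ σ, B.christoffel ν μ σ * B.invMetric σ ρ - ∑ σ, B.christoffel ρ μ σ * B.invMetric ν σ := by
  have h := congrFun (congrFun (B.matD_invMetricMat μ) ν) ρ
  simpa [matD, invMetricMat, gammaMat, Matrix.mul_apply, mul_comm] using h

theorem matD_frame (μ : Fin d) :
    matD μ B.frame = B.frame * B.omegaMat μ - B.gammaMat μ * B.frame := by
  rw [omegaMat, ← Matrix.mul_assoc, B.frame_mul_coframe]; noncomm_ring

theorem matD_coframe (μ : Fin d) :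
    matD μ B.coframe = B.coframe * B.gammaMat μ - B.omegaMat μ * B.coframe := by
  have h := congrArg (matD μ) B.coframe_mul_frame
  rw [matD_mul, matD_one, matD_frame] at h
  have h1 := B.coframe_mul_frame
  have h2 := B.frame_mul_coframe
  calc matD μ B.coframe = matD μ B.coframe * (B.frame * B.coframe) := by rw [h2, Matrix.mul_one]
    _ = (matD μ B.coframe * B.frame + B.coframe * (B.frame * B.omegaMat μ
          - B.gammaMat μ * B.frame)) * B.coframe
        - (B.coframe * B.frame) * B.omegaMat μ * B.coframe
        + B.coframe * B.gammaMat μ * (B.frame * B.coframe) := by noncomm_ring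
    _ = _ := by rw [h, h1, h2]; noncomm_ring

/-- The spin connection takes its values in the Lorentz algebra. -/
theorem omegaMat_antisymm (μ : Fin d) :
    etaMat U * B.omegaMat μ = -((B.omegaMat μ).transpose * etaMat U) := by
  have h := B.matD_metricMat μ
  rw [metricMat_eq, matD_mul, matD_mul, matD_etaMat, matD_transpose, matD_coframe,
    Matrix.transpose_sub, transpose_mul, transpose_mul] at h
  have hz : B.coframe.transpose * (etaMat U * B.omegaMat μ +
      (B.omegaMat μ).transpose * etaMat U) * B.coframe = 0 := by
    linear_combination (norm := noncomm_ring) -h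
  have h1 := B.coframe_mul_frame
  have h2 : B.frame.transpose * B.coframe.transpose = 1 := by
    rw [← transpose_mul, h1, Matrix.transpose_one]
  have h3 : etaMat U * B.omegaMat μ + (B.omegaMat μ).transpose * etaMat U = 0 := by
    calc etaMat U * B.omegaMat μ + (B.omegaMat μ).transpose * etaMat U
        = (B.frame.transpose * B.coframe.transpose) * (etaMat U * B.omegaMat μ +
          (B.omegaMat μ).transpose * etaMat U) * (B.coframe * B.frame) := by
          rw [h1, h2, Matrix.one_mul, Matrix.mul_one]
      _ = B.frame.transpose * (B.coframe.transpose * (etaMat U * B.omegaMat μ +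
          (B.omegaMat μ).transpose * etaMat U) * B.coframe) * B.frame := by noncomm_ring
      _ = 0 := by rw [hz, Matrix.mul_zero, Matrix.zero_mul]
  exact eq_neg_of_add_eq_zero_left h3

theorem riemannMat_eq (μ ν : Fin d) : B.riemannMat μ ν =
    matD μ (B.gammaMat ν) - matD ν (B.gammaMat μ) + B.gammaMat μ * B.gammaMat ν
      - B.gammaMat ν * B.gammaMat μ := by
  ext ρ σ
  simp only [riemannMat, riemannUp, gammaMat, matD, Matrix.of_apply, Matrix.sub_apply,
    Matrix.add_apply, Matrix.map_apply, Matrix.mul_apply, sum_sub_distrib]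
  ring

/-- The curvature of the spin connection. -/
theorem omegaMat_curvature (μ ν : Fin d) :
    matD μ (B.omegaMat ν) - matD ν (B.omegaMat μ) + B.omegaMat μ * B.omegaMat ν
      - B.omegaMat ν * B.omegaMat μ = B.coframe * B.riemannMat μ ν * B.frame := by
  have key : ∀ α β : Fin d, B.frame * matD α (B.omegaMat β) =
      matD α (matD β B.frame) + matD α (B.gammaMat β) * B.frame
        + B.gammaMat β * B.frame * B.omegaMat α - B.gammaMat β * B.gammaMat α * B.frame
        - B.frame * B.omegaMat α * B.omegaMat β + B.gammaMat α * B.frame * B.omegaMat β := by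
    intro α β
    have h := congrArg (matD α) (B.matD_frame β)
    rw [matD_sub, matD_mul, matD_mul, matD_frame B α] at h
    linear_combination (norm := noncomm_ring) -h
  have h : B.frame * (matD μ (B.omegaMat ν) - matD ν (B.omegaMat μ)
      + B.omegaMat μ * B.omegaMat ν - B.omegaMat ν * B.omegaMat μ)
      = B.riemannMat μ ν * B.frame := by
    rw [riemannMat_eq]
    linear_combination (norm := noncomm_ring) key μ ν - key ν μ + matD_comm μ ν B.frame
  rw [Matrix.mul_assoc, ← h, ← Matrix.mul_assoc, B.coframe_mul_frame, Matrix.one_mul]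

theorem riemann_eq (μ ν l σ : Fin d) :
    B.riemann μ ν l σ = (B.metricMat * B.riemannMat μ ν) l σ := by
  simp [riemann, Matrix.mul_apply, metricMat, riemannMat]

theorem riemannMat_antisymm (μ ν : Fin d) :
    B.metricMat * B.riemannMat μ ν = -((B.riemannMat μ ν).transpose * B.metricMat) := by
  have key : ∀ α β : Fin d, matD α (matD β B.metricMat) =
      (B.metricMat * B.gammaMat α + (B.gammaMat α).transpose * B.metricMat) * B.gammaMat β
      + B.metricMat * matD α (B.gammaMat β) + (matD α (B.gammaMat β)).transpose * B.metricMat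
      + (B.gammaMat β).transpose *
        (B.metricMat * B.gammaMat α + (B.gammaMat α).transpose * B.metricMat) := by
    intro α β
    rw [B.matD_metricMat β, matD_add, matD_mul, matD_mul, matD_transpose, B.matD_metricMat α]
    noncomm_ring
  have h := matD_comm μ ν B.metricMat
  rw [key, key] at h
  rw [riemannMat_eq]
  simp only [Matrix.transpose_sub, Matrix.transpose_add, transpose_mul]
  linear_combination (norm := noncomm_ring) h

theorem riemannUp_antisymm (μ ν ρ σ : Fin d) :
    B.riemannUp μ ν ρ σ = -B.riemannUp ν μ ρ σ := by
  simp only [riemannUp, sum_sub_distrib]; ring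

theorem riemann_antisymm_left (μ ν l σ : Fin d) :
    B.riemann μ ν l σ = -B.riemann ν μ l σ := by
  simp only [riemann]
  rw [← sum_neg_distrib]
  refine sum_congr rfl fun ρ _ => ?_
  rw [B.riemannUp_antisymm μ ν]; ring

theorem riemann_antisymm_right (μ ν l σ : Fin d) :
    B.riemann μ ν l σ = -B.riemann μ ν σ l := by
  rw [riemann_eq, riemannMat_antisymm, riemann_eq, Matrix.neg_apply]
  congr 1
  simp only [Matrix.mul_apply, transpose_apply]
  refine sum_congr rfl fun ρ _ => ?_
  rw [mul_comm]; congr 1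
  exact B.metric_symm _ _

/-- The algebraic Bianchi identity. -/
theorem riemannUp_cyclic (μ ν ρ σ : Fin d) :
    B.riemannUp μ ν ρ σ + B.riemannUp ν σ ρ μ + B.riemannUp σ μ ρ ν = 0 := by
  have h : ∀ α β γ : Fin d, ∑ l, B.christoffel ρ α l * B.christoffel l β γ =
      ∑ l, B.christoffel ρ α l * B.christoffel l γ β := fun α β γ =>
    sum_congr rfl fun l _ => by rw [B.christoffel_symm l β γ]
  simp only [riemannUp, sum_sub_distrib]
  rw [h μ ν σ, h ν σ μ, h σ μ ν, B.christoffel_symm ρ ν σ, B.christoffel_symm ρ μ σ,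
    B.christoffel_symm ρ ν μ]
  ring

theorem riemann_cyclic (μ ν l σ : Fin d) :
    B.riemann μ ν l σ + B.riemann ν σ l μ + B.riemann σ μ l ν = 0 := by
  simp only [riemann]
  rw [← sum_add_distrib, ← sum_add_distrib]
  refine sum_eq_zero fun ρ _ => ?_
  linear_combination B.metric l ρ * B.riemannUp_cyclic μ ν ρ σ

theorem Fn.eq_of_two_mul {f g : Fn U} (h : 2 * f = 2 * g) : f = g := by
  have h2 : (2 : ℂ) • f = (2 : ℂ) • g := by
    rw [two_smul, two_smul]; linear_combination h
  simpa using congrArg ((1 / 2 : ℂ) • ·) h2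

theorem riemann_pair_symm (μ ν l σ : Fin d) : B.riemann μ ν l σ = B.riemann l σ μ ν := by
  apply Fn.eq_of_two_mul
  have a := B.riemann_antisymm_left
  have b := B.riemann_antisymm_right
  have c := B.riemann_cyclic
  linear_combination c μ ν l σ - c μ ν σ l - c l σ μ ν + c l σ ν μ + b μ ν σ l + b ν l σ μ
    + a l μ σ ν - b μ l σ ν + a σ ν μ l - b ν σ μ l - b l σ ν μ - b σ μ ν l

/-! ### The covariant derivative of the curvature -/

/-- `∇_λ R_{μνρσ}`. -/
def nablaRiemann (lam μ ν ρ σ : Fin d) : Fn U :=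
  partialD lam (B.riemann μ ν ρ σ)
    - ∑ τ, B.christoffel τ lam μ * B.riemann τ ν ρ σ
    - ∑ τ, B.christoffel τ lam ν * B.riemann μ τ ρ σ
    - ∑ τ, B.christoffel τ lam ρ * B.riemann μ ν τ σ
    - ∑ τ, B.christoffel τ lam σ * B.riemann μ ν ρ τ

/-- `∇_λ R_{μν}`. -/
def nablaRicci (lam μ ν : Fin d) : Fn U :=
  partialD lam (B.ricci μ ν) - ∑ τ, B.christoffel τ lam μ * B.ricci τ ν
    - ∑ τ, B.christoffel τ lam ν * B.ricci μ τ

/-- `∇_λ R_{μν}` for the matrices `R_{μν}`. -/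
def nablaRiemannMat (lam μ ν : Fin d) : Matrix (Fin d) (Fin d) (Fn U) :=
  matD lam (B.riemannMat μ ν) + B.gammaMat lam * B.riemannMat μ ν
    - B.riemannMat μ ν * B.gammaMat lam
    - ∑ τ, B.christoffel τ lam μ • B.riemannMat τ ν
    - ∑ τ, B.christoffel τ lam ν • B.riemannMat μ τ

theorem metricMat_mul_nablaRiemannMat (lam μ ν ρ σ : Fin d) :
    (B.metricMat * B.nablaRiemannMat lam μ ν) ρ σ = B.nablaRiemann lam μ ν ρ σ := by
  have h : B.metricMat * B.nablaRiemannMat lam μ ν =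
      matD lam (B.metricMat * B.riemannMat μ ν)
      - (B.gammaMat lam).transpose * (B.metricMat * B.riemannMat μ ν)
      - B.metricMat * B.riemannMat μ ν * B.gammaMat lam
      - ∑ τ, B.christoffel τ lam μ • (B.metricMat * B.riemannMat τ ν)
      - ∑ τ, B.christoffel τ lam ν • (B.metricMat * B.riemannMat μ τ) := by
    rw [matD_mul, matD_metricMat, nablaRiemannMat]
    simp only [← Matrix.mul_smul, ← Matrix.mul_sum]
    noncomm_ring
  have hr : ∀ μ ν, B.metricMat * B.riemannMat μ ν = Matrix.of (B.riemann μ ν) := fun μ ν => by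
    ext l σ; exact (B.riemann_eq μ ν l σ).symm
  rw [h]
  simp only [hr, nablaRiemann, Matrix.sub_apply, Matrix.sum_apply, Matrix.smul_apply, matD,
    Matrix.map_apply, Matrix.of_apply, smul_eq_mul, Matrix.mul_apply, transpose_apply,
    gammaMat]
  rw [sum_congr rfl fun τ _ => mul_comm (B.riemann μ ν ρ τ) (B.christoffel τ lam σ)]
  ring

theorem nablaRiemann_antisymm_left (lam μ ν ρ σ : Fin d) :
    B.nablaRiemann lam μ ν ρ σ = -B.nablaRiemann lam ν μ ρ σ := by
  simp only [nablaRiemann]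
  rw [B.riemann_antisymm_left μ ν ρ σ]
  simp only [B.riemann_antisymm_left μ _ _ _, B.riemann_antisymm_left _ ν _ _, mul_neg,
    sum_neg_distrib, map_neg]
  ring

theorem nablaRiemann_antisymm_right (lam μ ν ρ σ : Fin d) :
    B.nablaRiemann lam μ ν ρ σ = -B.nablaRiemann lam μ ν σ ρ := by
  simp only [nablaRiemann]
  simp only [B.riemann_antisymm_right _ _ ρ _, B.riemann_antisymm_right _ _ _ σ, mul_neg,
    sum_neg_distrib, map_neg]
  ring

theorem nablaRiemann_pair_symm (lam μ ν ρ σ : Fin d) :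
    B.nablaRiemann lam μ ν ρ σ = B.nablaRiemann lam ρ σ μ ν := by
  simp only [nablaRiemann]
  simp only [B.riemann_pair_symm _ _ ρ _, B.riemann_pair_symm _ _ _ σ]
  ring

theorem riemannMat_neg_swap (μ ν : Fin d) : B.riemannMat μ ν = -B.riemannMat ν μ := by
  ext ρ σ; exact B.riemannUp_antisymm μ ν ρ σ

/-- The differential Bianchi identity. -/
theorem nablaRiemannMat_cyclic (lam μ ν : Fin d) :
    B.nablaRiemannMat lam μ ν + B.nablaRiemannMat μ ν lam + B.nablaRiemannMat ν lam μ = 0 := by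
  have hs : ∀ α β γ : Fin d, ∑ τ, B.christoffel τ α β • B.riemannMat τ γ =
      -∑ τ, B.christoffel τ β α • B.riemannMat γ τ := fun α β γ => by
    rw [← sum_neg_distrib]
    refine sum_congr rfl fun τ _ => ?_
    rw [B.christoffel_symm, B.riemannMat_neg_swap τ γ, smul_neg]
  have hd : ∀ α β γ : Fin d, matD α (B.riemannMat β γ) =
      matD α (matD β (B.gammaMat γ)) - matD α (matD γ (B.gammaMat β))
      + matD α (B.gammaMat β) * B.gammaMat γ + B.gammaMat β * matD α (B.gammaMat γ)
      - matD α (B.gammaMat γ) * B.gammaMat β - B.gammaMat γ * matD α (B.gammaMat β) := by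
    intro α β γ
    rw [riemannMat_eq, matD_sub, matD_add, matD_sub, matD_mul, matD_mul]
    noncomm_ring
  simp only [nablaRiemannMat]
  rw [hs lam μ ν, hs μ ν lam, hs ν lam μ, hd, hd, hd, riemannMat_eq, riemannMat_eq, riemannMat_eq]
  linear_combination (norm := noncomm_ring) matD_comm lam μ (B.gammaMat ν)
    + matD_comm μ ν (B.gammaMat lam) + matD_comm ν lam (B.gammaMat μ)

theorem nablaRiemann_cyclic (lam μ ν ρ σ : Fin d) :
    B.nablaRiemann lam μ ν ρ σ + B.nablaRiemann μ ν lam ρ σ + B.nablaRiemann ν lam μ ρ σ = 0 := by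
  simp only [← metricMat_mul_nablaRiemannMat, ← Matrix.add_apply, ← Matrix.mul_add,
    B.nablaRiemannMat_cyclic, Matrix.mul_zero, Matrix.zero_apply]

/-! ### Contractions -/

theorem sum_invMetric_riemann_inner (μ ν σ : Fin d) (l : Fin d) :
    ∑ ρ, B.invMetric l ρ * B.riemann μ ν ρ σ = B.riemannUp μ ν l σ := by
  have h : B.invMetricMat * (B.metricMat * B.riemannMat μ ν) = B.riemannMat μ ν := by
    rw [← Matrix.mul_assoc, B.invMetricMat_mul_metricMat, Matrix.one_mul]
  have h2 := congrFun (congrFun h l) σ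
  rw [Matrix.mul_apply] at h2
  simp only [← riemann_eq] at h2
  exact h2

/-- `g^{λρ} R_{λμρν} = R_{μν}`. -/
theorem sum_invMetric_riemann_outer (μ ν : Fin d) :
    ∑ l, ∑ ρ, B.invMetric l ρ * B.riemann l μ ρ ν = B.ricci μ ν := by
  simp only [sum_invMetric_riemann_inner, ricci]

/-- `g^{νρ} R_{μνρσ} = -R_{μσ}`. -/
theorem sum_invMetric_riemann_mid (μ σ : Fin d) :
    ∑ ν, ∑ ρ, B.invMetric ν ρ * B.riemann μ ν ρ σ = -B.ricci μ σ := by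
  rw [← sum_invMetric_riemann_outer]
  simp only [B.riemann_antisymm_left μ, mul_neg, sum_neg_distrib]

theorem ricci_symm (μ ν : Fin d) : B.ricci μ ν = B.ricci ν μ := by
  rw [← sum_invMetric_riemann_outer, ← sum_invMetric_riemann_outer, sum_comm]
  refine sum_congr rfl fun l _ => sum_congr rfl fun ρ _ => ?_
  rw [B.riemann_pair_symm, B.invMetric_symm]

/-- `g^{νρ} ∇_λ R_{μνρσ} = -∇_λ R_{μσ}`. -/
theorem sum_invMetric_nablaRiemann_mid (lam μ σ : Fin d) :
    ∑ ν, ∑ ρ, B.invMetric ν ρ * B.nablaRiemann lam μ ν ρ σ = -B.nablaRicci lam μ σ := by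
  have h : ∀ ν, ∑ ρ, B.invMetric ν ρ * B.nablaRiemann lam μ ν ρ σ =
      B.nablaRiemannMat lam μ ν ν σ := fun ν => by
    have h1 : B.invMetricMat * (B.metricMat * B.nablaRiemannMat lam μ ν) =
        B.nablaRiemannMat lam μ ν := by
      rw [← Matrix.mul_assoc, B.invMetricMat_mul_metricMat, Matrix.one_mul]
    have h2 := congrFun (congrFun h1 ν) σ
    rw [Matrix.mul_apply] at h2
    simpa only [metricMat_mul_nablaRiemannMat, invMetricMat, Matrix.of_apply] using h2
  have hR : ∀ μ σ, B.ricci μ σ = -∑ ν, B.riemannUp μ ν ν σ := fun μ σ => by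
    rw [ricci, ← sum_neg_distrib]
    exact sum_congr rfl fun ν _ => B.riemannUp_antisymm ν μ ν σ
  simp only [h]
  simp only [nablaRiemannMat, Matrix.sub_apply, Matrix.add_apply, Matrix.sum_apply,
    Matrix.smul_apply, Matrix.mul_apply, sum_add_distrib, sum_sub_distrib, matD,
    Matrix.map_apply, riemannMat, gammaMat, Matrix.of_apply, smul_eq_mul, nablaRicci, hR, map_neg,
    map_sum, mul_neg, sum_neg_distrib, mul_sum]
  rw [sum_comm (f := fun ν τ => B.christoffel τ lam μ * B.riemannUp τ ν ν σ),
    sum_comm (f := fun ν τ => B.riemannUp μ ν ν τ * B.christoffel τ lam σ),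
    sum_comm (f := fun ν τ => B.christoffel τ lam ν * B.riemannUp μ τ ν σ)]
  simp only [mul_comm (B.riemannUp μ _ _ _)]
  ring

/-- `∇^ρ R_{μνρσ} = ∇_μ R_{νσ} - ∇_ν R_{μσ}`. -/
theorem sum_invMetric_nablaRiemann_div (μ ν σ : Fin d) :
    ∑ l, ∑ ρ, B.invMetric l ρ * B.nablaRiemann l μ ν ρ σ =
      B.nablaRicci μ ν σ - B.nablaRicci ν μ σ := by
  have h : ∀ l ρ, B.invMetric l ρ * B.nablaRiemann l μ ν ρ σ =
      B.invMetric l ρ * B.nablaRiemann ν μ l ρ σ - B.invMetric l ρ * B.nablaRiemann μ ν l ρ σ :=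
    fun l ρ => by
      linear_combination B.invMetric l ρ * (B.nablaRiemann_cyclic l μ ν ρ σ
        - B.nablaRiemann_antisymm_left ν l μ ρ σ)
  simp only [h, sum_sub_distrib, sum_invMetric_nablaRiemann_mid]
  ring

/-- `∇^μ R_{μνρσ}` in terms of the Ricci tensor. -/
theorem sum_invMetric_nablaRiemann_div' (ν ρ σ : Fin d) :
    ∑ l, ∑ μ, B.invMetric l μ * B.nablaRiemann l μ ν ρ σ =
      B.nablaRicci ρ σ ν - B.nablaRicci σ ρ ν := by
  rw [← sum_invMetric_nablaRiemann_div]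
  refine sum_congr rfl fun l _ => sum_congr rfl fun μ _ => ?_
  rw [B.nablaRiemann_pair_symm]

theorem nablaRicci_eq_of_ricci_eq {f : Fn U} (h : ∀ μ ν, B.ricci μ ν = f * B.metric μ ν)
    (lam μ ν : Fin d) : B.nablaRicci lam μ ν = partialD lam f * B.metric μ ν := by
  simp only [nablaRicci, h, partialD_mul, partialD_metric]
  simp only [mul_left_comm _ f, ← mul_sum]
  ring

theorem scalarCurvature_eq_of_ricci_eq {f : Fn U} (h : ∀ μ ν, B.ricci μ ν = f * B.metric μ ν) :
    B.scalarCurvature = (d : ℂ) • f := by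
  have h1 : ∀ μ, ∑ ν, B.invMetric μ ν * (f * B.metric μ ν) = f := fun μ => by
    simp only [mul_left_comm _ f, ← mul_sum, B.metric_symm μ, sum_invMetric_mul_metric]
    simp
  simp only [scalarCurvature, h, h1]
  simp [Algebra.smul_def]

/-- Schur's lemma. -/
theorem partialD_eq_zero_of_ricci_eq {f : Fn U} (hd : (d : ℂ) ≠ 2)
    (h : ∀ μ ν, B.ricci μ ν = f * B.metric μ ν) (μ : Fin d) : partialD μ f = 0 := by
  have h1 : ∑ ν, ∑ σ, B.invMetric ν σ * ∑ l, ∑ ρ, B.invMetric l ρ * B.nablaRiemann l μ ν ρ σ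
      = ∑ l, ∑ ρ, B.invMetric l ρ * ∑ ν, ∑ σ, B.invMetric ν σ * B.nablaRiemann l μ ν ρ σ := by
    simp only [mul_sum]
    calc _ = ∑ ν, ∑ l, ∑ σ, ∑ ρ, B.invMetric ν σ * (B.invMetric l ρ * B.nablaRiemann l μ ν ρ σ) :=
          sum_congr rfl fun ν _ => sum_comm
      _ = ∑ l, ∑ ν, ∑ ρ, ∑ σ, B.invMetric ν σ * (B.invMetric l ρ * B.nablaRiemann l μ ν ρ σ) := by
          rw [sum_comm]
          exact sum_congr rfl fun l _ => sum_congr rfl fun ν _ => sum_comm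
      _ = _ := sum_congr rfl fun l _ => by
          rw [sum_comm]
          refine sum_congr rfl fun ρ _ => sum_congr rfl fun ν _ =>
            sum_congr rfl fun σ _ => ?_
          ring
  have h2 : ∀ l ρ, ∑ ν, ∑ σ, B.invMetric ν σ * B.nablaRiemann l μ ν ρ σ =
      partialD l f * B.metric μ ρ := fun l ρ => by
    rw [← B.nablaRicci_eq_of_ricci_eq h, ← neg_neg (B.nablaRicci l μ ρ),
      ← sum_invMetric_nablaRiemann_mid]
    simp only [B.nablaRiemann_antisymm_right l μ _ ρ, mul_neg, sum_neg_distrib]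
  simp only [h2, sum_invMetric_nablaRiemann_div, B.nablaRicci_eq_of_ricci_eq h] at h1
  have h3 : ∀ (a : Fn U) (ν ρ : Fin d), ∑ σ, B.invMetric ν σ * (a * B.metric ρ σ) =
      a * if ν = ρ then 1 else 0 := fun a ν ρ => by
    simp only [mul_left_comm _ a, ← mul_sum, B.metric_symm ρ, sum_invMetric_mul_metric]
  simp only [mul_sub, sum_sub_distrib, h3] at h1
  simp only [mul_ite, mul_one, mul_zero, if_true, Finset.sum_const, Finset.card_univ,
    Fintype.card_fin, sum_ite_eq', mem_univ] at h1
  have h4 : ((d : ℂ) - 2) • partialD μ f = 0 := by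
    rw [Algebra.smul_def, map_sub, map_natCast, map_ofNat]
    rw [nsmul_eq_mul] at h1
    linear_combination h1
  exact (smul_eq_zero_iff_right (sub_ne_zero.2 hd)).1 h4

end Background
end Geometry

attribute [local irreducible] oddMul oddDer evenMul evenDer fn del partialD

/-! ### Relations between the oscillators -/

section Relations

variable {n k d : ℕ}

theorem psiOsc_inj (i j : Fin n) (a b : Fin d) :
    (psiOsc i a : OddOsc n d k) = psiOsc j b ↔ i = j ∧ a = b := by
  simp [psiOsc, Sum.inlₗ]

theorem thetaOsc_inj (i j : Fin n) (a b : Fin k) :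
    (thetaOsc i a : OddOsc n d k) = thetaOsc j b ↔ i = j ∧ a = b := by
  simp [thetaOsc, Sum.inlₗ, Sum.inrₗ]

theorem psiOsc_ne_thetaOsc (i j : Fin n) (a : Fin d) (b : Fin k) :
    (psiOsc i a : OddOsc n d k) ≠ thetaOsc j b := by
  simp [psiOsc, thetaOsc, Sum.inlₗ, Sum.inrₗ]

theorem psiOsc_ne_cOsc (i : Fin n) (a : Fin d) : (psiOsc i a : OddOsc n d k) ≠ cOsc := by
  simp [psiOsc, cOsc, Sum.inlₗ, Sum.inrₗ]

theorem thetaOsc_ne_cOsc (i : Fin n) (a : Fin k) : (thetaOsc i a : OddOsc n d k) ≠ cOsc := by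
  simp [thetaOsc, cOsc, Sum.inlₗ, Sum.inrₗ]

variable {U : Opens (Fin d → ℝ)}

theorem oddDer_oddMul_of_ne {o o' : OddOsc n d k} (h : o ≠ o') :
    (oddDer o * oddMul o' : Op n k U) = -(oddMul o' * oddDer o) := by
  rw [oddDer_oddMul, if_neg h, zero_sub]

theorem oddMul_oddDer_of_ne {o o' : OddOsc n d k} (h : o ≠ o') :
    (oddMul o * oddDer o' : Op n k U) = -(oddDer o' * oddMul o) := by
  rw [oddDer_oddMul, if_neg h.symm, zero_sub, neg_neg]

theorem psiFlat_psiFlat (i j : Fin n) (a b : Fin d) :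
    (psiFlat i a * psiFlat j b : Op n k U) = -(psiFlat j b * psiFlat i a) := oddMul_oddMul _ _

theorem psiDer_psiDer (i j : Fin n) (a b : Fin d) :
    (psiDer i a * psiDer j b : Op n k U) = -(psiDer j b * psiDer i a) := oddDer_oddDer _ _

theorem psiDer_psiFlat (i j : Fin n) (a b : Fin d) :
    (psiDer i a * psiFlat j b : Op n k U) =
      (if i = j ∧ a = b then 1 else 0) - psiFlat j b * psiDer i a := by
  rw [psiDer, psiFlat, oddDer_oddMul]; simp only [psiOsc_inj]

theorem Commute.fn_right_sum {ι : Type*} {s : Finset ι} {X : Op n k U} {f : ι → Fn U}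
    {Y : ι → Op n k U} (hf : ∀ g : Fn U, Commute X (fn g)) (hY : ∀ a ∈ s, Commute X (Y a)) :
    Commute X (∑ a ∈ s, fn (f a) * Y a) :=
  Commute.sum_right _ _ _ fun a ha => (hf _).mul_right (hY a ha)

theorem commute_fn_fn (f g : Fn U) : Commute (fn f : Op n k U) (fn g) := fn_fn f g

theorem commute_fn_oddMul (f : Fn U) (o : OddOsc n d k) : Commute (fn f : Op n k U) (oddMul o) :=
  fn_oddMul f o

theorem commute_fn_oddDer (f : Fn U) (o : OddOsc n d k) : Commute (fn f : Op n k U) (oddDer o) :=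
  fn_oddDer f o

theorem commute_fn_evenMul (f : Fn U) (e : EvenOsc n) : Commute (fn f : Op n k U) (evenMul e) :=
  fn_evenMul f e

theorem commute_fn_evenDer (f : Fn U) (e : EvenOsc n) : Commute (fn f : Op n k U) (evenDer e) :=
  fn_evenDer f e

theorem commute_fn_psiFlat (f : Fn U) (i : Fin n) (a : Fin d) :
    Commute (fn f : Op n k U) (psiFlat i a) := fn_oddMul f _

theorem commute_fn_psiDer (f : Fn U) (i : Fin n) (a : Fin d) :
    Commute (fn f : Op n k U) (psiDer i a) := fn_oddDer f _

theorem commute_fn_psiBarFlat (f : Fn U) (i : Fin n) (a : Fin d) :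
    Commute (fn f : Op n k U) (psiBarFlat i a) := (commute_fn_psiDer f i a).smul_right _

theorem commute_fn_gam (f : Fn U) (i : Fin n) : Commute (fn f : Op n k U) (gam i) :=
  fn_evenMul f _

theorem commute_fn_gamBar (f : Fn U) (i : Fin n) : Commute (fn f : Op n k U) (gamBar i) :=
  (commute_fn_evenDer f _).neg_right

variable (B : Background U)

theorem commute_fn_psi (f : Fn U) (i : Fin n) (μ : Fin d) :
    Commute (fn f : Op n k U) (psi B i μ) :=
  Commute.fn_right_sum (commute_fn_fn f) fun a _ => commute_fn_psiFlat f i a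

theorem commute_fn_psiBar (f : Fn U) (i : Fin n) (μ : Fin d) :
    Commute (fn f : Op n k U) (psiBar B i μ) :=
  Commute.fn_right_sum (commute_fn_fn f) fun a _ => commute_fn_psiBarFlat f i a

theorem commute_fn_psiPsiBar (f : Fn U) (μ ν : Fin d) :
    Commute (fn f : Op n k U) (psiPsiBar B μ ν) :=
  Commute.sum_right _ _ _ fun i _ => (commute_fn_psi B f i μ).mul_right (commute_fn_psiBar B f i ν)

/-- An operator that commutes with the even oscillators. -/
def CommutesWithEven (X : Op n k U) : Prop :=
  ∀ e, Commute (evenMul e) X ∧ Commute (evenDer e) X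

theorem CommutesWithEven.mul {X Y : Op n k U} (hX : CommutesWithEven X) (hY : CommutesWithEven Y) :
    CommutesWithEven (X * Y) :=
  fun e => ⟨(hX e).1.mul_right (hY e).1, (hX e).2.mul_right (hY e).2⟩

theorem CommutesWithEven.add {X Y : Op n k U} (hX : CommutesWithEven X) (hY : CommutesWithEven Y) :
    CommutesWithEven (X + Y) :=
  fun e => ⟨(hX e).1.add_right (hY e).1, (hX e).2.add_right (hY e).2⟩

theorem CommutesWithEven.sub {X Y : Op n k U} (hX : CommutesWithEven X) (hY : CommutesWithEven Y) :
    CommutesWithEven (X - Y) :=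
  fun e => ⟨(hX e).1.sub_right (hY e).1, (hX e).2.sub_right (hY e).2⟩

theorem CommutesWithEven.smul {X : Op n k U} (r : ℂ) (hX : CommutesWithEven X) :
    CommutesWithEven (r • X) :=
  fun e => ⟨(hX e).1.smul_right r, (hX e).2.smul_right r⟩

theorem CommutesWithEven.one : CommutesWithEven (1 : Op n k U) :=
  fun _ => ⟨Commute.one_right _, Commute.one_right _⟩

theorem CommutesWithEven.sum {ι : Type*} {s : Finset ι} {X : ι → Op n k U}
    (hX : ∀ a ∈ s, CommutesWithEven (X a)) : CommutesWithEven (∑ a ∈ s, X a) :=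
  fun e => ⟨Commute.sum_right _ _ _ fun a ha => (hX a ha e).1,
    Commute.sum_right _ _ _ fun a ha => (hX a ha e).2⟩

theorem CommutesWithEven.oddMul (o : OddOsc n d k) :
    CommutesWithEven (oddMul o : Op n k U) :=
  fun e => ⟨(oddMul_evenMul o e).symm, (oddMul_evenDer o e).symm⟩

theorem CommutesWithEven.oddDer (o : OddOsc n d k) :
    CommutesWithEven (oddDer o : Op n k U) :=
  fun e => ⟨(oddDer_evenMul o e).symm, (oddDer_evenDer o e).symm⟩

theorem CommutesWithEven.fn (f : Fn U) : CommutesWithEven (fn f : Op n k U) :=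
  fun e => ⟨(fn_evenMul f e).symm, (fn_evenDer f e).symm⟩

theorem CommutesWithEven.del (μ : Fin d) : CommutesWithEven (del μ : Op n k U) :=
  fun e => ⟨(del_evenMul μ e).symm, (del_evenDer μ e).symm⟩

theorem CommutesWithEven.psi (i : Fin n) (μ : Fin d) :
    CommutesWithEven (psi B i μ : Op n k U) :=
  .sum fun _ _ => (CommutesWithEven.fn _).mul (.oddMul _)

theorem CommutesWithEven.psiBar (i : Fin n) (μ : Fin d) :
    CommutesWithEven (psiBar B i μ : Op n k U) :=
  .sum fun _ _ => (CommutesWithEven.fn _).mul ((CommutesWithEven.oddDer _).smul _)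

theorem CommutesWithEven.psiPsiBar (μ ν : Fin d) :
    CommutesWithEven (psiPsiBar B μ ν : Op n k U) :=
  .sum fun i _ => (CommutesWithEven.psi B i μ).mul (.psiBar B i ν)

theorem CommutesWithEven.hatNabla (μ : Fin d) :
    CommutesWithEven (hatNabla B μ : Op n k U) :=
  (CommutesWithEven.del μ).add (.sum fun _ _ => .sum fun _ _ => (CommutesWithEven.fn _).mul
    (.sum fun _ _ => (CommutesWithEven.oddMul _).mul ((CommutesWithEven.oddDer _).smul _)))

theorem CommutesWithEven.laplacian : CommutesWithEven (laplacian B : Op n k U) :=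
  .sum fun _ _ => .sum fun _ _ => (CommutesWithEven.fn _).mul
    (((CommutesWithEven.hatNabla B _).mul (.hatNabla B _)).sub
      (.sum fun _ _ => (CommutesWithEven.fn _).mul (.hatNabla B _)))

theorem CommutesWithEven.curvCoupling (κ : ℂ) :
    CommutesWithEven (curvCoupling B κ : Op n k U) :=
  .add (.sum fun _ _ => .sum fun _ _ => .sum fun _ _ => .sum fun _ _ =>
    (CommutesWithEven.fn _).mul ((CommutesWithEven.psiPsiBar B _ _).mul (.psiPsiBar B _ _)))
    ((CommutesWithEven.fn _).smul κ)

theorem CommutesWithEven.hamiltonianD (κ : ℂ) (m : ℝ) :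
    CommutesWithEven (hamiltonianD B κ m : Op n k U) :=
  .add (.sub (.laplacian B) (.smul _ .one)) (.curvCoupling B κ)

theorem CommutesWithEven.gam {X : Op n k U} (hX : CommutesWithEven X) (i : Fin n) :
    Commute (gam i) X := (hX _).1

theorem CommutesWithEven.gamBar {X : Op n k U} (hX : CommutesWithEven X) (i : Fin n) :
    Commute (gamBar i) X := (hX _).2.neg_left

theorem commute_gam_gam (i j : Fin n) : Commute (gam i : Op n k U) (gam j) := evenMul_evenMul _ _

theorem commute_gamBar_gamBar (i j : Fin n) : Commute (gamBar i : Op n k U) (gamBar j) :=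
  Commute.neg_left <| Commute.neg_right <| evenDer_evenDer _ _

theorem commute_gamBar_gam (i j : Fin n) : Commute (gamBar i : Op n k U) (gam j) := by
  refine Commute.neg_left ?_
  have h := evenDer_evenMul (k := k) (U := U) (Sum.inr i) (Sum.inl j)
  rw [if_neg (by simp), zero_add] at h
  exact h

/-! ### Anticommutators of curved oscillators -/

theorem fn_sum_mul_fn_sum_anticomm {ι : Type*} [Fintype ι] {f g : ι → Fn U} {X Y : ι → Op n k U}
    {K : ι → ι → Op n k U} (hX : ∀ h a, Commute (fn h) (X a)) (hY : ∀ h a, Commute (fn h) (Y a))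
    (hXY : ∀ a b, X a * Y b = K a b - Y b * X a) :
    (∑ a, fn (f a) * X a) * (∑ b, fn (g b) * Y b) =
      (∑ a, ∑ b, fn (f a * g b) * K a b) - (∑ b, fn (g b) * Y b) * ∑ a, fn (f a) * X a := by
  rw [sum_mul_sum, sum_mul_sum, sum_comm (s := Finset.univ (α := ι)),
    sum_comm (f := fun a b => fn (f a * g b) * K a b), ← sum_sub_distrib]
  refine sum_congr rfl fun b _ => ?_
  rw [← sum_sub_distrib]
  refine sum_congr rfl fun a _ => ?_
  calc fn (f a) * X a * (fn (g b) * Y b) = fn (f a) * (X a * fn (g b)) * Y b := by noncomm_ring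
    _ = fn (f a) * fn (g b) * (X a * Y b) := by rw [← (hX (g b) a).eq]; noncomm_ring
    _ = fn (f a) * fn (g b) * K a b - fn (f a) * fn (g b) * Y b * X a := by
        rw [hXY]; noncomm_ring
    _ = fn (f a) * fn (g b) * K a b - fn (g b) * (fn (f a) * Y b) * X a := by
        rw [fn_fn]; noncomm_ring
    _ = _ := by rw [(hY (f a) b).eq, fn_mul]; noncomm_ring

theorem psi_psi (i j : Fin n) (μ ν : Fin d) :
    (psi B i μ * psi B j ν : Op n k U) = -(psi B j ν * psi B i μ) := by
  rw [psi, psi, fn_sum_mul_fn_sum_anticomm (K := fun _ _ => 0)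
    (fun h a => commute_fn_psiFlat h i a) (fun h a => commute_fn_psiFlat h j a)
    (fun a b => by rw [psiFlat_psiFlat, zero_sub])]
  simp

theorem psiBarFlat_psiBarFlat (i j : Fin n) (a b : Fin d) :
    (psiBarFlat i a * psiBarFlat j b : Op n k U) = -(psiBarFlat j b * psiBarFlat i a) := by
  simp only [psiBarFlat, smul_mul_assoc, mul_smul_comm]
  rw [psiDer_psiDer, smul_comm, smul_neg, smul_neg]

theorem psiBar_psiBar (i j : Fin n) (μ ν : Fin d) :
    (psiBar B i μ * psiBar B j ν : Op n k U) = -(psiBar B j ν * psiBar B i μ) := by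
  rw [psiBar, psiBar, fn_sum_mul_fn_sum_anticomm (K := fun _ _ => 0)
    (fun h a => commute_fn_psiBarFlat h i a) (fun h a => commute_fn_psiBarFlat h j a)
    (fun a b => by rw [psiBarFlat_psiBarFlat, zero_sub])]
  simp

theorem psiBar_psi (i j : Fin n) (μ ν : Fin d) :
    (psiBar B i μ * psi B j ν : Op n k U) =
      (if i = j then fn (B.invMetric μ ν) else 0) - psi B j ν * psiBar B i μ := by
  rw [psiBar, psi, fn_sum_mul_fn_sum_anticomm
    (K := fun a b => if i = j ∧ a = b then eta a • (1 : Op n k U) else 0)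
    (fun h a => commute_fn_psiBarFlat h i a) (fun h a => commute_fn_psiFlat h j a)
    (fun a b => by
      rw [psiBarFlat, smul_mul_assoc, psiDer_psiFlat, smul_sub, smul_ite, smul_zero,
        mul_smul_comm])]
  congr 1
  by_cases h : i = j
  · simp only [h, true_and, if_true, mul_ite, mul_zero, sum_ite_eq, mem_univ,
      Background.invMetric, fn_sum, fn_smul, mul_smul_comm, mul_one]
  · simp [h]

/-- An operator that anticommutes with the curved `ψ` and `ψ̄`. -/
theorem psi_anticomm {X : Op n k U} (hf : ∀ f, Commute (fn f) X) (i : Fin n)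
    (h : ∀ a, X * psiFlat i a = -(psiFlat i a * X)) (μ : Fin d) :
    X * psi B i μ = -(psi B i μ * X) := by
  rw [psi, mul_sum, sum_mul, ← sum_neg_distrib]
  refine sum_congr rfl fun a _ => ?_
  rw [← mul_assoc, ← (hf _).eq, mul_assoc, h]; noncomm_ring

theorem psiBar_anticomm {X : Op n k U} (hf : ∀ f, Commute (fn f) X) (i : Fin n)
    (h : ∀ a, X * psiDer i a = -(psiDer i a * X)) (μ : Fin d) :
    X * psiBar B i μ = -(psiBar B i μ * X) := by
  rw [psiBar, mul_sum, sum_mul, ← sum_neg_distrib]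
  refine sum_congr rfl fun a _ => ?_
  rw [← mul_assoc, ← (hf _).eq, mul_assoc, psiBarFlat, mul_smul_comm, h, smul_neg, mul_neg,
    mul_assoc, smul_mul_assoc]

theorem theta_psi (i j : Fin n) (r : Fin k) (μ : Fin d) :
    (theta i r * psi B j μ : Op n k U) = -(psi B j μ * theta i r) :=
  psi_anticomm B (fun _ => commute_fn_oddMul _ _) j (fun _ => oddMul_oddMul _ _) μ

theorem theta_psiBar (i j : Fin n) (r : Fin k) (μ : Fin d) :
    (theta i r * psiBar B j μ : Op n k U) = -(psiBar B j μ * theta i r) :=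
  psiBar_anticomm B (fun _ => commute_fn_oddMul _ _) j
    (fun _ => oddMul_oddDer_of_ne (psiOsc_ne_thetaOsc _ _ _ _).symm) μ

theorem thetaBar_psi (i j : Fin n) (r : Fin k) (μ : Fin d) :
    (thetaBar i r * psi B j μ : Op n k U) = -(psi B j μ * thetaBar i r) :=
  psi_anticomm B (fun _ => commute_fn_oddDer _ _) j
    (fun _ => oddDer_oddMul_of_ne (psiOsc_ne_thetaOsc _ _ _ _).symm) μ

theorem thetaBar_psiBar (i j : Fin n) (r : Fin k) (μ : Fin d) :
    (thetaBar i r * psiBar B j μ : Op n k U) = -(psiBar B j μ * thetaBar i r) :=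
  psiBar_anticomm B (fun _ => commute_fn_oddDer _ _) j (fun _ => oddDer_oddDer _ _) μ

theorem cGhost_psi (j : Fin n) (μ : Fin d) :
    (cGhost * psi B j μ : Op n k U) = -(psi B j μ * cGhost) :=
  psi_anticomm B (fun _ => commute_fn_oddMul _ _) j (fun _ => oddMul_oddMul _ _) μ

theorem bGhost_psi (j : Fin n) (μ : Fin d) :
    (bGhost * psi B j μ : Op n k U) = -(psi B j μ * bGhost) :=
  psi_anticomm B (fun _ => commute_fn_oddDer _ _) j
    (fun _ => oddDer_oddMul_of_ne (psiOsc_ne_cOsc _ _).symm) μ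

theorem theta_theta (i j : Fin n) (r s : Fin k) :
    (theta i r * theta j s : Op n k U) = -(theta j s * theta i r) := oddMul_oddMul _ _

theorem thetaBar_thetaBar (i j : Fin n) (r s : Fin k) :
    (thetaBar i r * thetaBar j s : Op n k U) = -(thetaBar j s * thetaBar i r) := oddDer_oddDer _ _

theorem thetaBar_theta (i j : Fin n) (r s : Fin k) :
    (thetaBar i r * theta j s : Op n k U) =
      (if i = j ∧ r = s then 1 else 0) - theta j s * thetaBar i r := by
  rw [thetaBar, theta, oddDer_oddMul]; simp only [thetaOsc_inj]

theorem cGhost_theta (j : Fin n) (r : Fin k) :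
    (cGhost * theta j r : Op n k U) = -(theta j r * cGhost) := oddMul_oddMul _ _

theorem cGhost_thetaBar (j : Fin n) (r : Fin k) :
    (cGhost * thetaBar j r : Op n k U) = -(thetaBar j r * cGhost) :=
  oddMul_oddDer_of_ne (thetaOsc_ne_cOsc _ _).symm

theorem bGhost_theta (j : Fin n) (r : Fin k) :
    (bGhost * theta j r : Op n k U) = -(theta j r * bGhost) :=
  oddDer_oddMul_of_ne (thetaOsc_ne_cOsc _ _).symm

theorem bGhost_thetaBar (j : Fin n) (r : Fin k) :
    (bGhost * thetaBar j r : Op n k U) = -(thetaBar j r * bGhost) := oddDer_oddDer _ _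

theorem bGhost_cGhost : (bGhost * cGhost : Op n k U) = 1 - cGhost * bGhost := by
  rw [bGhost, cGhost, oddDer_oddMul, if_pos rfl]

theorem cGhost_mul_self : (cGhost * cGhost : Op n k U) = 0 := oddMul_mul_self _

theorem bGhost_mul_self : (bGhost * bGhost : Op n k U) = 0 := oddDer_mul_self _

/-! ### The covariant derivative `∇̂_μ` -/

/-- `ψ^a·∂/∂ψ^b`. -/
def flatBil (a b : Fin d) : Op n k U := ∑ i, psiFlat i a * psiDer i b

/-- The second quantization of a matrix. -/
def rotOp (M : Matrix (Fin d) (Fin d) (Fn U)) : Op n k U :=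
  ∑ a, ∑ b, fn (M a b) * flatBil a b

theorem rotOp_add (M N : Matrix (Fin d) (Fin d) (Fn U)) :
    (rotOp (M + N) : Op n k U) = rotOp M + rotOp N := by
  simp only [rotOp, Matrix.add_apply, fn_add, add_mul, sum_add_distrib]

theorem rotOp_neg (M : Matrix (Fin d) (Fin d) (Fn U)) :
    (rotOp (-M) : Op n k U) = -rotOp M := by
  simp only [rotOp, Matrix.neg_apply, fn_neg, neg_mul, sum_neg_distrib]

theorem rotOp_sub (M N : Matrix (Fin d) (Fin d) (Fn U)) :
    (rotOp (M - N) : Op n k U) = rotOp M - rotOp N := by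
  rw [sub_eq_add_neg, rotOp_add, rotOp_neg, sub_eq_add_neg]

theorem flatBil_psiFlat (a b c : Fin d) (i : Fin n) :
    (flatBil a b * psiFlat i c : Op n k U) =
      psiFlat i c * flatBil a b + if b = c then psiFlat i a else 0 := by
  have h : ∀ j, (psiFlat j a * psiDer j b * psiFlat i c : Op n k U) =
      psiFlat i c * (psiFlat j a * psiDer j b) + if j = i then (if b = c then psiFlat j a else 0)
        else 0 := fun j => by
    rw [mul_assoc, psiDer_psiFlat, mul_sub, ← mul_assoc, psiFlat_psiFlat j i]
    by_cases h1 : j = i <;> by_cases h2 : b = c <;> simp [h1, h2, mul_assoc, add_comm]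
  rw [flatBil, sum_mul, mul_sum]
  simp only [h, sum_add_distrib, sum_ite_eq', mem_univ, if_true]

theorem flatBil_psiDer (a b c : Fin d) (i : Fin n) :
    (flatBil a b * psiDer i c : Op n k U) =
      psiDer i c * flatBil a b - if a = c then psiDer i b else 0 := by
  have h : ∀ j, (psiFlat j a * psiDer j b * psiDer i c : Op n k U) =
      psiDer i c * (psiFlat j a * psiDer j b) - if j = i then (if a = c then psiDer j b else 0)
        else 0 := fun j => by
    rw [mul_assoc, psiDer_psiDer, ← mul_assoc, psiDer_psiFlat, mul_neg, sub_mul, ← mul_assoc]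
    by_cases h1 : j = i <;> by_cases h2 : a = c <;> simp [h1, h2, Ne.symm]
  rw [flatBil, sum_mul, mul_sum]
  simp only [h, sum_sub_distrib, sum_ite_eq', mem_univ, if_true]

theorem flatBil_flatBil (a b c e : Fin d) :
    (flatBil a b * flatBil c e : Op n k U) = flatBil c e * flatBil a b
      + (if b = c then flatBil a e else 0) - if a = e then flatBil c b else 0 := by
  have h : ∀ i, (flatBil a b * (psiFlat i c * psiDer i e) : Op n k U) =
      psiFlat i c * psiDer i e * flatBil a b + (if b = c then psiFlat i a * psiDer i e else 0)
      - if a = e then psiFlat i c * psiDer i b else 0 := fun i => by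
    rw [← mul_assoc, flatBil_psiFlat, add_mul, mul_assoc, flatBil_psiDer]
    split_ifs <;> noncomm_ring
  conv_lhs => rw [flatBil.eq_def c e]
  rw [mul_sum]
  simp only [h, sum_sub_distrib, sum_add_distrib]
  congr 1
  · congr 1
    · rw [flatBil.eq_def c e, sum_mul]
    · split_ifs <;> simp [flatBil]
  · split_ifs <;> simp [flatBil]

theorem commute_fn_flatBil (f : Fn U) (a b : Fin d) : Commute (fn f : Op n k U) (flatBil a b) :=
  Commute.sum_right _ _ _ fun i _ => (commute_fn_psiFlat f i a).mul_right (commute_fn_psiDer f i b)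

theorem commute_fn_rotOp (f : Fn U) (M : Matrix (Fin d) (Fin d) (Fn U)) :
    Commute (fn f : Op n k U) (rotOp M) :=
  Commute.sum_right _ _ _ fun a _ => Commute.fn_right_sum (commute_fn_fn f) fun b _ =>
    commute_fn_flatBil f a b

theorem rotOp_flatBil (M : Matrix (Fin d) (Fin d) (Fn U)) (c e : Fin d) :
    (rotOp M * flatBil c e : Op n k U) = flatBil c e * rotOp M
      + (∑ a, fn (M a c) * flatBil a e) - ∑ b, fn (M e b) * flatBil c b := by
  have h : ∀ a b, (fn (M a b) * flatBil a b * flatBil c e : Op n k U) =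
      flatBil c e * (fn (M a b) * flatBil a b) + (if b = c then fn (M a b) * flatBil a e else 0)
        - if a = e then fn (M a b) * flatBil c b else 0 := fun a b => by
    rw [mul_assoc, flatBil_flatBil, mul_sub, mul_add, mul_ite, mul_ite, mul_zero, ← mul_assoc,
      (commute_fn_flatBil _ _ _).eq, mul_assoc]
  simp only [rotOp, sum_mul, mul_sum, h, sum_add_distrib,
    sum_sub_distrib, sum_ite_eq', mem_univ, if_true]
  congr 1
  rw [sum_comm]
  simp only [sum_ite_eq', mem_univ, if_true]

theorem rotOp_rotOp (M N : Matrix (Fin d) (Fin d) (Fn U)) :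
    (rotOp M * rotOp N : Op n k U) = rotOp N * rotOp M + rotOp (M * N - N * M) := by
  have h : ∀ c e, (rotOp M * (fn (N c e) * flatBil c e) : Op n k U) =
      fn (N c e) * flatBil c e * rotOp M + (∑ a, fn (M a c * N c e) * flatBil a e)
        - ∑ b, fn (N c e * M e b) * flatBil c b := fun c e => by
    rw [← mul_assoc, ← (commute_fn_rotOp _ _).eq, mul_assoc, rotOp_flatBil, mul_sub, mul_add,
      mul_sum, mul_sum, mul_assoc]
    simp only [fn_mul, ← mul_assoc, fn_fn (N c e)]
  conv_lhs => rw [rotOp.eq_def N]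
  simp only [mul_sum, h, sum_add_distrib, sum_sub_distrib]
  rw [add_sub_assoc]
  congr 1
  · rw [rotOp.eq_def N]; simp only [sum_mul]
  · simp only [rotOp, Matrix.sub_apply, Matrix.mul_apply, fn_sub, sub_mul, fn_sum, sum_mul,
      sum_sub_distrib]
    congr 1
    · rw [Finset.sum_comm' (s := Finset.univ) (t := fun _ => Finset.univ) (s' := fun _ => Finset.univ)
        (t' := Finset.univ) (by simp)]
      calc _ = ∑ e, ∑ a, ∑ c, fn (M a c * N c e) * flatBil a e :=
            sum_congr rfl fun e _ => sum_comm
        _ = _ := sum_comm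
    · exact sum_congr rfl fun c _ => sum_comm

theorem commute_del_flatBil (μ : Fin d) (a b : Fin d) :
    Commute (del μ : Op n k U) (flatBil a b) :=
  Commute.sum_right _ _ _ fun _ _ =>
    Commute.mul_right (del_oddMul μ _ : Commute _ _) (del_oddDer μ _ : Commute _ _)

theorem del_rotOp (μ : Fin d) (M : Matrix (Fin d) (Fin d) (Fn U)) :
    (del μ * rotOp M : Op n k U) = rotOp M * del μ + rotOp (matD μ M) := by
  simp only [rotOp, mul_sum, sum_mul, ← sum_add_distrib]
  refine sum_congr rfl fun a _ => sum_congr rfl fun b _ => ?_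
  rw [← mul_assoc, del_fn, add_mul, mul_assoc, (commute_del_flatBil μ a b).eq, ← mul_assoc,
    add_comm]
  rfl

theorem hatNabla_eq (μ : Fin d) :
    (hatNabla B μ : Op n k U) = del μ + rotOp (-(B.omegaMat μ).transpose) := by
  rw [hatNabla, rotOp]
  congr 1
  refine sum_congr rfl fun a _ => sum_congr rfl fun b _ => ?_
  have h1 : B.spinConnection μ a b = eta a • B.omegaMat μ a b := by
    simp [Background.spinConnection, Background.omegaMat, Matrix.mul_apply, matD,
      Background.gammaMat]
  have h2 : eta b • eta a • B.omegaMat μ a b = -B.omegaMat μ b a := by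
    have h := congrFun (congrFun (B.omegaMat_antisymm μ) a) b
    rw [etaMat, Matrix.diagonal_mul, Matrix.neg_apply, Matrix.mul_diagonal,
      transpose_apply, ← Algebra.smul_def, mul_comm, ← Algebra.smul_def] at h
    rw [h, smul_neg, smul_smul, eta_mul_self, one_smul]
  rw [h1, Matrix.neg_apply, transpose_apply, ← h2, fn_smul _ (eta a • _), smul_mul_assoc,
    flatBil, ← mul_smul_comm, smul_sum]
  simp only [psiBarFlat, mul_smul_comm]

/-- `∇̂_μ` is a derivation. -/
theorem hatNabla_fn (μ : Fin d) (f : Fn U) :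
    (hatNabla B μ * fn f : Op n k U) = fn f * hatNabla B μ + fn (partialD μ f) := by
  rw [hatNabla_eq, add_mul, del_fn, ← (commute_fn_rotOp _ _).eq]; noncomm_ring

theorem rotOp_psiFlat (M : Matrix (Fin d) (Fin d) (Fn U)) (i : Fin n) (c : Fin d) :
    (rotOp M * psiFlat i c : Op n k U) = psiFlat i c * rotOp M + ∑ a, fn (M a c) * psiFlat i a := by
  simp only [rotOp, sum_mul, mul_sum, mul_assoc, flatBil_psiFlat, mul_add,
    sum_add_distrib, mul_ite, mul_zero, sum_ite_eq', mem_univ, if_true]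
  congr 1
  refine sum_congr rfl fun a _ => sum_congr rfl fun b _ => ?_
  rw [← mul_assoc, (commute_fn_psiFlat _ _ _).eq, mul_assoc]

theorem rotOp_psiDer (M : Matrix (Fin d) (Fin d) (Fn U)) (i : Fin n) (c : Fin d) :
    (rotOp M * psiDer i c : Op n k U) = psiDer i c * rotOp M - ∑ b, fn (M c b) * psiDer i b := by
  simp only [rotOp, sum_mul, mul_sum, mul_assoc, flatBil_psiDer, mul_sub,
    sum_sub_distrib, mul_ite, mul_zero]
  congr 1
  · refine sum_congr rfl fun a _ => sum_congr rfl fun b _ => ?_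
    rw [← mul_assoc, (commute_fn_psiDer _ _ _).eq, mul_assoc]
  · rw [sum_comm]
    simp only [sum_ite_eq', mem_univ, if_true]

theorem partialD_frame (μ ν a : Fin d) : partialD μ (B.frame ν a) =
    (∑ c, B.frame ν c * B.omegaMat μ c a) - ∑ l, B.christoffel ν μ l * B.frame l a := by
  have h := congrFun (congrFun (B.matD_frame μ) ν) a
  rw [Matrix.sub_apply, Matrix.mul_apply, Matrix.mul_apply] at h
  exact h

/-- Covariant constancy of the vielbein: the spin connection is traded for `Γ`. -/
theorem hatNabla_frame_comb {X : Fin d → Op n k U} (μ : Fin d)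
    (h : ∀ c, hatNabla B μ * X c = X c * hatNabla B μ - ∑ a, fn (B.omegaMat μ c a) * X a)
    (ν : Fin d) :
    hatNabla B μ * ∑ c, fn (B.frame ν c) * X c = (∑ c, fn (B.frame ν c) * X c) * hatNabla B μ
      - ∑ l, fn (B.christoffel ν μ l) * ∑ c, fn (B.frame l c) * X c := by
  have h1 : ∀ c, hatNabla B μ * (fn (B.frame ν c) * X c) =
      fn (B.frame ν c) * X c * hatNabla B μ
      + (∑ e, fn (B.frame ν e * B.omegaMat μ e c) * X c
        - ∑ e, fn (B.frame ν c * B.omegaMat μ c e) * X e)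
      - ∑ l, fn (B.christoffel ν μ l) * (fn (B.frame l c) * X c) := fun c => by
    rw [← mul_assoc, hatNabla_fn, add_mul, mul_assoc, h, mul_sub, partialD_frame, fn_sub, fn_sum,
      fn_sum, sub_mul, sum_mul, sum_mul, mul_sum]
    simp only [fn_mul, mul_assoc]
    abel
  rw [mul_sum]
  simp only [h1, sum_sub_distrib, sum_add_distrib]
  rw [sum_comm (f := fun c e => fn (B.frame ν e * B.omegaMat μ e c) * X c), sub_self,
    add_zero, sum_mul, sum_comm (f := fun c l =>
      fn (B.christoffel ν μ l) * (fn (B.frame l c) * X c))]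
  simp only [mul_sum]

/-- `[∇̂_μ, ψ^ν] = -Γ^ν_{μλ} ψ^λ`. -/
theorem hatNabla_psi (μ ν : Fin d) (i : Fin n) :
    (hatNabla B μ * psi B i ν : Op n k U) =
      psi B i ν * hatNabla B μ - ∑ l, fn (B.christoffel ν μ l) * psi B i l := by
  refine hatNabla_frame_comb B μ (fun c => ?_) ν
  have h : (del μ * psiFlat i c : Op n k U) = psiFlat i c * del μ := del_oddMul _ _
  rw [hatNabla_eq, add_mul, rotOp_psiFlat, h]
  simp only [Matrix.neg_apply, transpose_apply, fn_neg, neg_mul, sum_neg_distrib]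
  noncomm_ring

/-- `[∇̂_μ, ψ̄^ν] = -Γ^ν_{μλ} ψ̄^λ`. -/
theorem hatNabla_psiBar (μ ν : Fin d) (i : Fin n) :
    (hatNabla B μ * psiBar B i ν : Op n k U) =
      psiBar B i ν * hatNabla B μ - ∑ l, fn (B.christoffel ν μ l) * psiBar B i l := by
  refine hatNabla_frame_comb B μ (fun c => ?_) ν
  have h : (del μ * psiDer i c : Op n k U) = psiDer i c * del μ := del_oddDer _ _
  have h2 : ∀ b, eta c • B.omegaMat μ b c = -(eta b • B.omegaMat μ c b) := fun b => by
    have h := congrFun (congrFun (B.omegaMat_antisymm μ) b) c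
    rw [etaMat, Matrix.diagonal_mul, Matrix.neg_apply, Matrix.mul_diagonal,
      transpose_apply, ← Algebra.smul_def, mul_comm, ← Algebra.smul_def] at h
    calc eta c • B.omegaMat μ b c = eta c • eta b • (eta b • B.omegaMat μ b c) := by
          rw [smul_smul (eta b), eta_mul_self, one_smul]
      _ = -(eta b • eta c • eta c • B.omegaMat μ c b) := by
          rw [h, smul_neg, smul_neg, smul_comm (eta c) (eta b)]
      _ = _ := by rw [smul_smul (eta c), eta_mul_self, one_smul]
  have h3 : ∀ b, (eta c • (fn (-B.omegaMat μ b c) * psiDer i b) : Op n k U) =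
      fn (B.omegaMat μ c b) * psiBarFlat i b := fun b => by
    rw [← smul_mul_assoc, ← fn_smul, smul_neg, h2, neg_neg, fn_smul, smul_mul_assoc, psiBarFlat,
      mul_smul_comm]
  rw [psiBarFlat, hatNabla_eq, mul_smul_comm, add_mul, rotOp_psiDer, h]
  simp only [Matrix.neg_apply, transpose_apply]
  rw [smul_add, smul_sub, smul_sum]
  simp only [h3, mul_add, smul_mul_assoc]
  abel

/-- `ψ·ψ̄` contracted with a covariant tensor. -/
def bilOp (M : Fin d → Fin d → Fn U) : Op n k U := ∑ l, ∑ σ, fn (M l σ) * psiPsiBar B l σ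

theorem psiPsiBar_eq (l σ : Fin d) : (psiPsiBar B l σ : Op n k U) =
    ∑ a, ∑ b, fn (B.frame l a * (eta b • B.frame σ b)) * flatBil a b := by
  have h : ∀ i, (psi B i l * psiBar B i σ : Op n k U) =
      ∑ a, ∑ b, fn (B.frame l a * (eta b • B.frame σ b)) * (psiFlat i a * psiDer i b) := fun i => by
    rw [psi, psiBar, sum_mul_sum]
    refine sum_congr rfl fun a _ => sum_congr rfl fun b _ => ?_
    rw [fn_mul, fn_smul, psiBarFlat, mul_smul_comm, mul_smul_comm, mul_smul_comm, smul_mul_assoc,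
      mul_assoc, ← mul_assoc (psiFlat i a), ← (commute_fn_psiFlat _ _ _).eq]
    noncomm_ring
  simp only [psiPsiBar, h, flatBil, mul_sum]
  rw [sum_comm]
  exact sum_congr rfl fun a _ => sum_comm

theorem bilOp_eq (M : Fin d → Fin d → Fn U) : (bilOp B M : Op n k U) =
    rotOp (B.frame.transpose * Matrix.of M * B.frame * etaMat U) := by
  have h : ∀ a b, (B.frame.transpose * Matrix.of M * B.frame * etaMat U) a b =
      ∑ l, ∑ σ, M l σ * (B.frame l a * (eta b • B.frame σ b)) := fun a b => by
    rw [etaMat, Matrix.mul_diagonal, Matrix.mul_apply, sum_mul, sum_comm]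
    refine sum_congr rfl fun σ _ => ?_
    rw [Matrix.mul_apply, sum_mul, sum_mul]
    refine sum_congr rfl fun l _ => ?_
    rw [transpose_apply, Matrix.of_apply, Algebra.smul_def]; ring
  have h2 : ∀ l σ, (fn (M l σ) * psiPsiBar B l σ : Op n k U) =
      ∑ a, ∑ b, fn (M l σ * (B.frame l a * (eta b • B.frame σ b))) * flatBil a b := fun l σ => by
    simp only [psiPsiBar_eq, mul_sum, fn_mul, mul_assoc]
  simp only [bilOp, rotOp, h, fn_sum, sum_mul, h2]
  calc _ = ∑ l, ∑ a, ∑ σ, ∑ b, fn (M l σ * (B.frame l a * (eta b • B.frame σ b))) * flatBil a b :=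
        sum_congr rfl fun l _ => sum_comm
    _ = ∑ a, ∑ l, ∑ b, ∑ σ, fn (M l σ * (B.frame l a * (eta b • B.frame σ b))) * flatBil a b := by
        rw [sum_comm]
        exact sum_congr rfl fun l _ => sum_congr rfl fun a _ => sum_comm
    _ = _ := sum_congr rfl fun a _ => sum_comm

theorem curvOp_eq_bilOp (μ ν : Fin d) : (curvOp B μ ν : Op n k U) = bilOp B (B.riemann μ ν) := rfl

/-- The commutator of covariant derivatives. -/
theorem hatNabla_hatNabla (μ ν : Fin d) : (hatNabla B μ * hatNabla B ν : Op n k U) =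
    hatNabla B ν * hatNabla B μ + curvOp B μ ν := by
  have hM : Matrix.of (B.riemann μ ν) = B.metricMat * B.riemannMat μ ν := by
    ext l σ; exact B.riemann_eq μ ν l σ
  have h1 : B.frame.transpose * B.coframe.transpose = 1 := by
    rw [← transpose_mul, B.coframe_mul_frame, Matrix.transpose_one]
  have h2 : B.frame.transpose * (B.metricMat * B.riemannMat μ ν) * B.frame * etaMat U =
      -(B.coframe * B.riemannMat μ ν * B.frame).transpose := by
    rw [B.riemannMat_antisymm, B.metricMat_eq, transpose_mul, transpose_mul]
    calc _ = -(B.frame.transpose * ((B.riemannMat μ ν).transpose * (B.coframe.transpose *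
          (etaMat U * (B.coframe * B.frame) * etaMat U)))) := by noncomm_ring
      _ = _ := by rw [B.coframe_mul_frame, Matrix.mul_one, etaMat_mul_self, Matrix.mul_one]
  rw [curvOp_eq_bilOp, bilOp_eq, hM, h2, ← B.omegaMat_curvature, hatNabla_eq, hatNabla_eq]
  simp only [rotOp_neg, Matrix.transpose_sub, Matrix.transpose_add, transpose_mul, rotOp_sub,
    rotOp_add, add_mul, mul_add, mul_neg, neg_mul, del_rotOp, del_del ν μ,
    rotOp_rotOp (B.omegaMat μ).transpose, ← matD_transpose]
  abel

end Relations

/-! ### The constraints -/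

section Constraints

variable {n k d : ℕ} {U : Opens (Fin d → ℝ)}

theorem oddMul_oddDer_oddMul (o o' r : OddOsc n d k) :
    (oddMul o * oddDer o' * oddMul r : Op n k U) =
      oddMul r * (oddMul o * oddDer o') + if o' = r then oddMul o else 0 := by
  rw [mul_assoc, oddDer_oddMul, mul_sub, ← mul_assoc (oddMul o), oddMul_oddMul o r]
  split_ifs <;> noncomm_ring

theorem oddMul_oddDer_oddDer (o o' r : OddOsc n d k) :
    (oddMul o * oddDer o' * oddDer r : Op n k U) =
      oddDer r * (oddMul o * oddDer o') - if r = o then oddDer o' else 0 := by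
  rw [mul_assoc, oddDer_oddDer, ← mul_assoc, oddDer_oddMul]
  split_ifs <;> noncomm_ring

theorem oddDer_oddDer_oddMul (o o' r : OddOsc n d k) :
    (oddDer o * oddDer o' * oddMul r : Op n k U) =
      oddMul r * (oddDer o * oddDer o') + ((if o' = r then oddDer o else 0)
        - if o = r then oddDer o' else 0) := by
  rw [mul_assoc, oddDer_oddMul, mul_sub, ← mul_assoc (oddDer o), oddDer_oddMul]
  split_ifs <;> noncomm_ring

theorem oddDer_oddDer_oddDer (o o' r : OddOsc n d k) :
    (oddDer o * oddDer o' * oddDer r : Op n k U) = oddDer r * (oddDer o * oddDer o') := by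
  rw [mul_assoc, oddDer_oddDer o' r, mul_neg, ← mul_assoc, oddDer_oddDer o r]; noncomm_ring

theorem evenMul_evenDer_evenMul (e e' r : EvenOsc n) :
    (evenMul e * evenDer e' * evenMul r : Op n k U) =
      evenMul r * (evenMul e * evenDer e') + if e' = r then evenMul e else 0 := by
  rw [mul_assoc, evenDer_evenMul, mul_add, ← mul_assoc (evenMul e), evenMul_evenMul e r]
  split_ifs <;> noncomm_ring

theorem evenMul_evenDer_evenDer (e e' r : EvenOsc n) :
    (evenMul e * evenDer e' * evenDer r : Op n k U) =
      evenDer r * (evenMul e * evenDer e') - if r = e then evenDer e' else 0 := by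
  rw [mul_assoc, evenDer_evenDer, ← mul_assoc, ← mul_assoc, evenDer_evenMul]
  split_ifs <;> noncomm_ring

theorem evenDer_evenDer_evenMul (e e' r : EvenOsc n) :
    (evenDer e * evenDer e' * evenMul r : Op n k U) =
      evenMul r * (evenDer e * evenDer e') + ((if e' = r then evenDer e else 0)
        + if e = r then evenDer e' else 0) := by
  rw [mul_assoc, evenDer_evenMul, mul_add, ← mul_assoc (evenDer e), evenDer_evenMul]
  split_ifs <;> noncomm_ring

theorem evenDer_evenDer_evenDer (e e' r : EvenOsc n) :
    (evenDer e * evenDer e' * evenDer r : Op n k U) = evenDer r * (evenDer e * evenDer e') := by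
  rw [mul_assoc, evenDer_evenDer e' r, ← mul_assoc, evenDer_evenDer e r, mul_assoc]

theorem odd_odd_even {X Y Z : Op n k U} (h1 : X * Z = Z * X) (h2 : Y * Z = Z * Y) :
    X * Y * Z = Z * (X * Y) := by
  rw [mul_assoc, h2, ← mul_assoc, h1, mul_assoc]

theorem oddMul_oddDer_evenMul (o o' : OddOsc n d k) (r : EvenOsc n) :
    (oddMul o * oddDer o' * evenMul r : Op n k U) = evenMul r * (oddMul o * oddDer o') :=
  odd_odd_even (oddMul_evenMul _ _) (oddDer_evenMul _ _)

theorem oddMul_oddDer_evenDer (o o' : OddOsc n d k) (r : EvenOsc n) :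
    (oddMul o * oddDer o' * evenDer r : Op n k U) = evenDer r * (oddMul o * oddDer o') :=
  odd_odd_even (oddMul_evenDer _ _) (oddDer_evenDer _ _)

theorem oddDer_oddDer_evenMul (o o' : OddOsc n d k) (r : EvenOsc n) :
    (oddDer o * oddDer o' * evenMul r : Op n k U) = evenMul r * (oddDer o * oddDer o') :=
  odd_odd_even (oddDer_evenMul _ _) (oddDer_evenMul _ _)

theorem oddDer_oddDer_evenDer (o o' : OddOsc n d k) (r : EvenOsc n) :
    (oddDer o * oddDer o' * evenDer r : Op n k U) = evenDer r * (oddDer o * oddDer o') :=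
  odd_odd_even (oddDer_evenDer _ _) (oddDer_evenDer _ _)

theorem evenMul_evenDer_oddMul (e e' : EvenOsc n) (r : OddOsc n d k) :
    (evenMul e * evenDer e' * oddMul r : Op n k U) = oddMul r * (evenMul e * evenDer e') :=
  odd_odd_even (oddMul_evenMul _ _).symm (oddMul_evenDer _ _).symm

theorem evenMul_evenDer_oddDer (e e' : EvenOsc n) (r : OddOsc n d k) :
    (evenMul e * evenDer e' * oddDer r : Op n k U) = oddDer r * (evenMul e * evenDer e') :=
  odd_odd_even (oddDer_evenMul _ _).symm (oddDer_evenDer _ _).symm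

theorem evenDer_evenDer_oddMul (e e' : EvenOsc n) (r : OddOsc n d k) :
    (evenDer e * evenDer e' * oddMul r : Op n k U) = oddMul r * (evenDer e * evenDer e') :=
  odd_odd_even (oddMul_evenDer _ _).symm (oddMul_evenDer _ _).symm

theorem evenDer_evenDer_oddDer (e e' : EvenOsc n) (r : OddOsc n d k) :
    (evenDer e * evenDer e' * oddDer r : Op n k U) = oddDer r * (evenDer e * evenDer e') :=
  odd_odd_even (oddDer_evenDer _ _).symm (oddDer_evenDer _ _).symm

theorem young_psiFlat (i j l : Fin n) (a : Fin d) : (young i j * psiFlat l a : Op n k U) =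
    psiFlat l a * young i j + if j = l then psiFlat i a else 0 := by
  simp only [young, psiFlat, psiDer, theta, thetaBar, gam, bet, betBar, add_mul, sum_mul,
    mul_add, mul_sum, oddMul_oddDer_oddMul, evenMul_evenDer_oddMul, psiOsc_inj,
    (psiOsc_ne_thetaOsc _ _ _ _).symm, if_false, add_zero, ite_and, sum_add_distrib]
  by_cases h : j = l <;> simp [h]
  abel

theorem young_theta (i j l : Fin n) (r : Fin k) : (young i j * theta l r : Op n k U) =
    theta l r * young i j + if j = l then theta i r else 0 := by
  simp only [young, psiFlat, psiDer, theta, thetaBar, gam, bet, betBar, add_mul, sum_mul,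
    mul_add, mul_sum, oddMul_oddDer_oddMul, evenMul_evenDer_oddMul, thetaOsc_inj,
    psiOsc_ne_thetaOsc, if_false, add_zero, ite_and, sum_add_distrib]
  by_cases h : j = l <;> simp [h]
  abel

theorem young_psiDer (i j l : Fin n) (a : Fin d) : (young i j * psiDer l a : Op n k U) =
    psiDer l a * young i j - if l = i then psiDer j a else 0 := by
  simp only [young, psiFlat, psiDer, theta, thetaBar, gam, bet, betBar, add_mul, sum_mul,
    mul_add, mul_sum, oddMul_oddDer_oddDer, evenMul_evenDer_oddDer, psiOsc_inj,
    psiOsc_ne_thetaOsc, if_false, sub_zero, ite_and, sum_sub_distrib]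
  by_cases h : l = i <;> simp [h]
  abel

theorem young_thetaBar (i j l : Fin n) (r : Fin k) : (young i j * thetaBar l r : Op n k U) =
    thetaBar l r * young i j - if l = i then thetaBar j r else 0 := by
  simp only [young, psiFlat, psiDer, theta, thetaBar, gam, bet, betBar, add_mul, sum_mul,
    mul_add, mul_sum, oddMul_oddDer_oddDer, evenMul_evenDer_oddDer, thetaOsc_inj,
    (psiOsc_ne_thetaOsc _ _ _ _).symm, if_false, sub_zero, ite_and, sum_sub_distrib]
  by_cases h : l = i <;> simp [h]
  abel

theorem young_gam (i j l : Fin n) : (young i j * gam l : Op n k U) =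
    gam l * young i j + if j = l then gam i else 0 := by
  simp only [young, psiFlat, psiDer, theta, thetaBar, gam, bet, betBar, add_mul, sum_mul,
    mul_add, mul_sum, oddMul_oddDer_evenMul, evenMul_evenDer_evenMul, Sum.inl.injEq,
    reduceCtorEq, if_false, add_zero]
  abel

theorem young_bet (i j l : Fin n) : (young i j * bet l : Op n k U) =
    bet l * young i j + if j = l then bet i else 0 := by
  simp only [young, psiFlat, psiDer, theta, thetaBar, gam, bet, betBar, add_mul, sum_mul,
    mul_add, mul_sum, oddMul_oddDer_evenMul, evenMul_evenDer_evenMul, Sum.inr.injEq,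
    reduceCtorEq, if_false, add_zero]
  abel

theorem young_gamBar (i j l : Fin n) : (young i j * gamBar l : Op n k U) =
    gamBar l * young i j - if l = i then gamBar j else 0 := by
  simp only [young, psiFlat, psiDer, theta, thetaBar, gam, gamBar, bet, betBar, add_mul,
    sum_mul, mul_add, mul_sum, mul_neg, neg_mul, oddMul_oddDer_evenDer,
    evenMul_evenDer_evenDer, Sum.inr.injEq, reduceCtorEq, if_false, sub_zero]
  by_cases h : l = i <;> simp [h] <;> abel

theorem young_betBar (i j l : Fin n) : (young i j * betBar l : Op n k U) =
    betBar l * young i j - if l = i then betBar j else 0 := by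
  simp only [young, psiFlat, psiDer, theta, thetaBar, gam, bet, betBar, add_mul,
    sum_mul, mul_add, mul_sum, oddMul_oddDer_evenDer,
    evenMul_evenDer_evenDer, Sum.inl.injEq, reduceCtorEq, if_false, sub_zero]
  abel

theorem traceT_psiFlat (i j l : Fin n) (a : Fin d) : (traceT i j * psiFlat l a : Op n k U) =
    psiFlat l a * traceT i j
      + ((if j = l then psiBarFlat i a else 0) - if i = l then psiBarFlat j a else 0) := by
  simp only [traceT, psiFlat, psiDer, thetaBar, psiBarFlat, add_mul, sub_mul, sum_mul,
    mul_add, mul_sub, mul_sum, smul_mul_assoc, mul_smul_comm, oddDer_oddDer_oddMul,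
    evenDer_evenDer_oddMul, psiOsc_inj, (psiOsc_ne_thetaOsc _ _ _ _).symm, if_false, add_zero,
    sub_zero, ite_and, sum_add_distrib, smul_add, smul_sub, sum_sub_distrib]
  by_cases h : j = l <;> by_cases h' : i = l <;> simp [h, h'] <;> abel

theorem traceT_theta (i j l : Fin n) (r : Fin k) : (traceT i j * theta l r : Op n k U) =
    theta l r * traceT i j
      + ((if j = l then thetaBar i r else 0) - if i = l then thetaBar j r else 0) := by
  simp only [traceT, theta, psiDer, thetaBar, add_mul, sub_mul, sum_mul,
    mul_add, mul_sub, mul_sum, smul_mul_assoc, mul_smul_comm, oddDer_oddDer_oddMul,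
    evenDer_evenDer_oddMul, thetaOsc_inj, psiOsc_ne_thetaOsc, if_false, add_zero,
    sub_zero, ite_and, sum_add_distrib, sum_sub_distrib]
  by_cases h : j = l <;> by_cases h' : i = l <;> simp [h, h'] <;> abel

theorem traceT_psiDer (i j l : Fin n) (a : Fin d) :
    Commute (traceT i j : Op n k U) (psiDer l a) := by
  rw [Commute, SemiconjBy]
  simp only [traceT, psiDer, thetaBar, add_mul, sub_mul, sum_mul,
    mul_add, mul_sub, mul_sum, smul_mul_assoc, mul_smul_comm, oddDer_oddDer_oddDer,
    evenDer_evenDer_oddDer]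

theorem traceT_thetaBar (i j l : Fin n) (r : Fin k) :
    Commute (traceT i j : Op n k U) (thetaBar l r) := by
  rw [Commute, SemiconjBy]
  simp only [traceT, psiDer, thetaBar, add_mul, sub_mul, sum_mul,
    mul_add, mul_sub, mul_sum, smul_mul_assoc, mul_smul_comm, oddDer_oddDer_oddDer,
    evenDer_evenDer_oddDer]

theorem traceT_gamBar (i j l : Fin n) :
    Commute (traceT i j : Op n k U) (gamBar l) := by
  refine Commute.neg_right ?_
  rw [Commute, SemiconjBy]
  simp only [traceT, psiDer, thetaBar, add_mul, sub_mul, sum_mul,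
    mul_add, mul_sub, mul_sum, smul_mul_assoc, mul_smul_comm, oddDer_oddDer_evenDer,
    evenDer_evenDer_evenDer]

theorem traceT_gam (i j l : Fin n) : (traceT i j * gam l : Op n k U) =
    gam l * traceT i j
      + ((if j = l then gamBar i else 0) - if i = l then gamBar j else 0) := by
  simp only [traceT, gam, gamBar, psiDer, thetaBar, add_mul, sub_mul, sum_mul,
    mul_add, mul_sub, mul_sum, smul_mul_assoc, mul_smul_comm, oddDer_oddDer_evenMul,
    evenDer_evenDer_evenMul, Sum.inl.injEq, reduceCtorEq, if_false, zero_add]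
  by_cases h : j = l <;> by_cases h' : i = l <;> simp [h, h'] <;> abel

/-- The invariance of `X·Y` under an operator that rotates the flavors. -/
theorem commute_dot_of_rot {A : Op n k U} {i j : Fin n} {X Y : Fin n → Op n k U}
    (hX : ∀ l, A * X l = X l * A + if j = l then X i else 0)
    (hY : ∀ l, A * Y l = Y l * A - if l = i then Y j else 0) :
    Commute A (∑ l, X l * Y l) := by
  rw [Commute, SemiconjBy, mul_sum, sum_mul]
  have h : ∀ l, A * (X l * Y l) = X l * Y l * A + ((if j = l then X i * Y l else 0)
      - if l = i then X l * Y j else 0) := fun l => by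
    rw [← mul_assoc, hX, add_mul, mul_assoc, hY]
    split_ifs <;> noncomm_ring
  simp only [h, sum_add_distrib, sum_sub_distrib, sum_ite_eq,
    sum_ite_eq', mem_univ, if_true, sub_self, add_zero]

theorem commute_dot_of_rot' {A : Op n k U} {i j : Fin n} {X Y : Fin n → Op n k U}
    (hX : ∀ l, A * X l = X l * A + if j = l then X i else 0)
    (hY : ∀ l, A * Y l = Y l * A - if l = i then Y j else 0) :
    Commute A (∑ l, Y l * X l) := by
  rw [Commute, SemiconjBy, mul_sum, sum_mul]
  have h : ∀ l, A * (Y l * X l) = Y l * X l * A + ((if j = l then Y l * X i else 0)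
      - if l = i then Y j * X l else 0) := fun l => by
    rw [← mul_assoc, hY, sub_mul, mul_assoc, hX]
    split_ifs <;> noncomm_ring
  simp only [h, sum_add_distrib, sum_sub_distrib, sum_ite_eq,
    sum_ite_eq', mem_univ, if_true, sub_self, add_zero]

/-- The invariance of `γ̄·X + γ·X̄` under a trace. -/
theorem commute_super_of_trace {A : Op n k U} {i j : Fin n} {X Xb Y Yb : Fin n → Op n k U}
    (hX : ∀ l, A * X l = X l * A + ((if j = l then Xb i else 0) - if i = l then Xb j else 0))
    (hXb : ∀ l, Commute A (Xb l))
    (hY : ∀ l, A * Y l = Y l * A + ((if j = l then Yb i else 0) - if i = l then Yb j else 0))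
    (hYb : ∀ l, Commute A (Yb l)) :
    A * (∑ l, (Yb l * X l + Y l * Xb l)) = (∑ l, (Yb l * X l + Y l * Xb l)) * A
      + (Yb j * Xb i - Yb i * Xb j) + (Yb i * Xb j - Yb j * Xb i) := by
  have h : ∀ l, A * (Yb l * X l + Y l * Xb l) = (Yb l * X l + Y l * Xb l) * A
      + (((if j = l then Yb l * Xb i else 0) - if i = l then Yb l * Xb j else 0)
      + ((if j = l then Yb i * Xb l else 0) - if i = l then Yb j * Xb l else 0)) := fun l => by
    rw [mul_add, ← mul_assoc, ← mul_assoc, (hYb l).eq, hY, add_mul, mul_assoc, hX, mul_assoc (Y l),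
      (hXb l).eq]
    split_ifs <;> noncomm_ring
  rw [mul_sum, sum_mul]
  simp only [h, sum_add_distrib, sum_sub_distrib, sum_ite_eq,
    mem_univ, if_true, add_assoc]

theorem shiftedJ_eq (i : Fin n) : (shiftedJ i : Op n k U) = young i i - 1 := by
  have h : (shiftedJ i : Op n k U) = young i i - (((d : ℂ) + k - 2) / 2) • (1 : Op n k U)
      - physicalCharge d k • (1 : Op n k U) := rfl
  rw [h, sub_sub, ← add_smul, physicalCharge]
  congr 1
  convert one_smul ℂ (1 : Op n k U) using 2
  ring

theorem commute_of_anticomm {X Y Z : Op n k U} (h1 : X * Y = -(Y * X)) (h2 : X * Z = -(Z * X)) :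
    Commute X (Y * Z) := by
  rw [Commute, SemiconjBy, ← mul_assoc, h1, neg_mul, mul_assoc, h2, mul_neg, neg_neg, mul_assoc]

theorem commute_young {X : Op n k U} (h1 : ∀ i j a, Commute X (psiFlat i a * psiDer j a))
    (h2 : ∀ i j r, Commute X (theta i r * thetaBar j r)) (h3 : CommutesWithEven X) (i j : Fin n) :
    Commute X (young i j) :=
  (((Commute.sum_right _ _ _ fun a _ => h1 i j a).add_right
    (Commute.sum_right _ _ _ fun r _ => h2 i j r)).add_right
    ((h3 _).1.symm.mul_right (h3 _).2.symm)).add_right ((h3 _).1.symm.mul_right (h3 _).2.symm)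

theorem commute_traceT {X : Op n k U} (h1 : ∀ i j a, Commute X (psiDer i a * psiDer j a))
    (h2 : ∀ i j r, Commute X (thetaBar i r * thetaBar j r)) (h3 : CommutesWithEven X)
    (i j : Fin n) : Commute X (traceT i j) :=
  (((Commute.sum_right _ _ _ fun a _ => (h1 i j a).smul_right _).add_right
    (Commute.sum_right _ _ _ fun r _ => h2 i j r)).add_right
    ((h3 _).2.symm.mul_right (h3 _).2.symm)).sub_right ((h3 _).2.symm.mul_right (h3 _).2.symm)

end Constraints

/-! ### The constraints -/

section Constraints

variable {n k d : ℕ} {U : Opens (Fin d → ℝ)}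

theorem commute_fn_theta (f : Fn U) (i : Fin n) (r : Fin k) :
    Commute (fn f : Op n k U) (theta i r) := fn_oddMul f _

theorem commute_fn_thetaBar (f : Fn U) (i : Fin n) (r : Fin k) :
    Commute (fn f : Op n k U) (thetaBar i r) := fn_oddDer f _

theorem commute_del_psiFlat (μ : Fin d) (i : Fin n) (a : Fin d) :
    Commute (del μ : Op n k U) (psiFlat i a) := del_oddMul μ _

theorem commute_del_psiDer (μ : Fin d) (i : Fin n) (a : Fin d) :
    Commute (del μ : Op n k U) (psiDer i a) := del_oddDer μ _

theorem commute_del_theta (μ : Fin d) (i : Fin n) (r : Fin k) :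
    Commute (del μ : Op n k U) (theta i r) := del_oddMul μ _

theorem commute_del_thetaBar (μ : Fin d) (i : Fin n) (r : Fin k) :
    Commute (del μ : Op n k U) (thetaBar i r) := del_oddDer μ _

theorem commute_fn_young (f : Fn U) (i j : Fin n) : Commute (fn f : Op n k U) (young i j) := by
  refine commute_young (fun i j a => ?_) (fun i j r => ?_) ?_ i j
  · exact Commute.mul_right (commute_fn_psiFlat f i a) (commute_fn_psiDer f j a)
  · exact Commute.mul_right (commute_fn_theta f i r) (commute_fn_thetaBar f j r)
  · exact CommutesWithEven.fn f

theorem commute_del_young (μ : Fin d) (i j : Fin n) : Commute (del μ : Op n k U) (young i j) := by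
  refine commute_young (fun i j a => ?_) (fun i j r => ?_) ?_ i j
  · exact Commute.mul_right (commute_del_psiFlat μ i a) (commute_del_psiDer μ j a)
  · exact Commute.mul_right (commute_del_theta μ i r) (commute_del_thetaBar μ j r)
  · exact CommutesWithEven.del μ

theorem commute_cGhost_young (i j : Fin n) : Commute (cGhost : Op n k U) (young i j) :=
  commute_young (fun _ _ _ => commute_of_anticomm (k := k) (oddMul_oddMul _ _)
      (oddMul_oddDer_of_ne (psiOsc_ne_cOsc _ _).symm))
    (fun _ _ _ => commute_of_anticomm (k := k) (oddMul_oddMul _ _)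
      (oddMul_oddDer_of_ne (thetaOsc_ne_cOsc _ _).symm)) (.oddMul _) i j

theorem commute_bGhost_young (i j : Fin n) : Commute (bGhost : Op n k U) (young i j) :=
  commute_young (fun _ _ _ => commute_of_anticomm
      (oddDer_oddMul_of_ne (psiOsc_ne_cOsc _ _).symm) (oddDer_oddDer _ _))
    (fun _ _ _ => commute_of_anticomm
      (oddDer_oddMul_of_ne (thetaOsc_ne_cOsc _ _).symm) (oddDer_oddDer _ _)) (.oddDer _) i j

theorem commute_fn_traceT (f : Fn U) (i j : Fin n) : Commute (fn f : Op n k U) (traceT i j) := by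
  refine commute_traceT (fun i j a => ?_) (fun i j r => ?_) ?_ i j
  · exact Commute.mul_right (commute_fn_psiDer f i a) (commute_fn_psiDer f j a)
  · exact Commute.mul_right (commute_fn_thetaBar f i r) (commute_fn_thetaBar f j r)
  · exact CommutesWithEven.fn f

theorem commute_del_traceT (μ : Fin d) (i j : Fin n) : Commute (del μ : Op n k U) (traceT i j) := by
  refine commute_traceT (fun i j a => ?_) (fun i j r => ?_) ?_ i j
  · exact Commute.mul_right (commute_del_psiDer μ i a) (commute_del_psiDer μ j a)
  · exact Commute.mul_right (commute_del_thetaBar μ i r) (commute_del_thetaBar μ j r)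
  · exact CommutesWithEven.del μ

theorem commute_cGhost_traceT (i j : Fin n) : Commute (cGhost : Op n k U) (traceT i j) :=
  commute_traceT (fun _ _ _ => commute_of_anticomm (oddMul_oddDer_of_ne (psiOsc_ne_cOsc _ _).symm)
      (oddMul_oddDer_of_ne (psiOsc_ne_cOsc _ _).symm))
    (fun _ _ _ => commute_of_anticomm (oddMul_oddDer_of_ne (thetaOsc_ne_cOsc _ _).symm)
      (oddMul_oddDer_of_ne (thetaOsc_ne_cOsc _ _).symm)) (.oddMul _) i j

theorem commute_bGhost_traceT (i j : Fin n) : Commute (bGhost : Op n k U) (traceT i j) :=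
  commute_traceT (fun _ _ _ => commute_of_anticomm (oddDer_oddDer _ _) (oddDer_oddDer _ _))
    (fun _ _ _ => commute_of_anticomm (oddDer_oddDer _ _) (oddDer_oddDer _ _)) (.oddDer _) i j

variable (B : Background U)

theorem young_psiBarFlat (i j l : Fin n) (a : Fin d) : (young i j * psiBarFlat l a : Op n k U) =
    psiBarFlat l a * young i j - if l = i then psiBarFlat j a else 0 := by
  rw [psiBarFlat, mul_smul_comm, young_psiDer, smul_sub, smul_mul_assoc, smul_ite, smul_zero]
  rfl

theorem traceT_psiBarFlat (i j l : Fin n) (a : Fin d) :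
    Commute (traceT i j : Op n k U) (psiBarFlat l a) := (traceT_psiDer i j l a).smul_right _

theorem young_psi (i j l : Fin n) (μ : Fin d) : (young i j * psi B l μ : Op n k U) =
    psi B l μ * young i j + if j = l then psi B i μ else 0 := by
  simp only [psi, mul_sum, sum_mul]
  have h : ∀ a, (young i j * (fn (B.frame μ a) * psiFlat l a) : Op n k U) =
      fn (B.frame μ a) * psiFlat l a * young i j
      + if j = l then fn (B.frame μ a) * psiFlat i a else 0 := fun a => by
    rw [← mul_assoc, ← (commute_fn_young (k := k) _ _ _).eq, mul_assoc, young_psiFlat, mul_add, mul_ite,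
      mul_zero, mul_assoc]
  simp only [h, sum_add_distrib]
  split_ifs <;> simp

theorem young_psiBar (i j l : Fin n) (μ : Fin d) : (young i j * psiBar B l μ : Op n k U) =
    psiBar B l μ * young i j - if l = i then psiBar B j μ else 0 := by
  simp only [psiBar, mul_sum, sum_mul]
  have h : ∀ a, (young i j * (fn (B.frame μ a) * psiBarFlat l a) : Op n k U) =
      fn (B.frame μ a) * psiBarFlat l a * young i j
      - if l = i then fn (B.frame μ a) * psiBarFlat j a else 0 := fun a => by
    rw [← mul_assoc, ← (commute_fn_young (k := k) _ _ _).eq, mul_assoc, young_psiBarFlat, mul_sub, mul_ite,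
      mul_zero, mul_assoc]
  simp only [h, sum_sub_distrib]
  split_ifs <;> simp

theorem traceT_psi (i j l : Fin n) (μ : Fin d) : (traceT i j * psi B l μ : Op n k U) =
    psi B l μ * traceT i j
      + ((if j = l then psiBar B i μ else 0) - if i = l then psiBar B j μ else 0) := by
  simp only [psi, psiBar, mul_sum, sum_mul]
  have h : ∀ a, (traceT i j * (fn (B.frame μ a) * psiFlat l a) : Op n k U) =
      fn (B.frame μ a) * psiFlat l a * traceT i j
      + ((if j = l then fn (B.frame μ a) * psiBarFlat i a else 0)
        - if i = l then fn (B.frame μ a) * psiBarFlat j a else 0) := fun a => by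
    rw [← mul_assoc, ← (commute_fn_traceT (k := k) _ _ _).eq, mul_assoc, traceT_psiFlat, mul_add, mul_sub,
      mul_ite, mul_ite, mul_zero, mul_assoc]
  simp only [h, sum_add_distrib, sum_sub_distrib]
  split_ifs <;> simp

theorem traceT_psiBar (i j l : Fin n) (μ : Fin d) :
    Commute (traceT i j : Op n k U) (psiBar B l μ) :=
  Commute.fn_right_sum (fun f => (commute_fn_traceT (k := k) f i j).symm) fun _ _ => traceT_psiBarFlat i j l _

theorem commute_young_flatBil (i j : Fin n) (a b : Fin d) :
    Commute (young i j : Op n k U) (flatBil a b) :=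
  commute_dot_of_rot (fun l => young_psiFlat i j l a) (fun l => young_psiDer i j l b)

theorem commute_young_psiPsiBar (i j : Fin n) (μ ν : Fin d) :
    Commute (young i j : Op n k U) (psiPsiBar B μ ν) :=
  commute_dot_of_rot (fun l => young_psi B i j l μ) (fun l => young_psiBar B i j l ν)

theorem commute_young_hatNabla (i j : Fin n) (μ : Fin d) :
    Commute (young i j : Op n k U) (hatNabla B μ) := by
  rw [hatNabla_eq]
  exact (commute_del_young (k := k) μ i j).symm.add_right (Commute.sum_right _ _ _ fun a _ =>
    Commute.fn_right_sum (fun f => (commute_fn_young (k := k) f i j).symm) fun b _ =>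
      commute_young_flatBil i j a b)

theorem commute_young_superS (i j : Fin n) (μ : Fin d) :
    Commute (young i j : Op n k U) (superS B μ) := by
  rw [superS, sum_add_distrib]
  exact (commute_dot_of_rot' (fun l => young_psi B i j l μ) (fun l => young_gamBar i j l)).add_right
    (commute_dot_of_rot (fun l => young_gam i j l) (fun l => young_psiBar B i j l μ))

theorem commute_young_rho (i j : Fin n) : Commute (young i j : Op n k U) rho := by
  rw [rho, sum_comm]
  refine Commute.sum_right _ _ _ fun r _ => ?_
  rw [sum_add_distrib]
  exact (commute_dot_of_rot' (fun l => young_theta i j l r) (fun l => young_gamBar i j l)).add_right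
    (commute_dot_of_rot (fun l => young_gam i j l) (fun l => young_thetaBar i j l r))

theorem commute_young_gamBarGam (i j : Fin n) : Commute (young i j : Op n k U) gamBarGam :=
  commute_dot_of_rot' (fun l => young_gam i j l) (fun l => young_gamBar i j l)

/-- An operator sum contracted with antisymmetric coefficients. -/
theorem commute_sum_of_antisymm {A : Op n k U} {M X K : Fin d → Fin d → Op n k U}
    (hM : ∀ a b, M a b = -M b a) (hA : ∀ a b, Commute A (M a b))
    (hX : ∀ a b, A * X a b = X a b * A + K a b) (hK : ∀ a b, K a b = K b a) :
    Commute A (∑ a, ∑ b, M a b * X a b) := by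
  have h0 : ∑ a, ∑ b, M a b * K a b = 0 := by
    have h1 : ∑ a, ∑ b, M a b * K a b = -∑ a, ∑ b, M a b * K a b := by
      conv_lhs => rw [sum_comm]
      rw [← sum_neg_distrib]
      refine sum_congr rfl fun a _ => ?_
      rw [← sum_neg_distrib]
      refine sum_congr rfl fun b _ => ?_
      rw [hM b a, hK b a, neg_mul]
    have h2 : (2 : ℂ) • ∑ a, ∑ b, M a b * K a b = 0 := by
      rw [two_smul]; nth_rewrite 1 [h1]; abel
    exact (smul_eq_zero_iff_right two_ne_zero).1 h2
  have h3 : ∀ a b, A * (M a b * X a b) = M a b * X a b * A + M a b * K a b := fun a b => by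
    rw [← mul_assoc, (hA a b).eq, mul_assoc, hX, mul_add, mul_assoc]
  rw [Commute, SemiconjBy]
  simp only [mul_sum, sum_mul, h3, sum_add_distrib, h0, add_zero]

theorem traceT_dot {A : Op n k U} {i j : Fin n} {X Y Xb : Fin n → Op n k U}
    (hX : ∀ l, A * X l = X l * A + ((if j = l then Xb i else 0) - if i = l then Xb j else 0))
    (hY : ∀ l, Commute A (Y l)) :
    A * (∑ l, X l * Y l) = (∑ l, X l * Y l) * A + (Xb i * Y j - Xb j * Y i) := by
  have h : ∀ l, A * (X l * Y l) = X l * Y l * A + ((if j = l then Xb i * Y l else 0)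
      - if i = l then Xb j * Y l else 0) := fun l => by
    rw [← mul_assoc, hX, add_mul, mul_assoc, (hY l).eq]
    split_ifs <;> noncomm_ring
  rw [mul_sum, sum_mul]
  simp only [h, sum_add_distrib, sum_sub_distrib, sum_ite_eq,
    mem_univ, if_true]

theorem spinConnection_antisymm (μ a b : Fin d) :
    B.spinConnection μ a b = -B.spinConnection μ b a := by
  have h1 : ∀ a b, B.spinConnection μ a b = eta a • B.omegaMat μ a b := fun a b => by
    simp [Background.spinConnection, Background.omegaMat, Matrix.mul_apply, matD,
      Background.gammaMat]
  have h := congrFun (congrFun (B.omegaMat_antisymm μ) a) b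
  rw [etaMat, Matrix.diagonal_mul, Matrix.neg_apply, Matrix.mul_diagonal,
    transpose_apply, ← Algebra.smul_def, mul_comm, ← Algebra.smul_def] at h
  rw [h1, h1, h]

theorem commute_traceT_hatNabla (i j : Fin n) (μ : Fin d) :
    Commute (traceT i j : Op n k U) (hatNabla B μ) := by
  refine (commute_del_traceT (k := k) μ i j).symm.add_right (commute_sum_of_antisymm
    (M := fun a b => fn (B.spinConnection μ a b))
    (X := fun a b => ∑ l, psiFlat l a * psiBarFlat l b)
    (K := fun a b => psiBarFlat i a * psiBarFlat j b - psiBarFlat j a * psiBarFlat i b)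
    (fun a b => ?_) (fun a b => (commute_fn_traceT (k := k) _ i j).symm)
    (fun a b => traceT_dot (X := fun l => psiFlat l a) (Y := fun l => psiBarFlat l b)
      (Xb := fun l => psiBarFlat l a)
      (fun l => traceT_psiFlat i j l a) (fun l => traceT_psiBarFlat i j l b))
    (fun a b => ?_))
  · rw [spinConnection_antisymm, fn_neg]
  · rw [psiBarFlat_psiBarFlat i j a b, psiBarFlat_psiBarFlat i j b a]; abel

theorem traceT_psiPsiBar (i j : Fin n) (μ ν : Fin d) :
    (traceT i j * psiPsiBar B μ ν : Op n k U) = psiPsiBar B μ ν * traceT i j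
      + (psiBar B i μ * psiBar B j ν - psiBar B j μ * psiBar B i ν) :=
  traceT_dot (X := fun l => psi B l μ) (Y := fun l => psiBar B l ν) (Xb := fun l => psiBar B l μ)
    (fun l => traceT_psi B i j l μ) (fun l => traceT_psiBar B i j l ν)

theorem commute_traceT_curvOp (i j : Fin n) (μ ν : Fin d) :
    Commute (traceT i j : Op n k U) (curvOp B μ ν) := by
  refine commute_sum_of_antisymm (M := fun a b => fn (B.riemann μ ν a b)) (X := psiPsiBar B)
    (K := fun a b => psiBar B i a * psiBar B j b - psiBar B j a * psiBar B i b)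
    (fun a b => ?_) (fun a b => (commute_fn_traceT (k := k) _ i j).symm)
    (fun a b => traceT_psiPsiBar B i j a b) (fun a b => ?_)
  · rw [B.riemann_antisymm_right, fn_neg]
  · rw [psiBar_psiBar B i j a b, psiBar_psiBar B i j b a]; abel

theorem curvOp_antisymm (μ ν : Fin d) : (curvOp B μ ν : Op n k U) = -curvOp B ν μ := by
  simp only [curvOp, B.riemann_antisymm_left μ ν, fn_neg, neg_mul, sum_neg_distrib]

theorem commute_fn_curvOp (f : Fn U) (μ ν : Fin d) : Commute (fn f : Op n k U) (curvOp B μ ν) :=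
  Commute.sum_right _ _ _ fun _ _ => Commute.fn_right_sum (commute_fn_fn f) fun _ _ =>
    commute_fn_psiPsiBar B f _ _

theorem curvCoupling_eq (κ : ℂ) : (curvCoupling B κ : Op n k U) =
    ∑ μ, ∑ ν, psiPsiBar B μ ν * curvOp B μ ν + κ • (fn B.scalarCurvature : Op n k U) := by
  rw [curvCoupling]
  refine congrArg (· + _) ?_
  refine sum_congr rfl fun μ _ => sum_congr rfl fun ν _ => ?_
  simp only [curvOp, mul_sum]
  refine sum_congr rfl fun l _ => sum_congr rfl fun σ _ => ?_
  rw [← mul_assoc, ← mul_assoc, (commute_fn_psiPsiBar B _ _ _).eq]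

theorem curvCoupling_eq' (κ : ℂ) : (curvCoupling B κ : Op n k U) =
    ∑ l, ∑ σ, curvOp B l σ * psiPsiBar B l σ + κ • (fn B.scalarCurvature : Op n k U) := by
  rw [curvCoupling]
  refine congrArg (· + _) ?_
  calc _ = ∑ μ, ∑ l, ∑ ν, ∑ σ,
        (fn (B.riemann μ ν l σ) * (psiPsiBar B μ ν * psiPsiBar B l σ) : Op n k U) :=
        sum_congr rfl fun μ _ => sum_comm
    _ = ∑ l, ∑ μ, ∑ σ, ∑ ν,
        (fn (B.riemann μ ν l σ) * (psiPsiBar B μ ν * psiPsiBar B l σ) : Op n k U) := by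
        rw [sum_comm]
        exact sum_congr rfl fun l _ => sum_congr rfl fun μ _ => sum_comm
    _ = ∑ l, ∑ σ, ∑ μ, ∑ ν,
        (fn (B.riemann μ ν l σ) * (psiPsiBar B μ ν * psiPsiBar B l σ) : Op n k U) :=
        sum_congr rfl fun l _ => sum_comm
    _ = _ := by
        refine sum_congr rfl fun l _ => sum_congr rfl fun σ _ => ?_
        simp only [curvOp, sum_mul]
        refine sum_congr rfl fun μ _ => sum_congr rfl fun ν _ => ?_
        rw [B.riemann_pair_symm, mul_assoc]

theorem commute_traceT_curvCoupling (i j : Fin n) (κ : ℂ) :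
    Commute (traceT i j : Op n k U) (curvCoupling B κ) := by
  rw [curvCoupling_eq']
  refine (commute_sum_of_antisymm (M := curvOp B) (X := psiPsiBar B)
    (K := fun a b => psiBar B i a * psiBar B j b - psiBar B j a * psiBar B i b)
    (fun a b => curvOp_antisymm B a b)
    (fun a b => commute_traceT_curvOp B i j a b) (fun a b => traceT_psiPsiBar B i j a b)
    (fun a b => ?_)).add_right ((commute_fn_traceT (k := k) _ i j).symm.smul_right κ)
  rw [psiBar_psiBar B i j a b, psiBar_psiBar B i j b a]; abel

theorem commute_young_curvCoupling (i j : Fin n) (κ : ℂ) :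
    Commute (young i j : Op n k U) (curvCoupling B κ) :=
  Commute.add_right (Commute.sum_right _ _ _ fun μ _ => Commute.sum_right _ _ _ fun ν _ =>
    Commute.sum_right _ _ _ fun l _ => Commute.fn_right_sum
      (Y := fun σ => psiPsiBar B μ ν * psiPsiBar B l σ)
      (fun f => (commute_fn_young (k := k) f i j).symm) fun σ _ =>
      (commute_young_psiPsiBar (k := k) B i j μ ν).mul_right (commute_young_psiPsiBar (k := k) B i j l σ))
    ((commute_fn_young (k := k) _ i j).symm.smul_right κ)

theorem commute_traceT_superS (i j : Fin n) (μ : Fin d) :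
    Commute (traceT i j : Op n k U) (superS B μ) := by
  have h := commute_super_of_trace (X := fun l => psi B l μ) (Xb := fun l => psiBar B l μ)
    (Y := gam) (Yb := gamBar) (fun l => traceT_psi B i j l μ)
    (fun l => traceT_psiBar (k := k) B i j l μ) (fun l => traceT_gam i j l)
    (fun l => traceT_gamBar i j l)
  rw [Commute, SemiconjBy, superS, h]; abel

theorem commute_traceT_rho (i j : Fin n) : Commute (traceT i j : Op n k U) rho := by
  rw [rho, sum_comm]
  refine Commute.sum_right _ _ _ fun r _ => ?_
  have h := commute_super_of_trace (U := U) (X := fun l => theta l r) (Xb := fun l => thetaBar l r)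
    (Y := gam) (Yb := gamBar) (fun l => traceT_theta i j l r)
    (fun l => traceT_thetaBar i j l r) (fun l => traceT_gam i j l)
    (fun l => traceT_gamBar i j l)
  rw [Commute, SemiconjBy, h]; abel

theorem commute_traceT_gamBarGam (i j : Fin n) : Commute (traceT i j : Op n k U) gamBarGam := by
  have h1 : (gamBarGam : Op n k U) = ∑ l, gam l * gamBar l :=
    sum_congr rfl fun l _ => (commute_gamBar_gam l l).eq
  have h := traceT_dot (k := k) (U := U) (X := gam) (Y := gamBar) (Xb := gamBar) (fun l => traceT_gam i j l) (fun l => traceT_gamBar i j l)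
  rw [Commute, SemiconjBy, h1, h, (commute_gamBar_gamBar i j).eq]; abel

/-- The BRST charge commutes with whatever commutes with its building blocks. -/
theorem commute_brst {A : Op n k U} (hf : ∀ f, Commute A (fn f)) (hc : Commute A cGhost)
    (hb : Commute A bGhost) (hD : ∀ μ, Commute A (hatNabla B μ)) {κ : ℂ}
    (hR : Commute A (curvCoupling B κ)) (hS : ∀ μ, Commute A (superS B μ)) (hr : Commute A rho)
    (hG : Commute A gamBarGam) (m : ℝ) : Commute A (brst B κ m) := by
  have hL : Commute A (laplacian B) :=
    Commute.sum_right _ _ _ fun μ _ => Commute.fn_right_sum hf fun ν _ =>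
      ((hD μ).mul_right (hD ν)).sub_right (Commute.fn_right_sum hf fun l _ => hD l)
  exact ((hc.mul_right ((hL.sub_right ((Commute.one_right A).smul_right _)).add_right hR)).add_right
    (((Commute.sum_right _ _ _ fun μ _ => (hS μ).mul_right (hD μ)).smul_right _).add_right
      (hr.smul_right _))).add_right (hG.mul_right hb)

theorem commute_young_brst (i j : Fin n) (κ : ℂ) (m : ℝ) :
    Commute (young i j : Op n k U) (brst B κ m) :=
  commute_brst B (fun f => (commute_fn_young f i j).symm) (commute_cGhost_young i j).symm
    (commute_bGhost_young i j).symm (commute_young_hatNabla B i j)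
    (commute_young_curvCoupling B i j κ) (commute_young_superS B i j) (commute_young_rho i j)
    (commute_young_gamBarGam i j) m

theorem commute_traceT_brst (i j : Fin n) (κ : ℂ) (m : ℝ) :
    Commute (traceT i j : Op n k U) (brst B κ m) :=
  commute_brst B (fun f => (commute_fn_traceT f i j).symm) (commute_cGhost_traceT i j).symm
    (commute_bGhost_traceT i j).symm (commute_traceT_hatNabla B i j)
    (commute_traceT_curvCoupling B i j κ) (commute_traceT_superS B i j) (commute_traceT_rho i j)
    (commute_traceT_gamBarGam i j) m

/-- The BRST charge commutes with the constraints on every background. -/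
theorem brst_commutesWithConstraints (κ : ℂ) (m : ℝ) :
    CommutesWithConstraints (brst B κ m : Op n k U) :=
  ⟨fun i => by
    rw [shiftedJ_eq]
    exact (commute_young_brst B i i κ m).symm.sub_right (Commute.one_right _),
  fun i j _ => ⟨(commute_young_brst B i j κ m).symm, (commute_traceT_brst B i j κ m).symm⟩⟩

end Constraints

/-! ### The square of the BRST charge -/

section RingIdentities

variable {R : Type*} [Ring R]

theorem brst_sq_of_relations {c b H F G : R} (hcc : c * c = 0) (hbb : b * b = 0)
    (hbc : b * c = 1 - c * b) (hH : H * c = c * H) (hHb : H * b = b * H)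
    (hF : F * c = -(c * F)) (hFb : F * b = -(b * F)) (hGc : G * c = c * G) (hGb : G * b = b * G)
    (hGH : G * H = H * G) (hGF : G * F = F * G) :
    (c * H + F + G * b) * (c * H + F + G * b) = F * F + G * H + c * (H * F - F * H) := by
  have h1 : c * H * (c * H) = 0 := by
    rw [mul_assoc, ← mul_assoc H, hH, mul_assoc, ← mul_assoc, hcc, zero_mul]
  have h2 : F * (c * H) = -(c * (F * H)) := by rw [← mul_assoc, hF, neg_mul, mul_assoc]
  have h3 : G * b * (G * b) = 0 := by
    rw [mul_assoc, ← mul_assoc b, ← hGb, mul_assoc G b b, hbb, mul_zero, mul_zero]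
  have h4 : G * b * F = -(F * (G * b)) := by
    have h : b * F = -(F * b) := by rw [hFb, neg_neg]
    rw [mul_assoc, h, mul_neg, ← mul_assoc, hGF, mul_assoc]
  have h5 : G * b * (c * H) = G * H - c * H * (G * b) := by
    have h : c * H * (G * b) = G * (c * b * H) := by
      rw [mul_assoc, ← mul_assoc H, ← hGH, mul_assoc G, hHb, ← mul_assoc c, ← hGc]
      simp only [mul_assoc]
    rw [h, mul_assoc, ← mul_assoc b, hbc, sub_mul, mul_sub, one_mul]
  simp only [add_mul, mul_add, h1, h2, h3, h4, h5, mul_sub]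
  rw [mul_assoc c H F]
  abel

theorem sum_mul_sum_of_derivation {ι : Type*} [Fintype ι] {S D : ι → R}
    {g K : ι → ι → R} {Γ : ι → ι → ι → R}
    (hS : ∀ μ ν, S μ * S ν = g μ ν + g μ ν - S ν * S μ)
    (hD : ∀ μ ν, D μ * D ν = D ν * D μ + K μ ν)
    (hDS : ∀ μ ν, D μ * S ν = S ν * D μ - ∑ l, Γ ν μ l * S l)
    (hΓ : ∀ ν μ l, Γ ν μ l = Γ ν l μ) (hΓS : ∀ ν μ l κ, Γ ν μ l * S κ = S κ * Γ ν μ l) :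
    (∑ μ, S μ * D μ) * (∑ μ, S μ * D μ) + (∑ μ, S μ * D μ) * (∑ μ, S μ * D μ) =
      (∑ μ, ∑ ν, g μ ν * (D μ * D ν - ∑ l, Γ l μ ν * D l))
      + (∑ μ, ∑ ν, g μ ν * (D μ * D ν - ∑ l, Γ l μ ν * D l)) + ∑ μ, ∑ ν, S μ * S ν * K μ ν := by
  set T : ι → ι → R := fun μ ν => D μ * D ν - ∑ l, Γ l μ ν * D l with hTdef
  have hT : ∀ μ ν, T μ ν = T ν μ + K μ ν := fun μ ν => by
    simp only [hTdef, hD μ ν, hΓ _ μ ν]; abel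
  have hN : (∑ μ, S μ * D μ) * (∑ μ, S μ * D μ) = ∑ μ, ∑ ν, S μ * S ν * T μ ν := by
    rw [sum_mul_sum]
    refine sum_congr rfl fun μ _ => ?_
    have h : ∀ ν, S μ * D μ * (S ν * D ν) =
        S μ * S ν * (D μ * D ν) - ∑ l, S μ * S l * (Γ ν μ l * D ν) := fun ν => by
      have h1 : S μ * D μ * (S ν * D ν) = S μ * (D μ * S ν) * D ν := by simp only [mul_assoc]
      rw [h1, hDS, mul_sub, sub_mul, mul_sum, sum_mul]
      simp only [hΓS, mul_assoc]
    simp only [h, hTdef, mul_sub, sum_sub_distrib, mul_sum]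
    rw [sum_comm (f := fun ν l => S μ * S l * (Γ ν μ l * D ν))]
  have hX : ∑ μ, ∑ ν, S μ * S ν * T μ ν = (∑ μ, ∑ ν, g μ ν * T μ ν)
      + (∑ μ, ∑ ν, g μ ν * T μ ν) - ∑ μ, ∑ ν, S ν * S μ * T μ ν := by
    simp only [← sum_add_distrib, ← sum_sub_distrib]
    refine sum_congr rfl fun μ _ => sum_congr rfl fun ν _ => ?_
    rw [hS, sub_mul, add_mul]
  have hY : ∑ μ, ∑ ν, S ν * S μ * T μ ν =
      ∑ μ, ∑ ν, S μ * S ν * T μ ν - ∑ μ, ∑ ν, S μ * S ν * K μ ν := by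
    rw [sum_comm]
    simp only [← sum_sub_distrib, ← mul_sub]
    refine sum_congr rfl fun μ _ => sum_congr rfl fun ν _ => ?_
    rw [hT μ ν, add_sub_cancel_right]
  rw [hY] at hX
  rw [hN, ← sub_eq_zero]
  rw [← sub_eq_zero] at hX
  rw [← hX]
  abel

end RingIdentities

section Square

variable {n k d : ℕ} {U : Opens (Fin d → ℝ)}

/-- An operator that anticommutes with the flat `ψ`, `ψ̄` and commutes with everything that does
not contain them. -/
structure PsiOdd (A : Op n k U) : Prop where
  fn : ∀ f, Commute A (fn f)
  del : ∀ μ, Commute A (del μ)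
  even : CommutesWithEven A
  psiFlat : ∀ i a, A * psiFlat i a = -(psiFlat i a * A)
  psiDer : ∀ i a, A * psiDer i a = -(psiDer i a * A)

theorem psiOdd_oddMul {o : OddOsc n d k} (ho : ∀ i a, o ≠ psiOsc i a) :
    PsiOdd (oddMul o : Op n k U) where
  fn f := (commute_fn_oddMul f o).symm
  del μ := (del_oddMul μ o).symm
  even := .oddMul o
  psiFlat _ _ := oddMul_oddMul _ _
  psiDer i a := oddMul_oddDer_of_ne (ho i a)

theorem psiOdd_oddDer {o : OddOsc n d k} (ho : ∀ i a, o ≠ psiOsc i a) :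
    PsiOdd (oddDer o : Op n k U) where
  fn f := (commute_fn_oddDer f o).symm
  del μ := (del_oddDer μ o).symm
  even := .oddDer o
  psiFlat i a := oddDer_oddMul_of_ne (ho i a)
  psiDer _ _ := oddDer_oddDer _ _

theorem psiOdd_cGhost : PsiOdd (cGhost : Op n k U) :=
  psiOdd_oddMul fun _ _ => (psiOsc_ne_cOsc _ _).symm

theorem psiOdd_bGhost : PsiOdd (bGhost : Op n k U) :=
  psiOdd_oddDer fun _ _ => (psiOsc_ne_cOsc _ _).symm

theorem psiOdd_theta (i : Fin n) (r : Fin k) : PsiOdd (theta i r : Op n k U) :=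
  psiOdd_oddMul fun j a => (psiOsc_ne_thetaOsc j i a r).symm

theorem psiOdd_thetaBar (i : Fin n) (r : Fin k) : PsiOdd (thetaBar i r : Op n k U) :=
  psiOdd_oddDer fun j a => (psiOsc_ne_thetaOsc j i a r).symm

namespace PsiOdd

variable {A : Op n k U} (hA : PsiOdd A) (B : Background U)
include hA

theorem psi (i : Fin n) (μ : Fin d) : A * psi B i μ = -(SpinningParticle.psi B i μ * A) :=
  psi_anticomm B (fun f => (hA.fn f).symm) i (hA.psiFlat i) μ

theorem psiBar (i : Fin n) (μ : Fin d) : A * psiBar B i μ = -(SpinningParticle.psiBar B i μ * A) :=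
  psiBar_anticomm B (fun f => (hA.fn f).symm) i (hA.psiDer i) μ

theorem psiPsiBar (μ ν : Fin d) : Commute A (psiPsiBar B μ ν) :=
  Commute.sum_right _ _ _ fun i _ => commute_of_anticomm (hA.psi B i μ) (hA.psiBar B i ν)

theorem hatNabla (μ : Fin d) : Commute A (hatNabla B μ) := by
  rw [hatNabla_eq]
  refine Commute.add_right (hA.del μ) (Commute.sum_right _ _ _ fun a _ => ?_)
  refine Commute.fn_right_sum hA.fn fun b _ => Commute.sum_right _ _ _ fun i _ => ?_
  exact commute_of_anticomm (hA.psiFlat i a) (hA.psiDer i b)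

theorem curvOp (μ ν : Fin d) : Commute A (curvOp B μ ν) :=
  Commute.sum_right _ _ _ fun _ _ => Commute.fn_right_sum hA.fn fun _ _ => hA.psiPsiBar B _ _

theorem laplacian : Commute A (laplacian B) :=
  Commute.sum_right _ _ _ fun μ _ => Commute.fn_right_sum hA.fn fun ν _ =>
    Commute.sub_right (Commute.mul_right (hA.hatNabla B μ) (hA.hatNabla B ν))
      (Commute.fn_right_sum hA.fn fun l _ => hA.hatNabla B l)

theorem curvCoupling (κ : ℂ) : Commute A (curvCoupling B κ) := by
  rw [curvCoupling_eq]
  refine Commute.add_right (Commute.sum_right _ _ _ fun μ _ => Commute.sum_right _ _ _ fun ν _ => ?_)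
    (Commute.smul_right (hA.fn _) κ)
  exact Commute.mul_right (hA.psiPsiBar B μ ν) (hA.curvOp B μ ν)

theorem hamiltonianD (κ : ℂ) (m : ℝ) : Commute A (hamiltonianD B κ m) :=
  Commute.add_right (Commute.sub_right (hA.laplacian B) (Commute.smul_right (Commute.one_right A) _))
    (hA.curvCoupling B κ)

theorem superLin {X Y : Fin n → Op n k U} (hX : ∀ i, A * X i = -(X i * A))
    (hY : ∀ i, A * Y i = -(Y i * A)) :
    A * (∑ i, (gamBar i * X i + gam i * Y i)) = -((∑ i, (gamBar i * X i + gam i * Y i)) * A) := by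
  rw [mul_sum, sum_mul, ← sum_neg_distrib]
  refine sum_congr rfl fun i _ => ?_
  rw [mul_add, ← mul_assoc, ← mul_assoc, ← (hA.even.gam i).eq, ← (hA.even.gamBar i).eq, mul_assoc,
    mul_assoc, hX, hY]
  noncomm_ring

theorem superS (μ : Fin d) : A * superS B μ = -(SpinningParticle.superS B μ * A) :=
  hA.superLin (fun i => hA.psi B i μ) (fun i => hA.psiBar B i μ)

theorem superS_hatNabla : A * (∑ μ, SpinningParticle.superS B μ * SpinningParticle.hatNabla B μ) =
    -((∑ μ, SpinningParticle.superS B μ * SpinningParticle.hatNabla B μ) * A) := by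
  rw [mul_sum, sum_mul, ← sum_neg_distrib]
  refine sum_congr rfl fun μ _ => ?_
  rw [← mul_assoc, hA.superS B μ, neg_mul, mul_assoc, (hA.hatNabla B μ).eq, mul_assoc]

theorem boldNabla {m : ℝ} (hr : A * rho = -(rho * A)) :
    A * boldNabla B m = -(SpinningParticle.boldNabla B m * A) := by
  rw [SpinningParticle.boldNabla, mul_add, add_mul, mul_smul_comm, mul_smul_comm, smul_mul_assoc,
    smul_mul_assoc, hA.superS_hatNabla B, hr, smul_neg, smul_neg, neg_add]

end PsiOdd

theorem cGhost_rho : (cGhost * rho : Op n k U) = -(rho * cGhost) := by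
  rw [rho, sum_comm, mul_sum, sum_mul, ← sum_neg_distrib]
  exact sum_congr rfl fun r _ =>
    psiOdd_cGhost.superLin (fun i => cGhost_theta i r) (fun i => cGhost_thetaBar i r)

theorem bGhost_rho : (bGhost * rho : Op n k U) = -(rho * bGhost) := by
  rw [rho, sum_comm, mul_sum, sum_mul, ← sum_neg_distrib]
  exact sum_congr rfl fun r _ =>
    psiOdd_bGhost.superLin (fun i => bGhost_theta i r) (fun i => bGhost_thetaBar i r)

/-- The anticommutator of two odd generators. -/
theorem superLin_superLin {X Y X' Y' : Fin n → Op n k U} {f : Op n k U}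
    (hX : ∀ i, CommutesWithEven (X i)) (hY : ∀ i, CommutesWithEven (Y i))
    (hX' : ∀ i, CommutesWithEven (X' i)) (hY' : ∀ i, CommutesWithEven (Y' i))
    (hXX : ∀ i j, X i * X' j = -(X' j * X i)) (hYY : ∀ i j, Y i * Y' j = -(Y' j * Y i))
    (hXY : ∀ i j, X i * Y' j = (if i = j then f else 0) - Y' j * X i)
    (hYX : ∀ i j, Y i * X' j = (if i = j then f else 0) - X' j * Y i) :
    (∑ i, (gamBar i * X i + gam i * Y i)) * (∑ j, (gamBar j * X' j + gam j * Y' j)) =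
      gamBarGam * f + gamBarGam * f
        - (∑ j, (gamBar j * X' j + gam j * Y' j)) * ∑ i, (gamBar i * X i + gam i * Y i) := by
  have key : ∀ i j, (gamBar i * X i + gam i * Y i) * (gamBar j * X' j + gam j * Y' j) =
      (if i = j then gamBar i * gam i * f + gamBar i * gam i * f else 0)
        - (gamBar j * X' j + gam j * Y' j) * (gamBar i * X i + gam i * Y i) := fun i j => by
    have swap : ∀ {a b P Q : Op n k U}, Commute b P → a * P * (b * Q) = a * b * (P * Q) :=
      fun {a b P Q} h => by rw [mul_assoc, ← mul_assoc P, ← h.eq]; simp only [mul_assoc]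
    rw [add_mul, mul_add, mul_add, add_mul, mul_add, mul_add,
      swap ((hX i).gamBar j), swap ((hX i).gam j), swap ((hY i).gamBar j), swap ((hY i).gam j),
      swap ((hX' j).gamBar i), swap ((hX' j).gam i), swap ((hY' j).gamBar i), swap ((hY' j).gam i),
      hXX, hYY, hXY, hYX, (commute_gamBar_gamBar j i).eq, (commute_gam_gam j i).eq,
      (commute_gamBar_gam j i).eq, ← (commute_gamBar_gam i j).eq]
    by_cases h : i = j
    · subst h
      rw [if_pos rfl, if_pos rfl, (commute_gamBar_gam i i).eq]
      noncomm_ring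
    · rw [if_neg h, if_neg h]
      noncomm_ring
  rw [sum_mul_sum, sum_mul_sum, sum_comm
    (f := fun j i => (gamBar j * X' j + gam j * Y' j) * (gamBar i * X i + gam i * Y i))]
  simp only [key, sum_sub_distrib, sum_ite_eq, mem_univ, if_true,
    sum_add_distrib, gamBarGam, sum_mul]

theorem CommutesWithEven.theta (i : Fin n) (r : Fin k) : CommutesWithEven (theta i r : Op n k U) :=
  .oddMul _

theorem CommutesWithEven.thetaBar (i : Fin n) (r : Fin k) :
    CommutesWithEven (thetaBar i r : Op n k U) := .oddDer _

theorem commute_gamBarGam {A : Op n k U} (h1 : ∀ i, Commute (gamBar i) A)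
    (h2 : ∀ i, Commute (gam i) A) : Commute gamBarGam A :=
  Commute.sum_left _ _ _ fun i _ => Commute.mul_left (h1 i) (h2 i)

theorem CommutesWithEven.gamBarGam {A : Op n k U} (h : CommutesWithEven A) :
    Commute gamBarGam A := commute_gamBarGam h.gamBar h.gam

theorem commute_gamBarGam_gam (i : Fin n) : Commute (gamBarGam : Op n k U) (gam i) :=
  commute_gamBarGam (fun j => commute_gamBar_gam j i) (fun j => commute_gam_gam j i)

theorem commute_gamBarGam_gamBar (i : Fin n) : Commute (gamBarGam : Op n k U) (gamBar i) :=
  commute_gamBarGam (fun j => commute_gamBar_gamBar j i) (fun j => (commute_gamBar_gam i j).symm)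

theorem commute_gamBarGam_superLin {X Y : Fin n → Op n k U} (hX : ∀ i, CommutesWithEven (X i))
    (hY : ∀ i, CommutesWithEven (Y i)) :
    Commute gamBarGam (∑ i, (gamBar i * X i + gam i * Y i)) :=
  Commute.sum_right _ _ _ fun i _ => Commute.add_right
    (Commute.mul_right (commute_gamBarGam_gamBar i) (hX i).gamBarGam)
    (Commute.mul_right (commute_gamBarGam_gam i) (hY i).gamBarGam)

theorem commute_gamBarGam_rho : Commute (gamBarGam : Op n k U) rho := by
  rw [rho, sum_comm]
  exact Commute.sum_right _ _ _ fun r _ => commute_gamBarGam_superLin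
    (fun i => .theta i r) (fun i => .thetaBar i r)

theorem rho_mul_self : (rho * rho : Op n k U) = (k : ℂ) • gamBarGam := by
  obtain ⟨w, hw⟩ : ∃ w : Fin k → Op n k U,
      ∀ r, w r = ∑ i, (gamBar i * theta i r + gam i * thetaBar i r) := ⟨_, fun _ => rfl⟩
  have h : ∀ r s, w r * w s = gamBarGam * (if r = s then 1 else 0)
      + gamBarGam * (if r = s then 1 else 0) - w s * w r := fun r s => by
    rw [hw, hw]
    refine superLin_superLin (fun i => .theta i r) (fun i => .thetaBar i r) (fun i => .theta i s)
      (fun i => .thetaBar i s) (fun i j => theta_theta i j r s) (fun i j => thetaBar_thetaBar i j r s)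
      (fun i j => ?_) (fun i j => ?_)
    · simp only [thetaBar_theta, ← ite_and, eq_comm (a := j), eq_comm (a := s), sub_sub_cancel]
    · rw [thetaBar_theta, ite_and]
  have h2 : (rho * rho : Op n k U) + rho * rho = (k : ℂ) • (gamBarGam + gamBarGam) := by
    have e : (rho : Op n k U) = ∑ r, w r := by
      simp only [hw, rho]; rw [sum_comm]
    have h3 : ∀ r : Fin k, ∑ s, (gamBarGam * (if r = s then 1 else 0) : Op n k U) = gamBarGam := fun r => by
      simp only [mul_ite, mul_one, mul_zero, sum_ite_eq, mem_univ, if_true]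
    rw [e, sum_mul_sum]
    calc _ = ∑ r, ∑ s, w r * w s + ∑ r, ∑ s, w s * w r := by
          rw [sum_comm (f := fun r s => w s * w r)]
      _ = ∑ r, ∑ s, ((gamBarGam * (if r = s then 1 else 0) : Op n k U)
            + gamBarGam * (if r = s then 1 else 0)) := by
          simp only [← sum_add_distrib]
          refine sum_congr rfl fun r _ => sum_congr rfl fun s _ => ?_
          rw [h, sub_add_cancel]
      _ = ∑ _r : Fin k, ((gamBarGam : Op n k U) + gamBarGam) := by
          refine sum_congr rfl fun r _ => ?_
          rw [sum_add_distrib]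
          exact congrArg₂ (· + ·) (h3 r) (h3 r)
      _ = _ := by
          rw [Finset.sum_const, Finset.card_univ, Fintype.card_fin,
            Nat.cast_smul_eq_nsmul]
  linear_combination (norm := module) (1 / 2 : ℂ) • h2

variable (B : Background U)

theorem superS_superS (μ ν : Fin d) : (superS B μ * superS B ν : Op n k U) =
    gamBarGam * fn (B.invMetric μ ν) + gamBarGam * fn (B.invMetric μ ν)
      - superS B ν * superS B μ := by
  refine superLin_superLin (fun i => .psi B i μ) (fun i => .psiBar B i μ) (fun i => .psi B i ν)
    (fun i => .psiBar B i ν) (fun i j => psi_psi B i j μ ν) (fun i j => psiBar_psiBar B i j μ ν)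
    (fun i j => ?_) (fun i j => psiBar_psi B i j μ ν)
  simp only [psiBar_psi, B.invMetric_symm ν μ, eq_comm (a := j), sub_sub_cancel]

theorem superS_rho (μ : Fin d) : (superS B μ * rho : Op n k U) = -(rho * superS B μ) := by
  rw [rho, sum_comm, mul_sum, sum_mul, ← sum_neg_distrib]
  refine sum_congr rfl fun r _ => ?_
  have h := superLin_superLin (f := 0) (fun i : Fin n => .psi (k := k) B i μ) (fun i => .psiBar B i μ)
    (fun i => .theta i r) (fun i => .thetaBar i r)
    (fun i j => by rw [theta_psi, neg_neg]) (fun i j => by rw [thetaBar_psiBar, neg_neg])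
    (fun i j => by rw [thetaBar_psi]; simp) (fun i j => by rw [theta_psiBar]; simp)
  rw [mul_zero, add_zero, zero_sub] at h
  exact h

theorem commute_gamBarGam_superS (μ : Fin d) : Commute (gamBarGam : Op n k U) (superS B μ) :=
  commute_gamBarGam_superLin (fun i => .psi B i μ) (fun i => .psiBar B i μ)

theorem commute_gamBarGam_boldNabla (m : ℝ) :
    Commute (gamBarGam : Op n k U) (boldNabla B m) := by
  refine Commute.add_right (Commute.smul_right ?_ _) (Commute.smul_right commute_gamBarGam_rho _)
  refine Commute.sum_right _ _ _ fun μ _ => ?_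
  exact Commute.mul_right (commute_gamBarGam_superS B μ)
    (CommutesWithEven.hatNabla B μ).gamBarGam

/-- `Q² = 𝛁² + γ̄·γ 𝒟 + c [𝒟, 𝛁]`. -/
theorem brst_mul_self (κ : ℂ) (m : ℝ) : (brst B κ m * brst B κ m : Op n k U) =
    boldNabla B m * boldNabla B m + gamBarGam * hamiltonianD B κ m
      + cGhost * (hamiltonianD B κ m * boldNabla B m - boldNabla B m * hamiltonianD B κ m) := by
  refine brst_sq_of_relations cGhost_mul_self bGhost_mul_self bGhost_cGhost
    (psiOdd_cGhost.hamiltonianD B κ m).eq.symm (psiOdd_bGhost.hamiltonianD B κ m).eq.symm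
    ?_ ?_ (CommutesWithEven.oddMul _).gamBarGam.eq (CommutesWithEven.oddDer _).gamBarGam.eq
    (CommutesWithEven.hamiltonianD B κ m).gamBarGam.eq (commute_gamBarGam_boldNabla B m).eq
  · rw [psiOdd_cGhost.boldNabla B cGhost_rho, neg_neg]
  · rw [psiOdd_bGhost.boldNabla B bGhost_rho, neg_neg]

theorem commute_fn_superS (f : Fn U) (μ : Fin d) : Commute (fn f : Op n k U) (superS B μ) :=
  Commute.sum_right _ _ _ fun i _ => Commute.add_right
    (Commute.mul_right (commute_fn_gamBar f i) (commute_fn_psi B f i μ))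
    (Commute.mul_right (commute_fn_gam f i) (commute_fn_psiBar B f i μ))

/-- `[∇̂_μ, S^ν] = -Γ^ν_{μλ} S^λ`. -/
theorem hatNabla_superS (μ ν : Fin d) : (hatNabla B μ * superS B ν : Op n k U) =
    superS B ν * hatNabla B μ - ∑ l, fn (B.christoffel ν μ l) * superS B l := by
  simp only [superS, mul_sum, sum_mul]
  rw [sum_comm, ← sum_sub_distrib]
  refine sum_congr rfl fun i _ => ?_
  have h1 := ((CommutesWithEven.hatNabla (n := n) (k := k) B μ).gam i).eq
  have h2 := ((CommutesWithEven.hatNabla (n := n) (k := k) B μ).gamBar i).eq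
  rw [mul_add, ← mul_assoc, ← mul_assoc, ← h1, ← h2, mul_assoc, mul_assoc, hatNabla_psi,
    hatNabla_psiBar, mul_sub, mul_sub, mul_sum, mul_sum, add_mul]
  have h3 : ∀ l, (gamBar i * (fn (B.christoffel ν μ l) * psi B i l) : Op n k U) =
      fn (B.christoffel ν μ l) * (gamBar i * psi B i l) := fun l => by
    rw [← mul_assoc, ← (commute_fn_gamBar _ i).eq, mul_assoc]
  have h4 : ∀ l, (gam i * (fn (B.christoffel ν μ l) * psiBar B i l) : Op n k U) =
      fn (B.christoffel ν μ l) * (gam i * psiBar B i l) := fun l => by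
    rw [← mul_assoc, ← (commute_fn_gam _ i).eq, mul_assoc]
  simp only [h3, h4, mul_add, sum_add_distrib, mul_assoc]
  abel

/-- The square of `S^μ ∇̂_μ`. -/
theorem superS_hatNabla_mul_self :
    ((∑ μ, superS B μ * hatNabla B μ) * (∑ μ, superS B μ * hatNabla B μ) : Op n k U) =
      gamBarGam * laplacian B
        + (1 / 2 : ℂ) • ∑ μ, ∑ ν, superS B μ * superS B ν * curvOp B μ ν := by
  have h := sum_mul_sum_of_derivation (S := superS B) (D := hatNabla B) (K := curvOp B)
    (g := fun μ ν => (gamBarGam * fn (B.invMetric μ ν) : Op n k U))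
    (Γ := fun ν μ l => fn (B.christoffel ν μ l)) (superS_superS B) (hatNabla_hatNabla B)
    (hatNabla_superS B) (fun ν μ l => by rw [B.christoffel_symm])
    (fun ν μ l κ => (commute_fn_superS B _ κ).eq)
  have h2 : (∑ μ, ∑ ν, gamBarGam * fn (B.invMetric μ ν) * (hatNabla B μ * hatNabla B ν
      - ∑ l, fn (B.christoffel l μ ν) * hatNabla B l) : Op n k U) = gamBarGam * laplacian B := by
    simp only [laplacian, mul_sum, mul_assoc]
  rw [h2] at h
  have h3 : ∀ x y z : Op n k U, x + x = y + y + z → x = y + (1 / 2 : ℂ) • z := fun x y z e => by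
    have e' : (2 : ℂ) • x = (2 : ℂ) • y + z := by rw [two_smul, two_smul, e]
    linear_combination (norm := module) (1 / 2 : ℂ) • e'
  exact h3 _ _ _ h

theorem commute_hatNabla_rho (μ : Fin d) : Commute (hatNabla B μ : Op n k U) rho := by
  refine Commute.sum_right _ _ _ fun i _ => Commute.sum_right _ _ _ fun r _ => ?_
  have h := CommutesWithEven.hatNabla (n := n) (k := k) B μ
  exact Commute.add_right
    (Commute.mul_right (h.gamBar i).symm ((psiOdd_theta i r).hatNabla B μ).symm)
    (Commute.mul_right (h.gam i).symm ((psiOdd_thetaBar i r).hatNabla B μ).symm)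

theorem commute_hamiltonianD_rho (κ : ℂ) (m : ℝ) : Commute (hamiltonianD B κ m : Op n k U) rho := by
  refine Commute.sum_right _ _ _ fun i _ => Commute.sum_right _ _ _ fun r _ => ?_
  have h := CommutesWithEven.hamiltonianD (n := n) (k := k) B κ m
  exact Commute.add_right
    (Commute.mul_right (h.gamBar i).symm ((psiOdd_theta i r).hamiltonianD B κ m).symm)
    (Commute.mul_right (h.gam i).symm ((psiOdd_thetaBar i r).hamiltonianD B κ m).symm)

theorem superS_hatNabla_rho :
    ((∑ μ, superS B μ * hatNabla B μ) * rho : Op n k U) =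
      -(rho * ∑ μ, superS B μ * hatNabla B μ) := by
  rw [mul_sum, sum_mul, ← sum_neg_distrib]
  refine sum_congr rfl fun μ _ => ?_
  rw [mul_assoc, (commute_hatNabla_rho B μ).eq, ← mul_assoc, superS_rho, neg_mul, mul_assoc]

/-- `𝛁² = -γ̄·γ (∇² - m²) - ½ S^μ S^ν 𝐑_{μν}`. -/
theorem boldNabla_mul_self {m : ℝ} (hm : (m : ℂ) ^ 2 * k = (m : ℂ) ^ 2) :
    (boldNabla B m * boldNabla B m : Op n k U) =
      -(gamBarGam * laplacian B) + (m : ℂ) ^ 2 • gamBarGam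
        + (-(1 / 2) : ℂ) • ∑ μ, ∑ ν, superS B μ * superS B ν * curvOp B μ ν := by
  rw [boldNabla, add_mul, mul_add, mul_add]
  simp only [smul_mul_assoc, mul_smul_comm, superS_hatNabla_mul_self, superS_hatNabla_rho,
    rho_mul_self, smul_smul]
  have h1 : -Complex.I * -Complex.I = -1 := by rw [neg_mul_neg, Complex.I_mul_I]
  have h2 : (m : ℂ) * (m * k) = (m : ℂ) ^ 2 := by rw [← hm]; ring
  rw [h1, h2]
  module

theorem boldNabla_sq_add {m : ℝ} (hm : (m : ℂ) ^ 2 * k = (m : ℂ) ^ 2) (κ : ℂ) :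
    (boldNabla B m * boldNabla B m + gamBarGam * hamiltonianD B κ m : Op n k U) =
      (-(1 / 2) : ℂ) • ∑ μ, ∑ ν, superS B μ * superS B ν * curvOp B μ ν
        + gamBarGam * curvCoupling B κ := by
  rw [boldNabla_mul_self B hm, hamiltonianD, mul_add, mul_sub, mul_smul_comm, mul_one]
  abel

/-- The mass drops out of `[𝒟, 𝛁]`. -/
theorem hamiltonianD_boldNabla_comm (κ : ℂ) (m : ℝ) :
    (hamiltonianD B κ m * boldNabla B m - boldNabla B m * hamiltonianD B κ m : Op n k U) =
      (-Complex.I) • ((laplacian B + curvCoupling B κ) * (∑ μ, superS B μ * hatNabla B μ)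
        - (∑ μ, superS B μ * hatNabla B μ) * (laplacian B + curvCoupling B κ)) := by
  have hr := (commute_hamiltonianD_rho (n := n) (k := k) B κ m).eq
  have e : (hamiltonianD B κ m : Op n k U) =
      laplacian B + curvCoupling B κ - (m : ℂ) ^ 2 • (1 : Op n k U) := by
    rw [hamiltonianD]; abel
  have e2 : ∀ (a : ℂ) (X Y : Op n k U), a • X - a • Y = a • (X - Y) := fun a X Y => by module
  rw [boldNabla, mul_add, add_mul, mul_smul_comm, smul_mul_assoc, mul_smul_comm, smul_mul_assoc, hr,
    add_sub_add_right_eq_sub, e2, e, sub_mul, mul_sub, smul_mul_assoc, mul_smul_comm,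
    one_mul, mul_one, sub_sub_sub_cancel_right]

end Square

/-! ### The commutator of the Laplacian with `S^μ ∇̂_μ` -/

section RingIdentities

variable {R : Type*} [Ring R] {ι : Type*} [Fintype ι] {D S : ι → R} {Γ : ι → ι → ι → R}

/-- Covariant differentiation of a contraction with a vector. -/
theorem deriv_contract_vector (hDS : ∀ μ ν, D μ * S ν = S ν * D μ - ∑ l, Γ ν μ l * S l)
    (hΓS : ∀ ν μ l κ, Γ ν μ l * S κ = S κ * Γ ν μ l) (X : ι → R) (μ : ι) :
    D μ * ∑ l, S l * X l = ∑ l, S l * (D μ * X l - ∑ σ, Γ σ μ l * X σ) := by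
  have h : ∀ l, D μ * (S l * X l) = S l * (D μ * X l) - ∑ σ, S σ * (Γ l μ σ * X l) := fun l => by
    rw [← mul_assoc, hDS, sub_mul, sum_mul, mul_assoc]
    simp only [hΓS, mul_assoc]
  rw [mul_sum]
  simp only [h, mul_sub, sum_sub_distrib, mul_sum]
  rw [sum_comm]

/-- Covariant differentiation of a contraction with a tensor of rank two. -/
theorem deriv_contract_tensor {P : ι → ι → R}
    (hDP : ∀ μ a b, D μ * P a b =
      P a b * D μ - ∑ l, Γ a μ l * P l b - ∑ l, Γ b μ l * P a l)
    (hΓP : ∀ ν μ l a b, Γ ν μ l * P a b = P a b * Γ ν μ l) (X : ι → ι → R) (μ : ι) :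
    D μ * ∑ a, ∑ b, P a b * X a b =
      ∑ a, ∑ b, P a b * (D μ * X a b - ∑ l, Γ l μ a * X l b - ∑ l, Γ l μ b * X a l) := by
  have h : ∀ a b, D μ * (P a b * X a b) = P a b * (D μ * X a b)
      - ∑ l, P l b * (Γ a μ l * X a b) - ∑ l, P a l * (Γ b μ l * X a b) := fun a b => by
    rw [← mul_assoc, hDP, sub_mul, sub_mul, sum_mul, sum_mul, mul_assoc]
    simp only [hΓP, mul_assoc]
  simp only [mul_sum (s := Finset.univ), h, mul_sub, sum_sub_distrib]
  refine congrArg₂ (· - ·) (congrArg₂ (· - ·) rfl ?_) ?_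
  · calc _ = ∑ b, ∑ a, ∑ l, P l b * (Γ a μ l * X a b) := sum_comm
      _ = ∑ b, ∑ l, ∑ a, P l b * (Γ a μ l * X a b) :=
        sum_congr rfl fun b _ => sum_comm
      _ = _ := sum_comm
  · exact sum_congr rfl fun a _ => sum_comm

theorem third_deriv_comm {K : ι → ι → R} {dΓ Rup : ι → ι → ι → ι → R} {NK : ι → ι → ι → R}
    {D2 : ι → ι → R} {D3 : ι → ι → ι → R}
    (hD2 : ∀ μ ν, D2 μ ν = D μ * D ν - ∑ l, Γ l μ ν * D l)
    (hD3 : ∀ μ ν l, D3 μ ν l = D μ * D2 ν l - ∑ σ, Γ σ μ ν * D2 σ l - ∑ σ, Γ σ μ l * D2 ν σ)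
    (hD : ∀ μ ν, D μ * D ν = D ν * D μ + K μ ν)
    (hDΓ : ∀ μ σ ν l, D μ * Γ σ ν l = Γ σ ν l * D μ + dΓ μ σ ν l)
    (hΓ : ∀ ν μ l, Γ ν μ l = Γ ν l μ)
    (hΓΓ : ∀ a b c a' b' c', Γ a b c * Γ a' b' c' = Γ a' b' c' * Γ a b c)
    (hK : ∀ μ ν l, D μ * K ν l =
      K ν l * D μ + ∑ σ, Γ σ μ ν * K σ l + ∑ σ, Γ σ μ l * K ν σ + NK μ ν l)
    (hR : ∀ μ l τ ν, Rup μ l τ ν = dΓ μ τ l ν - dΓ l τ μ ν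
      + ∑ σ, (Γ τ μ σ * Γ σ l ν - Γ τ l σ * Γ σ μ ν)) (μ ν l : ι) :
    D3 μ ν l - D3 l μ ν = NK μ ν l + K ν l * D μ + K μ l * D ν - ∑ τ, Rup μ l τ ν * D τ := by
  have h1 : ∀ a b, D2 a b = D2 b a + K a b := fun a b => by
    simp only [hD2, hD a b, hΓ _ a b]; abel
  have h2 : D3 μ ν l = D3 μ l ν + K ν l * D μ + NK μ ν l := by
    have e : D3 μ ν l = D3 μ l ν
        + (D μ * K ν l - ∑ σ, Γ σ μ ν * K σ l - ∑ σ, Γ σ μ l * K ν σ) := by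
      have e1 : ∑ σ, Γ σ μ ν * D2 σ l = ∑ σ, Γ σ μ ν * D2 l σ + ∑ σ, Γ σ μ ν * K σ l := by
        rw [← sum_add_distrib]
        exact sum_congr rfl fun σ _ => by rw [h1 σ l, mul_add]
      have e2 : ∑ σ, Γ σ μ l * D2 ν σ = ∑ σ, Γ σ μ l * D2 σ ν + ∑ σ, Γ σ μ l * K ν σ := by
        rw [← sum_add_distrib]
        exact sum_congr rfl fun σ _ => by rw [h1 ν σ, mul_add]
      rw [hD3 μ ν l, hD3 μ l ν, h1 ν l, mul_add, e1, e2]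
      abel
    rw [e, hK]; abel
  have h3 : ∀ a b c, D3 a b c = D a * D b * D c - ∑ σ, Γ σ b c * (D a * D σ)
      - ∑ σ, dΓ a σ b c * D σ - ∑ σ, Γ σ a b * D2 σ c - ∑ σ, Γ σ a c * (D b * D σ)
      + ∑ τ, (∑ σ, Γ τ b σ * Γ σ a c) * D τ := fun a b c => by
    have e1 : D a * D2 b c = D a * D b * D c - ∑ σ, Γ σ b c * (D a * D σ)
        - ∑ σ, dΓ a σ b c * D σ := by
      rw [hD2, mul_sub, mul_sum, sub_sub, ← sum_add_distrib, mul_assoc]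
      refine congrArg (_ - ·) (sum_congr rfl fun σ _ => ?_)
      rw [← mul_assoc, hDΓ, add_mul, mul_assoc]
    have e2 : ∑ σ, Γ σ a c * D2 b σ = ∑ σ, Γ σ a c * (D b * D σ)
        - ∑ τ, (∑ σ, Γ τ b σ * Γ σ a c) * D τ := by
      simp only [hD2, mul_sub, mul_sum, sum_mul, sum_sub_distrib]
      refine congrArg (_ - ·) ?_
      rw [sum_comm]
      refine sum_congr rfl fun τ _ => sum_congr rfl fun σ _ => ?_
      rw [← mul_assoc, hΓΓ]
    rw [hD3, e1, e2]; abel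
  have h4 : D3 μ l ν = D3 l μ ν + K μ l * D ν - ∑ τ, Rup μ l τ ν * D τ := by
    have e : ∑ τ, Rup μ l τ ν * D τ = ∑ τ, dΓ μ τ l ν * D τ - ∑ τ, dΓ l τ μ ν * D τ
        + (∑ τ, (∑ σ, Γ τ μ σ * Γ σ l ν) * D τ - ∑ τ, (∑ σ, Γ τ l σ * Γ σ μ ν) * D τ) := by
      simp only [hR, ← sum_sub_distrib, ← sum_add_distrib, ← sub_mul, ← add_mul]
    rw [e, h3, h3, hD μ l, add_mul]
    simp only [hΓ _ μ l]
    abel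
  rw [h2, h4]; abel

/-- The commutator of a Laplacian with a Dirac operator. -/
theorem laplacian_comm_of_derivation {g K : ι → ι → R} {dΓ Rup : ι → ι → ι → ι → R}
    {NK : ι → ι → ι → R}
    (hD : ∀ μ ν, D μ * D ν = D ν * D μ + K μ ν)
    (hDS : ∀ μ ν, D μ * S ν = S ν * D μ - ∑ l, Γ ν μ l * S l)
    (hDg : ∀ μ a b, D μ * g a b =
      g a b * D μ - ∑ l, Γ a μ l * g l b - ∑ l, Γ b μ l * g a l)
    (hDΓ : ∀ μ σ ν l, D μ * Γ σ ν l = Γ σ ν l * D μ + dΓ μ σ ν l)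
    (hΓ : ∀ ν μ l, Γ ν μ l = Γ ν l μ)
    (hΓΓ : ∀ a b c a' b' c', Γ a b c * Γ a' b' c' = Γ a' b' c' * Γ a b c)
    (hΓS : ∀ ν μ l κ, Γ ν μ l * S κ = S κ * Γ ν μ l)
    (hΓg : ∀ ν μ l a b, Γ ν μ l * g a b = g a b * Γ ν μ l)
    (hgS : ∀ a b κ, g a b * S κ = S κ * g a b)
    (hK : ∀ μ ν l, D μ * K ν l =
      K ν l * D μ + ∑ σ, Γ σ μ ν * K σ l + ∑ σ, Γ σ μ l * K ν σ + NK μ ν l)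
    (hR : ∀ μ l τ ν, Rup μ l τ ν = dΓ μ τ l ν - dΓ l τ μ ν
      + ∑ σ, (Γ τ μ σ * Γ σ l ν - Γ τ l σ * Γ σ μ ν)) :
    (∑ μ, ∑ ν, g μ ν * (D μ * D ν - ∑ l, Γ l μ ν * D l)) * (∑ l, S l * D l)
      - (∑ l, S l * D l) * (∑ μ, ∑ ν, g μ ν * (D μ * D ν - ∑ l, Γ l μ ν * D l)) =
    ∑ l, S l * ∑ μ, ∑ ν, g μ ν *
      (NK μ ν l + K ν l * D μ + K μ l * D ν - ∑ τ, Rup μ l τ ν * D τ) := by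
  obtain ⟨D2, hD2⟩ : ∃ D2 : ι → ι → R, ∀ μ ν, D2 μ ν = D μ * D ν - ∑ l, Γ l μ ν * D l :=
    ⟨_, fun _ _ => rfl⟩
  obtain ⟨D3, hD3⟩ : ∃ D3 : ι → ι → ι → R, ∀ μ ν l, D3 μ ν l =
    D μ * D2 ν l - ∑ σ, Γ σ μ ν * D2 σ l - ∑ σ, Γ σ μ l * D2 ν σ := ⟨_, fun _ _ _ => rfl⟩
  have hN : ∀ ν, D ν * ∑ l, S l * D l = ∑ l, S l * D2 ν l := fun ν => by
    rw [deriv_contract_vector hDS hΓS]; simp only [hD2]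
  have hD2N : ∀ μ ν, D2 μ ν * ∑ l, S l * D l = ∑ l, S l * D3 μ ν l := fun μ ν => by
    rw [hD2, sub_mul, mul_assoc, hN, deriv_contract_vector hDS hΓS, sum_mul]
    have h : ∀ σ, Γ σ μ ν * D σ * ∑ l, S l * D l = ∑ l, S l * (Γ σ μ ν * D2 σ l) := fun σ => by
      rw [mul_assoc, hN, mul_sum]
      refine sum_congr rfl fun l _ => ?_
      rw [← mul_assoc, hΓS, mul_assoc]
    simp only [h]
    rw [sum_comm, ← sum_sub_distrib]
    refine sum_congr rfl fun l _ => ?_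
    rw [← mul_sum, ← mul_sub, hD3]
    refine congrArg (_ * ·) ?_
    abel
  simp only [← hD2]
  have h1 : (∑ μ, ∑ ν, g μ ν * D2 μ ν) * (∑ l, S l * D l) =
      ∑ l, S l * ∑ μ, ∑ ν, g μ ν * D3 μ ν l := by
    have h : ∀ μ ν, g μ ν * D2 μ ν * (∑ l, S l * D l) = ∑ l, S l * (g μ ν * D3 μ ν l) :=
      fun μ ν => by
        rw [mul_assoc, hD2N, mul_sum]
        refine sum_congr rfl fun l _ => ?_
        rw [← mul_assoc, hgS, mul_assoc]
    simp only [sum_mul _ _ (∑ l, S l * D l), h]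
    simp only [mul_sum]
    rw [sum_comm (s := Finset.univ (α := ι)) (f := fun l μ => ∑ ν, S l * (g μ ν * D3 μ ν l))]
    exact sum_congr rfl fun μ _ => sum_comm
  have h2 : (∑ l, S l * D l) * (∑ μ, ∑ ν, g μ ν * D2 μ ν) =
      ∑ l, S l * ∑ μ, ∑ ν, g μ ν * D3 l μ ν := by
    rw [sum_mul]
    refine sum_congr rfl fun l _ => ?_
    rw [mul_assoc, deriv_contract_tensor hDg hΓg]
    simp only [hD3]
  rw [h1, h2, ← sum_sub_distrib]
  refine sum_congr rfl fun l _ => ?_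
  rw [← mul_sub, ← sum_sub_distrib]
  refine congrArg (_ * ·) (sum_congr rfl fun μ _ => ?_)
  rw [← sum_sub_distrib]
  refine sum_congr rfl fun ν _ => ?_
  rw [← mul_sub, third_deriv_comm hD2 hD3 hD hDΓ hΓ hΓΓ hK hR]

end RingIdentities

section Commutator

variable {n k d : ℕ} {U : Opens (Fin d → ℝ)} (B : Background U)

/-- `[∇̂_μ, ψ^a·ψ̄^b] = -Γ^a_{μλ} ψ^λ·ψ̄^b - Γ^b_{μλ} ψ^a·ψ̄^λ`. -/
theorem hatNabla_psiPsiBar (μ a b : Fin d) : (hatNabla B μ * psiPsiBar B a b : Op n k U) =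
    psiPsiBar B a b * hatNabla B μ - ∑ l, fn (B.christoffel a μ l) * psiPsiBar B l b
      - ∑ l, fn (B.christoffel b μ l) * psiPsiBar B a l := by
  have h : ∀ i : Fin n, (hatNabla B μ * (psi B i a * psiBar B i b) : Op n k U) =
      psi B i a * psiBar B i b * hatNabla B μ
      - ∑ l, fn (B.christoffel a μ l) * (psi B i l * psiBar B i b)
      - ∑ l, fn (B.christoffel b μ l) * (psi B i a * psiBar B i l) := fun i => by
    rw [← mul_assoc, hatNabla_psi, sub_mul, mul_assoc, hatNabla_psiBar, mul_sub, mul_sum,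
      sum_mul]
    have e : ∀ l, (psi B i a * (fn (B.christoffel b μ l) * psiBar B i l) : Op n k U) =
        fn (B.christoffel b μ l) * (psi B i a * psiBar B i l) := fun l => by
      rw [← mul_assoc, ← (commute_fn_psi B _ i a).eq, mul_assoc]
    simp only [e, mul_assoc]
    abel
  simp only [psiPsiBar, mul_sum, sum_mul, h, sum_sub_distrib]
  refine congrArg₂ (· - ·) (congrArg₂ (· - ·) rfl sum_comm) sum_comm

theorem hatNabla_invMetric (μ a b : Fin d) : (hatNabla B μ * fn (B.invMetric a b) : Op n k U) =
    fn (B.invMetric a b) * hatNabla B μ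
      - ∑ l, fn (B.christoffel a μ l) * fn (B.invMetric l b)
      - ∑ l, fn (B.christoffel b μ l) * fn (B.invMetric a l) := by
  rw [hatNabla_fn, B.partialD_invMetric]
  simp only [fn_sub, fn_neg, fn_sum, fn_mul]
  abel

theorem commute_fn_bilOp (f : Fn U) (M : Fin d → Fin d → Fn U) :
    Commute (fn f : Op n k U) (bilOp B M) :=
  Commute.sum_right _ _ _ fun _ _ => Commute.fn_right_sum (commute_fn_fn f) fun _ _ =>
    commute_fn_psiPsiBar B f _ _

theorem bilOp_add (M N : Fin d → Fin d → Fn U) :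
    (bilOp B (fun a b => M a b + N a b) : Op n k U) = bilOp B M + bilOp B N := by
  simp only [bilOp, fn_add, add_mul, sum_add_distrib]

theorem bilOp_sum {ι : Type*} (s : Finset ι) (f : ι → Fn U) (M : ι → Fin d → Fin d → Fn U) :
    (bilOp B (fun a b => ∑ x ∈ s, f x * M x a b) : Op n k U) =
      ∑ x ∈ s, fn (f x) * bilOp B (M x) := by
  simp only [bilOp, fn_sum, fn_mul, sum_mul, mul_sum, mul_assoc]
  exact (sum_congr rfl fun a _ => sum_comm).trans sum_comm

theorem hatNabla_bilOp (μ : Fin d) (M : Fin d → Fin d → Fn U) :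
    (hatNabla B μ * bilOp B M : Op n k U) = bilOp B M * hatNabla B μ
      + bilOp B (fun a b => partialD μ (M a b) - ∑ l, B.christoffel l μ a * M l b
        - ∑ l, B.christoffel l μ b * M a l) := by
  have e : ∀ N : Fin d → Fin d → Fn U, (bilOp B N : Op n k U) =
      ∑ a, ∑ b, psiPsiBar B a b * fn (N a b) := fun N => by
    simp only [bilOp, (commute_fn_psiPsiBar B _ _ _).eq]
  rw [e, e, deriv_contract_tensor (hatNabla_psiPsiBar B)
    (fun ν μ l a b => (commute_fn_psiPsiBar B _ a b).eq)]
  simp only [sum_mul, ← sum_add_distrib]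
  refine sum_congr rfl fun a _ => sum_congr rfl fun b _ => ?_
  rw [hatNabla_fn, mul_assoc, ← mul_add]
  simp only [fn_sub, fn_sum, fn_mul]
  refine congrArg (_ * ·) ?_
  abel

theorem hatNabla_curvOp (μ ν l : Fin d) : (hatNabla B μ * curvOp B ν l : Op n k U) =
    curvOp B ν l * hatNabla B μ + ∑ σ, fn (B.christoffel σ μ ν) * curvOp B σ l
      + ∑ σ, fn (B.christoffel σ μ l) * curvOp B ν σ + bilOp B (B.nablaRiemann μ ν l) := by
  simp only [curvOp_eq_bilOp, ← bilOp_sum]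
  rw [hatNabla_bilOp, add_assoc, add_assoc, ← bilOp_add, ← bilOp_add]
  refine congrArg (_ + bilOp B ·) (funext fun a => funext fun b => ?_)
  rw [Background.nablaRiemann]; ring

/-- The commutator of the Laplacian with `S^λ ∇̂_λ`. -/
theorem laplacian_superS_hatNabla :
    (laplacian B * (∑ l, superS B l * hatNabla B l)
      - (∑ l, superS B l * hatNabla B l) * laplacian B : Op n k U) =
    ∑ l, superS B l * ∑ μ, ∑ ν, fn (B.invMetric μ ν) *
      (bilOp B (B.nablaRiemann μ ν l) + curvOp B ν l * hatNabla B μ + curvOp B μ l * hatNabla B ν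
        - ∑ τ, fn (B.riemannUp μ l τ ν) * hatNabla B τ) := by
  refine laplacian_comm_of_derivation (g := fun μ ν => fn (B.invMetric μ ν))
    (Γ := fun l μ ν => fn (B.christoffel l μ ν)) (K := curvOp B) (S := superS B) (D := hatNabla B)
    (NK := fun μ ν l => bilOp B (B.nablaRiemann μ ν l))
    (dΓ := fun μ l a b => fn (partialD μ (B.christoffel l a b)))
    (Rup := fun μ l τ ν => fn (B.riemannUp μ l τ ν))
    (hatNabla_hatNabla B) (hatNabla_superS B) (hatNabla_invMetric B)
    (fun μ σ ν l => hatNabla_fn B μ _) (fun ν μ l => by rw [B.christoffel_symm])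
    (fun _ _ _ _ _ _ => fn_fn _ _) (fun _ _ _ κ => (commute_fn_superS B _ κ).eq)
    (fun _ _ _ _ _ => fn_fn _ _) (fun _ _ κ => (commute_fn_superS B _ κ).eq)
    (hatNabla_curvOp B) (fun μ l τ ν => ?_)
  simp only [Background.riemannUp, fn_add, fn_sub, fn_sum, fn_mul]

end Commutator

section Commutator

variable {n k d : ℕ} {U : Opens (Fin d → ℝ)} (B : Background U)

/-! ### The commutator of the curvature coupling with `S^μ ∇̂_μ` -/

theorem psiPsiBar_psi (a b τ : Fin d) (j : Fin n) : (psiPsiBar B a b * psi B j τ : Op n k U) =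
    psi B j τ * psiPsiBar B a b + fn (B.invMetric b τ) * psi B j a := by
  have h : ∀ i, (psi B i a * psiBar B i b * psi B j τ : Op n k U) =
      psi B j τ * (psi B i a * psiBar B i b)
        + if i = j then fn (B.invMetric b τ) * psi B i a else 0 := fun i => by
    rw [mul_assoc, psiBar_psi, mul_sub, ← mul_assoc (psi B i a), psi_psi B i j, mul_ite, mul_zero,
      ← (commute_fn_psi B _ i a).eq]
    noncomm_ring
  simp only [psiPsiBar, sum_mul, mul_sum, h, sum_add_distrib,
    sum_ite_eq', mem_univ, if_true]

theorem psiPsiBar_psiBar (a b τ : Fin d) (j : Fin n) :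
    (psiPsiBar B a b * psiBar B j τ : Op n k U) =
      psiBar B j τ * psiPsiBar B a b - fn (B.invMetric a τ) * psiBar B j b := by
  have h : ∀ i, (psi B i a * psiBar B i b * psiBar B j τ : Op n k U) =
      psiBar B j τ * (psi B i a * psiBar B i b)
        - if i = j then fn (B.invMetric a τ) * psiBar B i b else 0 := fun i => by
    have e : (psi B i a * psiBar B j τ : Op n k U) =
        (if i = j then fn (B.invMetric a τ) else 0) - psiBar B j τ * psi B i a := by
      simp only [psiBar_psi B j i, B.invMetric_symm τ a, eq_comm (a := j), sub_sub_cancel]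
    rw [mul_assoc, psiBar_psiBar B i j, mul_neg, ← mul_assoc, e, sub_mul, ite_mul, zero_mul]
    noncomm_ring
  simp only [psiPsiBar, sum_mul, mul_sum, h, sum_sub_distrib,
    sum_ite_eq', mem_univ, if_true]

theorem psiPsiBar_superS (a b τ : Fin d) : (psiPsiBar B a b * superS B τ : Op n k U) =
    superS B τ * psiPsiBar B a b + (fn (B.invMetric b τ) * (∑ i, gamBar i * psi B i a)
      - fn (B.invMetric a τ) * ∑ i, gam i * psiBar B i b) := by
  simp only [superS, mul_sum, sum_mul, ← sum_sub_distrib,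
    ← sum_add_distrib]
  refine sum_congr rfl fun i _ => ?_
  have h1 := ((CommutesWithEven.psiPsiBar (n := n) (k := k) B a b).gam i).eq
  have h2 := ((CommutesWithEven.psiPsiBar (n := n) (k := k) B a b).gamBar i).eq
  have h3 := (commute_fn_gam (k := k) (B.invMetric a τ) i).eq
  have h4 := (commute_fn_gamBar (k := k) (B.invMetric b τ) i).eq
  rw [mul_add, ← mul_assoc, ← mul_assoc, ← h1, ← h2, mul_assoc, mul_assoc, psiPsiBar_psi,
    psiPsiBar_psiBar, ← mul_assoc (fn (B.invMetric b τ)), ← mul_assoc (fn (B.invMetric a τ)), h3,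
    h4]
  noncomm_ring

/-- Antisymmetric tensors rotate `S^τ`. -/
theorem sum_antisymm_psiPsiBar_superS {M : Fin d → Fin d → Op n k U}
    (hM : ∀ a b, M a b = -M b a) (τ : Fin d) :
    (∑ a, ∑ b, M a b * (psiPsiBar B a b * superS B τ) : Op n k U) =
      ∑ a, ∑ b, M a b * (superS B τ * psiPsiBar B a b)
        + ∑ a, ∑ b, M a b * (fn (B.invMetric b τ) * superS B a) := by
  have h : ∑ a, ∑ b, M a b * (fn (B.invMetric a τ) * ∑ i, gam i * psiBar B i b) =
      -∑ a, ∑ b, M a b * (fn (B.invMetric b τ) * ∑ i, gam i * psiBar B i a) := by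
    rw [sum_comm, ← sum_neg_distrib]
    refine sum_congr rfl fun a _ => ?_
    rw [← sum_neg_distrib]
    refine sum_congr rfl fun b _ => ?_
    rw [hM b a, neg_mul]
  have h2 : ∀ a, (superS B a : Op n k U) =
      ∑ i, gamBar i * psi B i a + ∑ i, gam i * psiBar B i a := fun a => by
    rw [superS, sum_add_distrib]
  simp only [psiPsiBar_superS, mul_add, mul_sub, sum_add_distrib, sum_sub_distrib, h]
  simp only [h2 _, mul_add, sum_add_distrib]
  simp only [← h2]
  abel

theorem curvOp_superS (μ ν τ : Fin d) : (curvOp B μ ν * superS B τ : Op n k U) =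
    superS B τ * curvOp B μ ν
      + ∑ a, ∑ b, fn (B.riemann μ ν a b * B.invMetric b τ) * superS B a := by
  have h := sum_antisymm_psiPsiBar_superS (k := k) (n := n) B
    (M := fun a b => fn (B.riemann μ ν a b)) (fun a b => by
      rw [B.riemann_antisymm_right, fn_neg]) τ
  simp only [curvOp, sum_mul, mul_sum, mul_assoc, fn_mul, h]
  refine congrArg (· + _) (sum_congr rfl fun a _ => sum_congr rfl fun b _ => ?_)
  rw [← mul_assoc, (commute_fn_superS B _ τ).eq, mul_assoc]

theorem sum_curvOp_superS (ν : Fin d) : (∑ μ, curvOp B μ ν * superS B μ : Op n k U) =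
    ∑ μ, superS B μ * curvOp B μ ν - ∑ a, fn (B.ricci ν a) * superS B a := by
  simp only [curvOp_superS, sum_add_distrib, sub_eq_add_neg]
  refine congrArg (_ + ·) ?_
  rw [sum_comm, ← sum_neg_distrib]
  refine sum_congr rfl fun a _ => ?_
  simp only [← sum_mul, ← fn_sum]
  rw [← neg_mul, ← fn_neg, ← B.sum_invMetric_riemann_outer, ← sum_neg_distrib]
  refine congrArg (fn · * _) (sum_congr rfl fun μ _ => ?_)
  rw [← sum_neg_distrib]
  refine sum_congr rfl fun b _ => ?_
  rw [B.riemann_antisymm_right, B.invMetric_symm]; ring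

theorem curvCoupling_superS (κ : ℂ) (τ : Fin d) : (curvCoupling B κ * superS B τ : Op n k U) =
    superS B τ * curvCoupling B κ + ∑ b, fn (B.invMetric b τ) *
      ((∑ a, superS B a * curvOp B a b) + (∑ a, superS B a * curvOp B a b)
        - ∑ a, fn (B.ricci b a) * superS B a) := by
  have h1 : ∑ b, fn (B.invMetric b τ) * ((∑ a, superS B a * curvOp B a b)
      + (∑ a, superS B a * curvOp B a b) - ∑ a, fn (B.ricci b a) * superS B a) =
      (∑ a, ∑ b, curvOp B a b * (fn (B.invMetric b τ) * superS B a) : Op n k U)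
        + ∑ a, ∑ b, fn (B.invMetric b τ) * superS B a * curvOp B a b := by
    rw [sum_comm (f := fun a b => curvOp B a b * (fn (B.invMetric b τ) * superS B a)),
      sum_comm (f := fun a b => fn (B.invMetric b τ) * superS B a * curvOp B a b),
      ← sum_add_distrib]
    refine sum_congr rfl fun b _ => ?_
    have e : ∀ a, (curvOp B a b * (fn (B.invMetric b τ) * superS B a) : Op n k U) =
        fn (B.invMetric b τ) * (curvOp B a b * superS B a) := fun a => by
      rw [← mul_assoc, ← (commute_fn_curvOp B _ a b).eq, mul_assoc]
    simp only [e, ← mul_sum, mul_assoc]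
    rw [← mul_add, sum_curvOp_superS]
    refine congrArg (_ * ·) ?_
    abel
  have h2 : ∑ a, ∑ b, curvOp B a b * (superS B τ * psiPsiBar B a b) =
      (∑ a, ∑ b, superS B τ * (curvOp B a b * psiPsiBar B a b) : Op n k U)
        + ∑ a, ∑ b, fn (B.invMetric b τ) * superS B a * curvOp B a b := by
    have e : ∀ a b, (curvOp B a b * (superS B τ * psiPsiBar B a b) : Op n k U) =
        superS B τ * (curvOp B a b * psiPsiBar B a b) + ∑ a', ∑ b',
          fn (B.invMetric b' τ) * superS B a' * (fn (B.riemann a' b' a b) * psiPsiBar B a b) :=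
      fun a b => by
        rw [← mul_assoc, curvOp_superS, add_mul, mul_assoc]
        simp only [sum_mul]
        refine congrArg (_ + ·) (sum_congr rfl fun a' _ => sum_congr rfl fun b' _ => ?_)
        rw [B.riemann_pair_symm, mul_comm (B.riemann a' b' a b), fn_mul, mul_assoc, mul_assoc,
          mul_assoc, ← mul_assoc (superS B a'), ← (commute_fn_superS B _ a').eq, mul_assoc]
    simp only [e, sum_add_distrib]
    refine congrArg (_ + ·) ?_
    simp only [curvOp, mul_sum]
    calc _ = ∑ a, ∑ a', ∑ b, ∑ b', (fn (B.invMetric b' τ) * superS B a' *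
          (fn (B.riemann a' b' a b) * psiPsiBar B a b) : Op n k U) :=
          sum_congr rfl fun a _ => sum_comm
      _ = ∑ a', ∑ a, ∑ b', ∑ b, (fn (B.invMetric b' τ) * superS B a' *
          (fn (B.riemann a' b' a b) * psiPsiBar B a b) : Op n k U) := by
          rw [sum_comm]
          exact sum_congr rfl fun a' _ => sum_congr rfl fun a _ => sum_comm
      _ = _ := sum_congr rfl fun a' _ => sum_comm
  have h3 := sum_antisymm_psiPsiBar_superS (k := k) (n := n) B (M := curvOp B)
    (fun a b => curvOp_antisymm B a b) τ
  rw [h1, curvCoupling_eq', add_mul, mul_add, smul_mul_assoc, mul_smul_comm,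
    (commute_fn_superS B _ τ).eq]
  simp only [sum_mul, mul_sum, mul_assoc _ (psiPsiBar B _ _) (superS B τ), h3, h2]
  abel

theorem hatNabla_curvCoupling (κ : ℂ) (μ : Fin d) :
    (hatNabla B μ * curvCoupling B κ : Op n k U) = curvCoupling B κ * hatNabla B μ
      + ∑ a, ∑ b, psiPsiBar B a b * bilOp B (B.nablaRiemann μ a b)
      + κ • fn (partialD μ B.scalarCurvature) := by
  rw [curvCoupling_eq, mul_add, deriv_contract_tensor (hatNabla_psiPsiBar B)
    (fun ν μ l a b => (commute_fn_psiPsiBar B _ a b).eq), mul_smul_comm, hatNabla_fn, add_mul,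
    smul_mul_assoc]
  have h : ∀ a b, (psiPsiBar B a b * (hatNabla B μ * curvOp B a b
      - ∑ l, fn (B.christoffel l μ a) * curvOp B l b
      - ∑ l, fn (B.christoffel l μ b) * curvOp B a l) : Op n k U) =
      psiPsiBar B a b * curvOp B a b * hatNabla B μ
        + psiPsiBar B a b * bilOp B (B.nablaRiemann μ a b) := fun a b => by
    rw [hatNabla_curvOp, mul_assoc, ← mul_add]
    refine congrArg (_ * ·) ?_
    abel
  simp only [h, sum_add_distrib, sum_mul]
  module

theorem sum_invMetric_riemannUp (l τ : Fin d) :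
    ∑ μ, ∑ ν, B.invMetric μ ν * B.riemannUp μ l τ ν = -∑ b, B.invMetric b τ * B.ricci b l := by
  have h : ∀ ρ, ∑ μ, ∑ ν, B.invMetric μ ν * B.riemann μ l ρ ν = -B.ricci ρ l := fun ρ => by
    rw [B.ricci_symm, ← B.sum_invMetric_riemann_outer, ← sum_neg_distrib]
    refine sum_congr rfl fun μ _ => ?_
    rw [← sum_neg_distrib]
    refine sum_congr rfl fun ν _ => ?_
    rw [B.riemann_antisymm_right]; ring
  calc _ = ∑ μ, ∑ ν, ∑ ρ, B.invMetric ρ τ * (B.invMetric μ ν * B.riemann μ l ρ ν) := by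
        refine sum_congr rfl fun μ _ => sum_congr rfl fun ν _ => ?_
        rw [← B.sum_invMetric_riemann_inner, mul_sum]
        refine sum_congr rfl fun ρ _ => ?_
        rw [B.invMetric_symm τ]; ring
    _ = ∑ ρ, ∑ μ, ∑ ν, B.invMetric ρ τ * (B.invMetric μ ν * B.riemann μ l ρ ν) :=
        (sum_congr rfl fun μ _ => sum_comm).trans sum_comm
    _ = _ := by simp only [← mul_sum, h, mul_neg, sum_neg_distrib]

/-- The obstruction to the commutation of `∇² + ℜ` with `S^λ ∇̂_λ`. -/
theorem laplacian_add_curvCoupling_comm (κ : ℂ) :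
    ((laplacian B + curvCoupling B κ) * (∑ l, superS B l * hatNabla B l)
      - (∑ l, superS B l * hatNabla B l) * (laplacian B + curvCoupling B κ) : Op n k U) =
    ∑ l, superS B l * (∑ μ, ∑ ν, fn (B.invMetric μ ν) * bilOp B (B.nablaRiemann μ ν l)
      - ∑ μ, ∑ ν, psiPsiBar B μ ν * bilOp B (B.nablaRiemann l μ ν)
      - κ • fn (partialD l B.scalarCurvature)) := by
  set T1 : Op n k U := ∑ l, ∑ b, fn (B.invMetric b l) * (∑ a, superS B a * curvOp B a b)
    * hatNabla B l with hT1
  set T2 : Op n k U := ∑ l, ∑ b, fn (B.invMetric b l) * (∑ a, fn (B.ricci b a) * superS B a)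
    * hatNabla B l with hT2
  have hgS : ∀ μ ν l (X : Op n k U), superS B l * (fn (B.invMetric μ ν) * X) =
      fn (B.invMetric μ ν) * superS B l * X := fun μ ν l X => by
    rw [← mul_assoc, (commute_fn_superS B _ l).eq]
  have hA : ∑ l, superS B l * ∑ μ, ∑ ν, fn (B.invMetric μ ν) * (curvOp B ν l * hatNabla B μ) =
      -T1 := by
    have e : ∀ l μ ν, superS B l * (fn (B.invMetric μ ν) * (curvOp B ν l * hatNabla B μ)) =
        (-(fn (B.invMetric ν μ) * (superS B l * curvOp B l ν) * hatNabla B μ) : Op n k U) :=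
      fun l μ ν => by
        rw [hgS, curvOp_antisymm, B.invMetric_symm]; noncomm_ring
    simp only [hT1, mul_sum, sum_mul, e, sum_neg_distrib]
    rw [sum_comm]
    exact congrArg (- ·) (sum_congr rfl fun μ _ => sum_comm)
  have hA' : ∑ l, superS B l * ∑ μ, ∑ ν, fn (B.invMetric μ ν) * (curvOp B μ l * hatNabla B ν) =
      -T1 := by
    rw [← hA]
    refine sum_congr rfl fun l _ => congrArg (_ * ·) ?_
    rw [sum_comm]
    refine sum_congr rfl fun μ _ => sum_congr rfl fun ν _ => ?_
    rw [B.invMetric_symm]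
  have hB : ∑ l, superS B l * ∑ μ, ∑ ν, fn (B.invMetric μ ν) *
      (∑ τ, fn (B.riemannUp μ l τ ν) * hatNabla B τ) = -T2 := by
    have e : ∀ l, (∑ μ, ∑ ν, fn (B.invMetric μ ν) *
        (∑ τ, fn (B.riemannUp μ l τ ν) * hatNabla B τ) : Op n k U) =
        ∑ τ, fn (-∑ b, B.invMetric b τ * B.ricci b l) * hatNabla B τ := fun l => by
      simp only [← sum_invMetric_riemannUp, mul_sum, sum_mul, fn_sum, fn_mul,
        mul_assoc]
      exact (sum_congr rfl fun μ _ => sum_comm).trans sum_comm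
    have e2 : ∀ l τ, superS B l * (fn (-∑ b, B.invMetric b τ * B.ricci b l) * hatNabla B τ) =
        (-∑ b, fn (B.invMetric b τ) * (fn (B.ricci b l) * superS B l) * hatNabla B τ : Op n k U) :=
      fun l τ => by
        rw [← mul_assoc, ← (commute_fn_superS B _ l).eq]
        simp only [fn_neg, fn_sum, fn_mul, sum_mul, neg_mul, mul_assoc]
    have e3 : ∀ l, (superS B l * ∑ τ, fn (-∑ b, B.invMetric b τ * B.ricci b l) * hatNabla B τ :
        Op n k U) = -∑ τ, ∑ b,
          fn (B.invMetric b τ) * (fn (B.ricci b l) * superS B l) * hatNabla B τ := fun l => by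
      rw [mul_sum, ← sum_neg_distrib]
      exact sum_congr rfl fun τ _ => e2 l τ
    simp only [e, hT2, e3, sum_neg_distrib]
    simp only [mul_sum, sum_mul]
    rw [sum_comm]
    exact congrArg (- ·) (sum_congr rfl fun τ _ => sum_comm)
  have hC : curvCoupling B κ * (∑ l, superS B l * hatNabla B l)
      - (∑ l, superS B l * hatNabla B l) * curvCoupling B κ = T1 + T1 - T2
        - ∑ l, superS B l * (∑ μ, ∑ ν, psiPsiBar B μ ν * bilOp B (B.nablaRiemann l μ ν)
          + κ • fn (partialD l B.scalarCurvature)) := by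
    have e1 : ∀ l, (curvCoupling B κ * (superS B l * hatNabla B l) : Op n k U) =
        superS B l * (curvCoupling B κ * hatNabla B l)
        + (∑ b, fn (B.invMetric b l) * (∑ a, superS B a * curvOp B a b) * hatNabla B l
          + ∑ b, fn (B.invMetric b l) * (∑ a, superS B a * curvOp B a b) * hatNabla B l
          - ∑ b, fn (B.invMetric b l) * (∑ a, fn (B.ricci b a) * superS B a) * hatNabla B l) :=
      fun l => by
        rw [← mul_assoc, curvCoupling_superS, add_mul, mul_assoc, sum_mul]
        simp only [mul_sub, mul_add, sub_mul, add_mul, sum_add_distrib,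
          sum_sub_distrib]
    have e2 : ∀ l, (superS B l * hatNabla B l * curvCoupling B κ : Op n k U) =
        superS B l * (curvCoupling B κ * hatNabla B l)
        + superS B l * (∑ μ, ∑ ν, psiPsiBar B μ ν * bilOp B (B.nablaRiemann l μ ν)
          + κ • fn (partialD l B.scalarCurvature)) := fun l => by
      rw [mul_assoc, hatNabla_curvCoupling, add_assoc, mul_add]
    simp only [mul_sum (s := Finset.univ) (a := curvCoupling B κ),
      sum_mul _ _ (curvCoupling B κ), e1, e2, sum_add_distrib,
      sum_sub_distrib, ← hT1, ← hT2]
    abel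
  have hL := laplacian_superS_hatNabla (n := n) (k := k) B
  simp only [mul_add, mul_sub, sum_add_distrib, sum_sub_distrib] at hL
  rw [hA, hA', hB] at hL
  rw [add_mul, mul_add, add_sub_add_comm, hL, hC]
  simp only [mul_add, mul_sub, sum_add_distrib, sum_sub_distrib]
  abel

end Commutator

/-! ### Levels -/

section Level

variable {n k d : ℕ} {U : Opens (Fin d → ℝ)}

theorem oddMul_oddDer_self_apply (o : OddOsc n d k) (Ψ : Wave n k U) (p) :
    (oddMul o * oddDer o : Op n k U) Ψ p = ((if o ∈ p.1 then 1 else 0 : ℕ) : ℂ) • Ψ p := by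
  simp only [mul_apply, oddMul_apply, oddDer_apply]
  by_cases h : o ∈ p.1
  · simp [h, oddSign_erase, smul_smul, oddSign_mul_self]
  · simp [h]

theorem evenMul_evenDer_self_apply (e : EvenOsc n) (Ψ : Wave n k U) (p) :
    (evenMul e * evenDer e : Op n k U) Ψ p = ((p.2 e : ℕ) : ℂ) • Ψ p := by
  simp only [mul_apply, evenMul_apply, evenDer_apply]
  by_cases h : p.2 e = 0
  · simp [h]
  · have h1 : p.2 e - 1 + 1 = p.2 e := Nat.succ_pred_eq_of_ne_zero h
    simp only [h, if_false, Function.update_self, Function.update_idem, h1, Function.update_eq_self]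

/-- `N_{ψ_i} + N_{θ_i} + N_{γ_i} + N_{β_i}` is diagonal, with natural eigenvalues. -/
theorem exists_young_self_apply (i : Fin n) (p) :
    ∃ N : ℕ, ∀ Ψ : Wave n k U, (young i i : Op n k U) Ψ p = (N : ℂ) • Ψ p := by
  refine ⟨∑ a : Fin d, (if (psiOsc i a : OddOsc n d k) ∈ p.1 then 1 else 0)
    + ∑ r : Fin k, (if (thetaOsc i r : OddOsc n d k) ∈ p.1 then 1 else 0)
    + p.2 (Sum.inl i) + p.2 (Sum.inr i), fun Ψ => ?_⟩
  have e : (young i i : Op n k U) = ∑ a, oddMul (psiOsc i a) * oddDer (psiOsc i a)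
    + ∑ r, oddMul (thetaOsc i r) * oddDer (thetaOsc i r)
    + evenMul (Sum.inl i) * evenDer (Sum.inl i) + evenMul (Sum.inr i) * evenDer (Sum.inr i) := rfl
  rw [e]
  simp only [LinearMap.add_apply, Pi.add_apply, LinearMap.sum_apply, Finset.sum_apply,
    oddMul_oddDer_self_apply, evenMul_evenDer_self_apply]
  simp only [← sum_smul, ← add_smul, ← Nat.cast_sum, ← Nat.cast_add]

/-- The number of oscillators whose flavor lies in `s`. -/
def levelOp (s : Finset (Fin n)) : Op n k U := ∑ i ∈ s, young i i

def HasLevel (s : Finset (Fin n)) (z : ℤ) (Ψ : Wave n k U) : Prop :=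
  (levelOp s : Op n k U) Ψ = (z : ℂ) • Ψ

theorem HasLevel.eq_zero {s : Finset (Fin n)} {z : ℤ} {Ψ : Wave n k U} (h : HasLevel s z Ψ)
    (hz : z < 0) : Ψ = 0 := by
  funext p
  choose N hN using fun i => exists_young_self_apply (k := k) (U := U) i p
  have h1 := congrFun h p
  rw [levelOp, LinearMap.sum_apply, Finset.sum_apply] at h1
  simp only [hN, ← sum_smul, Pi.smul_apply, ← Nat.cast_sum] at h1
  rw [← sub_eq_zero, ← sub_smul] at h1
  refine (smul_eq_zero_iff_right ?_).1 h1
  have h2 : (((∑ i ∈ s, N i : ℕ) : ℤ) - z : ℤ) ≠ 0 := by have := Nat.cast_nonneg (α := ℤ) (∑ i ∈ s, N i); omega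
  exact_mod_cast h2

theorem HasLevel.lower {s : Finset (Fin n)} {z : ℤ} {Ψ : Wave n k U} (h : HasLevel s z Ψ)
    {A : Fin n → Op n k U}
    (hA : ∀ i l, young i i * A l = A l * young i i - if l = i then A i else 0) (l : Fin n) :
    HasLevel s (z - if l ∈ s then 1 else 0) (A l Ψ) := by
  have h1 : (levelOp s * A l : Op n k U) = A l * levelOp s - if l ∈ s then A l else 0 := by
    rw [levelOp, sum_mul, mul_sum]
    simp only [hA, sum_sub_distrib, sum_ite_eq]
  have h2 : levelOp s (A l Ψ) = A l (levelOp s Ψ) - (if l ∈ s then A l else 0) Ψ :=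
    LinearMap.congr_fun h1 Ψ
  rw [HasLevel, h2, h, map_smul]
  split_ifs <;> simp [sub_smul]

variable {s : Finset (Fin n)} {z : ℤ} {Ψ : Wave n k U}

theorem HasLevel.psiBar (B : Background U) (h : HasLevel s z Ψ) (l : Fin n) (μ : Fin d) :
    HasLevel s (z - if l ∈ s then 1 else 0) (psiBar B l μ Ψ) :=
  h.lower (A := fun l => SpinningParticle.psiBar B l μ) (fun i l => young_psiBar B i i l μ) l

theorem HasLevel.psiDer (h : HasLevel s z Ψ) (l : Fin n) (a : Fin d) :
    HasLevel s (z - if l ∈ s then 1 else 0) (psiDer l a Ψ) :=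
  h.lower (A := fun l => SpinningParticle.psiDer l a) (fun i l => young_psiDer i i l a) l

theorem HasLevel.thetaBar (h : HasLevel s z Ψ) (l : Fin n) (r : Fin k) :
    HasLevel s (z - if l ∈ s then 1 else 0) (thetaBar l r Ψ) :=
  h.lower (A := fun l => SpinningParticle.thetaBar l r) (fun i l => young_thetaBar i i l r) l

theorem HasLevel.gamBar (h : HasLevel s z Ψ) (l : Fin n) :
    HasLevel s (z - if l ∈ s then 1 else 0) (gamBar l Ψ) :=
  h.lower (A := SpinningParticle.gamBar) (fun i l => young_gamBar i i l) l

theorem HasLevel.betBar (h : HasLevel s z Ψ) (l : Fin n) :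
    HasLevel s (z - if l ∈ s then 1 else 0) (betBar l Ψ) :=
  h.lower (A := SpinningParticle.betBar) (fun i l => young_betBar i i l) l

theorem young_self_of_mem_reduced (h : Ψ ∈ reduced n k U) (i : Fin n) :
    (young i i : Op n k U) Ψ = Ψ := by
  have h1 : Ψ ∈ LinearMap.ker (shiftedJ i : Op n k U) := (Submodule.mem_iInf _).1 h.1 i
  rw [LinearMap.mem_ker, shiftedJ_eq, LinearMap.sub_apply, sub_eq_zero] at h1
  exact h1

theorem hasLevel_of_mem_reduced (h : Ψ ∈ reduced n k U) (s : Finset (Fin n)) :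
    HasLevel s s.card Ψ := by
  rw [HasLevel, levelOp, LinearMap.sum_apply]
  simp only [young_self_of_mem_reduced h, Finset.sum_const, Int.cast_natCast, Nat.cast_smul_eq_nsmul]

end Level

section LowLevel

variable {n k d : ℕ} {U : Opens (Fin d → ℝ)} (B : Background U)

theorem sum_rotate₃ {ι M : Type*} [Fintype ι] [AddCommMonoid M] (f : ι → ι → ι → M) :
    ∑ a, ∑ b, ∑ c, f a b c = ∑ c, ∑ a, ∑ b, f a b c := by
  rw [sum_comm]
  simp_rw [sum_comm (s := Finset.univ) (t := Finset.univ) (f := fun a c => f a _ c)]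
  rw [sum_comm]
  exact sum_congr rfl fun c _ => sum_comm

theorem sum_fn_apply₂ {ι : Type*} [Fintype ι] (f : ι → ι → Fn U) (Ψ : Wave n k U) :
    ∑ a, ∑ b, fn (f a b) Ψ = fn (∑ a, ∑ b, f a b) Ψ := by
  simp only [fn_sum, LinearMap.sum_apply]

theorem sum_mul_eq_zero_of_antisymm {M N : Fin d → Fin d → Fn U} (hM : ∀ a b, M a b = -M b a)
    (hN : ∀ a b, N a b = N b a) : ∑ a, ∑ b, M a b * N a b = 0 := by
  refine Background.Fn.eq_of_two_mul ?_
  rw [mul_zero, two_mul]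
  nth_rewrite 2 [sum_comm]
  simp only [← sum_add_distrib]
  refine sum_eq_zero fun a _ => sum_eq_zero fun b _ => ?_
  rw [hM b a, hN b a]
  ring

theorem superS_eq (μ : Fin d) : (superS B μ : Op n k U) =
    ∑ i, (psi B i μ * gamBar i + gam i * psiBar B i μ) :=
  sum_congr rfl fun i _ => by rw [((CommutesWithEven.psi B i μ).gamBar i).eq]

theorem gamBarGam_eq : (gamBarGam : Op n k U) = ∑ i, gam i * gamBar i :=
  sum_congr rfl fun i _ => (commute_gamBar_gam i i).eq

theorem superS_psi (l a : Fin d) (i : Fin n) : (superS B l * psi B i a : Op n k U) =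
    fn (B.invMetric l a) * gam i - psi B i a * superS B l := by
  have h : ∀ j, ((gamBar j * psi B j l + gam j * psiBar B j l) * psi B i a : Op n k U) =
      (if j = i then fn (B.invMetric l a) * gam i else 0)
        - psi B i a * (gamBar j * psi B j l + gam j * psiBar B j l) := fun j => by
    have h1 := ((CommutesWithEven.psi (k := k) B i a).gam j).eq
    have h2 := ((CommutesWithEven.psi (k := k) B i a).gamBar j).eq
    rw [add_mul, mul_assoc, mul_assoc, psi_psi B j i, psiBar_psi, mul_add, ← mul_assoc (psi B i a),
      ← mul_assoc (psi B i a), ← h1, ← h2]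
    split_ifs with e
    · rw [mul_sub, ← (commute_fn_gam _ j).eq, e]; noncomm_ring
    · noncomm_ring
  simp only [superS, sum_mul, mul_sum, h, sum_sub_distrib, sum_ite_eq',
    mem_univ, if_true]

theorem commute_superS_gam (l : Fin d) (i : Fin n) : Commute (superS B l : Op n k U) (gam i) :=
  Commute.sum_left _ _ _ fun j _ => Commute.add_left
    (Commute.mul_left (commute_gamBar_gam j i) ((CommutesWithEven.psi B j l).gam i).symm)
    (Commute.mul_left (commute_gam_gam j i) ((CommutesWithEven.psiBar B j l).gam i).symm)

theorem superS_superS_curvOp (μ ν : Fin d) : (superS B μ * superS B ν * curvOp B μ ν : Op n k U) =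
    ∑ a, ∑ b, fn (B.riemann μ ν a b) * (superS B μ * superS B ν * psiPsiBar B a b) := by
  rw [curvOp, mul_sum]
  refine sum_congr rfl fun a _ => ?_
  rw [mul_sum]
  refine sum_congr rfl fun b _ => ?_
  have h := (Commute.mul_right (commute_fn_superS (n := n) (k := k) B (B.riemann μ ν a b) μ)
    (commute_fn_superS (n := n) (k := k) B (B.riemann μ ν a b) ν)).eq
  rw [← mul_assoc, ← h, mul_assoc]

variable {z : ℤ} {Ψ : Wave n k U}

section

variable (h : HasLevel Finset.univ z Ψ)
include h

theorem HasLevel.psiBar_univ (l : Fin n) (μ : Fin d) :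
    HasLevel Finset.univ (z - 1) (SpinningParticle.psiBar B l μ Ψ) := by
  simpa using h.psiBar B l μ

theorem HasLevel.gamBar_univ (l : Fin n) : HasLevel Finset.univ (z - 1) (SpinningParticle.gamBar l Ψ) := by
  simpa using h.gamBar l

theorem HasLevel.superS_eq_zero (hz : z ≤ 0) (μ : Fin d) : SpinningParticle.superS B μ Ψ = 0 := by
  rw [superS_eq, LinearMap.sum_apply]
  refine sum_eq_zero fun i _ => ?_
  rw [LinearMap.add_apply, mul_apply, mul_apply,
    (h.gamBar_univ i).eq_zero (by omega), (h.psiBar_univ B i μ).eq_zero (by omega), map_zero,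
    map_zero, add_zero]

theorem HasLevel.gamBarGam_eq_zero (hz : z ≤ 0) : (gamBarGam : Op n k U) Ψ = 0 := by
  rw [gamBarGam_eq, LinearMap.sum_apply]
  refine sum_eq_zero fun i _ => ?_
  rw [mul_apply, (h.gamBar_univ i).eq_zero (by omega), map_zero]

theorem HasLevel.superS_psi (hz : z ≤ 0) (l a : Fin d) (i : Fin n) :
    SpinningParticle.superS B l (psi B i a Ψ) = fn (B.invMetric l a) (gam i Ψ) := by
  have h1 := LinearMap.congr_fun (SpinningParticle.superS_psi (k := k) B l a i) Ψ
  rw [LinearMap.sub_apply, mul_apply, mul_apply, mul_apply,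
    h.superS_eq_zero B hz, map_zero, sub_zero] at h1
  exact h1

theorem HasLevel.superS_superS (hz : z ≤ 1) (μ ν : Fin d) :
    SpinningParticle.superS B μ (SpinningParticle.superS B ν Ψ) = fn (B.invMetric μ ν) ((gamBarGam : Op n k U) Ψ) := by
  have e : SpinningParticle.superS B ν Ψ = ∑ i, (psi B i ν (SpinningParticle.gamBar i Ψ) + gam i (SpinningParticle.psiBar B i ν Ψ)) := by
    rw [superS_eq, LinearMap.sum_apply]; rfl
  have e2 : (gamBarGam : Op n k U) Ψ = ∑ i, gam i (SpinningParticle.gamBar i Ψ) := by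
    rw [gamBarGam_eq, LinearMap.sum_apply]; rfl
  rw [e, e2, map_sum, map_sum]
  refine sum_congr rfl fun i _ => ?_
  have h1 : SpinningParticle.superS B μ (gam i (SpinningParticle.psiBar B i ν Ψ)) = gam i (SpinningParticle.superS B μ (SpinningParticle.psiBar B i ν Ψ)) :=
    LinearMap.congr_fun (commute_superS_gam B μ i).eq _
  rw [map_add, (h.gamBar_univ i).superS_psi B (by omega), h1,
    (h.psiBar_univ B i ν).superS_eq_zero B (by omega), map_zero, add_zero]

theorem HasLevel.superS_superS_psiPsiBar (hz : z ≤ 2) (μ ν a b : Fin d) :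
    SpinningParticle.superS B μ (SpinningParticle.superS B ν (psiPsiBar B a b Ψ)) =
      fn (B.invMetric μ ν) ((gamBarGam : Op n k U) (psiPsiBar B a b Ψ))
      - fn (B.invMetric μ a) (∑ i, gam i (SpinningParticle.superS B ν (SpinningParticle.psiBar B i b Ψ)))
      + fn (B.invMetric ν a) (∑ i, gam i (SpinningParticle.superS B μ (SpinningParticle.psiBar B i b Ψ))) := by
  have e : psiPsiBar B a b Ψ = ∑ i, psi B i a (SpinningParticle.psiBar B i b Ψ) := by
    rw [psiPsiBar, LinearMap.sum_apply]; rfl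
  simp only [e, map_sum, ← sum_sub_distrib, ← sum_add_distrib]
  refine sum_congr rfl fun i _ => ?_
  have h1 : (SpinningParticle.superS B μ * SpinningParticle.superS B ν * psi B i a : Op n k U) =
      psi B i a * (SpinningParticle.superS B μ * SpinningParticle.superS B ν) - fn (B.invMetric μ a) * (gam i * SpinningParticle.superS B ν)
        + fn (B.invMetric ν a) * (gam i * SpinningParticle.superS B μ) := by
    rw [mul_assoc, SpinningParticle.superS_psi, mul_sub, ← mul_assoc, ← mul_assoc,
      SpinningParticle.superS_psi, ← (commute_fn_superS B _ μ).eq, mul_assoc,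
      (commute_superS_gam B μ i).eq]
    noncomm_ring
  have h2 := LinearMap.congr_fun h1 (SpinningParticle.psiBar B i b Ψ)
  simp only [LinearMap.sub_apply, LinearMap.add_apply, mul_apply] at h2
  rw [h2, (h.psiBar_univ B i b).superS_superS B (by omega)]
  have h3 : fn (B.invMetric μ ν) ((gamBarGam : Op n k U) (psi B i a (SpinningParticle.psiBar B i b Ψ))) =
      psi B i a (fn (B.invMetric μ ν) ((gamBarGam : Op n k U) (SpinningParticle.psiBar B i b Ψ))) := by
    have h4 : (fn (B.invMetric μ ν) * (gamBarGam * psi B i a) : Op n k U) =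
        psi B i a * (fn (B.invMetric μ ν) * gamBarGam) := by
      rw [(CommutesWithEven.psi B i a).gamBarGam.eq, ← mul_assoc, (commute_fn_psi B _ i a).eq,
        mul_assoc]
    exact LinearMap.congr_fun h4 _
  rw [h3]

/-- The curvature term of `𝛁²` on states of level at most two. -/
theorem HasLevel.sum_superS_superS_curvOp (hz : z ≤ 2) :
    (∑ μ, ∑ ν, SpinningParticle.superS B μ * SpinningParticle.superS B ν * curvOp B μ ν : Op n k U) Ψ =
      (-2 : ℂ) • ∑ μ, ∑ b, fn (B.ricci μ b) (∑ i, gam i (SpinningParticle.superS B μ (SpinningParticle.psiBar B i b Ψ))) := by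
  set T : Fin d → Fin d → Wave n k U := fun μ b => ∑ i, gam i (SpinningParticle.superS B μ (SpinningParticle.psiBar B i b Ψ))
  have e : ∀ μ ν, (SpinningParticle.superS B μ * SpinningParticle.superS B ν * curvOp B μ ν : Op n k U) Ψ =
      ∑ a, ∑ b, (fn (B.riemann μ ν a b * B.invMetric μ ν) ((gamBarGam : Op n k U)
          (psiPsiBar B a b Ψ)) - fn (B.riemann μ ν a b * B.invMetric μ a) (T ν b)
        + fn (B.riemann μ ν a b * B.invMetric ν a) (T μ b)) := fun μ ν => by
    rw [SpinningParticle.superS_superS_curvOp, LinearMap.sum_apply]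
    refine sum_congr rfl fun a _ => ?_
    rw [LinearMap.sum_apply]
    refine sum_congr rfl fun b _ => ?_
    simp only [mul_apply, h.superS_superS_psiPsiBar B hz, fn_mul, map_add, map_sub, T]
  rw [LinearMap.sum_apply]
  simp only [LinearMap.sum_apply, e, sum_add_distrib, sum_sub_distrib]
  have t1 : ∑ μ, ∑ ν, ∑ a, ∑ b, fn (B.riemann μ ν a b * B.invMetric μ ν)
      ((gamBarGam : Op n k U) (psiPsiBar B a b Ψ)) = 0 := by
    rw [sum_rotate₃]
    refine sum_eq_zero fun a _ => ?_
    rw [sum_rotate₃]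
    refine sum_eq_zero fun b _ => ?_
    rw [sum_fn_apply₂, sum_mul_eq_zero_of_antisymm (fun μ ν => B.riemann_antisymm_left μ ν a b)
      B.invMetric_symm, fn_zero, LinearMap.zero_apply]
  have t2 : ∑ μ, ∑ ν, ∑ a, ∑ b, fn (B.riemann μ ν a b * B.invMetric μ a) (T ν b) =
      ∑ ν, ∑ b, fn (B.ricci ν b) (T ν b) := by
    rw [sum_comm]
    refine sum_congr rfl fun ν _ => ?_
    rw [sum_rotate₃]
    refine sum_congr rfl fun b _ => ?_
    rw [sum_fn_apply₂, ← B.sum_invMetric_riemann_outer]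
    simp only [mul_comm]
  have t3 : ∑ μ, ∑ ν, ∑ a, ∑ b, fn (B.riemann μ ν a b * B.invMetric ν a) (T μ b) =
      -∑ μ, ∑ b, fn (B.ricci μ b) (T μ b) := by
    rw [← sum_neg_distrib]
    refine sum_congr rfl fun μ _ => ?_
    rw [sum_rotate₃, ← sum_neg_distrib]
    refine sum_congr rfl fun b _ => ?_
    rw [sum_fn_apply₂, ← LinearMap.neg_apply, ← fn_neg, ← B.sum_invMetric_riemann_mid]
    simp only [mul_comm]
  rw [t1, t2, t3]
  module

end

end LowLevel

section Obstruction

variable {n k d : ℕ} {U : Opens (Fin d → ℝ)} (B : Background U)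

theorem psiPsiBar_psiPsiBar (μ ν a b : Fin d) :
    (psiPsiBar B μ ν * psiPsiBar B a b : Op n k U) = fn (B.invMetric ν a) * psiPsiBar B μ b
      - ∑ i, ∑ j, psi B i μ * (psi B j a * (psiBar B i ν * psiBar B j b)) := by
  have h : ∀ j : Fin n, (psiPsiBar B μ ν * (psi B j a * psiBar B j b) : Op n k U) =
      fn (B.invMetric ν a) * (psi B j μ * psiBar B j b)
        - ∑ i, psi B i μ * (psi B j a * (psiBar B i ν * psiBar B j b)) := fun j => by
    have h1 : (psi B j a * psiPsiBar B μ ν * psiBar B j b : Op n k U) =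
        -∑ i, psi B i μ * (psi B j a * (psiBar B i ν * psiBar B j b)) := by
      rw [psiPsiBar, mul_sum, sum_mul, ← sum_neg_distrib]
      refine sum_congr rfl fun i _ => ?_
      rw [← mul_assoc (psi B j a), psi_psi B j i]
      noncomm_ring
    rw [← mul_assoc, psiPsiBar_psi, add_mul, h1]
    noncomm_ring
  have e : (psiPsiBar B a b : Op n k U) = ∑ j, psi B j a * psiBar B j b := rfl
  have e' : (psiPsiBar B μ b : Op n k U) = ∑ j, psi B j μ * psiBar B j b := rfl
  rw [e, e', mul_sum, mul_sum, sum_congr rfl fun j _ => h j,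
    sum_sub_distrib, sum_comm (f := fun j i => psi B i μ * _)]

theorem psiPsiBar_apply (a b : Fin d) (Ψ : Wave n k U) :
    psiPsiBar B a b Ψ = ∑ i, psi B i a (psiBar B i b Ψ) := by
  rw [psiPsiBar, LinearMap.sum_apply]; rfl

theorem psiPsiBar_psiPsiBar_apply (μ ν a b : Fin d) (Ψ : Wave n k U) :
    psiPsiBar B μ ν (psiPsiBar B a b Ψ) = fn (B.invMetric ν a) (psiPsiBar B μ b Ψ)
      - ∑ i, ∑ j, psi B i μ (psi B j a (psiBar B i ν (psiBar B j b Ψ))) := by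
  have h := LinearMap.congr_fun (psiPsiBar_psiPsiBar (n := n) (k := k) B μ ν a b) Ψ
  simpa only [mul_apply, LinearMap.sub_apply, LinearMap.sum_apply] using h

theorem gamBarGam_apply (Ψ : Wave n k U) :
    (gamBarGam : Op n k U) Ψ = ∑ i, gam i (gamBar i Ψ) := by
  rw [gamBarGam_eq, LinearMap.sum_apply]; rfl

theorem superS_apply (μ : Fin d) (Ψ : Wave n k U) :
    superS B μ Ψ = ∑ i, (psi B i μ (gamBar i Ψ) + gam i (psiBar B i μ Ψ)) := by
  rw [superS_eq, LinearMap.sum_apply]; rfl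

theorem gamBarGam_psi (i : Fin n) (a : Fin d) (Ψ : Wave n k U) :
    (gamBarGam : Op n k U) (psi B i a Ψ) = psi B i a ((gamBarGam : Op n k U) Ψ) :=
  LinearMap.congr_fun (CommutesWithEven.psi B i a).gamBarGam.eq Ψ

theorem gamBarGam_fn (f : Fn U) (Ψ : Wave n k U) :
    (gamBarGam : Op n k U) (fn f Ψ) = fn f ((gamBarGam : Op n k U) Ψ) :=
  LinearMap.congr_fun (CommutesWithEven.fn f).gamBarGam.eq Ψ

theorem superS_fn (f : Fn U) (μ : Fin d) (Ψ : Wave n k U) :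
    superS B μ (fn f Ψ) = fn f (superS B μ Ψ) :=
  LinearMap.congr_fun (commute_fn_superS B f μ).symm.eq Ψ

theorem psi_fn (f : Fn U) (i : Fin n) (μ : Fin d) (Ψ : Wave n k U) :
    psi B i μ (fn f Ψ) = fn f (psi B i μ Ψ) :=
  LinearMap.congr_fun (commute_fn_psi B f i μ).symm.eq Ψ

theorem psiPsiBar_fn (f : Fn U) (a b : Fin d) (Ψ : Wave n k U) :
    psiPsiBar B a b (fn f Ψ) = fn f (psiPsiBar B a b Ψ) :=
  LinearMap.congr_fun (commute_fn_psiPsiBar B f a b).symm.eq Ψ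

theorem gam_fn (f : Fn U) (i : Fin n) (Ψ : Wave n k U) :
    gam i (fn f Ψ) = fn f (gam i Ψ) :=
  LinearMap.congr_fun (commute_fn_gam f i).symm.eq Ψ

theorem fn_fn_apply (f g : Fn U) (Ψ : Wave n k U) : fn f (fn g Ψ) = fn (f * g) Ψ := by
  rw [fn_mul]; rfl

theorem bilOp_apply (M : Fin d → Fin d → Fn U) (Ψ : Wave n k U) :
    bilOp B M Ψ = ∑ a, ∑ b, fn (M a b) (psiPsiBar B a b Ψ) := by
  simp only [bilOp, LinearMap.sum_apply, mul_apply]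

variable {z : ℤ} {Ψ : Wave n k U}

section

variable (h : HasLevel Finset.univ z Ψ)
include h

theorem HasLevel.gamBarGam_psiPsiBar_psiPsiBar (hz : z ≤ 2) (μ ν a b : Fin d) :
    (gamBarGam : Op n k U) (psiPsiBar B μ ν (psiPsiBar B a b Ψ)) =
      fn (B.invMetric ν a) ((gamBarGam : Op n k U) (psiPsiBar B μ b Ψ)) := by
  rw [psiPsiBar_psiPsiBar_apply, map_sub, gamBarGam_fn, sub_eq_self, map_sum]
  refine sum_eq_zero fun i _ => ?_
  rw [map_sum]
  refine sum_eq_zero fun j _ => ?_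
  rw [gamBarGam_psi, gamBarGam_psi,
    ((h.psiBar_univ B j b).psiBar_univ B i ν).gamBarGam_eq_zero (by omega), map_zero, map_zero]

theorem HasLevel.gamBarGam_curvCoupling (hz : z ≤ 2) (κ : ℂ) :
    (gamBarGam : Op n k U) (curvCoupling B κ Ψ) =
      -(gamBarGam : Op n k U) (bilOp B B.ricci Ψ)
        + κ • (gamBarGam : Op n k U) (fn B.scalarCurvature Ψ) := by
  have e : (curvCoupling B κ : Op n k U) Ψ =
      ∑ μ, ∑ ν, ∑ a, ∑ b, fn (B.riemann μ ν a b) (psiPsiBar B μ ν (psiPsiBar B a b Ψ))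
        + κ • fn B.scalarCurvature Ψ := by
    simp only [curvCoupling, LinearMap.add_apply, LinearMap.sum_apply, mul_apply,
      LinearMap.smul_apply]
  rw [e, map_add, map_smul, bilOp_apply]
  refine congrArg₂ (· + ·) ?_ rfl
  simp only [map_sum, gamBarGam_fn, h.gamBarGam_psiPsiBar_psiPsiBar B hz, fn_fn_apply]
  rw [← sum_neg_distrib]
  refine sum_congr rfl fun μ _ => ?_
  rw [sum_rotate₃, ← sum_neg_distrib]
  refine sum_congr rfl fun b _ => ?_
  rw [sum_fn_apply₂, ← LinearMap.neg_apply, ← fn_neg, ← B.sum_invMetric_riemann_mid]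
  simp only [mul_comm]

theorem HasLevel.superS_psiPsiBar (hz : z ≤ 1) (l a b : Fin d) :
    SpinningParticle.superS B l (psiPsiBar B a b Ψ) =
      fn (B.invMetric l a) (∑ i, gam i (SpinningParticle.psiBar B i b Ψ)) := by
  rw [psiPsiBar_apply, map_sum, map_sum]
  exact sum_congr rfl fun i _ => (h.psiBar_univ B i b).superS_psi B (by omega) l a i

theorem HasLevel.superS_psiPsiBar_psiPsiBar (hz : z ≤ 2) (l μ ν a b : Fin d) :
    SpinningParticle.superS B l (psiPsiBar B μ ν (psiPsiBar B a b Ψ)) =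
      fn (B.invMetric ν a) (SpinningParticle.superS B l (psiPsiBar B μ b Ψ))
      - fn (B.invMetric l μ) (∑ i, ∑ j, gam i (SpinningParticle.psi B j a
          (SpinningParticle.psiBar B i ν (SpinningParticle.psiBar B j b Ψ))))
      + fn (B.invMetric l a) (∑ i, ∑ j, SpinningParticle.psi B i μ (gam j
          (SpinningParticle.psiBar B i ν (SpinningParticle.psiBar B j b Ψ)))) := by
  rw [psiPsiBar_psiPsiBar_apply, map_sub, superS_fn, sub_add]
  refine congrArg₂ (· - ·) rfl ?_
  simp only [map_sum, ← sum_sub_distrib]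
  refine sum_congr rfl fun i _ => sum_congr rfl fun j _ => ?_
  have h1 := fun Φ => LinearMap.congr_fun (SpinningParticle.superS_psi (k := k) B l μ i) Φ
  simp only [LinearMap.sub_apply, mul_apply] at h1
  rw [h1, ((h.psiBar_univ B j b).psiBar_univ B i ν).superS_psi B (by omega), psi_fn]

end

variable (κ : ℂ)

theorem laplacian_add_curvCoupling_comm_apply (Ψ : Wave n k U) :
    ((laplacian B + curvCoupling B κ) * (∑ l, superS B l * hatNabla B l)
      - (∑ l, superS B l * hatNabla B l) * (laplacian B + curvCoupling B κ) : Op n k U) Ψ =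
    ∑ l, superS B l (∑ μ, ∑ ν, fn (B.invMetric μ ν) (bilOp B (B.nablaRiemann μ ν l) Ψ))
    - ∑ l, superS B l (∑ μ, ∑ ν, psiPsiBar B μ ν (bilOp B (B.nablaRiemann l μ ν) Ψ))
    - κ • ∑ l, superS B l (fn (partialD l B.scalarCurvature) Ψ) := by
  rw [laplacian_add_curvCoupling_comm, LinearMap.sum_apply]
  simp only [mul_apply, LinearMap.sub_apply, LinearMap.sum_apply, LinearMap.smul_apply,
    map_sub, map_smul, sum_sub_distrib, smul_sum]

theorem sum_superS_psiPsiBar_bilOp (Ψ : Wave n k U) :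
    ∑ l, superS B l (∑ μ, ∑ ν, psiPsiBar B μ ν (bilOp B (B.nablaRiemann l μ ν) Ψ)) =
    ∑ l, ∑ μ, ∑ ν, ∑ a, ∑ b, fn (B.nablaRiemann l μ ν a b)
      (superS B l (psiPsiBar B μ ν (psiPsiBar B a b Ψ))) := by
  simp only [bilOp_apply, map_sum, psiPsiBar_fn, superS_fn]

theorem sum_superS_bilOp (Ψ : Wave n k U) :
    ∑ l, superS B l (∑ μ, ∑ ν, fn (B.invMetric μ ν) (bilOp B (B.nablaRiemann μ ν l) Ψ)) =
    ∑ l, ∑ a, ∑ b, fn (∑ μ, ∑ ν, B.invMetric μ ν * B.nablaRiemann μ ν l a b)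
      (superS B l (psiPsiBar B a b Ψ)) := by
  refine sum_congr rfl fun l _ => ?_
  simp only [bilOp_apply, map_sum, superS_fn, fn_fn_apply]
  rw [sum_rotate₃]
  refine sum_congr rfl fun a _ => ?_
  rw [sum_rotate₃]
  exact sum_congr rfl fun b _ => sum_fn_apply₂ _ _

theorem Background.sum_invMetric_nablaRiemann_double (b : Fin d) :
    ∑ l, ∑ a, (∑ μ, ∑ ν, B.invMetric μ ν * B.nablaRiemann μ ν l a b) * B.invMetric l a =
      -∑ μ, ∑ ν, B.nablaRicci μ ν b * B.invMetric μ ν := by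
  simp only [sum_mul, ← sum_neg_distrib]
  rw [sum_rotate₃]
  refine sum_congr rfl fun μ _ => ?_
  rw [sum_rotate₃]
  refine sum_congr rfl fun ν _ => ?_
  rw [← neg_mul, ← B.sum_invMetric_nablaRiemann_mid, sum_mul]
  refine sum_congr rfl fun l _ => ?_
  rw [sum_mul]
  exact sum_congr rfl fun a _ => by ring

theorem sum_psiPsiBar_bilOp_contract (z : Fin d → Fin d → Fin d → Wave n k U) :
    ∑ l, ∑ μ, ∑ ν, ∑ a, ∑ b, fn (B.nablaRiemann l μ ν a b * B.invMetric ν a) (z l μ b) =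
      -∑ l, ∑ μ, ∑ b, fn (B.nablaRicci l μ b) (z l μ b) := by
  simp only [← sum_neg_distrib]
  refine sum_congr rfl fun l _ => sum_congr rfl fun μ _ => ?_
  rw [sum_rotate₃]
  refine sum_congr rfl fun b _ => ?_
  rw [sum_fn_apply₂, ← LinearMap.neg_apply, ← fn_neg, ← B.sum_invMetric_nablaRiemann_mid]
  simp only [mul_comm]

theorem HasLevel.laplacian_add_curvCoupling_comm_eq_zero (h : HasLevel Finset.univ z Ψ)
    (hz : z ≤ 1) :
    ((laplacian B + curvCoupling B 0) * (∑ l, SpinningParticle.superS B l * hatNabla B l)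
      - (∑ l, SpinningParticle.superS B l * hatNabla B l) * (laplacian B + curvCoupling B 0) :
        Op n k U) Ψ = 0 := by
  set Y : Fin d → Wave n k U := fun b => ∑ i, gam i (SpinningParticle.psiBar B i b Ψ)
  have hY : ∀ l a b, SpinningParticle.superS B l (psiPsiBar B a b Ψ) =
      fn (B.invMetric l a) (Y b) := h.superS_psiPsiBar B hz
  rw [laplacian_add_curvCoupling_comm_apply, zero_smul, sub_zero, sum_superS_bilOp,
    sum_superS_psiPsiBar_bilOp]
  have e : ∀ i j ν b, SpinningParticle.psiBar B i ν (SpinningParticle.psiBar B j b Ψ) = 0 :=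
    fun i j ν b => ((h.psiBar_univ B j b).psiBar_univ B i ν).eq_zero (by omega)
  have e1 : ∀ l μ ν a b, SpinningParticle.superS B l (psiPsiBar B μ ν (psiPsiBar B a b Ψ)) =
      fn (B.invMetric ν a) (fn (B.invMetric l μ) (Y b)) := fun l μ ν a b => by
    rw [psiPsiBar_psiPsiBar_apply]
    simp only [e, map_zero, sum_const_zero, sub_zero]
    rw [superS_fn, hY]
  have e2 : ∀ l μ ν a b, fn (B.nablaRiemann l μ ν a b)
      (SpinningParticle.superS B l (psiPsiBar B μ ν (psiPsiBar B a b Ψ))) =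
      fn (B.nablaRiemann l μ ν a b * B.invMetric ν a) (fn (B.invMetric l μ) (Y b)) :=
    fun l μ ν a b => by rw [e1, fn_fn_apply]
  simp only [e2]
  rw [sum_psiPsiBar_bilOp_contract B fun l μ b => fn (B.invMetric l μ) (Y b)]
  simp only [hY, fn_fn_apply]
  rw [sum_rotate₃, sum_rotate₃ fun l μ b => fn (B.nablaRicci l μ b * B.invMetric l μ) (Y b),
    sub_neg_eq_add, ← sum_add_distrib]
  refine sum_eq_zero fun b _ => ?_
  rw [sum_fn_apply₂, sum_fn_apply₂, ← LinearMap.add_apply, ← fn_add,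
    B.sum_invMetric_nablaRiemann_double, neg_add_cancel, fn_zero, LinearMap.zero_apply]

theorem HasLevel.laplacian_add_curvCoupling_comm_eq_zero_of_nablaRicci
    (h : HasLevel Finset.univ z Ψ) (hz : z ≤ 2) (hN : ∀ l μ ν, B.nablaRicci l μ ν = 0)
    (hR : ∀ l, partialD l B.scalarCurvature = 0) :
    ((laplacian B + curvCoupling B κ) * (∑ l, SpinningParticle.superS B l * hatNabla B l)
      - (∑ l, SpinningParticle.superS B l * hatNabla B l) * (laplacian B + curvCoupling B κ) :
        Op n k U) Ψ = 0 := by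
  rw [laplacian_add_curvCoupling_comm_apply, sum_superS_bilOp, sum_superS_psiPsiBar_bilOp]
  have e1 : ∀ l a b, ∑ μ, ∑ ν, B.invMetric μ ν * B.nablaRiemann μ ν l a b = 0 := fun l a b => by
    rw [B.sum_invMetric_nablaRiemann_div', hN, hN, sub_zero]
  have e2 : ∀ μ ν b, ∑ l, ∑ a, B.invMetric l a * B.nablaRiemann l μ ν a b = 0 := fun μ ν b => by
    rw [B.sum_invMetric_nablaRiemann_div, hN, hN, sub_zero]
  simp only [e1, hR, fn_zero, LinearMap.zero_apply, map_zero, sum_const_zero, smul_zero,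
    sub_zero, zero_sub, neg_eq_zero, h.superS_psiPsiBar_psiPsiBar B hz, map_add, map_sub,
    fn_fn_apply, sum_add_distrib, sum_sub_distrib]
  rw [sum_psiPsiBar_bilOp_contract]
  simp only [hN, fn_zero, LinearMap.zero_apply, sum_const_zero, neg_zero, zero_sub]
  set Z1 : Fin d → Fin d → Fin d → Wave n k U := fun ν a b => ∑ i, ∑ j, gam i
    (SpinningParticle.psi B j a (SpinningParticle.psiBar B i ν (SpinningParticle.psiBar B j b Ψ)))
  set Z2 : Fin d → Fin d → Fin d → Wave n k U := fun μ ν b => ∑ i, ∑ j,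
    SpinningParticle.psi B i μ (gam j
      (SpinningParticle.psiBar B i ν (SpinningParticle.psiBar B j b Ψ)))
  have t1 : ∑ l, ∑ μ, ∑ ν, ∑ a, ∑ b,
      fn (B.nablaRiemann l μ ν a b * B.invMetric l μ) (Z1 ν a b) = 0 := by
    rw [sum_rotate₃]
    refine sum_eq_zero fun ν _ => ?_
    rw [sum_rotate₃]
    refine sum_eq_zero fun a _ => ?_
    rw [sum_rotate₃]
    refine sum_eq_zero fun b _ => ?_
    rw [sum_fn_apply₂]
    simp only [mul_comm (B.nablaRiemann _ _ _ _ _), e1, fn_zero, LinearMap.zero_apply]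
  have t2 : ∑ l, ∑ μ, ∑ ν, ∑ a, ∑ b,
      fn (B.nablaRiemann l μ ν a b * B.invMetric l a) (Z2 μ ν b) = 0 := by
    rw [sum_comm]
    refine sum_eq_zero fun μ _ => ?_
    rw [sum_comm]
    refine sum_eq_zero fun ν _ => ?_
    rw [sum_rotate₃]
    refine sum_eq_zero fun b _ => ?_
    rw [sum_fn_apply₂]
    simp only [mul_comm (B.nablaRiemann _ _ _ _ _), e2, fn_zero, LinearMap.zero_apply]
  rw [t1, t2]
  simp

end Obstruction

section Young

variable {k d : ℕ} {U : Opens (Fin d → ℝ)} {Ψ : Wave 2 k U}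

theorem antisymm_of_mem_reduced (h : Ψ ∈ reduced 2 k U) {X Y : Fin 2 → Op 2 k U}
    (hX : ∀ i j l, young i j * X l = X l * young i j - if l = i then X j else 0)
    (hY : ∀ i j l, young i j * Y l = Y l * young i j - if l = i then Y j else 0) (i j : Fin 2) :
    X i (Y j Ψ) = -X j (Y i Ψ) := by
  have hY0 : (young 0 1 : Op 2 k U) Ψ = 0 := by
    have h1 := (Submodule.mem_iInf _).1 ((Submodule.mem_iInf _).1 ((Submodule.mem_iInf _).1 h.2 0) 1)
      (by decide)
    exact h1.1
  have hs : ∀ i, X i (Y i Ψ) = 0 := fun i => by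
    have h1 := hasLevel_of_mem_reduced h {i}
    have h2 := (h1.lower (A := Y) (fun i l => hY i i l) i).lower (A := X) (fun i l => hX i i l) i
    exact h2.eq_zero (by simp)
  have h01 : X 0 (Y 1 Ψ) + X 1 (Y 0 Ψ) = 0 := by
    have e1 := LinearMap.congr_fun (hX 0 1 0) (Y 0 Ψ)
    have e2 := LinearMap.congr_fun (hY 0 1 0) Ψ
    simp only [if_true, LinearMap.sub_apply, mul_apply, hY0, map_zero, zero_sub] at e1 e2
    rw [hs, e2, map_zero, map_neg] at e1
    rw [← neg_eq_zero, neg_add, ← sub_eq_add_neg]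
    exact e1.symm
  fin_cases i <;> fin_cases j
  · simp [hs]
  · exact eq_neg_of_add_eq_zero_left h01
  · exact eq_neg_of_add_eq_zero_right h01
  · simp [hs]

end Young

section Consistency

variable {n k d : ℕ} {U : Opens (Fin d → ℝ)} (B : Background U)

theorem gamBarGam_psiPsiBar_eq_zero {z : ℤ} {Ψ : Wave n k U} (h : HasLevel Finset.univ z Ψ)
    (hz : z ≤ 1) (a b : Fin d) : (gamBarGam : Op n k U) (psiPsiBar B a b Ψ) = 0 := by
  rw [psiPsiBar_apply, map_sum]
  refine sum_eq_zero fun i _ => ?_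
  rw [gamBarGam_psi, (h.psiBar_univ B i b).gamBarGam_eq_zero (by omega), map_zero]

theorem brst_brst_apply {κ : ℂ} {m : ℝ} {Ψ Φ : Wave n k U}
    (h1 : (boldNabla B m * boldNabla B m + gamBarGam * hamiltonianD B κ m : Op n k U) Ψ = Φ)
    (h2 : (hamiltonianD B κ m * boldNabla B m - boldNabla B m * hamiltonianD B κ m : Op n k U) Ψ
      = 0) : brst B κ m (brst B κ m Ψ) = Φ := by
  have h := LinearMap.congr_fun (brst_mul_self (n := n) (k := k) B κ m) Ψ
  rw [LinearMap.add_apply, h1, mul_apply (cGhost : Op n k U), h2, map_zero,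
    add_zero] at h
  exact h

theorem brst_brst_of_hasLevel_one {m : ℝ} (hm : (m : ℂ) ^ 2 * k = (m : ℂ) ^ 2) {Ψ : Wave n k U}
    (h : HasLevel Finset.univ 1 Ψ) : brst B 0 m (brst B 0 m Ψ) = 0 := by
  refine brst_brst_apply B ?_ ?_
  · rw [boldNabla_sq_add B hm, LinearMap.add_apply, LinearMap.smul_apply,
      h.sum_superS_superS_curvOp B (by norm_num), mul_apply,
      h.gamBarGam_curvCoupling B (by norm_num), bilOp_apply]
    have e : ∀ i μ b, superS B μ (psiBar B i b Ψ) = 0 := fun i μ b =>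
      (h.psiBar_univ B i b).superS_eq_zero B (by norm_num) μ
    simp only [e, map_zero, sum_const_zero, smul_zero, map_sum, gamBarGam_fn,
      gamBarGam_psiPsiBar_eq_zero B h le_rfl, zero_smul, neg_zero, add_zero]
  · rw [hamiltonianD_boldNabla_comm, LinearMap.smul_apply,
      h.laplacian_add_curvCoupling_comm_eq_zero B le_rfl, smul_zero]

theorem massiveQ₂_isConsistent (m : ℝ) : IsConsistent (massiveQ₂ B m) :=
  ⟨brst_commutesWithConstraints B 0 m, fun _ h =>
    brst_brst_of_hasLevel_one B (by simp) (by simpa using hasLevel_of_mem_reduced h Finset.univ)⟩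

theorem psiNumber_eq : (psiNumber B : Op n k U) = ∑ i, ∑ a, psiFlat i a * psiDer i a := by
  have h1 : (psiNumber B : Op n k U) = bilOp B B.metric := rfl
  have h2 : B.frame.transpose * Matrix.of B.metric * B.frame * etaMat U = 1 := by
    have h3 : (Matrix.of B.metric : Matrix (Fin d) (Fin d) (Fn U)) = B.metricMat := rfl
    have h4 : B.frame.transpose * B.coframe.transpose = 1 := by
      rw [← transpose_mul, B.coframe_mul_frame, Matrix.transpose_one]
    rw [h3, B.metricMat_eq, mul_assoc B.coframe.transpose, ← mul_assoc B.frame.transpose, h4,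
      one_mul, mul_assoc (etaMat U), B.coframe_mul_frame, mul_one, etaMat_mul_self]
  rw [h1, bilOp_eq, h2, rotOp, sum_comm (f := fun i a => psiFlat i a * psiDer i a)]
  refine sum_congr rfl fun a _ => ?_
  rw [sum_eq_single a]
  · rw [Matrix.one_apply_eq, fn_one, one_mul, flatBil]
  · intro b _ hb
    rw [Matrix.one_apply_ne hb.symm, fn_zero, zero_mul]
  · exact fun h => absurd (mem_univ a) h

theorem levelOp_univ : (levelOp Finset.univ : Op n k U) = psiNumber B
    + ∑ i, ∑ r, theta i r * thetaBar i r + ∑ i, gam i * betBar i - ∑ i, bet i * gamBar i := by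
  simp only [levelOp, young, sum_add_distrib, psiNumber_eq, gamBar, mul_neg,
    sum_neg_distrib, sub_neg_eq_add]

theorem CommutesWithEven.psiNumber : CommutesWithEven (psiNumber B : Op n k U) :=
  CommutesWithEven.sum fun _ _ => CommutesWithEven.sum fun _ _ =>
    (CommutesWithEven.fn _).mul (CommutesWithEven.psiPsiBar B _ _)

theorem sum_fn_eq_zero_of_symm {M : Fin d → Fin d → Fn U} (hM : ∀ a b, M a b = M b a)
    {W : Fin d → Fin d → Wave n k U} (hW : ∀ a b, W a b = -W b a) :
    ∑ a, ∑ b, fn (M a b) (W a b) = 0 := by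
  have h : ∑ a, ∑ b, fn (M a b) (W a b) = -∑ a, ∑ b, fn (M a b) (W a b) := by
    nth_rewrite 1 [sum_comm]
    simp only [← sum_neg_distrib]
    exact sum_congr rfl fun a _ => sum_congr rfl fun b _ => by
      rw [hM b a, hW b a, map_neg]
  have h2 : (2 : ℂ) • ∑ a, ∑ b, fn (M a b) (W a b) = 0 := by
    rw [two_smul]; nth_rewrite 1 [h]; exact neg_add_cancel _
  exact (smul_eq_zero.1 h2).resolve_left two_ne_zero

end Consistency

section TwoFlavors

variable {k d : ℕ} {U : Opens (Fin d → ℝ)} (B : Background U) {Ψ : Wave 2 k U}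

theorem sum_gam_gam_eq_zero {n : ℕ} {W : Fin n → Fin n → Wave n k U}
    (hW : ∀ i j, W i j = -W j i) : ∑ i, ∑ j, gam i (gam j (W i j)) = 0 := by
  have h : ∑ i, ∑ j, gam i (gam j (W i j)) = -∑ i, ∑ j, gam i (gam j (W i j)) := by
    nth_rewrite 1 [sum_comm]
    simp only [← sum_neg_distrib]
    refine sum_congr rfl fun i _ => sum_congr rfl fun j _ => ?_
    rw [hW j i, map_neg, map_neg]
    exact congrArg _ (LinearMap.congr_fun (commute_gam_gam j i).eq _)
  have h2 : (2 : ℂ) • ∑ i, ∑ j, gam i (gam j (W i j)) = 0 := by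
    rw [two_smul]; nth_rewrite 1 [h]; exact neg_add_cancel _
  exact (smul_eq_zero.1 h2).resolve_left two_ne_zero

theorem gamBarGam_psiNumber_sub_one (h : Ψ ∈ reduced 2 k U) :
    (gamBarGam : Op 2 k U) (psiNumber B Ψ - Ψ) =
      -∑ i, ∑ j, ∑ r, gam i (theta j r (thetaBar j r (gamBar i Ψ))) := by
  have hg : ∀ i j, gamBar j (gamBar i Ψ) = 0 := by
    have h1 : ∀ i j, gamBar i (gamBar j Ψ) = -gamBar j (gamBar i Ψ) :=
      antisymm_of_mem_reduced h (young_gamBar) (young_gamBar)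
    intro i j
    have h2 : gamBar i (gamBar j Ψ) = gamBar j (gamBar i Ψ) :=
      LinearMap.congr_fun (commute_gamBar_gamBar i j).eq Ψ
    have h3 : (2 : ℂ) • gamBar j (gamBar i Ψ) = 0 := by
      rw [two_smul]; nth_rewrite 1 [← h2, h1 i j]; exact neg_add_cancel _
    exact (smul_eq_zero.1 h3).resolve_left two_ne_zero
  have hb : ∀ i j, betBar i (gamBar j Ψ) = -betBar j (gamBar i Ψ) :=
    antisymm_of_mem_reduced h young_betBar young_gamBar
  have hl : ∀ i, psiNumber B (gamBar i Ψ) - gamBar i Ψ =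
      -∑ j, ∑ r, theta j r (thetaBar j r (gamBar i Ψ)) - ∑ j, gam j (betBar j (gamBar i Ψ)) := by
    intro i
    have h1 : HasLevel Finset.univ 1 (gamBar i Ψ) := by
      simpa using (hasLevel_of_mem_reduced h Finset.univ).gamBar_univ i
    rw [HasLevel, levelOp_univ B] at h1
    simp only [LinearMap.add_apply, LinearMap.sub_apply, LinearMap.sum_apply, mul_apply,
      hg, map_zero, sum_const_zero, sub_zero, Int.cast_one, one_smul] at h1
    nth_rewrite 2 [← h1]
    abel
  have hc : ∀ i, gamBar i (psiNumber B Ψ) = psiNumber B (gamBar i Ψ) := fun i =>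
    LinearMap.congr_fun ((CommutesWithEven.psiNumber (n := 2) (k := k) B).gamBar i).eq Ψ
  simp only [gamBarGam_apply, map_sub, hc]
  have e : ∀ i, gam i (psiNumber B (gamBar i Ψ)) - gam i (gamBar i Ψ) =
      -∑ j, ∑ r, gam i (theta j r (thetaBar j r (gamBar i Ψ)))
        - ∑ j, gam i (gam j (betBar j (gamBar i Ψ))) := fun i => by
    rw [← map_sub, hl i]
    simp only [map_sub, map_neg, map_sum]
  rw [← sum_sub_distrib, sum_congr rfl fun i _ => e i, sum_sub_distrib,
    sum_gam_gam_eq_zero (W := fun i j => betBar j (gamBar i Ψ)) (fun i j => hb j i), sub_zero,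
    sum_neg_distrib]

theorem sum_ricci_superS_psiBar (h : Ψ ∈ reduced 2 k U) :
    ∑ μ, ∑ b, fn (B.ricci μ b) (∑ i, gam i (superS B μ (psiBar B i b Ψ))) =
      -(gamBarGam : Op 2 k U) (bilOp B B.ricci Ψ) := by
  have ha : ∀ b i j, gamBar j (psiBar B i b Ψ) = -gamBar i (psiBar B j b Ψ) := fun b i j =>
    antisymm_of_mem_reduced h young_gamBar (Y := fun i => psiBar B i b)
      (fun i j l => young_psiBar B i j l b) j i
  have e : ∀ μ b, ∑ i, gam i (superS B μ (psiBar B i b Ψ)) =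
      -(gamBarGam : Op 2 k U) (psiPsiBar B μ b Ψ)
        + ∑ i, ∑ j, gam i (gam j (psiBar B j μ (psiBar B i b Ψ))) := fun μ b => by
    have e1 : ∀ i, gam i (superS B μ (psiBar B i b Ψ)) =
        ∑ j, gam i (psi B j μ (gamBar j (psiBar B i b Ψ)))
          + ∑ j, gam i (gam j (psiBar B j μ (psiBar B i b Ψ))) := fun i => by
      rw [superS_apply, map_sum, ← sum_add_distrib]
      simp only [map_add]
    rw [sum_congr rfl fun i _ => e1 i, sum_add_distrib]
    refine congrArg₂ (· + ·) ?_ rfl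
    rw [psiPsiBar_apply, map_sum, sum_comm, ← sum_neg_distrib]
    refine sum_congr rfl fun j _ => ?_
    rw [gamBarGam_psi, gamBarGam_apply, map_sum, ← sum_neg_distrib]
    refine sum_congr rfl fun i _ => ?_
    rw [ha b i j, map_neg, map_neg]
    exact congrArg _ (LinearMap.congr_fun ((CommutesWithEven.psi (k := k) B j μ).gam i).eq _)
  simp only [e, map_add, sum_add_distrib]
  rw [sum_fn_eq_zero_of_symm (W := fun μ b =>
    ∑ i, ∑ j, gam i (gam j (psiBar B j μ (psiBar B i b Ψ)))) B.ricci_symm, add_zero, bilOp_apply, map_sum,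
    ← sum_neg_distrib]
  · refine sum_congr rfl fun μ _ => ?_
    rw [map_sum, ← sum_neg_distrib]
    exact sum_congr rfl fun b _ => by rw [map_neg, gamBarGam_fn]
  · intro a b
    rw [sum_comm, ← sum_neg_distrib]
    refine sum_congr rfl fun i _ => ?_
    rw [← sum_neg_distrib]
    refine sum_congr rfl fun j _ => ?_
    have h1 : psiBar B i a (psiBar B j b Ψ) = -psiBar B j b (psiBar B i a Ψ) :=
      LinearMap.congr_fun (psiBar_psiBar B i j a b) Ψ
    rw [h1, map_neg, map_neg]
    exact congrArg _ (LinearMap.congr_fun (commute_gam_gam j i).eq _)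

theorem boldNabla_sq_add_apply {m : ℝ} (hm : (m : ℂ) ^ 2 * k = (m : ℂ) ^ 2) (κ : ℂ)
    (h : Ψ ∈ reduced 2 k U) :
    (boldNabla B m * boldNabla B m + gamBarGam * hamiltonianD B κ m : Op 2 k U) Ψ =
      κ • (gamBarGam : Op 2 k U) (fn B.scalarCurvature Ψ)
        - (2 : ℂ) • (gamBarGam : Op 2 k U) (bilOp B B.ricci Ψ) := by
  have hl : HasLevel Finset.univ 2 Ψ := by simpa using hasLevel_of_mem_reduced h Finset.univ
  rw [boldNabla_sq_add B hm, LinearMap.add_apply, LinearMap.smul_apply,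
    hl.sum_superS_superS_curvOp B le_rfl, sum_ricci_superS_psiBar B h, mul_apply,
    hl.gamBarGam_curvCoupling B le_rfl]
  module

end TwoFlavors

section Einstein

variable {k : ℕ} {U : Opens (Fin 4 → ℝ)} (B : Background U) {Ψ : Wave 2 k U}

theorem psiNumber_fn (f : Fn U) (Ψ : Wave 2 k U) :
    psiNumber B (fn f Ψ) = fn f (psiNumber B Ψ) := by
  have h1 : ∀ Φ : Wave 2 k U, psiNumber B Φ = bilOp B B.metric Φ := fun _ => rfl
  rw [h1, h1]
  exact LinearMap.congr_fun (commute_fn_bilOp B f B.metric).symm.eq Ψ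

theorem boldNabla_sq_add_of_ricci_eq {m : ℝ} (hm : (m : ℂ) ^ 2 * k = (m : ℂ) ^ 2) {f : Fn U}
    (hf : ∀ μ ν, B.ricci μ ν = f * B.metric μ ν) (h : Ψ ∈ reduced 2 k U) :
    (boldNabla B m * boldNabla B m + gamBarGam * hamiltonianD B (1 / 2) m : Op 2 k U) Ψ =
      (-(1 / 2) : ℂ) • (gamBarGam * (psiNumber B - 1) * fn B.scalarCurvature : Op 2 k U) Ψ := by
  have h1 : bilOp B B.ricci Ψ = fn f (psiNumber B Ψ) := by
    have h2 : psiNumber B Ψ = bilOp B B.metric Ψ := rfl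
    rw [h2, bilOp_apply, bilOp_apply]
    simp only [map_sum, fn_fn_apply, hf]
  have h3 : (gamBarGam * (psiNumber B - 1) * fn B.scalarCurvature : Op 2 k U) Ψ =
      (gamBarGam : Op 2 k U) (psiNumber B (fn B.scalarCurvature Ψ) - fn B.scalarCurvature Ψ) := rfl
  rw [boldNabla_sq_add_apply B hm _ h, h1, h3, psiNumber_fn, B.scalarCurvature_eq_of_ricci_eq hf,
    fn_smul, LinearMap.smul_apply, LinearMap.smul_apply, map_sub, map_smul, map_smul]
  push_cast
  module

theorem Background.IsEinstein.exists_ricci_eq {B : Background U} (h : B.IsEinstein) :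
    ∃ f : Fn U, (∀ μ ν, B.ricci μ ν = f * B.metric μ ν) ∧ ∀ μ, partialD μ f = 0 := by
  obtain ⟨lam, hl⟩ := h
  exact ⟨algebraMap ℂ _ lam, fun μ ν => by rw [hl, Algebra.smul_def],
    fun μ => partialD_algebraMap μ _⟩

theorem hamiltonianD_boldNabla_comm_of_isEinstein (hB : B.IsEinstein) (κ : ℂ) (m : ℝ)
    (h : Ψ ∈ reduced 2 k U) :
    (hamiltonianD B κ m * boldNabla B m - boldNabla B m * hamiltonianD B κ m : Op 2 k U) Ψ
      = 0 := by
  obtain ⟨f, hf, hd⟩ := hB.exists_ricci_eq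
  have hl : HasLevel Finset.univ 2 Ψ := by simpa using hasLevel_of_mem_reduced h Finset.univ
  rw [hamiltonianD_boldNabla_comm, LinearMap.smul_apply,
    hl.laplacian_add_curvCoupling_comm_eq_zero_of_nablaRicci B κ le_rfl, smul_zero]
  · intro l μ ν
    rw [B.nablaRicci_eq_of_ricci_eq hf, hd, zero_mul]
  · intro l
    rw [B.scalarCurvature_eq_of_ricci_eq hf, map_smul, hd, smul_zero]

theorem boldNabla_sq_add_of_isEinstein (hB : B.IsEinstein) {m : ℝ}
    (hm : (m : ℂ) ^ 2 * k = (m : ℂ) ^ 2) (h : Ψ ∈ reduced 2 k U) :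
    (boldNabla B m * boldNabla B m + gamBarGam * hamiltonianD B (1 / 2) m : Op 2 k U) Ψ =
      (-(1 / 2) : ℂ) • (gamBarGam * (psiNumber B - 1) * fn B.scalarCurvature : Op 2 k U) Ψ := by
  obtain ⟨f, hf, -⟩ := hB.exists_ricci_eq
  exact boldNabla_sq_add_of_ricci_eq B hm hf h

theorem brst_brst_of_isEinstein (hB : B.IsEinstein) {m : ℝ}
    (hm : (m : ℂ) ^ 2 * k = (m : ℂ) ^ 2) (h : Ψ ∈ reduced 2 k U) :
    brst B (1 / 2) m (brst B (1 / 2) m Ψ) =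
      (-(1 / 2) : ℂ) • (gamBarGam * (psiNumber B - 1) * fn B.scalarCurvature : Op 2 k U) Ψ :=
  brst_brst_apply B (boldNabla_sq_add_of_isEinstein B hB hm h)
    (hamiltonianD_boldNabla_comm_of_isEinstein B hB _ m h)

theorem brst_brst_of_isEinstein' (hB : B.IsEinstein) {m : ℝ}
    (hm : (m : ℂ) ^ 2 * k = (m : ℂ) ^ 2) (h : Ψ ∈ reduced 2 k U) :
    brst B (1 / 2) m (brst B (1 / 2) m Ψ) = (1 / 2 : ℂ) • fn B.scalarCurvature
      (∑ i, ∑ j, ∑ r, gam i (theta j r (thetaBar j r (gamBar i Ψ)))) := by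
  have h3 : (gamBarGam * (psiNumber B - 1) * fn B.scalarCurvature : Op 2 k U) Ψ =
      (gamBarGam : Op 2 k U) (psiNumber B (fn B.scalarCurvature Ψ) - fn B.scalarCurvature Ψ) := rfl
  rw [brst_brst_of_isEinstein B hB hm h, h3, psiNumber_fn, ← map_sub, gamBarGam_fn,
    gamBarGam_psiNumber_sub_one B h, map_neg]
  module

theorem masslessQ_isConsistent (hB : B.IsEinstein) : IsConsistent (masslessQ B) := by
  refine ⟨brst_commutesWithConstraints B _ 0, fun Ψ h => ?_⟩
  have hm : (((0 : ℝ) : ℂ)) ^ 2 * ((0 : ℕ) : ℂ) = ((0 : ℝ) : ℂ) ^ 2 := by simp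
  have h1 := brst_brst_of_isEinstein' (k := 0) B hB (m := 0) hm h
  simp only [Finset.univ_eq_empty, Finset.sum_empty, sum_const_zero, map_zero,
    smul_zero] at h1
  rw [masslessQ]
  convert h1

end Einstein

/-! ### States built on a reference vector -/

section Vacuum

variable {n k d : ℕ} {U : Opens (Fin d → ℝ)}

theorem oddDer_vacuum (o : OddOsc n d k) : (oddDer o : Op n k U) vacuum = 0 := by
  funext p
  rw [oddDer_apply]
  split_ifs with h
  · rfl
  · have h1 : (insert o p.1, p.2) ≠ ((∅, 0) : Finset (OddOsc n d k) × (EvenOsc n → ℕ)) :=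
      fun h2 => Finset.insert_ne_empty _ _ (congrArg Prod.fst h2)
    rw [vacuum, if_neg h1, smul_zero]; rfl

theorem evenDer_vacuum (e : EvenOsc n) : (evenDer e : Op n k U) vacuum = 0 := by
  funext p
  rw [evenDer_apply]
  have h1 : (p.1, Function.update p.2 e (p.2 e + 1)) ≠
      ((∅, 0) : Finset (OddOsc n d k) × (EvenOsc n → ℕ)) := fun h2 => by
    have h3 := congrFun (congrArg Prod.snd h2) e
    simp at h3
  rw [vacuum, if_neg h1, smul_zero]; rfl

theorem del_vacuum (μ : Fin d) : (del μ : Op n k U) vacuum = 0 := by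
  funext p
  rw [del_apply, vacuum]
  split_ifs
  · exact partialD_one μ
  · exact map_zero _

theorem fn_vacuum_eq_zero {f : Fn U} (h : (fn f : Op n k U) vacuum = 0) : f = 0 := by
  have h1 := congrFun h (∅, 0)
  rw [fn_apply, vacuum, if_pos rfl, mul_one] at h1
  exact h1

end Vacuum

/-- A vector without matter oscillators and independent of `x`. -/
structure IsRef {n k d : ℕ} {U : Opens (Fin d → ℝ)} (Ω : Wave n k U) : Prop where
  psiDer : ∀ i a, psiDer i a Ω = 0
  thetaBar : ∀ i r, thetaBar i r Ω = 0
  evenDer : ∀ e, evenDer e Ω = 0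
  del : ∀ μ, del μ Ω = 0

section Ref

variable {n k d : ℕ} {U : Opens (Fin d → ℝ)}

theorem isRef_vacuum : IsRef (vacuum : Wave n k U) :=
  ⟨fun _ _ => oddDer_vacuum _, fun _ _ => oddDer_vacuum _, evenDer_vacuum, del_vacuum⟩

theorem IsRef.cGhost {Ω : Wave n k U} (h : IsRef Ω) : IsRef (cGhost Ω) := by
  refine ⟨fun i a => ?_, fun i r => ?_, fun e => ?_, fun μ => ?_⟩
  · have h1 := LinearMap.congr_fun (oddMul_oddDer_of_ne (U := U) (psiOsc_ne_cOsc (k := k) i a).symm) Ω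
    exact (neg_eq_zero.1 (h1.symm.trans (by
      rw [mul_apply]; exact (congrArg _ (h.psiDer i a)).trans (map_zero _))))
  · have h1 := LinearMap.congr_fun (cGhost_thetaBar (U := U) i r) Ω
    exact (neg_eq_zero.1 (h1.symm.trans (by
      rw [mul_apply]; exact (congrArg _ (h.thetaBar i r)).trans (map_zero _))))
  · have h1 := LinearMap.congr_fun (oddMul_evenDer (U := U) (cOsc : OddOsc n d k) e) Ω
    exact h1.symm.trans (by
      rw [mul_apply]; exact (congrArg _ (h.evenDer e)).trans (map_zero _))
  · have h1 := LinearMap.congr_fun (del_oddMul (U := U) μ (cOsc : OddOsc n d k)) Ω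
    exact h1.trans (by
      rw [mul_apply]; exact (congrArg _ (h.del μ)).trans (map_zero _))

variable {Ω : Wave n k U} (h : IsRef Ω) (B : Background U)
include h

theorem IsRef.gamBar (i : Fin n) : gamBar i Ω = 0 := by
  rw [SpinningParticle.gamBar, LinearMap.neg_apply, h.evenDer, neg_zero]

theorem IsRef.betBar (i : Fin n) : betBar i Ω = 0 := h.evenDer _

theorem IsRef.psiBar (i : Fin n) (μ : Fin d) : psiBar B i μ Ω = 0 := by
  rw [SpinningParticle.psiBar, LinearMap.sum_apply]
  refine sum_eq_zero fun a _ => ?_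
  rw [mul_apply, psiBarFlat, LinearMap.smul_apply, h.psiDer, smul_zero, map_zero]

theorem IsRef.hatNabla (μ : Fin d) : hatNabla B μ Ω = 0 := by
  rw [SpinningParticle.hatNabla, LinearMap.add_apply, h.del, zero_add, LinearMap.sum_apply]
  refine sum_eq_zero fun a _ => ?_
  rw [LinearMap.sum_apply]
  refine sum_eq_zero fun b _ => ?_
  rw [mul_apply, LinearMap.sum_apply, sum_eq_zero, map_zero]
  intro i _
  rw [mul_apply, psiBarFlat, LinearMap.smul_apply, h.psiDer, smul_zero, map_zero]

theorem IsRef.superS (μ : Fin d) : superS B μ Ω = 0 := by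
  rw [superS_apply]
  refine sum_eq_zero fun i _ => ?_
  rw [h.gamBar, h.psiBar, map_zero, map_zero, add_zero]

theorem IsRef.rho : (rho : Op n k U) Ω = 0 := by
  rw [SpinningParticle.rho, LinearMap.sum_apply]
  refine sum_eq_zero fun i _ => ?_
  rw [LinearMap.sum_apply]
  refine sum_eq_zero fun r _ => ?_
  have h1 : (SpinningParticle.gamBar i * theta i r : Op n k U) =
      theta i r * SpinningParticle.gamBar i := ((CommutesWithEven.theta i r).gamBar i).eq
  rw [h1, LinearMap.add_apply, mul_apply, mul_apply, h.gamBar, h.thetaBar,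
    map_zero, map_zero, add_zero]

theorem IsRef.young (i j : Fin n) : (young i j : Op n k U) Ω = 0 := by
  simp only [SpinningParticle.young, LinearMap.add_apply, LinearMap.sum_apply,
    mul_apply, h.psiDer, h.thetaBar, h.betBar, h.evenDer, map_zero,
    sum_const_zero, add_zero]

theorem IsRef.traceT (i j : Fin n) : (traceT i j : Op n k U) Ω = 0 := by
  simp only [SpinningParticle.traceT, LinearMap.add_apply, LinearMap.sub_apply,
    LinearMap.sum_apply, LinearMap.smul_apply,
    mul_apply, h.psiDer, h.thetaBar, h.evenDer, map_zero, smul_zero,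
    sum_const_zero, add_zero, sub_zero]

end Ref

section Elementary

variable {n k d : ℕ} {U : Opens (Fin d → ℝ)} (B : Background U)

theorem gamBar_bet (i j : Fin n) :
    (gamBar i * bet j : Op n k U) = bet j * gamBar i - if i = j then 1 else 0 := by
  have h := evenDer_evenMul (U := U) (k := k) (Sum.inr i : EvenOsc n) (Sum.inr j)
  simp only [Sum.inr.injEq] at h
  rw [gamBar, bet, neg_mul, h, mul_neg]
  abel

theorem betBar_gam (i j : Fin n) :
    (betBar i * gam j : Op n k U) = gam j * betBar i + if i = j then 1 else 0 := by
  have h := evenDer_evenMul (U := U) (k := k) (Sum.inl i : EvenOsc n) (Sum.inl j)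
  simp only [Sum.inl.injEq] at h
  rw [betBar, gam, h, add_comm]

theorem commute_gam_bet (i j : Fin n) : Commute (gam i : Op n k U) (bet j) := evenMul_evenMul _ _

theorem traceT_bet (i j l : Fin n) : (traceT i j * bet l : Op n k U) =
    bet l * traceT i j + ((if j = l then betBar i else 0) - if i = l then betBar j else 0) := by
  simp only [traceT, bet, betBar, psiDer, thetaBar, add_mul, sub_mul, mul_add, mul_sub,
    sum_mul, mul_sum, smul_mul_assoc, mul_smul_comm, oddDer_oddDer_evenMul,
    evenDer_evenDer_evenMul, Sum.inr.injEq, reduceCtorEq, if_false, add_zero]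
  abel

theorem bet_comm {X : Op n k U} (hX : CommutesWithEven X) (j : Fin n) : Commute X (bet j) :=
  (hX _).1.symm

theorem superS_bet (μ : Fin d) (j : Fin n) : (superS B μ * bet j : Op n k U) =
    bet j * superS B μ - psi B j μ := by
  have h : ∀ i, ((psi B i μ * gamBar i + gam i * psiBar B i μ) * bet j : Op n k U) =
      bet j * (psi B i μ * gamBar i + gam i * psiBar B i μ)
        - if i = j then psi B i μ else 0 := fun i => by
    have h1 := (bet_comm (CommutesWithEven.psi (k := k) B i μ) j).eq
    have h2 := (bet_comm (CommutesWithEven.psiBar (k := k) B i μ) j).eq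
    have h3 := (commute_gam_bet (k := k) (U := U) i j).eq
    rw [add_mul, mul_assoc, mul_assoc, gamBar_bet, h2, ← mul_assoc (gam i), h3, mul_sub,
      ← mul_assoc (psi B i μ), h1]
    split_ifs <;> noncomm_ring
  rw [superS_eq, sum_mul, sum_congr rfl fun i _ => h i, sum_sub_distrib,
    mul_sum, sum_ite_eq', if_pos (mem_univ j)]

theorem superS_theta (μ : Fin d) (j : Fin n) (r : Fin k) :
    (superS B μ * theta j r : Op n k U) = -(theta j r * superS B μ) := by
  rw [(psiOdd_theta j r).superS B μ, neg_neg]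

theorem rho_eq : (rho : Op n k U) =
    ∑ i, ∑ r, (theta i r * gamBar i + gam i * thetaBar i r) :=
  sum_congr rfl fun i _ => sum_congr rfl fun r _ => by
    rw [((CommutesWithEven.theta i r).gamBar i).eq]

theorem rho_bet (j : Fin n) : (rho * bet j : Op n k U) = bet j * rho - ∑ r, theta j r := by
  have h : ∀ i r, ((theta i r * gamBar i + gam i * thetaBar i r) * bet j : Op n k U) =
      bet j * (theta i r * gamBar i + gam i * thetaBar i r)
        - if i = j then theta i r else 0 := fun i r => by
    have h1 := (bet_comm (CommutesWithEven.theta (U := U) i r) j).eq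
    have h2 := (bet_comm (CommutesWithEven.thetaBar (U := U) i r) j).eq
    have h3 := (commute_gam_bet (k := k) (U := U) i j).eq
    rw [add_mul, mul_assoc, mul_assoc, gamBar_bet, h2, ← mul_assoc (gam i), h3, mul_sub,
      ← mul_assoc (theta i r), h1]
    split_ifs <;> noncomm_ring
  simp only [rho_eq, sum_mul, mul_sum, h, sum_sub_distrib]
  rw [sum_comm (f := fun i r => if i = j then theta i r else 0)]
  simp only [sum_ite_eq', mem_univ, if_true]

theorem commute_rho_gam (j : Fin n) : Commute (rho : Op n k U) (gam j) := by
  rw [rho_eq]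
  exact Commute.sum_left _ _ _ fun i _ => Commute.sum_left _ _ _ fun r _ => Commute.add_left
    (Commute.mul_left ((CommutesWithEven.theta i r).gam j).symm (commute_gamBar_gam i j))
    (Commute.mul_left (commute_gam_gam i j) ((CommutesWithEven.thetaBar i r).gam j).symm)

theorem rho_psi (j : Fin n) (μ : Fin d) : (rho * psi B j μ : Op n k U) = -(psi B j μ * rho) := by
  have h : ∀ i r, ((theta i r * gamBar i + gam i * thetaBar i r) * psi B j μ : Op n k U) =
      -(psi B j μ * (theta i r * gamBar i + gam i * thetaBar i r)) := fun i r => by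
    have h1 := ((CommutesWithEven.psi (k := k) B j μ).gamBar i).eq
    have h2 := ((CommutesWithEven.psi (k := k) B j μ).gam i).eq
    rw [add_mul, mul_assoc, mul_assoc, h1, thetaBar_psi, ← mul_assoc (theta i r), theta_psi,
      mul_add, ← mul_assoc (psi B j μ) (gam i), ← h2]
    noncomm_ring
  simp only [rho_eq, sum_mul, mul_sum, h, sum_neg_distrib]

theorem rho_theta (j : Fin n) (s : Fin k) :
    (rho * theta j s : Op n k U) = gam j - theta j s * rho := by
  have h : ∀ i r, ((theta i r * gamBar i + gam i * thetaBar i r) * theta j s : Op n k U) =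
      (if i = j then if r = s then gam i else 0 else 0)
        - theta j s * (theta i r * gamBar i + gam i * thetaBar i r) := fun i r => by
    have h1 := ((CommutesWithEven.theta (U := U) j s).gamBar i).eq
    have h2 := ((CommutesWithEven.theta (U := U) j s).gam i).eq
    rw [add_mul, mul_assoc, mul_assoc, h1, thetaBar_theta, ← mul_assoc (theta i r), theta_theta,
      mul_add, ← mul_assoc (theta j s) (gam i), ← h2, ite_and]
    split_ifs <;> noncomm_ring
  simp only [rho_eq, sum_mul, mul_sum, h, sum_sub_distrib]
  have e : ∀ i, ∑ r, (if i = j then if r = s then (gam i : Op n k U) else 0 else 0) =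
      if i = j then gam i else 0 := fun i => by split_ifs <;> simp
  simp only [e, sum_ite_eq', mem_univ, if_true]

end Elementary

/-! ### Tensor fields as states -/

section Tensors

variable {n k d r : ℕ} {U : Opens (Fin d → ℝ)} (B : Background U)

/-- A tuple of states that transforms like a contravariant tensor. -/
def IsCovariant (Z : (Fin r → Fin d) → Wave n k U) : Prop :=
  ∀ μ I, hatNabla B μ (Z I) =
    -∑ j, ∑ l, fn (B.christoffel (I j) μ l) (Z (Function.update I j l))

/-- `T_I Z^I`. -/
def ten (Z : (Fin r → Fin d) → Wave n k U) (T : Tensor r U) : Wave n k U := ∑ I, fn (T I) (Z I)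

theorem ten_add (Z : (Fin r → Fin d) → Wave n k U) (S T : Tensor r U) :
    ten Z (S + T) = ten Z S + ten Z T := by
  simp only [ten, Pi.add_apply, fn_add, LinearMap.add_apply, sum_add_distrib]

theorem ten_smul (Z : (Fin r → Fin d) → Wave n k U) (c : ℂ) (T : Tensor r U) :
    ten Z (c • T) = c • ten Z T := by
  simp only [ten, Pi.smul_apply, fn_smul, LinearMap.smul_apply, smul_sum]

theorem ten_neg (Z : (Fin r → Fin d) → Wave n k U) (T : Tensor r U) : ten Z (-T) = -ten Z T := by
  simp only [ten, Pi.neg_apply, fn_neg, LinearMap.neg_apply, sum_neg_distrib]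

theorem ten_sub (Z : (Fin r → Fin d) → Wave n k U) (S T : Tensor r U) :
    ten Z (S - T) = ten Z S - ten Z T := by
  rw [sub_eq_add_neg, ten_add, ten_neg, sub_eq_add_neg]

theorem ten_zero (Z : (Fin r → Fin d) → Wave n k U) : ten Z (0 : Tensor r U) = 0 := by
  simp only [ten, Pi.zero_apply, fn_zero, LinearMap.zero_apply, sum_const_zero]

theorem map_ten {n' k' : ℕ} {A : Wave n k U →ₗ[ℂ] Wave n' k' U}
    (hA : ∀ f Φ, A (fn f Φ) = fn f (A Φ)) (Z : (Fin r → Fin d) → Wave n k U) (T : Tensor r U) :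
    A (ten Z T) = ten (fun I => A (Z I)) T := by
  simp only [ten, map_sum, hA]

theorem sum_update_swap {M : Type*} [AddCommMonoid M] (j : Fin r)
    (f : (Fin r → Fin d) → (Fin r → Fin d) → M) :
    ∑ I, ∑ l, f I (Function.update I j l) = ∑ I, ∑ l, f (Function.update I j l) I := by
  rw [← Fintype.sum_prod_type', ← Fintype.sum_prod_type']
  refine Finset.sum_nbij' (fun p => (Function.update p.1 j p.2, p.1 j))
    (fun p => (Function.update p.1 j p.2, p.1 j)) ?_ ?_ ?_ ?_ ?_
  · simp
  · simp
  · rintro ⟨I, l⟩ -; simp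
  · rintro ⟨I, l⟩ -; simp
  · rintro ⟨I, l⟩ -; simp

theorem sum_rotate_tensor {ι M : Type*} [Fintype ι] [AddCommMonoid M] (f : Fin d → Fin d → ι → M) :
    ∑ a, ∑ b, ∑ c, f a b c = ∑ c, ∑ a, ∑ b, f a b c := by
  calc _ = ∑ a, ∑ c, ∑ b, f a b c := sum_congr rfl fun a _ => sum_comm
    _ = _ := sum_comm

variable {B} {Z : (Fin r → Fin d) → Wave n k U}

theorem hatNabla_ten (hZ : IsCovariant B Z) (T : Tensor r U) (μ : Fin d) :
    hatNabla B μ (ten Z T) = ten Z (fun I => cov B T (Fin.cons μ I)) := by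
  have e1 : ∀ I, hatNabla B μ (fn (T I) (Z I)) = fn (partialD μ (T I)) (Z I)
      - ∑ j, ∑ l, fn (T I * B.christoffel (I j) μ l) (Z (Function.update I j l)) := fun I => by
    have h1 := LinearMap.congr_fun (hatNabla_fn (n := n) (k := k) B μ (T I)) (Z I)
    rw [LinearMap.add_apply, mul_apply, mul_apply, hZ] at h1
    rw [h1, map_neg, map_sum, add_comm, ← sub_eq_add_neg]
    simp only [map_sum, fn_fn_apply]
  have e2 : ∀ I, cov B T (Fin.cons μ I) = partialD μ (T I)
      - ∑ j, ∑ l, B.christoffel l μ (I j) * T (Function.update I j l) := fun I => rfl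
  simp only [ten, map_sum, e1, e2, fn_sub, fn_sum, LinearMap.sub_apply, LinearMap.sum_apply,
    sum_sub_distrib]
  refine congrArg₂ (· - ·) rfl ?_
  rw [sum_comm, sum_comm (f := fun I j => ∑ l,
    fn (B.christoffel l μ (I j) * T (Function.update I j l)) (Z I))]
  refine sum_congr rfl fun j _ => ?_
  have h2 := sum_update_swap j (fun I J =>
    (fn (T I * B.christoffel (I j) μ (J j)) : Op n k U) (Z J))
  simp only [Function.update_self] at h2
  rw [h2]
  simp only [mul_comm]

theorem cov_cov_cons (B : Background U) (T : Tensor r U) (μ ν : Fin d) (I : Fin r → Fin d) :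
    cov B (cov B T) (Fin.cons μ (Fin.cons ν I)) =
      cov B (fun J => cov B T (Fin.cons ν J)) (Fin.cons μ I)
        - ∑ l, B.christoffel l μ ν * cov B T (Fin.cons l I) := by
  have e1 : cov B (cov B T) (Fin.cons μ (Fin.cons ν I)) =
      partialD μ (cov B T (Fin.cons ν I)) - ∑ j : Fin (r + 1), ∑ l,
        B.christoffel l μ ((Fin.cons ν I : Fin (r + 1) → Fin d) j) *
          cov B T (Function.update (Fin.cons ν I) j l) := rfl
  have e2 : cov B (fun J => cov B T (Fin.cons ν J)) (Fin.cons μ I) =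
      partialD μ (cov B T (Fin.cons ν I)) - ∑ j, ∑ l,
        B.christoffel l μ (I j) * cov B T (Fin.cons ν (Function.update I j l)) := rfl
  rw [e1, e2, Fin.sum_univ_succ]
  simp only [Fin.cons_zero, Fin.cons_succ, Fin.update_cons_zero, ← Fin.cons_update]
  ring

theorem laplacian_ten (hZ : IsCovariant B Z) (T : Tensor r U) :
    laplacian B (ten Z T) = ten Z (box B T) := by
  have e1 : ∀ I, box B T I = ∑ μ, ∑ ν, B.invMetric μ ν *
      cov B (cov B T) (Fin.cons μ (Fin.cons ν I)) := fun I => rfl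
  have e2 : ∀ μ ν, hatNabla B μ (hatNabla B ν (ten Z T))
      - ∑ l, fn (B.christoffel l μ ν) (hatNabla B l (ten Z T)) =
      ten Z (fun I => cov B (cov B T) (Fin.cons μ (Fin.cons ν I))) := fun μ ν => by
    rw [hatNabla_ten hZ T ν, hatNabla_ten hZ]
    simp only [hatNabla_ten hZ, cov_cov_cons]
    simp only [ten, fn_sub, fn_sum, LinearMap.sub_apply, LinearMap.sum_apply,
      sum_sub_distrib, map_sum, fn_fn_apply]
    exact congrArg₂ (· - ·) rfl sum_comm
  have e3 : laplacian B (ten Z T) = ∑ μ, ∑ ν, fn (B.invMetric μ ν)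
      (ten Z (fun I => cov B (cov B T) (Fin.cons μ (Fin.cons ν I)))) := by
    simp only [laplacian, LinearMap.sum_apply, mul_apply, LinearMap.sub_apply, e2]
  rw [e3]
  simp only [ten, map_sum, fn_fn_apply]
  rw [sum_rotate_tensor]
  refine sum_congr rfl fun I _ => ?_
  rw [sum_fn_apply₂, e1]

end Tensors

/-! ### Pairs of creation operators antisymmetrized in the flavor -/

section Kets

variable {k d : ℕ} {U : Opens (Fin d → ℝ)} (B : Background U)

/-- `(X_1 Y_2 - X_2 Y_1) Ω`. -/
def ket (X Y : Fin 2 → Op 2 k U) (Ω : Wave 2 k U) : Wave 2 k U := X 0 (Y 1 Ω) - X 1 (Y 0 Ω)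

/-- Creation operators in the fundamental representation of the flavor rotations. -/
def IsCreation (X : Fin 2 → Op 2 k U) : Prop :=
  ∀ i j l, young i j * X l = X l * young i j + if j = l then X i else 0

theorem isCreation_psi (μ : Fin d) : IsCreation (k := k) fun i => psi B i μ :=
  fun i j l => young_psi B i j l μ

theorem isCreation_theta (r : Fin k) : IsCreation (U := U) fun i => theta i r :=
  fun i j l => young_theta i j l r

theorem isCreation_gam : IsCreation (U := U) (k := k) gam := young_gam

theorem isCreation_bet : IsCreation (U := U) (k := k) bet := young_bet

variable {X Y : Fin 2 → Op 2 k U} {Ω : Wave 2 k U}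

theorem IsCreation.apply (hX : IsCreation X) (i j l : Fin 2) (Φ : Wave 2 k U) :
    young i j (X l Φ) = X l (young i j Φ) + if j = l then X i Φ else 0 := by
  have h := LinearMap.congr_fun (hX i j l) Φ
  rw [LinearMap.add_apply, mul_apply, mul_apply] at h
  rw [h]
  split_ifs <;> rfl

theorem young_zero_one_ket (hX : IsCreation X) (hY : IsCreation Y) (hΩ : IsRef Ω) :
    young 0 1 (ket X Y Ω) = 0 := by
  simp [ket, hX.apply, hY.apply, hΩ.young]

theorem young_self_ket (hX : IsCreation X) (hY : IsCreation Y) (hΩ : IsRef Ω) (i : Fin 2) :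
    young i i (ket X Y Ω) = ket X Y Ω := by
  fin_cases i <;> simp [ket, hX.apply, hY.apply, hΩ.young]

theorem mem_reduced_two_iff {Ψ : Wave 2 k U} : Ψ ∈ reduced 2 k U ↔
    (∀ i, (young i i : Op 2 k U) Ψ = Ψ) ∧ (young 0 1 : Op 2 k U) Ψ = 0 ∧
      (traceT 0 1 : Op 2 k U) Ψ = 0 := by
  refine ⟨fun h => ⟨young_self_of_mem_reduced h, ?_⟩, fun h => ⟨?_, ?_⟩⟩
  · exact (Submodule.mem_iInf _).1 ((Submodule.mem_iInf _).1 ((Submodule.mem_iInf _).1 h.2 0) 1)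
      (by decide)
  · refine (Submodule.mem_iInf _).2 fun i => ?_
    rw [LinearMap.mem_ker, shiftedJ_eq, LinearMap.sub_apply, h.1 i]
    exact sub_self _
  · refine (Submodule.mem_iInf _).2 fun i => (Submodule.mem_iInf _).2 fun j =>
      (Submodule.mem_iInf _).2 fun hij => ?_
    obtain ⟨rfl, rfl⟩ : i = 0 ∧ j = 1 := by omega
    exact ⟨h.2.1, h.2.2⟩

variable (k U) in
/-- The constraints other than the trace. -/
def youngKer : Submodule ℂ (Wave 2 k U) where
  carrier := {Ψ | (∀ i, (young i i : Op 2 k U) Ψ = Ψ) ∧ (young 0 1 : Op 2 k U) Ψ = 0}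
  add_mem' := fun h h' => ⟨fun i => by rw [map_add, h.1, h'.1], by rw [map_add, h.2, h'.2, add_zero]⟩
  zero_mem' := ⟨fun _ => map_zero _, map_zero _⟩
  smul_mem' := fun c _ h => ⟨fun i => by rw [map_smul, h.1], by rw [map_smul, h.2, smul_zero]⟩

theorem ket_mem_youngKer (hX : IsCreation X) (hY : IsCreation Y) (hΩ : IsRef Ω) :
    ket X Y Ω ∈ youngKer k U :=
  ⟨young_self_ket hX hY hΩ, young_zero_one_ket hX hY hΩ⟩

theorem fn_mem_youngKer {Ψ : Wave 2 k U} (h : Ψ ∈ youngKer k U) (f : Fn U) :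
    fn f Ψ ∈ youngKer k U := by
  have e : ∀ i j, (young i j : Op 2 k U) (fn f Ψ) = fn f (young i j Ψ) := fun i j =>
    LinearMap.congr_fun (commute_fn_young f i j).symm.eq Ψ
  exact ⟨fun i => by rw [e, h.1], by rw [e, h.2, map_zero]⟩

/-- Lowering operators dual to `X` under the trace. -/
def IsTraceDual (X Xb : Fin 2 → Op 2 k U) : Prop :=
  ∀ i j l, traceT i j * X l = X l * traceT i j
    + ((if j = l then Xb i else 0) - if i = l then Xb j else 0)

theorem IsTraceDual.apply {Xb : Fin 2 → Op 2 k U} (hX : IsTraceDual X Xb) (i j l : Fin 2)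
    (Φ : Wave 2 k U) : traceT i j (X l Φ) = X l (traceT i j Φ)
      + ((if j = l then Xb i Φ else 0) - if i = l then Xb j Φ else 0) := by
  have h := LinearMap.congr_fun (hX i j l) Φ
  rw [LinearMap.add_apply, mul_apply, mul_apply, LinearMap.sub_apply] at h
  rw [h]
  split_ifs <;> rfl

theorem traceT_ket {Xb Yb : Fin 2 → Op 2 k U} (hX : IsTraceDual X Xb) (hY : IsTraceDual Y Yb)
    (hΩ : IsRef Ω) (hYb : ∀ i, Yb i Ω = 0) {Φ : Wave 2 k U}
    (hXY : ∀ i, Xb i (Y i Ω) = Φ) : traceT 0 1 (ket X Y Ω) = (-2 : ℂ) • Φ := by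
  simp only [ket, map_sub, hX.apply, hY.apply, hΩ.traceT, map_zero, hYb, hXY]
  simp
  module

theorem isTraceDual_psi (μ : Fin d) :
    IsTraceDual (k := k) (fun i => psi B i μ) fun i => psiBar B i μ :=
  fun i j l => traceT_psi B i j l μ

theorem isTraceDual_theta (r : Fin k) :
    IsTraceDual (U := U) (fun i => theta i r) fun i => thetaBar i r :=
  fun i j l => traceT_theta i j l r

theorem isTraceDual_gam : IsTraceDual (k := k) (U := U) gam gamBar := traceT_gam

theorem isTraceDual_bet : IsTraceDual (k := k) (U := U) bet betBar := traceT_bet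

end Kets

section Apply

variable {n k d : ℕ} {U : Opens (Fin d → ℝ)} (B : Background U) (Φ : Wave n k U)

theorem hatNabla_psi_apply (μ ν : Fin d) (i : Fin n) : hatNabla B μ (psi B i ν Φ) =
    psi B i ν (hatNabla B μ Φ) - ∑ l, fn (B.christoffel ν μ l) (psi B i l Φ) := by
  have h := LinearMap.congr_fun (hatNabla_psi (k := k) B μ ν i) Φ
  simpa only [LinearMap.sub_apply, LinearMap.sum_apply, mul_apply] using h

theorem hatNabla_theta_apply (μ : Fin d) (i : Fin n) (r : Fin k) :
    hatNabla B μ (theta i r Φ) = theta i r (hatNabla B μ Φ) :=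
  LinearMap.congr_fun ((psiOdd_theta i r).hatNabla B μ).symm.eq Φ

theorem hatNabla_gam_apply (μ : Fin d) (i : Fin n) :
    hatNabla B μ (gam i Φ) = gam i (hatNabla B μ Φ) :=
  LinearMap.congr_fun ((CommutesWithEven.hatNabla B μ).gam i).symm.eq Φ

theorem hatNabla_bet_apply (μ : Fin d) (i : Fin n) :
    hatNabla B μ (bet i Φ) = bet i (hatNabla B μ Φ) :=
  LinearMap.congr_fun (bet_comm (CommutesWithEven.hatNabla B μ) i).eq Φ

theorem superS_psi_apply (μ ν : Fin d) (i : Fin n) : superS B μ (psi B i ν Φ) =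
    fn (B.invMetric μ ν) (gam i Φ) - psi B i ν (superS B μ Φ) :=
  LinearMap.congr_fun (superS_psi (k := k) B μ ν i) Φ

theorem superS_theta_apply (μ : Fin d) (i : Fin n) (r : Fin k) :
    superS B μ (theta i r Φ) = -theta i r (superS B μ Φ) :=
  LinearMap.congr_fun (superS_theta B μ i r) Φ

theorem superS_gam_apply (μ : Fin d) (i : Fin n) :
    superS B μ (gam i Φ) = gam i (superS B μ Φ) :=
  LinearMap.congr_fun (commute_superS_gam B μ i).eq Φ

theorem superS_bet_apply (μ : Fin d) (i : Fin n) :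
    superS B μ (bet i Φ) = bet i (superS B μ Φ) - psi B i μ Φ :=
  LinearMap.congr_fun (superS_bet (k := k) B μ i) Φ

theorem psiBar_psi_apply (i j : Fin n) (μ ν : Fin d) : psiBar B i μ (psi B j ν Φ) =
    (if i = j then fn (B.invMetric μ ν) Φ else 0) - psi B j ν (psiBar B i μ Φ) := by
  have h := LinearMap.congr_fun (psiBar_psi (k := k) B i j μ ν) Φ
  rw [LinearMap.sub_apply, mul_apply, mul_apply] at h
  rw [h]
  split_ifs <;> rfl

theorem psiBar_theta_apply (i j : Fin n) (r : Fin k) (μ : Fin d) :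
    psiBar B i μ (theta j r Φ) = -theta j r (psiBar B i μ Φ) := by
  have h := LinearMap.congr_fun (theta_psiBar (k := k) B j i r μ) Φ
  rw [LinearMap.neg_apply, mul_apply, mul_apply] at h
  rw [h, neg_neg]

theorem psiBar_gam_apply (i j : Fin n) (μ : Fin d) :
    psiBar B i μ (gam j Φ) = gam j (psiBar B i μ Φ) :=
  LinearMap.congr_fun ((CommutesWithEven.psiBar B i μ).gam j).symm.eq Φ

theorem psiBar_bet_apply (i j : Fin n) (μ : Fin d) :
    psiBar B i μ (bet j Φ) = bet j (psiBar B i μ Φ) :=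
  LinearMap.congr_fun (bet_comm (CommutesWithEven.psiBar B i μ) j).eq Φ

theorem psiBar_fn (f : Fn U) (i : Fin n) (μ : Fin d) :
    psiBar B i μ (fn f Φ) = fn f (psiBar B i μ Φ) :=
  LinearMap.congr_fun (commute_fn_psiBar B f i μ).symm.eq Φ

theorem theta_fn (f : Fn U) (i : Fin n) (r : Fin k) : theta i r (fn f Φ) = fn f (theta i r Φ) :=
  LinearMap.congr_fun (commute_fn_theta f i r).symm.eq Φ

theorem cGhost_fn (f : Fn U) : cGhost (fn f Φ) = fn f (cGhost Φ) :=
  LinearMap.congr_fun (commute_fn_oddMul f (cOsc : OddOsc n d k)).symm.eq Φ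

theorem bGhost_fn (f : Fn U) : bGhost (fn f Φ) = fn f (bGhost Φ) :=
  LinearMap.congr_fun (commute_fn_oddDer f (cOsc : OddOsc n d k)).symm.eq Φ

theorem cGhost_psi_apply (i : Fin n) (μ : Fin d) :
    cGhost (psi B i μ Φ) = -psi B i μ (cGhost Φ) :=
  LinearMap.congr_fun (cGhost_psi (k := k) B i μ) Φ

theorem cGhost_theta_apply (i : Fin n) (r : Fin k) :
    cGhost (theta i r Φ) = -theta i r (cGhost Φ) :=
  LinearMap.congr_fun (cGhost_theta (U := U) i r) Φ

theorem cGhost_gam_apply (i : Fin n) : cGhost (gam i Φ) = gam i (cGhost Φ) :=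
  LinearMap.congr_fun (((CommutesWithEven.oddMul (cOsc : OddOsc n d k)).gam i).symm.eq) Φ

theorem cGhost_bet_apply (i : Fin n) : cGhost (bet i Φ) = bet i (cGhost Φ) :=
  LinearMap.congr_fun (bet_comm (CommutesWithEven.oddMul (cOsc : OddOsc n d k)) i).eq Φ

theorem cGhost_cGhost_apply : (cGhost : Op n k U) (cGhost Φ) = 0 :=
  LinearMap.congr_fun (cGhost_mul_self (n := n) (k := k) (U := U)) Φ

theorem bGhost_cGhost_apply : (bGhost : Op n k U) (cGhost Φ) = Φ - cGhost (bGhost Φ) :=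
  LinearMap.congr_fun (bGhost_cGhost (n := n) (k := k) (U := U)) Φ

theorem bGhost_psi_apply (i : Fin n) (μ : Fin d) :
    bGhost (psi B i μ Φ) = -psi B i μ (bGhost Φ) :=
  LinearMap.congr_fun (bGhost_psi (k := k) B i μ) Φ

theorem bGhost_theta_apply (i : Fin n) (r : Fin k) :
    bGhost (theta i r Φ) = -theta i r (bGhost Φ) :=
  LinearMap.congr_fun (bGhost_theta (U := U) i r) Φ

theorem bGhost_gam_apply (i : Fin n) : bGhost (gam i Φ) = gam i (bGhost Φ) :=
  LinearMap.congr_fun (((CommutesWithEven.oddDer (cOsc : OddOsc n d k)).gam i).symm.eq) Φ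

theorem bGhost_bet_apply (i : Fin n) : bGhost (bet i Φ) = bet i (bGhost Φ) :=
  LinearMap.congr_fun (bet_comm (CommutesWithEven.oddDer (cOsc : OddOsc n d k)) i).eq Φ

theorem bGhost_vacuum : (bGhost : Op n k U) vacuum = 0 := oddDer_vacuum _

theorem gamBarGam_theta (i : Fin n) (r : Fin k) :
    (gamBarGam : Op n k U) (theta i r Φ) = theta i r ((gamBarGam : Op n k U) Φ) :=
  LinearMap.congr_fun (CommutesWithEven.theta i r).gamBarGam.eq Φ

theorem gamBar_bet_apply (i j : Fin n) :
    gamBar i (bet j Φ) = bet j (gamBar i Φ) - if i = j then Φ else 0 := by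
  have h := LinearMap.congr_fun (gamBar_bet (k := k) (U := U) i j) Φ
  rw [LinearMap.sub_apply, mul_apply, mul_apply] at h
  rw [h]
  split_ifs <;> rfl

theorem betBar_gam_apply (i j : Fin n) :
    betBar i (gam j Φ) = gam j (betBar i Φ) + if i = j then Φ else 0 := by
  have h := LinearMap.congr_fun (betBar_gam (k := k) (U := U) i j) Φ
  rw [LinearMap.add_apply, mul_apply, mul_apply] at h
  rw [h]
  split_ifs <;> rfl

theorem psi_gam_apply (i j : Fin n) (μ : Fin d) : psi B i μ (gam j Φ) = gam j (psi B i μ Φ) :=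
  LinearMap.congr_fun ((CommutesWithEven.psi B i μ).gam j).symm.eq Φ

theorem theta_gam_apply (i j : Fin n) (r : Fin k) :
    theta i r (gam j Φ) = gam j (theta i r Φ) :=
  LinearMap.congr_fun ((CommutesWithEven.theta i r).gam j).symm.eq Φ

theorem psi_psi_apply (i j : Fin n) (μ ν : Fin d) :
    psi B i μ (psi B j ν Φ) = -psi B j ν (psi B i μ Φ) :=
  LinearMap.congr_fun (psi_psi (k := k) B i j μ ν) Φ

theorem theta_theta_apply (i j : Fin n) (r s : Fin k) :
    theta i r (theta j s Φ) = -theta j s (theta i r Φ) :=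
  LinearMap.congr_fun (theta_theta (U := U) i j r s) Φ

theorem theta_psi_apply (i j : Fin n) (r : Fin k) (μ : Fin d) :
    theta i r (psi B j μ Φ) = -psi B j μ (theta i r Φ) :=
  LinearMap.congr_fun (theta_psi (k := k) B i j r μ) Φ

theorem rho_gam_apply (i : Fin n) : (rho : Op n k U) (gam i Φ) = gam i ((rho : Op n k U) Φ) :=
  LinearMap.congr_fun (commute_rho_gam i).eq Φ

theorem rho_psi_apply (i : Fin n) (μ : Fin d) :
    (rho : Op n k U) (psi B i μ Φ) = -psi B i μ ((rho : Op n k U) Φ) :=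
  LinearMap.congr_fun (rho_psi (k := k) B i μ) Φ

theorem rho_theta_apply (i : Fin n) (r : Fin k) :
    (rho : Op n k U) (theta i r Φ) = gam i Φ - theta i r ((rho : Op n k U) Φ) :=
  LinearMap.congr_fun (rho_theta (U := U) i r) Φ

theorem rho_bet_apply (i : Fin n) (Φ : Wave n 1 U) :
    (rho : Op n 1 U) (bet i Φ) = bet i ((rho : Op n 1 U) Φ) - theta i 0 Φ := by
  have h := LinearMap.congr_fun (rho_bet (k := 1) (U := U) i) Φ
  rw [Fin.sum_univ_one] at h
  exact h

theorem rho_fn (f : Fn U) : (rho : Op n k U) (fn f Φ) = fn f ((rho : Op n k U) Φ) := by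
  have h : Commute (fn f : Op n k U) rho := by
    rw [rho_eq]
    refine Commute.sum_right _ _ _ fun i _ => Commute.sum_right _ _ _ fun r _ => ?_
    exact Commute.add_right (Commute.mul_right (commute_fn_theta f i r) (commute_fn_gamBar f i))
      (Commute.mul_right (commute_fn_gam f i) (commute_fn_thetaBar f i r))
  exact LinearMap.congr_fun h.symm.eq Φ

end Apply

section KetActions

variable {k d : ℕ} {U : Opens (Fin d → ℝ)} (B : Background U)

abbrev psiV (μ : Fin d) : Fin 2 → Op 2 k U := fun i => psi B i μ

abbrev thetaV (r : Fin k) : Fin 2 → Op 2 k U := fun i => theta i r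

def ketPP (Ω : Wave 2 k U) (I : Fin 2 → Fin d) : Wave 2 k U := ket (psiV B (I 0)) (psiV B (I 1)) Ω

def ketPG (Ω : Wave 2 k U) (I : Fin 1 → Fin d) : Wave 2 k U := ket (psiV B (I 0)) gam Ω

def ketPB (Ω : Wave 2 k U) (I : Fin 1 → Fin d) : Wave 2 k U := ket (psiV B (I 0)) bet Ω

def ketGB (Ω : Wave 2 k U) (_ : Fin 0 → Fin d) : Wave 2 k U := ket gam bet Ω

def ketTP (r : Fin k) (Ω : Wave 2 k U) (I : Fin 1 → Fin d) : Wave 2 k U :=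
  ket (thetaV r) (psiV B (I 0)) Ω

def ketTT (r : Fin k) (Ω : Wave 2 k U) (_ : Fin 0 → Fin d) : Wave 2 k U :=
  ket (thetaV r) (thetaV r) Ω

def ketTG (r : Fin k) (Ω : Wave 2 k U) (_ : Fin 0 → Fin d) : Wave 2 k U := ket (thetaV r) gam Ω

def ketTB (r : Fin k) (Ω : Wave 2 k U) (_ : Fin 0 → Fin d) : Wave 2 k U := ket (thetaV r) bet Ω

variable {Ω : Wave 2 k U} (hΩ : IsRef Ω) (r : Fin k)

section Covariant

include hΩ

theorem isCovariant_ketPP : IsCovariant B (ketPP B Ω) := fun μ I => by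
  simp only [ketPP, ket, psiV, map_sub, hatNabla_psi_apply, hΩ.hatNabla, map_zero, map_sum,
    psi_fn, Fin.sum_univ_two, zero_sub, map_neg, sum_sub_distrib, Function.update_self,
    Function.update_of_ne (one_ne_zero : (1 : Fin 2) ≠ 0),
    Function.update_of_ne (zero_ne_one : (0 : Fin 2) ≠ 1)]
  abel

theorem isCovariant_ketPB : IsCovariant B (ketPB B Ω) := fun μ I => by
  simp only [ketPB, ket, psiV, map_sub, hatNabla_psi_apply, hatNabla_bet_apply, hΩ.hatNabla,
    map_zero, Fin.sum_univ_one, zero_sub, sum_sub_distrib, Function.update_self]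
  abel

theorem isCovariant_ketTP : IsCovariant B (ketTP B r Ω) := fun μ I => by
  simp only [ketTP, ket, psiV, thetaV, map_sub, hatNabla_psi_apply, hatNabla_theta_apply,
    hΩ.hatNabla, map_zero, Fin.sum_univ_one, zero_sub, sum_sub_distrib,
    Function.update_self, map_neg, map_sum, theta_fn]
  abel

theorem isCovariant_ketGB : IsCovariant B (ketGB (d := d) Ω) := fun μ I => by
  simp only [ketGB, ket, map_sub, hatNabla_gam_apply, hatNabla_bet_apply, hΩ.hatNabla, map_zero,
    sub_zero, Finset.univ_eq_empty, Finset.sum_empty, neg_zero]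

theorem isCovariant_ketTT : IsCovariant B (ketTT (d := d) r Ω) := fun μ I => by
  simp only [ketTT, ket, map_sub, hatNabla_theta_apply, hΩ.hatNabla, map_zero,
    sub_zero, Finset.univ_eq_empty, Finset.sum_empty, neg_zero]

theorem isCovariant_ketTB : IsCovariant B (ketTB (d := d) r Ω) := fun μ I => by
  simp only [ketTB, ket, map_sub, hatNabla_theta_apply, hatNabla_bet_apply, hΩ.hatNabla, map_zero,
    sub_zero, Finset.univ_eq_empty, Finset.sum_empty, neg_zero]

theorem superS_ketPP (μ : Fin d) (I : Fin 2 → Fin d) : superS B μ (ketPP B Ω I) =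
    -fn (B.invMetric μ (I 0)) (ketPG B Ω ![I 1]) - fn (B.invMetric μ (I 1)) (ketPG B Ω ![I 0]) := by
  simp only [ketPP, ketPG, ket, psiV, map_sub, superS_psi_apply, hΩ.superS, map_zero, sub_zero,
    psi_fn, psi_gam_apply, cons_val_zero]
  abel

theorem superS_ketGB (μ : Fin d) (I) : superS B μ (ketGB Ω I) = ketPG B Ω ![μ] := by
  simp only [ketPG, ketGB, ket, psiV, map_sub, superS_gam_apply, superS_bet_apply, hΩ.superS,
    map_zero, zero_sub, psi_gam_apply, cons_val_zero, map_neg]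
  abel

theorem superS_ketPB (μ : Fin d) (I : Fin 1 → Fin d) : superS B μ (ketPB B Ω I) =
    fn (B.invMetric μ (I 0)) (ketGB Ω ![]) + ketPP B Ω ![μ, I 0] := by
  have h := psi_psi_apply B Ω 0 1 μ (I 0)
  have h' := psi_psi_apply B Ω 1 0 μ (I 0)
  simp only [ketPB, ketPP, ketGB, ket, psiV, map_sub, superS_psi_apply, superS_bet_apply,
    hΩ.superS, map_zero, zero_sub, cons_val_zero, cons_val_one, map_neg,
    sub_neg_eq_add, h, h']
  abel

theorem superS_ketTP (μ : Fin d) (I : Fin 1 → Fin d) : superS B μ (ketTP B r Ω I) =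
    -fn (B.invMetric μ (I 0)) (ketTG r Ω ![]) := by
  simp only [ketTP, ketTG, ket, psiV, thetaV, map_sub, superS_psi_apply, superS_theta_apply,
    hΩ.superS, map_zero, sub_zero, theta_fn]
  abel

theorem superS_ketTT (μ : Fin d) (I) : superS B μ (ketTT r Ω I) = 0 := by
  simp only [ketTT, ket, thetaV, map_sub, superS_theta_apply, hΩ.superS, map_zero, neg_zero,
    sub_zero]

theorem superS_ketTB (μ : Fin d) (I) : superS B μ (ketTB r Ω I) = ketTP B r Ω ![μ] := by
  simp only [ketTP, ketTB, ket, psiV, thetaV, map_sub, superS_bet_apply, superS_theta_apply,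
    hΩ.superS, map_zero, zero_sub, map_neg, neg_neg, cons_val_zero]

theorem gamBarGam_bet (i : Fin 2) : (gamBarGam : Op 2 k U) (bet i Ω) = -gam i Ω := by
  simp only [gamBarGam_apply, gamBar_bet_apply, hΩ.gamBar, map_zero, zero_sub, map_neg,
    apply_ite, neg_zero, sum_ite_eq', mem_univ, if_true]

theorem gamBarGam_ketPB (I : Fin 1 → Fin d) :
    (gamBarGam : Op 2 k U) (ketPB B Ω I) = -ketPG B Ω I := by
  simp only [ketPB, ketPG, ket, psiV, map_sub, gamBarGam_psi, gamBarGam_bet hΩ, map_neg]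
  abel

theorem gamBarGam_ketTB (I : Fin 0 → Fin d) :
    (gamBarGam : Op 2 k U) (ketTB r Ω I) = -ketTG r Ω I := by
  simp only [ketTB, ketTG, ket, thetaV, map_sub, gamBarGam_theta, gamBarGam_bet hΩ, map_neg]
  abel

end Covariant

theorem cGhost_ketPP (I : Fin 2 → Fin d) : cGhost (ketPP B Ω I) = ketPP B (cGhost Ω) I := by
  simp only [ketPP, ket, psiV, map_sub, cGhost_psi_apply, map_neg, neg_neg]

theorem cGhost_ketGB (I : Fin 0 → Fin d) : cGhost (ketGB Ω I) = ketGB (cGhost Ω) I := by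
  simp only [ketGB, ket, map_sub, cGhost_gam_apply, cGhost_bet_apply]

theorem cGhost_ketTP (I : Fin 1 → Fin d) : cGhost (ketTP B r Ω I) = ketTP B r (cGhost Ω) I := by
  simp only [ketTP, ket, psiV, thetaV, map_sub, cGhost_psi_apply, cGhost_theta_apply, map_neg,
    neg_neg]

theorem cGhost_ketTT (I : Fin 0 → Fin d) : cGhost (ketTT r Ω I) = ketTT r (cGhost Ω) I := by
  simp only [ketTT, ket, thetaV, map_sub, cGhost_theta_apply, map_neg, neg_neg]

theorem cGhost_ketPB (I : Fin 1 → Fin d) : cGhost (ketPB B Ω I) = -ketPB B (cGhost Ω) I := by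
  simp only [ketPB, ket, psiV, map_sub, cGhost_psi_apply, cGhost_bet_apply]
  abel

theorem cGhost_ketTB (I : Fin 0 → Fin d) : cGhost (ketTB r Ω I) = -ketTB r (cGhost Ω) I := by
  simp only [ketTB, ket, thetaV, map_sub, cGhost_theta_apply, cGhost_bet_apply]
  abel

theorem bGhost_ketPP (I : Fin 2 → Fin d) : bGhost (ketPP B Ω I) = ketPP B (bGhost Ω) I := by
  simp only [ketPP, ket, psiV, map_sub, bGhost_psi_apply, map_neg, neg_neg]

theorem bGhost_ketGB (I : Fin 0 → Fin d) : bGhost (ketGB Ω I) = ketGB (bGhost Ω) I := by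
  simp only [ketGB, ket, map_sub, bGhost_gam_apply, bGhost_bet_apply]

theorem bGhost_ketTP (I : Fin 1 → Fin d) : bGhost (ketTP B r Ω I) = ketTP B r (bGhost Ω) I := by
  simp only [ketTP, ket, psiV, thetaV, map_sub, bGhost_psi_apply, bGhost_theta_apply, map_neg,
    neg_neg]

theorem bGhost_ketTT (I : Fin 0 → Fin d) : bGhost (ketTT r Ω I) = ketTT r (bGhost Ω) I := by
  simp only [ketTT, ket, thetaV, map_sub, bGhost_theta_apply, map_neg, neg_neg]

theorem bGhost_ketPB (I : Fin 1 → Fin d) : bGhost (ketPB B Ω I) = -ketPB B (bGhost Ω) I := by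
  simp only [ketPB, ket, psiV, map_sub, bGhost_psi_apply, bGhost_bet_apply]
  abel

theorem bGhost_ketTB (I : Fin 0 → Fin d) : bGhost (ketTB r Ω I) = -ketTB r (bGhost Ω) I := by
  simp only [ketTB, ket, thetaV, map_sub, bGhost_theta_apply, bGhost_bet_apply]
  abel

theorem ket_zero (X Y : Fin 2 → Op 2 k U) : ket X Y 0 = 0 := by simp [ket]

end KetActions

section KetRho

variable {d : ℕ} {U : Opens (Fin d → ℝ)} (B : Background U) {Ω : Wave 2 1 U} (hΩ : IsRef Ω)
include hΩ

theorem rho_ketPP (I : Fin 2 → Fin d) : (rho : Op 2 1 U) (ketPP B Ω I) = 0 := by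
  simp only [ketPP, ket, psiV, map_sub, rho_psi_apply, hΩ.rho, map_zero, neg_zero, sub_zero]

theorem rho_ketGB (I : Fin 0 → Fin d) : (rho : Op 2 1 U) (ketGB Ω I) = ketTG 0 Ω I := by
  simp only [ketGB, ketTG, ket, thetaV, map_sub, rho_gam_apply, rho_bet_apply, hΩ.rho, map_zero,
    zero_sub, map_neg, theta_gam_apply]
  abel

theorem rho_ketPB (I : Fin 1 → Fin d) : (rho : Op 2 1 U) (ketPB B Ω I) = ketTP B 0 Ω I := by
  have h := theta_psi_apply B Ω 0 1 0 (I 0)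
  have h' := theta_psi_apply B Ω 1 0 0 (I 0)
  simp only [ketPB, ketTP, ket, psiV, thetaV, map_sub, rho_psi_apply, rho_bet_apply, hΩ.rho,
    map_zero, zero_sub, map_neg, h, h']
  abel

theorem rho_ketTP (I : Fin 1 → Fin d) : (rho : Op 2 1 U) (ketTP B 0 Ω I) = -ketPG B Ω I := by
  simp only [ketTP, ketPG, ket, psiV, thetaV, map_sub, rho_theta_apply, rho_psi_apply, hΩ.rho,
    map_zero, neg_zero, sub_zero, psi_gam_apply]
  abel

theorem rho_ketTT (I : Fin 0 → Fin d) :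
    (rho : Op 2 1 U) (ketTT 0 Ω I) = (-2 : ℂ) • ketTG 0 Ω I := by
  simp only [ketTT, ketTG, ket, thetaV, map_sub, rho_theta_apply, hΩ.rho, map_zero, sub_zero,
    theta_gam_apply]
  module

theorem rho_ketTB (I : Fin 0 → Fin d) :
    (rho : Op 2 1 U) (ketTB 0 Ω I) = ketGB Ω I + ketTT 0 Ω I := by
  simp only [ketTT, ketTB, ketGB, ket, thetaV, map_sub, rho_theta_apply, rho_bet_apply, hΩ.rho,
    map_zero, zero_sub, map_neg, sub_neg_eq_add]
  abel

end KetRho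

section Contractions

variable {n k d r : ℕ} {U : Opens (Fin d → ℝ)} (B : Background U)

theorem sum_fin_succ_arrow {M : Type*} [AddCommMonoid M] (f : (Fin (r + 1) → Fin d) → M) :
    ∑ I, f I = ∑ μ, ∑ I : Fin r → Fin d, f (Fin.cons μ I) := by
  rw [← (Fin.consEquiv fun _ : Fin (r + 1) => Fin d).sum_comp, Fintype.sum_prod_type]
  rfl

theorem sum_fin_zero_arrow {M : Type*} [AddCommMonoid M] (f : (Fin 0 → Fin d) → M) :
    ∑ I, f I = f ![] := by
  rw [Fintype.sum_unique]
  exact congrArg f (Subsingleton.elim _ _)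

theorem sum_fin_one_arrow {M : Type*} [AddCommMonoid M] (f : (Fin 1 → Fin d) → M) :
    ∑ I, f I = ∑ μ, f ![μ] := by
  rw [sum_fin_succ_arrow]
  exact sum_congr rfl fun μ _ => sum_fin_zero_arrow _

theorem sum_fin_two_arrow {M : Type*} [AddCommMonoid M] (f : (Fin 2 → Fin d) → M) :
    ∑ I, f I = ∑ μ, ∑ ν, f ![μ, ν] := by
  rw [sum_fin_succ_arrow]
  exact sum_congr rfl fun μ _ => sum_fin_one_arrow _

/-- `S^μ ∇̂_μ` on a tensor. -/
theorem superS_hatNabla_ten {Z : (Fin r → Fin d) → Wave n k U} (hZ : IsCovariant B Z)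
    {W : (Fin (r + 1) → Fin d) → Wave n k U} (hW : ∀ μ I, superS B μ (Z I) = W (Fin.cons μ I))
    (T : Tensor r U) :
    (∑ μ, superS B μ * hatNabla B μ : Op n k U) (ten Z T) = ten W (cov B T) := by
  have e : ten W (cov B T) = ∑ I, fn (cov B T I) (W I) := rfl
  rw [LinearMap.sum_apply, e, sum_fin_succ_arrow]
  refine sum_congr rfl fun μ _ => ?_
  rw [mul_apply, hatNabla_ten hZ, map_ten fun f Φ => superS_fn B f μ Φ]
  simp only [hW, ten]

theorem ten_contract {K : (Fin r → Fin d) → Wave n k U} (T : Tensor (r + 2) U) :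
    ten (fun I => fn (B.invMetric (I 0) (I 1)) (K fun j => I j.succ.succ)) T =
      ten K (contract B T) := by
  have e : ∀ I, contract B T I = ∑ μ, ∑ ν, B.invMetric μ ν * T (Fin.cons μ (Fin.cons ν I)) :=
    fun I => rfl
  simp only [ten, sum_fin_succ_arrow, fn_fn_apply, e]
  rw [sum_rotate_tensor]
  refine sum_congr rfl fun I _ => ?_
  rw [← sum_fn_apply₂]
  exact sum_congr rfl fun μ _ => sum_congr rfl fun ν _ => by
    rw [mul_comm (B.invMetric μ ν)]; rfl

end Contractions

section KetTensors

variable {k d : ℕ} {U : Opens (Fin d → ℝ)} (B : Background U) {Ω : Wave 2 k U} (hΩ : IsRef Ω)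
  (r : Fin k)

theorem ketPP_swap (Ω : Wave 2 k U) (μ ν : Fin d) : ketPP B Ω ![μ, ν] = ketPP B Ω ![ν, μ] := by
  have h := psi_psi_apply B Ω 0 1 μ ν
  have h' := psi_psi_apply B Ω 1 0 μ ν
  simp only [ketPP, ket, psiV, cons_val_zero, cons_val_one, h, h']
  abel

theorem fin_two_eta (I : Fin 2 → Fin d) : ![I 0, I 1] = I := by
  funext j; fin_cases j <;> rfl

theorem fin_one_eta (I : Fin 1 → Fin d) : ![I 0] = I := by
  funext j; fin_cases j; rfl

/-- `S^μ ∇̂_μ`. -/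
def dirac : Op 2 k U := ∑ μ, superS B μ * hatNabla B μ

theorem curvCoupling_apply_of_ricciFlat (hB : B.IsRicciFlat) (κ : ℂ) (Ψ : Wave 2 k U) :
    curvCoupling B κ Ψ = -∑ μ, ∑ ν, ∑ a, ∑ b, fn (B.riemann μ ν a b)
      (∑ i, ∑ j, psi B i μ (psi B j a (psiBar B i ν (psiBar B j b Ψ)))) := by
  have hR : B.scalarCurvature = 0 := by
    rw [Background.scalarCurvature]
    exact sum_eq_zero fun μ _ => sum_eq_zero fun ν _ => by rw [hB, mul_zero]
  have e : (curvCoupling B κ : Op 2 k U) Ψ =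
      ∑ μ, ∑ ν, ∑ a, ∑ b, fn (B.riemann μ ν a b) (psiPsiBar B μ ν (psiPsiBar B a b Ψ)) := by
    simp only [curvCoupling, LinearMap.sum_apply, mul_apply, hR, fn_zero, smul_zero,
      add_zero]
  rw [e]
  simp only [psiPsiBar_psiPsiBar_apply, map_sub, fn_fn_apply, sum_sub_distrib]
  rw [sub_eq_neg_self]
  refine sum_eq_zero fun μ _ => ?_
  rw [sum_rotate₃]
  refine sum_eq_zero fun b _ => ?_
  have h1 := B.sum_invMetric_riemann_mid μ b
  rw [hB, neg_zero] at h1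
  rw [sum_fn_apply₂]
  simp only [mul_comm (B.riemann _ _ _ _), h1, fn_zero, LinearMap.zero_apply]

theorem curvCoupling_apply_eq_zero (hB : B.IsRicciFlat) (κ : ℂ) {Ψ : Wave 2 k U}
    (h : ∀ i j ν b, psiBar B i ν (psiBar B j b Ψ) = 0) : curvCoupling B κ Ψ = 0 := by
  rw [curvCoupling_apply_of_ricciFlat B hB]
  simp only [h, map_zero, sum_const_zero, neg_zero]

include hΩ

theorem dirac_ketPP {h : Tensor 2 U} (hs : IsSymm h) :
    dirac B (ten (ketPP B Ω) h) = (-2 : ℂ) • ten (ketPG B Ω) (div B h) := by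
  have h1 := superS_hatNabla_ten B (isCovariant_ketPP B hΩ)
    (W := fun I => -fn (B.invMetric (I 0) (I 1)) (ketPG B Ω ![I 2])
      - fn (B.invMetric (I 0) (I 2)) (ketPG B Ω ![I 1])) (superS_ketPP B hΩ) h
  have hc : ∀ μ ν ρ, cov B h (Fin.cons μ (Fin.cons ν (Fin.cons ρ ![]))) =
      cov B h (Fin.cons μ (Fin.cons ρ (Fin.cons ν ![]))) := by
    have e : ∀ μ ν ρ, cov B h (Fin.cons μ (Fin.cons ν (Fin.cons ρ ![]))) =
        partialD μ (h ![ν, ρ]) - (∑ l, B.christoffel l μ ν * h ![l, ρ]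
          + ∑ l, B.christoffel l μ ρ * h ![ν, l]) := fun μ ν ρ => by
      have e1 : cov B h (Fin.cons μ (Fin.cons ν (Fin.cons ρ ![]))) =
        partialD μ (h ![ν, ρ]) - ∑ j : Fin 2, ∑ l, B.christoffel l μ (![ν, ρ] j) *
          h (Function.update ![ν, ρ] j l) := rfl
      rw [e1, Fin.sum_univ_two]
      have u0 : ∀ l, Function.update ![ν, ρ] 0 l = ![l, ρ] := fun l => by
        funext j; fin_cases j <;> rfl
      have u1 : ∀ l, Function.update ![ν, ρ] 1 l = ![ν, l] := fun l => by
        funext j; fin_cases j <;> rfl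
      simp only [u0, u1]
      rfl
    intro μ ν ρ
    rw [e, e, hs ν ρ]
    simp only [hs _ ρ, hs ν _]
    ring
  have h2 : ten (fun I : Fin 3 → Fin d => fn (B.invMetric (I 0) (I 1)) (ketPG B Ω ![I 2]))
      (cov B h) = ten (ketPG B Ω) (div B h) := by
    refine Eq.trans ?_ (ten_contract B (K := ketPG B Ω) (cov B h))
    refine congrArg (fun Z => ten Z (cov B h)) (funext fun I => ?_)
    exact congrArg _ (congrArg _ (fin_one_eta (fun j => I j.succ.succ)))
  have h3 : ten (fun I : Fin 3 → Fin d => fn (B.invMetric (I 0) (I 2)) (ketPG B Ω ![I 1]))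
      (cov B h) = ten (fun I : Fin 3 → Fin d => fn (B.invMetric (I 0) (I 1)) (ketPG B Ω ![I 2]))
      (cov B h) := by
    simp only [ten, sum_fin_succ_arrow, sum_fin_zero_arrow]
    refine sum_congr rfl fun μ _ => ?_
    rw [sum_comm]
    exact sum_congr rfl fun ν _ => sum_congr rfl fun ρ _ => by rw [hc]; rfl
  have h4 : ten (fun I : Fin 3 → Fin d => -fn (B.invMetric (I 0) (I 1)) (ketPG B Ω ![I 2])
      - fn (B.invMetric (I 0) (I 2)) (ketPG B Ω ![I 1])) (cov B h) =
      -ten (fun I : Fin 3 → Fin d => fn (B.invMetric (I 0) (I 1)) (ketPG B Ω ![I 2])) (cov B h)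
      - ten (fun I : Fin 3 → Fin d => fn (B.invMetric (I 0) (I 2)) (ketPG B Ω ![I 1]))
        (cov B h) := by
    simp only [ten, map_sub, map_neg, sum_sub_distrib, sum_neg_distrib]
  rw [dirac]
  refine h1.trans ?_
  rw [h4, h3, h2]
  module

theorem dirac_ketGB (f : Tensor 0 U) :
    dirac B (ten (ketGB Ω) f) = ten (ketPG B Ω) (cov B f) :=
  superS_hatNabla_ten B (isCovariant_ketGB B hΩ) (fun μ I => by
    rw [superS_ketGB B hΩ]
    exact congrArg _ (funext fun j => by fin_cases j; rfl)) f

theorem dirac_ketTB (f : Tensor 0 U) :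
    dirac B (ten (ketTB r Ω) f) = ten (ketTP B r Ω) (cov B f) :=
  superS_hatNabla_ten B (isCovariant_ketTB B hΩ r) (fun μ I => by
    rw [superS_ketTB B hΩ]
    exact congrArg _ (funext fun j => by fin_cases j; rfl)) f

theorem dirac_ketTT (f : Tensor 0 U) : dirac B (ten (ketTT r Ω) f) = 0 := by
  have h1 := superS_hatNabla_ten B (isCovariant_ketTT B hΩ r)
    (W := fun _ => 0) (superS_ketTT B hΩ r) f
  refine h1.trans ?_
  simp only [ten, map_zero, sum_const_zero]

theorem dirac_ketTP (A : Tensor 1 U) :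
    dirac B (ten (ketTP B r Ω) A) = -ten (ketTG r Ω) (div B A) := by
  have h1 := superS_hatNabla_ten B (isCovariant_ketTP B hΩ r)
    (W := fun I => -fn (B.invMetric (I 0) (I 1)) (ketTG r Ω ![])) (superS_ketTP B hΩ r) A
  refine h1.trans ?_
  rw [div, LinearMap.comp_apply, ← ten_contract B (K := ketTG r Ω) (cov B A)]
  simp only [ten, map_neg, sum_neg_distrib]
  rfl

theorem dirac_ketPB (v : Tensor 1 U) :
    dirac B (ten (ketPB B Ω) v) = ten (ketGB Ω) (div B v) + ten (ketPP B Ω) (cov B v) := by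
  have h1 := superS_hatNabla_ten B (isCovariant_ketPB B hΩ)
    (W := fun I => fn (B.invMetric (I 0) (I 1)) (ketGB Ω ![]) + ketPP B Ω ![I 0, I 1])
    (superS_ketPB B hΩ) v
  refine h1.trans ?_
  rw [div, LinearMap.comp_apply, ← ten_contract B (K := ketGB Ω) (cov B v)]
  simp only [ten, map_add, sum_add_distrib, fin_two_eta]
  rfl

theorem curvCoupling_ketPP (hB : B.IsRicciFlat) (κ : ℂ) {h : Tensor 2 U} (hs : IsSymm h) :
    curvCoupling B κ (ten (ketPP B Ω) h) = ten (ketPP B Ω) ((2 : ℂ) • riemannAct B h) := by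
  have e1 : ∀ (I : Fin 2 → Fin d) μ ν a b,
      ∑ i, ∑ j, psi B i μ (psi B j a (psiBar B i ν (psiBar B j b (ketPP B Ω I)))) =
      -fn (B.invMetric ν (I 0) * B.invMetric b (I 1) + B.invMetric b (I 0) * B.invMetric ν (I 1))
        (ketPP B Ω ![μ, a]) := fun I μ ν a b => by
    have q1 : ∀ i m β σ, psiBar B i β (psi B m σ Ω) =
        if i = m then fn (B.invMetric β σ) Ω else 0 := fun i m β σ => by
      rw [psiBar_psi_apply, hΩ.psiBar, map_zero, sub_zero]
    have q2 : ∀ j l m ρ σ, psiBar B j b (psi B l ρ (psi B m σ Ω)) =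
        (if j = l then fn (B.invMetric b ρ) (psi B m σ Ω) else 0)
          - if j = m then fn (B.invMetric b σ) (psi B l ρ Ω) else 0 := fun j l m ρ σ => by
      rw [psiBar_psi_apply, q1, apply_ite (psi B l ρ), psi_fn, map_zero]
    have z : (0 : Fin 2) ≠ 1 := zero_ne_one
    have o : (1 : Fin 2) ≠ 0 := one_ne_zero
    simp only [Fin.sum_univ_two, ketPP, ket, psiV, map_sub, q2, if_true, if_neg z, if_neg o,
      map_zero, psiBar_fn, q1, psi_fn, sub_zero, zero_sub, fn_fn_apply, fn_add,
      LinearMap.add_apply, cons_val_zero, cons_val_one, sub_neg_eq_add]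
    rw [mul_comm (B.invMetric b (I 1)), mul_comm (B.invMetric b (I 0))]
    abel
  have e2 : ∀ μ ν a b, ∑ i, ∑ j, psi B i μ (psi B j a (psiBar B i ν (psiBar B j b
      (ten (ketPP B Ω) h)))) =
      -fn ((2 : ℂ) • ∑ ρ, ∑ σ, B.invMetric ν ρ * B.invMetric b σ * h ![ρ, σ])
        (ketPP B Ω ![μ, a]) := fun μ ν a b => by
    have e3 : ∑ i, ∑ j, psi B i μ (psi B j a (psiBar B i ν (psiBar B j b
        (ten (ketPP B Ω) h)))) = ∑ I, fn (h I) (∑ i, ∑ j, psi B i μ (psi B j a (psiBar B i ν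
          (psiBar B j b (ketPP B Ω I))))) := by
      simp only [ten, map_sum, psiBar_fn, psi_fn]
      exact sum_rotate_tensor _
    simp only [e3, e1, map_neg, fn_fn_apply, sum_neg_distrib]
    rw [← LinearMap.sum_apply, ← fn_sum]
    refine congrArg (fun f => -fn f (ketPP B Ω ![μ, a])) ?_
    rw [sum_fin_two_arrow, two_smul]
    simp only [mul_add, sum_add_distrib]
    refine congrArg₂ (· + ·) ?_ ?_
    · exact sum_congr rfl fun ρ _ => sum_congr rfl fun σ _ => mul_comm _ _
    · rw [sum_comm]
      refine sum_congr rfl fun ρ _ => sum_congr rfl fun σ _ => ?_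
      rw [hs σ ρ, mul_comm]
      exact congrArg (· * _) (mul_comm _ _)
  rw [curvCoupling_apply_of_ricciFlat B hB]
  simp only [e2, map_neg, fn_fn_apply, sum_neg_distrib, neg_neg]
  rw [ten, sum_fin_two_arrow]
  refine sum_congr rfl fun μ _ => ?_
  rw [sum_comm]
  refine sum_congr rfl fun a _ => ?_
  rw [sum_fn_apply₂]
  refine congrArg (fun f => fn f (ketPP B Ω ![μ, a])) ?_
  simp only [mul_smul_comm, ← smul_sum, mul_sum, Pi.smul_apply]
  refine congrArg _ ?_
  refine sum_congr rfl fun ν _ => sum_congr rfl fun b _ =>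
    sum_congr rfl fun ρ _ => sum_congr rfl fun σ _ => ?_
  simp only [cons_val_zero, cons_val_one]
  ring

end KetTensors

section Charge

variable {k d r : ℕ} {U : Opens (Fin d → ℝ)} (B : Background U)

theorem hamiltonianD_ten {Z : (Fin r → Fin d) → Wave 2 k U} (hZ : IsCovariant B Z) (κ : ℂ) (m : ℝ)
    (T : Tensor r U) : hamiltonianD B κ m (ten Z T) =
      ten Z (box B T - (m : ℂ) ^ 2 • T) + curvCoupling B κ (ten Z T) := by
  rw [hamiltonianD, LinearMap.add_apply, LinearMap.sub_apply, laplacian_ten hZ, ten_sub, ten_smul]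
  rfl

theorem curvCoupling_ten_eq_zero (hB : B.IsRicciFlat) (κ : ℂ) {Z : (Fin r → Fin d) → Wave 2 k U}
    (h : ∀ i j ν b I, psiBar B i ν (psiBar B j b (Z I)) = 0) (T : Tensor r U) :
    curvCoupling B κ (ten Z T) = 0 := by
  refine curvCoupling_apply_eq_zero B hB κ fun i j ν b => ?_
  rw [map_ten fun f Φ => psiBar_fn B Φ f j b, map_ten fun f Φ => psiBar_fn B Φ f i ν]
  simp only [ten, h, map_zero, sum_const_zero]

theorem boldNabla_apply (m : ℝ) (Ψ : Wave 2 k U) :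
    boldNabla B m Ψ = (-Complex.I) • dirac B Ψ + (m : ℂ) • (rho : Op 2 k U) Ψ := rfl

theorem brst_apply (κ : ℂ) (m : ℝ) (Ψ : Wave 2 k U) : brst B κ m Ψ =
    cGhost (hamiltonianD B κ m Ψ) + boldNabla B m Ψ + (gamBarGam : Op 2 k U) (bGhost Ψ) := rfl

end Charge

section Massive

variable {d : ℕ} {U : Opens (Fin d → ℝ)} (B : Background U) (hB : B.IsRicciFlat)
  {Ω : Wave 2 1 U} (hΩ : IsRef Ω) (m : ℝ)

section

include hΩ

theorem psiBar_psiBar_ketPB (i j : Fin 2) (ν b : Fin d) (I) :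
    psiBar B i ν (psiBar B j b (ketPB B Ω I)) = 0 := by
  simp only [ketPB, ket, psiV, map_sub, psiBar_psi_apply, psiBar_bet_apply, hΩ.psiBar, map_zero,
    sub_zero]
  split_ifs <;> simp only [psiBar_fn, psiBar_bet_apply, hΩ.psiBar, map_zero, sub_zero]

theorem psiBar_psiBar_ketTP (i j : Fin 2) (ν b : Fin d) (I) :
    psiBar B i ν (psiBar B j b (ketTP B 0 Ω I)) = 0 := by
  simp only [ketTP, ket, psiV, thetaV, map_sub, psiBar_psi_apply, psiBar_theta_apply, hΩ.psiBar,
    map_zero, sub_zero, map_neg]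
  split_ifs <;> simp only [psiBar_fn, hΩ.psiBar, map_zero, sub_zero,
    neg_zero]

theorem psiBar_psiBar_ketGB (i j : Fin 2) (ν b : Fin d) (I) :
    psiBar B i ν (psiBar B j b (ketGB Ω I)) = 0 := by
  simp only [ketGB, ket, map_sub, psiBar_gam_apply, psiBar_bet_apply, hΩ.psiBar,
    map_zero, sub_zero]

theorem psiBar_psiBar_ketTT (i j : Fin 2) (ν b : Fin d) (I) :
    psiBar B i ν (psiBar B j b (ketTT 0 Ω I)) = 0 := by
  simp only [ketTT, ket, thetaV, map_sub, psiBar_theta_apply, hΩ.psiBar,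
    map_zero, sub_zero, neg_zero]

theorem psiBar_psiBar_ketTB (i j : Fin 2) (ν b : Fin d) (I) :
    psiBar B i ν (psiBar B j b (ketTB 0 Ω I)) = 0 := by
  simp only [ketTB, ket, thetaV, map_sub, psiBar_theta_apply, psiBar_bet_apply, hΩ.psiBar,
    map_zero, sub_zero, neg_zero]

theorem bold_ketPP {h : Tensor 2 U} (hs : IsSymm h) : boldNabla B m (ten (ketPP B Ω) h) =
    (2 * Complex.I) • ten (ketPG B Ω) (div B h) := by
  rw [boldNabla_apply, dirac_ketPP B hΩ hs, map_ten fun f Φ => rho_fn Φ f]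
  simp only [rho_ketPP B hΩ, ten, map_zero, sum_const_zero]
  module

theorem bold_ketGB (f : Tensor 0 U) : boldNabla B m (ten (ketGB Ω) f) =
    (-Complex.I) • ten (ketPG B Ω) (cov B f) + (m : ℂ) • ten (ketTG 0 Ω) f := by
  rw [boldNabla_apply, dirac_ketGB B hΩ, map_ten fun f Φ => rho_fn Φ f]
  simp only [rho_ketGB hΩ]

theorem bold_ketPB (v : Tensor 1 U) : boldNabla B m (ten (ketPB B Ω) v) =
    (-Complex.I) • (ten (ketGB Ω) (div B v) + ten (ketPP B Ω) (cov B v))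
      + (m : ℂ) • ten (ketTP B 0 Ω) v := by
  rw [boldNabla_apply, dirac_ketPB B hΩ, map_ten fun f Φ => rho_fn Φ f]
  simp only [rho_ketPB B hΩ]

theorem bold_ketTP (A : Tensor 1 U) : boldNabla B m (ten (ketTP B 0 Ω) A) =
    Complex.I • ten (ketTG 0 Ω) (div B A) - (m : ℂ) • ten (ketPG B Ω) A := by
  rw [boldNabla_apply, dirac_ketTP B hΩ, map_ten fun f Φ => rho_fn Φ f]
  simp only [rho_ketTP B hΩ]
  have e : ten (fun I => -ketPG B Ω I) A = -ten (ketPG B Ω) A := by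
    simp only [ten, map_neg, sum_neg_distrib]
  rw [e]
  module

theorem bold_ketTT (f : Tensor 0 U) : boldNabla B m (ten (ketTT 0 Ω) f) =
    (-2 * m : ℂ) • ten (ketTG 0 Ω) f := by
  rw [boldNabla_apply, dirac_ketTT B hΩ, map_ten fun f Φ => rho_fn Φ f]
  simp only [rho_ketTT hΩ]
  have e : ten (fun I => (-2 : ℂ) • ketTG 0 Ω I) f = (-2 : ℂ) • ten (ketTG 0 Ω) f := by
    simp only [ten, map_smul, smul_sum]
  rw [e]
  module

theorem bold_ketTB (f : Tensor 0 U) : boldNabla B m (ten (ketTB 0 Ω) f) =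
    (-Complex.I) • ten (ketTP B 0 Ω) (cov B f)
      + (m : ℂ) • (ten (ketGB Ω) f + ten (ketTT 0 Ω) f) := by
  rw [boldNabla_apply, dirac_ketTB B hΩ, map_ten fun f Φ => rho_fn Φ f]
  simp only [rho_ketTB hΩ]
  have e : ten (fun I => ketGB Ω I + ketTT 0 Ω I) f = ten (ketGB Ω) f + ten (ketTT 0 Ω) f := by
    simp only [ten, map_add, sum_add_distrib]
  rw [e]

end

theorem ten_eq_zero {n k r : ℕ} {Z : (Fin r → Fin d) → Wave n k U} (h : ∀ I, Z I = 0)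
    (T : Tensor r U) : ten Z T = 0 := by
  simp only [ten, h, map_zero, sum_const_zero]

theorem ten_neg_left {n k r : ℕ} {Z Z' : (Fin r → Fin d) → Wave n k U} (h : ∀ I, Z I = -Z' I)
    (T : Tensor r U) : ten Z T = -ten Z' T := by
  simp only [ten, h, map_neg, sum_neg_distrib]

theorem cGhost_ten {n k r : ℕ} (Z : (Fin r → Fin d) → Wave n k U) (T : Tensor r U) :
    cGhost (ten Z T) = ten (fun I => cGhost (Z I)) T := map_ten (fun f Φ => cGhost_fn Φ f) Z T

theorem bGhost_ten {n k r : ℕ} (Z : (Fin r → Fin d) → Wave n k U) (T : Tensor r U) :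
    bGhost (ten Z T) = ten (fun I => bGhost (Z I)) T := map_ten (fun f Φ => bGhost_fn Φ f) Z T

theorem gamBarGam_ten {n k r : ℕ} (Z : (Fin r → Fin d) → Wave n k U) (T : Tensor r U) :
    (gamBarGam : Op n k U) (ten Z T) = ten (fun I => (gamBarGam : Op n k U) (Z I)) T :=
  map_ten (fun f Φ => gamBarGam_fn f Φ) Z T

variable (d U) in
abbrev vac : Wave 2 1 U := vacuum

variable (d U) in
abbrev cvac : Wave 2 1 U := cGhost vacuum

theorem isRef_vac : IsRef (vac d U) := isRef_vacuum

theorem isRef_cvac : IsRef (cvac d U) := isRef_vacuum.cGhost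

theorem bGhost_cvac : bGhost (cvac d U) = vac d U := by
  rw [bGhost_cGhost_apply, bGhost_vacuum, map_zero, sub_zero]

theorem cGhost_cvac : cGhost (cvac d U) = 0 := cGhost_cGhost_apply _

include hB

theorem massiveQ_ketPP {h : Tensor 2 U} (hs : IsSymm h) :
    massiveQ B m (ten (ketPP B (vac d U)) h) =
      ten (ketPP B (cvac d U)) (box B h - (m : ℂ) ^ 2 • h + (2 : ℂ) • riemannAct B h)
        + (2 * Complex.I) • ten (ketPG B (vac d U)) (div B h) := by
  rw [massiveQ, brst_apply, hamiltonianD_ten B (isCovariant_ketPP B isRef_vac),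
    curvCoupling_ketPP B isRef_vac hB _ hs, ← ten_add, bold_ketPP B isRef_vac m hs, cGhost_ten,
    bGhost_ten]
  simp only [cGhost_ketPP, bGhost_ketPP, bGhost_vacuum]
  rw [ten_eq_zero (Z := ketPP B 0) (fun I => ket_zero _ _), map_zero, add_zero]

theorem massiveQ_ketGB (f : Tensor 0 U) : massiveQ B m (ten (ketGB (vac d U)) f) =
    ten (ketGB (cvac d U)) (box B f - (m : ℂ) ^ 2 • f)
      - Complex.I • ten (ketPG B (vac d U)) (cov B f) + (m : ℂ) • ten (ketTG 0 (vac d U)) f := by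
  rw [massiveQ, brst_apply, hamiltonianD_ten B (isCovariant_ketGB B isRef_vac),
    curvCoupling_ten_eq_zero B hB _ (psiBar_psiBar_ketGB B isRef_vac), add_zero,
    bold_ketGB B isRef_vac m, cGhost_ten, bGhost_ten]
  simp only [cGhost_ketGB, bGhost_ketGB, bGhost_vacuum]
  rw [ten_eq_zero (Z := ketGB 0) (fun I => ket_zero _ _), map_zero]
  have e : ten (fun I => ketGB (cGhost (vac d U)) I) (box B f - (m : ℂ) ^ 2 • f) =
    ten (ketGB (cvac d U)) (box B f - (m : ℂ) ^ 2 • f) := rfl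
  rw [e]
  module

theorem massiveQ_ketTP (A : Tensor 1 U) : massiveQ B m (ten (ketTP B 0 (vac d U)) A) =
    ten (ketTP B 0 (cvac d U)) (box B A - (m : ℂ) ^ 2 • A)
      + Complex.I • ten (ketTG 0 (vac d U)) (div B A) - (m : ℂ) • ten (ketPG B (vac d U)) A := by
  rw [massiveQ, brst_apply, hamiltonianD_ten B (isCovariant_ketTP B isRef_vac 0),
    curvCoupling_ten_eq_zero B hB _ (psiBar_psiBar_ketTP B isRef_vac), add_zero,
    bold_ketTP B isRef_vac m, cGhost_ten, bGhost_ten]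
  simp only [cGhost_ketTP, bGhost_ketTP, bGhost_vacuum]
  rw [ten_eq_zero (Z := ketTP B 0 0) (fun I => ket_zero _ _), map_zero]
  have e : ten (fun I => ketTP B 0 (cGhost (vac d U)) I) (box B A - (m : ℂ) ^ 2 • A) =
    ten (ketTP B 0 (cvac d U)) (box B A - (m : ℂ) ^ 2 • A) := rfl
  rw [e]
  module

theorem massiveQ_ketTT (f : Tensor 0 U) : massiveQ B m (ten (ketTT 0 (vac d U)) f) =
    ten (ketTT 0 (cvac d U)) (box B f - (m : ℂ) ^ 2 • f)
      - (2 * m : ℂ) • ten (ketTG 0 (vac d U)) f := by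
  rw [massiveQ, brst_apply, hamiltonianD_ten B (isCovariant_ketTT B isRef_vac 0),
    curvCoupling_ten_eq_zero B hB _ (psiBar_psiBar_ketTT B isRef_vac), add_zero,
    bold_ketTT B isRef_vac m, cGhost_ten, bGhost_ten]
  simp only [cGhost_ketTT, bGhost_ketTT, bGhost_vacuum]
  rw [ten_eq_zero (Z := ketTT 0 0) (fun I => ket_zero _ _), map_zero]
  have e : ten (fun I => ketTT 0 (cGhost (vac d U)) I) (box B f - (m : ℂ) ^ 2 • f) =
    ten (ketTT 0 (cvac d U)) (box B f - (m : ℂ) ^ 2 • f) := rfl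
  rw [e]
  module

theorem massiveQ_ketPB (v : Tensor 1 U) : massiveQ B m (ten (ketPB B (vac d U)) v) =
    -ten (ketPB B (cvac d U)) (box B v - (m : ℂ) ^ 2 • v)
      - Complex.I • (ten (ketGB (vac d U)) (div B v) + ten (ketPP B (vac d U)) (cov B v))
      + (m : ℂ) • ten (ketTP B 0 (vac d U)) v := by
  rw [massiveQ, brst_apply, hamiltonianD_ten B (isCovariant_ketPB B isRef_vac),
    curvCoupling_ten_eq_zero B hB _ (psiBar_psiBar_ketPB B isRef_vac), add_zero,
    bold_ketPB B isRef_vac m, cGhost_ten, bGhost_ten,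
    ten_neg_left (fun I => cGhost_ketPB B (Ω := vac d U) I)]
  have e : ten (fun I => bGhost (ketPB B (vac d U) I)) v = 0 :=
    ten_eq_zero (fun I => by rw [bGhost_ketPB, bGhost_vacuum, ketPB, ket_zero, neg_zero]) v
  rw [e, map_zero]
  have e : ten (fun I => ketPB B (cGhost (vac d U)) I) (box B v - (m : ℂ) ^ 2 • v) =
    ten (ketPB B (cvac d U)) (box B v - (m : ℂ) ^ 2 • v) := rfl
  rw [e]
  module

theorem massiveQ_ketTB (f : Tensor 0 U) : massiveQ B m (ten (ketTB 0 (vac d U)) f) =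
    -ten (ketTB 0 (cvac d U)) (box B f - (m : ℂ) ^ 2 • f)
      - Complex.I • ten (ketTP B 0 (vac d U)) (cov B f)
      + (m : ℂ) • (ten (ketGB (vac d U)) f + ten (ketTT 0 (vac d U)) f) := by
  rw [massiveQ, brst_apply, hamiltonianD_ten B (isCovariant_ketTB B isRef_vac 0),
    curvCoupling_ten_eq_zero B hB _ (psiBar_psiBar_ketTB B isRef_vac), add_zero,
    bold_ketTB B isRef_vac m, cGhost_ten, bGhost_ten,
    ten_neg_left (fun I => cGhost_ketTB 0 (Ω := vac d U) I)]
  have e : ten (fun I => bGhost (ketTB 0 (vac d U) I)) f = 0 :=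
    ten_eq_zero (fun I => by rw [bGhost_ketTB, bGhost_vacuum, ketTB, ket_zero, neg_zero]) f
  rw [e, map_zero]
  have e : ten (fun I => ketTB 0 (cGhost (vac d U)) I) (box B f - (m : ℂ) ^ 2 • f) =
    ten (ketTB 0 (cvac d U)) (box B f - (m : ℂ) ^ 2 • f) := rfl
  rw [e]
  module

theorem massiveQ_ketPB_cvac (v : Tensor 1 U) : massiveQ B m (ten (ketPB B (cvac d U)) v) =
    (-Complex.I) • (ten (ketGB (cvac d U)) (div B v) + ten (ketPP B (cvac d U)) (cov B v))
      + (m : ℂ) • ten (ketTP B 0 (cvac d U)) v + ten (ketPG B (vac d U)) v := by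
  rw [massiveQ, brst_apply, hamiltonianD_ten B (isCovariant_ketPB B isRef_cvac),
    curvCoupling_ten_eq_zero B hB _ (psiBar_psiBar_ketPB B isRef_cvac), add_zero,
    bold_ketPB B isRef_cvac m, cGhost_ten, bGhost_ten,
    ten_neg_left (fun I => bGhost_ketPB B (Ω := cvac d U) I), bGhost_cvac, map_neg, gamBarGam_ten,
    ten_neg_left (fun I => gamBarGam_ketPB B isRef_vac I)]
  have e : ten (fun I => cGhost (ketPB B (cvac d U) I)) (box B v - (m : ℂ) ^ 2 • v) = 0 :=
    ten_eq_zero (fun I => by rw [cGhost_ketPB, cGhost_cvac, ketPB, ket_zero, neg_zero]) _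
  rw [e, zero_add, neg_neg]

theorem massiveQ_ketTB_cvac (f : Tensor 0 U) : massiveQ B m (ten (ketTB 0 (cvac d U)) f) =
    (-Complex.I) • ten (ketTP B 0 (cvac d U)) (cov B f)
      + (m : ℂ) • (ten (ketGB (cvac d U)) f + ten (ketTT 0 (cvac d U)) f)
      + ten (ketTG 0 (vac d U)) f := by
  rw [massiveQ, brst_apply, hamiltonianD_ten B (isCovariant_ketTB B isRef_cvac 0),
    curvCoupling_ten_eq_zero B hB _ (psiBar_psiBar_ketTB B isRef_cvac), add_zero,
    bold_ketTB B isRef_cvac m, cGhost_ten, bGhost_ten,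
    ten_neg_left (fun I => bGhost_ketTB 0 (Ω := cvac d U) I), bGhost_cvac, map_neg, gamBarGam_ten,
    ten_neg_left (fun I => gamBarGam_ketTB isRef_vac 0 I)]
  have e : ten (fun I => cGhost (ketTB 0 (cvac d U) I)) (box B f - (m : ℂ) ^ 2 • f) = 0 :=
    ten_eq_zero (fun I => by rw [cGhost_ketTB, cGhost_cvac, ketTB, ket_zero, neg_zero]) _
  rw [e, zero_add, neg_neg]

end Massive

section Fields

variable {d : ℕ} {U : Opens (Fin d → ℝ)} (B : Background U)

theorem ten_ketPP_eq {Ω : Wave 2 1 U} {h : Tensor 2 U} (hs : IsSymm h) :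
    ten (ketPP B Ω) h = (2 : ℂ) • ∑ μ, ∑ ν, fn (h ![μ, ν]) (psi B 0 μ (psi B 1 ν Ω)) := by
  have e : ∀ μ ν, ketPP B Ω ![μ, ν] = psi B 0 μ (psi B 1 ν Ω) + psi B 0 ν (psi B 1 μ Ω) :=
    fun μ ν => by
      have h' := psi_psi_apply B Ω 1 0 μ ν
      simp only [ketPP, ket, psiV, cons_val_zero, cons_val_one, h', sub_neg_eq_add]
  simp only [ten, sum_fin_two_arrow, e, map_add, sum_add_distrib]
  rw [two_smul, sum_comm (f := fun μ ν => fn (h ![μ, ν]) (psi B 0 ν (psi B 1 μ Ω)))]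
  refine congrArg₂ (· + ·) rfl ?_
  exact sum_congr rfl fun μ _ => sum_congr rfl fun ν _ => by rw [hs ν μ]

theorem stringField_eq {h : Tensor 2 U} (hs : IsSymm h) (v A : Tensor 1 U) (φ aux : Tensor 0 U) :
    stringField B h v A φ aux = (1 / 2 : ℂ) • ten (ketPP B (vac d U)) h
      + ten (ketGB (vac d U)) ((1 / 2 : ℂ) • tr B h - φ)
      - (Complex.I / 2) • ten (ketPB B (cvac d U)) v - Complex.I • ten (ketTP B 0 (vac d U)) A
      - ten (ketTT 0 (vac d U)) φ + ten (ketTB 0 (cvac d U)) aux := by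
  have e1 : (1 / 2 : ℂ) • ten (ketPP B (vac d U)) h =
      ∑ μ, ∑ ν, fn (h ![μ, ν]) (psi B 0 μ (psi B 1 ν vacuum)) := by
    rw [ten_ketPP_eq B hs, smul_smul]; norm_num
  have e2 : ten (ketGB (vac d U)) ((1 / 2 : ℂ) • tr B h - φ) =
      (1 / 2 : ℂ) • (fn (tr B h ![]) (gam 0 (bet 1 vacuum)) - fn (tr B h ![]) (gam 1 (bet 0 vacuum)))
        - (fn (φ ![]) (gam 0 (bet 1 vacuum)) - fn (φ ![]) (gam 1 (bet 0 vacuum))) := by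
    rw [ten_sub, ten_smul]
    simp only [ten, sum_fin_zero_arrow, ketGB, ket, map_sub]
  have e3 : ten (ketPB B (cvac d U)) v =
      ∑ μ, (fn (v ![μ]) (psi B 0 μ (bet 1 (cGhost vacuum)))
        - fn (v ![μ]) (psi B 1 μ (bet 0 (cGhost vacuum)))) := by
    simp only [ten, sum_fin_one_arrow, ketPB, ket, map_sub, psiV, cons_val_zero]
  have e4 : ten (ketTP B 0 (vac d U)) A =
      ∑ μ, (fn (A ![μ]) (theta 0 0 (psi B 1 μ vacuum))
        + fn (A ![μ]) (psi B 0 μ (theta 1 0 vacuum))) := by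
    have h' := fun μ => theta_psi_apply B (vac d U) 1 0 0 μ
    simp only [ten, sum_fin_one_arrow, ketTP, ket, psiV, thetaV, cons_val_zero, h',
      sub_neg_eq_add, map_add]
  have e5 : ten (ketTT 0 (vac d U)) φ = (2 : ℂ) • fn (φ ![]) (theta 0 0 (theta 1 0 vacuum)) := by
    have h' := theta_theta_apply (vac d U) 1 0 0 0
    simp only [ten, sum_fin_zero_arrow, ketTT, ket, thetaV, h', two_smul, sub_neg_eq_add, map_add]
  have e6 : ten (ketTB 0 (cvac d U)) aux = fn (aux ![]) (theta 0 0 (bet 1 (cGhost vacuum)))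
      - fn (aux ![]) (theta 1 0 (bet 0 (cGhost vacuum))) := by
    simp only [ten, sum_fin_zero_arrow, ketTB, ket, map_sub, thetaV]
  rw [e1, e2, e3, e4, e5, e6]
  simp only [stringField, LinearMap.add_apply, LinearMap.sub_apply, LinearMap.sum_apply,
    LinearMap.smul_apply, mul_apply, map_add, map_sub, map_smul]
  abel

theorem gaugeState_eq (ε : Tensor 1 U) (Sg : Tensor 0 U) :
    gaugeState B ε Sg =
      Complex.I • ten (ketPB B (vac d U)) ε + ten (ketTB 0 (vac d U)) Sg := by
  simp only [gaugeState, LinearMap.add_apply, LinearMap.sub_apply, LinearMap.sum_apply,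
    LinearMap.smul_apply, mul_apply, map_sub, ten, sum_fin_zero_arrow,
    sum_fin_one_arrow, ketPB, ketTB, ket, psiV, thetaV, cons_val_zero]

theorem ten_ketPP_symm2 (Ω : Wave 2 1 U) (T : Tensor 2 U) :
    ten (ketPP B Ω) (symm2 T) = (2 : ℂ) • ten (ketPP B Ω) T := by
  have e : symm2 T = (fun I => T ![I 0, I 1]) + fun I => T ![I 1, I 0] := rfl
  have e1 : ten (ketPP B Ω) (fun I => T ![I 1, I 0]) = ten (ketPP B Ω) T := by
    rw [ten, ten, sum_fin_two_arrow, sum_fin_two_arrow, sum_comm]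
    refine sum_congr rfl fun μ _ => sum_congr rfl fun ν _ => ?_
    rw [ketPP_swap]; rfl
  rw [e, ten_add, e1, two_smul]
  simp only [fin_two_eta]

theorem isSymm_symm2 (T : Tensor 2 U) : IsSymm (symm2 T) := fun _ _ => add_comm _ _

theorem tr_symm2 (T : Tensor 2 U) : tr B (symm2 T) = (2 : ℂ) • contract B T := by
  funext I
  have e : tr B (symm2 T) I =
      ∑ α, ∑ β, B.invMetric α β * (T ![α, β] + T ![β, α]) := rfl
  have e2 : ((2 : ℂ) • contract B T) I = (2 : ℂ) • ∑ α, ∑ β, B.invMetric α β * T ![α, β] := by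
    rw [Subsingleton.elim I ![]]; rfl
  rw [e, e2, two_smul]
  simp only [mul_add, sum_add_distrib]
  refine congrArg₂ (· + ·) rfl ?_
  rw [sum_comm]
  exact sum_congr rfl fun α _ => sum_congr rfl fun β _ => by rw [B.invMetric_symm]

/-- The general state of ghost number one that satisfies the constraints other than the trace. -/
def residual (a : Tensor 2 U) (p q : Tensor 0 U) (e u : Tensor 1 U) (w : Tensor 0 U) : Wave 2 1 U :=
  ten (ketPP B (cvac d U)) a + ten (ketGB (cvac d U)) p + ten (ketTT 0 (cvac d U)) q
    + ten (ketTP B 0 (cvac d U)) e + ten (ketPG B (vac d U)) u + ten (ketTG 0 (vac d U)) w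

variable (hB : B.IsRicciFlat) (m : ℝ)
include hB

theorem massiveQ_stringField {h : Tensor 2 U} (hs : IsSymm h) (v A : Tensor 1 U)
    (φ aux : Tensor 0 U) : massiveQ B m (stringField B h v A φ aux) = residual B
      ((1 / 2 : ℂ) • (box B h - (m : ℂ) ^ 2 • h + (2 : ℂ) • riemannAct B h)
        - (1 / 4 : ℂ) • symm2 (cov B v))
      (box B ((1 / 2 : ℂ) • tr B h - φ) - (m : ℂ) ^ 2 • ((1 / 2 : ℂ) • tr B h - φ)
        - (1 / 2 : ℂ) • div B v + (m : ℂ) • aux)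
      ((m : ℂ) • aux - (box B φ - (m : ℂ) ^ 2 • φ))
      ((-Complex.I) • (box B A - (m : ℂ) ^ 2 • A + ((m : ℂ) / 2) • v + cov B aux))
      (Complex.I • (div B h - cov B ((1 / 2 : ℂ) • tr B h - φ) + (m : ℂ) • A - (1 / 2 : ℂ) • v))
      ((m : ℂ) • ((1 / 2 : ℂ) • tr B h - φ) + div B A + (2 * m : ℂ) • φ + aux) := by
  rw [stringField_eq B hs, map_add (massiveQ B m), map_sub (massiveQ B m), map_sub (massiveQ B m),
    map_sub (massiveQ B m), map_add (massiveQ B m), map_smul (massiveQ B m),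
    map_smul (massiveQ B m), map_smul (massiveQ B m), massiveQ_ketPP B hB m hs,
    massiveQ_ketGB B hB, massiveQ_ketPB_cvac B hB, massiveQ_ketTP B hB, massiveQ_ketTT B hB,
    massiveQ_ketTB_cvac B hB, residual]
  generalize tr B h = t
  simp only [ten_add, ten_sub, ten_smul, ten_ketPP_symm2]
  match_scalars <;> first | ring1 | linear_combination (1 / 2) * Complex.I_sq | linear_combination -Complex.I_sq

theorem massiveQ_gaugeState (ε : Tensor 1 U) (Sg : Tensor 0 U) :
    massiveQ B m (gaugeState B ε Sg) = stringField B (symm2 (cov B ε))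
      ((2 : ℂ) • (box B ε - (m : ℂ) ^ 2 • ε)) (cov B Sg - (m : ℂ) • ε) (-((m : ℂ) • Sg))
      (-(box B Sg - (m : ℂ) ^ 2 • Sg)) := by
  have ht : tr B (symm2 (cov B ε)) = (2 : ℂ) • div B ε := tr_symm2 B _
  rw [gaugeState_eq, map_add, map_smul, massiveQ_ketPB B hB, massiveQ_ketTB B hB,
    stringField_eq B (isSymm_symm2 _), ht, ten_ketPP_symm2]
  simp only [ten_sub, ten_smul, ten_neg]
  match_scalars <;> first | ring1 | linear_combination (1 / 2) * Complex.I_sq | linear_combination -Complex.I_sq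

end Fields

section Slots

variable {n k d : ℕ} {U : Opens (Fin d → ℝ)} (B : Background U)

/-- `∂/∂ψ_i^μ = e^a_μ ∂/∂ψ_i^a`. -/
def psiLow (i : Fin n) (μ : Fin d) : Op n k U := ∑ a, fn (B.coframe a μ) * psiDer i a

theorem psiLow_psi (i j : Fin n) (μ ν : Fin d) : (psiLow B i μ * psi B j ν : Op n k U) =
    (if μ = ν ∧ i = j then 1 else 0) - psi B j ν * psiLow B i μ := by
  rw [psiLow, psi, fn_sum_mul_fn_sum_anticomm
    (K := fun a b => if i = j ∧ a = b then (1 : Op n k U) else 0)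
    (fun h a => commute_fn_psiDer h i a) (fun h a => commute_fn_psiFlat h j a)
    (fun a b => psiDer_psiFlat i j a b)]
  refine congrArg₂ (· - ·) ?_ rfl
  have e : (∑ a, B.coframe a μ * B.frame ν a) = if μ = ν then 1 else 0 := by
    have h := congrFun (congrFun B.frame_mul_coframe ν) μ
    rw [Matrix.mul_apply, Matrix.one_apply] at h
    simp only [mul_comm (B.coframe _ μ), h, eq_comm]
  by_cases h : i = j
  · simp only [h, true_and, mul_ite, mul_one, mul_zero, sum_ite_eq, mem_univ,
      if_true, ← fn_sum, e, and_true]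
    split_ifs
    · exact fn_one
    · exact fn_zero
  · simp [h]

theorem psiLow_anticomm {X : Op n k U} (hf : ∀ f, Commute (fn f) X) (i : Fin n)
    (h : ∀ a, X * psiDer i a = -(psiDer i a * X)) (μ : Fin d) :
    X * psiLow B i μ = -(psiLow B i μ * X) := by
  rw [psiLow, mul_sum, sum_mul, ← sum_neg_distrib]
  refine sum_congr rfl fun a _ => ?_
  rw [← mul_assoc, ← (hf _).eq, mul_assoc, h]; noncomm_ring

theorem CommutesWithEven.psiLow (i : Fin n) (μ : Fin d) :
    CommutesWithEven (psiLow B i μ : Op n k U) :=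
  .sum fun _ _ => (CommutesWithEven.fn _).mul (CommutesWithEven.oddDer _)

theorem commute_fn_psiLow (f : Fn U) (i : Fin n) (μ : Fin d) :
    Commute (fn f : Op n k U) (psiLow B i μ) :=
  Commute.fn_right_sum (fun _ => commute_fn_fn _ _) fun _ _ => commute_fn_psiDer _ _ _

theorem psiLow_psiLow (i j : Fin n) (μ ν : Fin d) :
    (psiLow B i μ * psiLow B j ν : Op n k U) = -(psiLow B j ν * psiLow B i μ) := by
  refine psiLow_anticomm B (fun f => commute_fn_psiLow B f i μ) j (fun a => ?_) ν
  have h := psiLow_anticomm (k := k) B (X := psiDer j a) (fun f => commute_fn_psiDer f j a) i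
    (fun b => psiDer_psiDer j i a b) μ
  rw [h, neg_neg]

theorem young_psiLow (i j l : Fin n) (μ : Fin d) : (young i j * psiLow B l μ : Op n k U) =
    psiLow B l μ * young i j - if l = i then psiLow B j μ else 0 := by
  simp only [psiLow, mul_sum, sum_mul]
  have h : ∀ a, (young i j * (fn (B.coframe a μ) * psiDer l a) : Op n k U) =
      fn (B.coframe a μ) * psiDer l a * young i j
        - if l = i then fn (B.coframe a μ) * psiDer j a else 0 := fun a => by
    rw [← mul_assoc, ← (commute_fn_young (k := k) _ _ _).eq, mul_assoc, young_psiDer, mul_sub,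
      mul_ite, mul_zero, mul_assoc]
  simp only [h, sum_sub_distrib]
  split_ifs <;> simp

theorem sum_psi_psiLow (i j : Fin n) :
    (∑ μ, psi B i μ * psiLow B j μ : Op n k U) = ∑ a, psiFlat i a * psiDer j a := by
  have e : ∀ μ, (psi B i μ * psiLow B j μ : Op n k U) =
      ∑ a, ∑ b, fn (B.coframe b μ * B.frame μ a) * (psiFlat i a * psiDer j b) := fun μ => by
    simp only [psi, psiLow, sum_mul, mul_sum]
    refine (sum_congr rfl fun b _ => sum_congr rfl fun a _ => ?_).trans
      sum_comm
    rw [fn_mul, mul_assoc, ← mul_assoc (psiFlat i _), ← (commute_fn_psiFlat (k := k) _ i _).eq,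
      mul_assoc, ← mul_assoc, (commute_fn_fn (k := k) (n := n) _ _).eq, mul_assoc]
  have e2 : ∀ a b, ∑ μ, B.coframe b μ * B.frame μ a = if b = a then 1 else 0 := fun a b => by
    have h := congrFun (congrFun B.coframe_mul_frame b) a
    rwa [Matrix.mul_apply, Matrix.one_apply] at h
  simp only [e]
  rw [sum_comm]
  refine sum_congr rfl fun a _ => ?_
  rw [sum_comm]
  simp only [← sum_mul, ← fn_sum, e2]
  rw [sum_eq_single a]
  · rw [if_pos rfl, fn_one, one_mul]
  · intro b _ hb
    rw [if_neg hb, fn_zero, zero_mul]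
  · simp

/-- The oscillators of one flavor of the massive model: `ψ^μ`, `θ`, `γ` and `β`. -/
abbrev Slot (d : ℕ) : Type := Fin d ⊕ Fin 3

def slotRaise : Slot d → Fin 2 → Op 2 1 U
  | .inl μ, i => psi B i μ
  | .inr 0, i => theta i 0
  | .inr 1, i => gam i
  | .inr 2, i => bet i

def slotLower : Slot d → Fin 2 → Op 2 1 U
  | .inl μ, i => psiLow B i μ
  | .inr 0, i => thetaBar i 0
  | .inr 1, i => betBar i
  | .inr 2, i => evenDer (Sum.inr i)

def slotParity : Slot d → Bool
  | .inl _ => true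
  | .inr 0 => true
  | .inr 1 => false
  | .inr 2 => false

def slotSign (A C : Slot d) : ℂ := if slotParity A && slotParity C then -1 else 1

def slotCharge : Slot d → ℤ
  | .inl _ => 0
  | .inr 0 => 0
  | .inr 1 => 1
  | .inr 2 => -1

theorem mul_eq_neg_one_smul {X Y : Op 2 1 U} (h : X * Y = -(Y * X)) :
    X * Y = (-1 : ℂ) • (Y * X) := by rw [h]; module

theorem mul_eq_one_smul {X Y : Op 2 1 U} (h : Commute X Y) : X * Y = (1 : ℂ) • (Y * X) := by
  rw [h.eq, one_smul]

theorem mul_eq_add_neg_one_smul {X Y Z : Op 2 1 U} (h : X * Y = Z - Y * X) :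
    X * Y = Z + (-1 : ℂ) • (Y * X) := by rw [h]; module

theorem mul_eq_zero_add_neg_one_smul {X Y : Op 2 1 U} (h : X * Y = -(Y * X)) :
    X * Y = 0 + (-1 : ℂ) • (Y * X) := by rw [h]; module

theorem mul_eq_zero_add_one_smul {X Y : Op 2 1 U} (h : Commute X Y) :
    X * Y = 0 + (1 : ℂ) • (Y * X) := by rw [h.eq, one_smul, zero_add]

theorem mul_eq_add_one_smul {X Y Z : Op 2 1 U} (h : X * Y = Z + Y * X) :
    X * Y = Z + (1 : ℂ) • (Y * X) := by rw [h, one_smul]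

theorem slotLower_slotLower (A C : Slot d) (i j : Fin 2) : (slotLower B A i * slotLower B C j) =
    slotSign A C • (slotLower B C j * slotLower B A i) := by
  have hp := CommutesWithEven.psiLow (k := 1) (n := 2) B
  have ht := CommutesWithEven.thetaBar (U := U) (k := 1) (n := 2)
  have htp : ∀ i j μ, (thetaBar i 0 * psiLow B j μ : Op 2 1 U) = -(psiLow B j μ * thetaBar i 0) :=
    fun i j => psiLow_anticomm B (fun f => commute_fn_oddDer f _) j fun a => oddDer_oddDer _ _
  rcases A with μ | a <;> rcases C with ν | c
  · exact mul_eq_neg_one_smul (psiLow_psiLow B i j μ ν)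
  · fin_cases c
    · exact mul_eq_neg_one_smul (neg_eq_iff_eq_neg.1 (htp j i μ).symm)
    · exact mul_eq_one_smul (hp i μ (Sum.inl j)).2.symm
    · exact mul_eq_one_smul (hp i μ (Sum.inr j)).2.symm
  · fin_cases a
    · exact mul_eq_neg_one_smul (htp i j ν)
    · exact mul_eq_one_smul (hp j ν (Sum.inl i)).2
    · exact mul_eq_one_smul (hp j ν (Sum.inr i)).2
  · fin_cases a <;> fin_cases c
    · exact mul_eq_neg_one_smul (thetaBar_thetaBar (U := U) i j 0 0)
    · exact mul_eq_one_smul (ht i 0 (Sum.inl j)).2.symm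
    · exact mul_eq_one_smul (ht i 0 (Sum.inr j)).2.symm
    · exact mul_eq_one_smul (ht j 0 (Sum.inl i)).2
    · exact mul_eq_one_smul (evenDer_evenDer _ _)
    · exact mul_eq_one_smul (evenDer_evenDer _ _)
    · exact mul_eq_one_smul (ht j 0 (Sum.inr i)).2
    · exact mul_eq_one_smul (evenDer_evenDer _ _)
    · exact mul_eq_one_smul (evenDer_evenDer _ _)

theorem slotRaise_slotRaise (A C : Slot d) (i j : Fin 2) : (slotRaise B A i * slotRaise B C j) =
    slotSign A C • (slotRaise B C j * slotRaise B A i) := by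
  have hp := CommutesWithEven.psi (k := 1) (n := 2) B
  have ht := CommutesWithEven.theta (U := U) (k := 1) (n := 2)
  rcases A with μ | a <;> rcases C with ν | c
  · exact mul_eq_neg_one_smul (psi_psi B i j μ ν)
  · fin_cases c
    · exact mul_eq_neg_one_smul (neg_eq_iff_eq_neg.1 (theta_psi B j i 0 μ).symm)
    · exact mul_eq_one_smul (hp i μ (Sum.inl j)).1.symm
    · exact mul_eq_one_smul (hp i μ (Sum.inr j)).1.symm
  · fin_cases a
    · exact mul_eq_neg_one_smul (theta_psi B i j 0 ν)
    · exact mul_eq_one_smul (hp j ν (Sum.inl i)).1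
    · exact mul_eq_one_smul (hp j ν (Sum.inr i)).1
  · fin_cases a <;> fin_cases c
    · exact mul_eq_neg_one_smul (theta_theta (U := U) i j 0 0)
    · exact mul_eq_one_smul (ht i 0 (Sum.inl j)).1.symm
    · exact mul_eq_one_smul (ht i 0 (Sum.inr j)).1.symm
    · exact mul_eq_one_smul (ht j 0 (Sum.inl i)).1
    · exact mul_eq_one_smul (evenMul_evenMul _ _)
    · exact mul_eq_one_smul (evenMul_evenMul _ _)
    · exact mul_eq_one_smul (ht j 0 (Sum.inr i)).1
    · exact mul_eq_one_smul (evenMul_evenMul _ _)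
    · exact mul_eq_one_smul (evenMul_evenMul _ _)

theorem slotLower_slotRaise (A C : Slot d) (i j : Fin 2) : (slotLower B A i * slotRaise B C j) =
    (if A = C ∧ i = j then 1 else 0) + slotSign A C • (slotRaise B C j * slotLower B A i) := by
  have hp := CommutesWithEven.psi (k := 1) (n := 2) B
  have hl := CommutesWithEven.psiLow (k := 1) (n := 2) B
  have ht := CommutesWithEven.theta (U := U) (k := 1) (n := 2)
  have hb := CommutesWithEven.thetaBar (U := U) (k := 1) (n := 2)
  rcases A with μ | a <;> rcases C with ν | c
  · have h := mul_eq_add_neg_one_smul (psiLow_psi (k := 1) B i j μ ν)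
    simp only [Sum.inl.injEq]
    exact h
  · rw [if_neg (by simp)]
    fin_cases c
    · exact mul_eq_zero_add_neg_one_smul (neg_eq_iff_eq_neg.1 (psiLow_anticomm B
        (X := (theta j 0 : Op 2 1 U)) (fun f => commute_fn_oddMul f _) i (fun a =>
          oddMul_oddDer_of_ne (psiOsc_ne_thetaOsc (k := 1) i j a 0).symm) μ).symm)
    · exact mul_eq_zero_add_one_smul (hl i μ (Sum.inl j)).1.symm
    · exact mul_eq_zero_add_one_smul (hl i μ (Sum.inr j)).1.symm
  · rw [if_neg (by simp)]
    fin_cases a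
    · exact mul_eq_zero_add_neg_one_smul (thetaBar_psi B i j 0 ν)
    · exact mul_eq_zero_add_one_smul (hp j ν (Sum.inl i)).2
    · exact mul_eq_zero_add_one_smul (hp j ν (Sum.inr i)).2
  · have he : ∀ s t : EvenOsc 2, s ≠ t → Commute (evenDer s : Op 2 1 U) (evenMul t) :=
      fun s t hst => by rw [Commute, SemiconjBy, evenDer_evenMul, if_neg hst, zero_add]
    have he' : ∀ (f : Fin 2 → EvenOsc 2), f.Injective → (evenDer (f i) * evenMul (f j) : Op 2 1 U) =
        (if i = j then 1 else 0) + evenMul (f j) * evenDer (f i) :=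
      fun f hf => by rw [evenDer_evenMul]; simp only [hf.eq_iff]
    rcases eq_or_ne a c with rfl | hac
    · simp only [true_and]
      fin_cases a
      · exact mul_eq_add_neg_one_smul ((thetaBar_theta (U := U) (k := 1) i j 0 0).trans
          (by simp only [and_true]; rfl))
      · exact mul_eq_add_one_smul (he' Sum.inl Sum.inl_injective)
      · exact mul_eq_add_one_smul (he' Sum.inr Sum.inr_injective)
    · rw [if_neg (by simp [hac])]
      fin_cases a <;> fin_cases c <;> try exact absurd rfl hac
      · exact mul_eq_zero_add_one_smul (hb i 0 (Sum.inl j)).1.symm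
      · exact mul_eq_zero_add_one_smul (hb i 0 (Sum.inr j)).1.symm
      · exact mul_eq_zero_add_one_smul (ht j 0 (Sum.inl i)).2
      · exact mul_eq_zero_add_one_smul (he _ _ (by simp))
      · exact mul_eq_zero_add_one_smul (ht j 0 (Sum.inr i)).2
      · exact mul_eq_zero_add_one_smul (he _ _ (by simp))

theorem young_slotLower (A : Slot d) (i j l : Fin 2) : young i j * slotLower B A l =
    slotLower B A l * young i j - if l = i then slotLower B A j else 0 := by
  rcases A with μ | a
  · exact young_psiLow B i j l μ
  · fin_cases a
    · exact young_thetaBar i j l 0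
    · exact young_betBar i j l
    · have h := young_gamBar (U := U) (k := 1) i j l
      simp only [gamBar, mul_neg, neg_mul] at h
      have h2 := neg_inj.2 h
      rw [neg_neg] at h2
      refine h2.trans ?_
      by_cases hl : l = i
      · simp [slotLower, hl]; abel
      · simp [slotLower, hl]

theorem young_eq_sum_slot (i j : Fin 2) :
    (young i j : Op 2 1 U) = ∑ A : Slot d, slotRaise B A i * slotLower B A j := by
  rw [Fintype.sum_sum_type, Fin.sum_univ_three]
  simp only [slotRaise, slotLower, sum_psi_psiLow, young, Fin.sum_univ_one]
  abel

theorem commute_ghostNumber {X : Op n k U} (hX : CommutesWithEven X)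
    (hc : cGhost * X = -(X * cGhost)) (hb : bGhost * X = -(X * bGhost)) :
    Commute ghostNumber X := by
  refine Commute.add_left ?_ (Commute.sum_left _ _ _ fun i _ => Commute.sub_left
    (Commute.mul_left (hX _).1 (hX _).2) (Commute.mul_left (hX _).1 (hX _).2))
  rw [Commute, SemiconjBy, mul_assoc, hb, mul_neg, ← mul_assoc, hc, neg_mul, neg_neg, mul_assoc]

theorem commute_cb {X : Op n k U} (hc : Commute cGhost X) (hb : Commute bGhost X) :
    Commute (cGhost * bGhost : Op n k U) X := hc.mul_left hb

theorem ghostNumber_slotLower (A : Slot d) (i : Fin 2) : ghostNumber * slotLower B A i =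
    slotLower B A i * ghostNumber - (slotCharge A : ℂ) • slotLower B A i := by
  have hc : ∀ e, Commute (cGhost * bGhost : Op 2 1 U) (evenDer e) := fun e =>
    commute_cb (CommutesWithEven.oddMul (cOsc : OddOsc 2 d 1) e).2.symm
      (CommutesWithEven.oddDer (cOsc : OddOsc 2 d 1) e).2.symm
  rcases A with μ | a
  · rw [slotCharge, Int.cast_zero, zero_smul, sub_zero]
    exact (commute_ghostNumber (CommutesWithEven.psiLow B i μ)
      (psiLow_anticomm B (fun _ => commute_fn_oddMul _ _) i
        (fun a => oddMul_oddDer_of_ne (psiOsc_ne_cOsc _ _).symm) μ)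
      (psiLow_anticomm B (fun _ => commute_fn_oddDer _ _) i (fun a => oddDer_oddDer _ _) μ)).eq
  · fin_cases a
    · refine Eq.trans ?_ (sub_eq_self.2 (by
        change ((0 : ℤ) : ℂ) • _ = (0 : Op 2 1 U)
        rw [Int.cast_zero, zero_smul])).symm
      exact (commute_ghostNumber (CommutesWithEven.thetaBar (U := U) i (0 : Fin 1))
        (cGhost_thetaBar i 0) (bGhost_thetaBar i 0)).eq
    · have h := hc (Sum.inl i)
      simp only [slotLower, slotCharge, ghostNumber, betBar, gam, bet, add_mul, mul_add, h.eq,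
        sum_mul, mul_sum, sub_mul, mul_sub, evenMul_evenDer_evenDer, Sum.inl.injEq,
        reduceCtorEq, if_false, sub_zero]
      simp only [sum_sub_distrib, sum_ite_eq, mem_univ, if_true]
      push_cast
      module
    · have h := hc (Sum.inr i)
      simp only [slotLower, slotCharge, ghostNumber, betBar, gam, bet, add_mul, mul_add, h.eq,
        sum_mul, mul_sum, sub_mul, mul_sub, evenMul_evenDer_evenDer, Sum.inr.injEq,
        reduceCtorEq, if_false, sub_zero]
      simp only [sum_sub_distrib, sum_ite_eq, mem_univ, if_true]
      push_cast
      module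

theorem ghostNumber_slotRaise (A : Slot d) (i : Fin 2) : ghostNumber * slotRaise B A i =
    slotRaise B A i * ghostNumber + (slotCharge A : ℂ) • slotRaise B A i := by
  have hc : ∀ e, Commute (cGhost * bGhost : Op 2 1 U) (evenMul e) := fun e =>
    commute_cb (CommutesWithEven.oddMul (cOsc : OddOsc 2 d 1) e).1.symm
      (CommutesWithEven.oddDer (cOsc : OddOsc 2 d 1) e).1.symm
  rcases A with μ | a
  · rw [slotCharge, Int.cast_zero, zero_smul, add_zero]
    exact (commute_ghostNumber (CommutesWithEven.psi B i μ)
      (cGhost_psi B i μ) (bGhost_psi B i μ)).eq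
  · fin_cases a
    · refine Eq.trans ?_ (add_eq_left.2 (by
        change ((0 : ℤ) : ℂ) • _ = (0 : Op 2 1 U)
        rw [Int.cast_zero, zero_smul])).symm
      exact (commute_ghostNumber (CommutesWithEven.theta (U := U) i (0 : Fin 1))
        (cGhost_theta i 0) (bGhost_theta i 0)).eq
    · have h := hc (Sum.inl i)
      simp only [slotRaise, slotCharge, ghostNumber, betBar, gam, bet, add_mul, mul_add, h.eq,
        sum_mul, mul_sum, sub_mul, mul_sub, evenMul_evenDer_evenMul, Sum.inl.injEq,
        reduceCtorEq, if_false, add_zero]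
      simp only [sum_sub_distrib, sum_add_distrib, sum_ite_eq',
        mem_univ, if_true]
      push_cast
      module
    · have h := hc (Sum.inr i)
      simp only [slotRaise, slotCharge, ghostNumber, betBar, gam, bet, add_mul, mul_add, h.eq,
        sum_mul, mul_sum, sub_mul, mul_sub, evenMul_evenDer_evenMul, Sum.inr.injEq,
        reduceCtorEq, if_false, add_zero]
      simp only [sum_sub_distrib, sum_add_distrib, sum_ite_eq',
        mem_univ, if_true]
      push_cast
      module

end Slots

section LevelZero

variable {n k d : ℕ} {U : Opens (Fin d → ℝ)}

theorem exists_eq_of_psiDer_thetaBar_evenDer_eq_zero {Φ : Wave n k U}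
    (h1 : ∀ i a, psiDer i a Φ = 0) (h2 : ∀ i r, thetaBar i r Φ = 0) (h3 : ∀ e, evenDer e Φ = 0) :
    ∃ f g, Φ = fn f vacuum + fn g (cGhost vacuum) := by
  have hodd : ∀ o : OddOsc n d k, o ≠ cOsc → oddDer o Φ = 0 := by
    rintro (⟨i, a⟩ | ⟨⟨i, r⟩ | u⟩) ho
    · exact h1 i a
    · exact h2 i r
    · exact absurd rfl ho
  have ho : ∀ p o, o ∈ p.1 → o ≠ cOsc → Φ p = 0 := fun p o hp hc => by
    have h := congrFun (hodd o hc) (p.1.erase o, p.2)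
    rw [oddDer_apply, if_neg (Finset.notMem_erase o p.1)] at h
    simp only [Finset.insert_erase hp] at h
    refine (smul_eq_zero_iff_right ?_).1 h
    exact pow_ne_zero _ (by norm_num)
  have he : ∀ p e, p.2 e ≠ 0 → Φ p = 0 := fun p e hp => by
    have h := congrFun (h3 e) (p.1, Function.update p.2 e (p.2 e - 1))
    rw [evenDer_apply] at h
    simp only [Function.update_self, Function.update_idem,
      Nat.sub_add_cancel (Nat.one_le_iff_ne_zero.2 hp),
      Function.update_eq_self] at h
    exact (smul_eq_zero_iff_right (by exact_mod_cast hp)).1 h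
  refine ⟨Φ (∅, 0), Φ ({cOsc}, 0), ?_⟩
  funext p
  rw [Pi.add_apply, fn_apply, fn_apply, cGhost, oddMul_apply]
  by_cases h2 : p.2 = 0
  · by_cases hc : (cOsc : OddOsc n d k) ∈ p.1
    · have hv : (vacuum : Wave n k U) p = 0 := if_neg fun h => by rw [h] at hc; simp at hc
      rw [if_pos hc, hv, mul_zero, zero_add]
      by_cases hp : p.1 = {cOsc}
      · have e : p = ({cOsc}, 0) := Prod.ext hp h2
        rw [e]
        simp [oddSign, vacuum, Finset.filter_singleton]
      · obtain ⟨o, ho1, ho2⟩ : ∃ o ∈ p.1, o ≠ cOsc := by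
          by_contra! hne
          exact hp (Finset.eq_singleton_iff_unique_mem.2 ⟨hc, hne⟩)
        have hv : (vacuum : Wave n k U) (p.1.erase cOsc, p.2) = 0 := if_neg fun h => by
          have h3 : o ∈ p.1.erase cOsc := Finset.mem_erase.2 ⟨ho2, ho1⟩
          have h4 : p.1.erase cOsc = ∅ := congrArg Prod.fst h
          rw [h4] at h3
          exact Finset.notMem_empty o h3
        rw [ho p o ho1 ho2, hv, smul_zero, mul_zero]
    · rw [if_neg hc, mul_zero, add_zero]
      by_cases hp : p.1 = ∅
      · have e : p = (∅, 0) := Prod.ext hp h2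
        rw [e, vacuum, if_pos rfl, mul_one]
      · obtain ⟨o, ho1⟩ := Finset.nonempty_iff_ne_empty.2 hp
        have hv : (vacuum : Wave n k U) p = 0 := if_neg fun h => hp (congrArg Prod.fst h)
        rw [hv, mul_zero, ho p o ho1 fun h => hc (h ▸ ho1)]
  · obtain ⟨e, he'⟩ := Function.ne_iff.1 h2
    have hv : ∀ s, (vacuum : Wave n k U) (s, p.2) = 0 := fun s =>
      if_neg fun h => h2 (congrArg Prod.snd h)
    rw [he p e he', show (vacuum : Wave n k U) p = 0 from hv p.1, hv, smul_zero]
    simp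

theorem ghostNumber_vacuum : (ghostNumber : Op n k U) vacuum = 0 := by
  simp only [ghostNumber, LinearMap.add_apply, LinearMap.sum_apply, LinearMap.sub_apply,
    mul_apply, bGhost_vacuum, betBar, evenDer_vacuum, map_zero, sub_self,
    sum_const_zero, add_zero]

theorem ghostNumber_cGhost_vacuum :
    (ghostNumber : Op n k U) (cGhost vacuum) = cGhost vacuum := by
  have h : IsRef (cGhost (vacuum : Wave n k U)) := isRef_vacuum.cGhost
  simp only [ghostNumber, LinearMap.add_apply, LinearMap.sum_apply, LinearMap.sub_apply,
    mul_apply, bGhost_cGhost_apply, bGhost_vacuum, h.betBar, h.evenDer, map_zero,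
    sub_zero, sum_const_zero, add_zero]

theorem ghostNumber_fn (f : Fn U) (Φ : Wave n k U) :
    (ghostNumber : Op n k U) (fn f Φ) = fn f ((ghostNumber : Op n k U) Φ) := by
  have h : Commute (fn f : Op n k U) ghostNumber :=
    Commute.add_right (Commute.mul_right (commute_fn_oddMul _ _) (commute_fn_oddDer _ _))
      (Commute.sum_right _ _ _ fun i _ => Commute.sub_right
        (Commute.mul_right (commute_fn_evenMul _ _) (commute_fn_evenDer _ _))
        (Commute.mul_right (commute_fn_evenMul _ _) (commute_fn_evenDer _ _)))
  exact LinearMap.congr_fun h.symm.eq Φ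

theorem ghostNumber_fn_add_fn {f g : Fn U} {z : ℤ}
    (h : (ghostNumber : Op n k U) (fn f vacuum + fn g (cGhost vacuum)) =
      (z : ℂ) • (fn f vacuum + fn g (cGhost vacuum))) : (z ≠ 0 → f = 0) ∧ (z ≠ 1 → g = 0) := by
  rw [map_add, ghostNumber_fn, ghostNumber_fn, ghostNumber_vacuum, ghostNumber_cGhost_vacuum,
    map_zero, zero_add] at h
  have h1 := congrArg (bGhost : Op n k U) h
  rw [map_smul, map_add, bGhost_fn, bGhost_fn, bGhost_cGhost_apply, bGhost_vacuum, map_zero,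
    map_zero, zero_add, sub_zero] at h1
  have hg : (((1 : ℂ) - z) • g : Fn U) = 0 := fn_vacuum_eq_zero (n := n) (k := k) <| by
    rw [fn_smul, LinearMap.smul_apply]
    linear_combination (norm := module) h1
  have h2 := congrArg (cGhost : Op n k U) h1
  rw [map_smul, cGhost_fn] at h2
  have hf : ((z : ℂ) • f : Fn U) = 0 := fn_vacuum_eq_zero (n := n) (k := k) <| by
    rw [fn_smul, LinearMap.smul_apply]
    linear_combination (norm := module) h2 - h
  refine ⟨fun hz => (smul_eq_zero_iff_right (by exact_mod_cast hz)).1 hf, fun hz =>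
    (smul_eq_zero_iff_right (sub_ne_zero.2 ?_)).1 hg⟩
  exact_mod_cast hz.symm

end LevelZero

section Expansion

variable {d : ℕ} {U : Opens (Fin d → ℝ)} (B : Background U)

theorem slotLower_fn (A : Slot d) (i : Fin 2) (f : Fn U) (Φ : Wave 2 1 U) :
    slotLower B A i (fn f Φ) = fn f (slotLower B A i Φ) := by
  have h : Commute (fn f) (slotLower B A i) := by
    rcases A with μ | a
    · exact commute_fn_psiLow B f i μ
    · fin_cases a
      · exact commute_fn_thetaBar f i 0
      · exact commute_fn_evenDer f _
      · exact commute_fn_evenDer f _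
  exact LinearMap.congr_fun h.symm.eq Φ

theorem slotRaise_fn (A : Slot d) (i : Fin 2) (f : Fn U) (Φ : Wave 2 1 U) :
    slotRaise B A i (fn f Φ) = fn f (slotRaise B A i Φ) := by
  have h : Commute (fn f) (slotRaise B A i) := by
    rcases A with μ | a
    · exact Commute.fn_right_sum (fun _ => commute_fn_fn _ _) fun _ _ => commute_fn_psiFlat _ _ _
    · fin_cases a
      · exact commute_fn_theta f i 0
      · exact commute_fn_evenMul f _
      · exact commute_fn_evenMul f _
  exact LinearMap.congr_fun h.symm.eq Φ

def slotCoef (Ψ : Wave 2 1 U) (A C : Slot d) : Wave 2 1 U := slotLower B A 0 (slotLower B C 1 Ψ)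

def slotKet (A C : Slot d) (Φ : Wave 2 1 U) : Wave 2 1 U := ket (slotRaise B A) (slotRaise B C) Φ

theorem slotKet_fn (A C : Slot d) (f : Fn U) (Φ : Wave 2 1 U) :
    slotKet B A C (fn f Φ) = fn f (slotKet B A C Φ) := by
  simp only [slotKet, ket, slotRaise_fn, map_sub]

theorem slotSign_comm (A C : Slot d) : slotSign A C = slotSign C A := by
  rw [slotSign, slotSign, Bool.and_comm]

theorem slotSign_mul_self (A C : Slot d) : slotSign A C * slotSign A C = 1 := by
  rw [slotSign]; split_ifs <;> norm_num

theorem slotRaise_slotRaise_apply (A C : Slot d) (i j : Fin 2) (Φ : Wave 2 1 U) :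
    slotRaise B A i (slotRaise B C j Φ) = slotSign A C • slotRaise B C j (slotRaise B A i Φ) :=
  LinearMap.congr_fun (slotRaise_slotRaise B A C i j) Φ

theorem slotKet_swap (A C : Slot d) (Φ : Wave 2 1 U) :
    slotKet B C A Φ = (-slotSign A C) • slotKet B A C Φ := by
  rw [slotKet, slotKet, ket, ket, slotRaise_slotRaise_apply B C A 0 1,
    slotRaise_slotRaise_apply B C A 1 0, slotSign_comm C A]
  module

section Reduced

variable {Ψ : Wave 2 1 U} (h : Ψ ∈ reduced 2 1 U)
include h

theorem slotCoef_swap (A C : Slot d) :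
    slotCoef B Ψ A C = (-slotSign A C) • slotCoef B Ψ C A := by
  have h1 := antisymm_of_mem_reduced h (X := slotLower B A) (Y := slotLower B C)
    (young_slotLower B A) (young_slotLower B C) 0 1
  have h2 : slotLower B A 1 (slotLower B C 0 Ψ) =
    slotSign A C • slotLower B C 0 (slotLower B A 1 Ψ) :=
    LinearMap.congr_fun (slotLower_slotLower B A C 1 0) Ψ
  rw [slotCoef, h1, h2, neg_smul]
  rfl

/-- `s_{AC} (X^A_0 X^C_1 - X^A_1 X^C_0) Ψ_{AC}`, a term of the expansion of a reduced state. -/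
def slotTerm (Ψ : Wave 2 1 U) (A C : Slot d) : Wave 2 1 U :=
  slotSign A C • slotKet B A C (slotCoef B Ψ A C)

theorem slotTerm_swap (A C : Slot d) : slotTerm B Ψ A C = slotTerm B Ψ C A := by
  have hl : ∀ (z : ℂ) Φ, slotKet B C A (z • Φ) = z • slotKet B C A Φ := fun z Φ => by
    simp only [slotKet, ket, map_smul, smul_sub]
  rw [slotTerm, slotTerm, slotCoef_swap B h C A, hl, slotKet_swap B A C, slotSign_comm C A, smul_smul,
    smul_smul, mul_assoc, neg_mul_neg, slotSign_mul_self, mul_one]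

theorem slot_expansion_two : (2 : ℂ) • Ψ = ∑ A, ∑ C, slotTerm B Ψ A C := by
  have h1 : Ψ = ∑ C, slotRaise B C 1 (slotLower B C 1 Ψ) := by
    have e := young_self_of_mem_reduced h 1
    rw [young_eq_sum_slot B, LinearMap.sum_apply] at e
    exact e.symm
  have h2 : ∀ C, slotLower B C 1 Ψ = ∑ A, slotRaise B A 0 (slotCoef B Ψ A C) := fun C => by
    have e := LinearMap.congr_fun (young_slotLower B C 0 0 1) Ψ
    rw [if_neg (by decide), sub_zero, mul_apply, mul_apply,
      young_self_of_mem_reduced h 0, young_eq_sum_slot B, LinearMap.sum_apply] at e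
    exact e.symm
  have h3 : Ψ = ∑ A, ∑ C, slotRaise B C 1 (slotRaise B A 0 (slotCoef B Ψ A C)) := by
    conv_lhs => rw [h1]
    rw [sum_comm]
    exact sum_congr rfl fun C _ => by rw [h2, map_sum]
  have h4 : Ψ = ∑ A, ∑ C, slotRaise B A 1 (slotRaise B C 0 (slotCoef B Ψ C A)) :=
    h3.trans sum_comm
  refine (two_smul ℂ Ψ).trans ((congrArg₂ (· + ·) h3 h4).trans ?_)
  rw [← sum_add_distrib]
  refine sum_congr rfl fun A _ => ?_
  rw [← sum_add_distrib]
  refine sum_congr rfl fun C _ => ?_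
  rw [slotTerm, slotKet, ket, slotRaise_slotRaise_apply B C A 1 0, slotCoef_swap B h C A, map_smul,
    map_smul, slotSign_comm C A]
  module

theorem slot_expansion : Ψ = (1 / 2 : ℂ) • ∑ μ, ∑ ν, slotTerm B Ψ (.inl μ) (.inl ν)
    + ∑ μ, slotTerm B Ψ (.inr 0) (.inl μ) + ∑ μ, slotTerm B Ψ (.inl μ) (.inr 1)
    + ∑ μ, slotTerm B Ψ (.inl μ) (.inr 2) + (1 / 2 : ℂ) • slotTerm B Ψ (.inr 0) (.inr 0)
    + slotTerm B Ψ (.inr 0) (.inr 1) + slotTerm B Ψ (.inr 0) (.inr 2)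
    + (1 / 2 : ℂ) • slotTerm B Ψ (.inr 1) (.inr 1) + slotTerm B Ψ (.inr 1) (.inr 2)
    + (1 / 2 : ℂ) • slotTerm B Ψ (.inr 2) (.inr 2) := by
  have h1 := slot_expansion_two B h
  simp only [Fintype.sum_sum_type, Fin.sum_univ_three, sum_add_distrib] at h1
  have e1 := fun μ => slotTerm_swap B h (.inl μ) (.inr 0)
  have e2 := fun μ => slotTerm_swap B h (.inr 1) (.inl μ)
  have e3 := fun μ => slotTerm_swap B h (.inr 2) (.inl μ)
  simp only [e1, e2, e3] at h1
  rw [slotTerm_swap B h (.inr 1) (.inr 0), slotTerm_swap B h (.inr 2) (.inr 0),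
    slotTerm_swap B h (.inr 2) (.inr 1)] at h1
  linear_combination (norm := module) (1 / 2 : ℂ) • h1

theorem exists_slotCoef_eq (A C : Slot d) :
    ∃ f g, slotCoef B Ψ A C = fn f (vac d U) + fn g (cvac d U) := by
  have h0 := ((hasLevel_of_mem_reduced h Finset.univ).lower (A := slotLower B C)
    (fun i l => by rw [young_slotLower B C i i l]) 1).lower
      (A := slotLower B A) (fun i l => by rw [young_slotLower B A i i l]) 0
  have h1 : HasLevel Finset.univ 0 (slotCoef B Ψ A C) := by
    convert h0 using 1
    · simp
    · rfl
  refine exists_eq_of_psiDer_thetaBar_evenDer_eq_zero (fun i a => (h1.psiDer i a).eq_zero (by simp))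
    (fun i r => (h1.thetaBar i r).eq_zero (by simp)) ?_
  rintro (i | i)
  · exact (h1.betBar i).eq_zero (by simp)
  · exact neg_eq_zero.1 ((h1.gamBar i).eq_zero (by simp))

end Reduced

theorem ghostNumber_slotCoef {Ψ : Wave 2 1 U} {s : ℤ}
    (h : (ghostNumber : Op 2 1 U) Ψ = (s : ℂ) • Ψ) (A C : Slot d) :
    (ghostNumber : Op 2 1 U) (slotCoef B Ψ A C) =
      ((s - slotCharge A - slotCharge C : ℤ) : ℂ) • slotCoef B Ψ A C := by
  have h1 := LinearMap.congr_fun (ghostNumber_slotLower B C 1) Ψ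
  have h2 := LinearMap.congr_fun (ghostNumber_slotLower B A 0) (slotLower B C 1 Ψ)
  simp only [LinearMap.sub_apply, LinearMap.smul_apply, mul_apply] at h1 h2
  rw [h1, h, map_sub, map_smul, map_smul, map_smul] at h2
  rw [slotCoef, h2]
  push_cast
  module

theorem exists_slotCoef_eq_of_mem_reducedGh {Ψ : Wave 2 1 U} {s : ℤ} (h : Ψ ∈ reducedGh 2 1 U s)
    (A C : Slot d) : ∃ f g, slotCoef B Ψ A C = fn f (vac d U) + fn g (cvac d U) ∧
      (s ≠ slotCharge A + slotCharge C → f = 0) ∧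
      (s ≠ slotCharge A + slotCharge C + 1 → g = 0) := by
  obtain ⟨f, g, hfg⟩ := exists_slotCoef_eq B h.1 A C
  have hs : (ghostNumber : Op 2 1 U) Ψ = (s : ℂ) • Ψ := by
    have h1 := LinearMap.mem_ker.1 h.2
    rw [LinearMap.sub_apply, sub_eq_zero] at h1
    exact h1
  have h2 := ghostNumber_slotCoef B hs A C
  rw [hfg] at h2
  obtain ⟨h3, h4⟩ := ghostNumber_fn_add_fn h2
  exact ⟨f, g, hfg, fun hne => h3 (by omega), fun hne => h4 (by omega)⟩

end Expansion

section Classification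

variable {d : ℕ} {U : Opens (Fin d → ℝ)} (B : Background U)

theorem isCreation_slotRaise (A : Slot d) : IsCreation (slotRaise B A) := by
  rcases A with μ | a
  · exact isCreation_psi B μ
  · fin_cases a
    · exact isCreation_theta 0
    · exact isCreation_gam
    · exact isCreation_bet

variable (U) in
/-- The states of ghost number `s` that satisfy the constraints other than the trace. -/
def youngKerGh (s : ℤ) : Submodule ℂ (Wave 2 1 U) :=
  youngKer 1 U ⊓ LinearMap.ker (ghostNumber - (s : ℂ) • (1 : Op 2 1 U))

theorem mem_youngKerGh_iff {s : ℤ} {Ψ : Wave 2 1 U} : Ψ ∈ youngKerGh U s ↔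
    Ψ ∈ youngKer 1 U ∧ (ghostNumber : Op 2 1 U) Ψ = (s : ℂ) • Ψ := by
  rw [youngKerGh, Submodule.mem_inf, LinearMap.mem_ker, LinearMap.sub_apply, sub_eq_zero]
  rfl

theorem mem_reducedGh_iff {s : ℤ} {Ψ : Wave 2 1 U} :
    Ψ ∈ reducedGh 2 1 U s ↔ Ψ ∈ youngKerGh U s ∧ (traceT 0 1 : Op 2 1 U) Ψ = 0 := by
  rw [reducedGh, youngKerGh, Submodule.mem_inf, Submodule.mem_inf, mem_reduced_two_iff]
  exact ⟨fun h => ⟨⟨⟨h.1.1, h.1.2.1⟩, h.2⟩, h.1.2.2⟩, fun h => ⟨⟨h.1.1.1, h.1.1.2, h.2⟩, h.1.2⟩⟩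

theorem ghostNumber_slotRaise_apply (A : Slot d) (i : Fin 2) (Φ : Wave 2 1 U) :
    (ghostNumber : Op 2 1 U) (slotRaise B A i Φ) =
      slotRaise B A i ((ghostNumber : Op 2 1 U) Φ) + (slotCharge A : ℂ) • slotRaise B A i Φ := by
  have h := LinearMap.congr_fun (ghostNumber_slotRaise B A i) Φ
  simpa only [LinearMap.add_apply, LinearMap.smul_apply, mul_apply] using h

theorem slotKet_mem_youngKerGh {Ω : Wave 2 1 U} (hΩ : IsRef Ω) {z : ℤ}
    (hz : (ghostNumber : Op 2 1 U) Ω = (z : ℂ) • Ω) (A C : Slot d) :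
    slotKet B A C Ω ∈ youngKerGh U (z + slotCharge A + slotCharge C) := by
  refine mem_youngKerGh_iff.2
    ⟨ket_mem_youngKer (isCreation_slotRaise B A) (isCreation_slotRaise B C) hΩ, ?_⟩
  simp only [slotKet, ket, map_sub, ghostNumber_slotRaise_apply, hz, map_smul, map_add]
  push_cast
  module

theorem ten_mem_youngKerGh {r : ℕ} {Ω : Wave 2 1 U} (hΩ : IsRef Ω) {z : ℤ}
    (hz : (ghostNumber : Op 2 1 U) Ω = (z : ℂ) • Ω) {A C : (Fin r → Fin d) → Slot d} {s : ℤ}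
    (hs : ∀ I, z + slotCharge (A I) + slotCharge (C I) = s) (T : Tensor r U) :
    ten (fun I => slotKet B (A I) (C I) Ω) T ∈ youngKerGh U s := by
  refine Submodule.sum_mem _ fun I _ => ?_
  have h := mem_youngKerGh_iff.1 (slotKet_mem_youngKerGh B hΩ hz (A I) (C I))
  rw [hs I] at h
  exact mem_youngKerGh_iff.2 ⟨fn_mem_youngKer h.1 _, by rw [ghostNumber_fn, h.2, map_smul]⟩

theorem ghostNumber_vac : (ghostNumber : Op 2 1 U) (vac d U) = ((0 : ℤ) : ℂ) • vac d U := by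
  rw [ghostNumber_vacuum, Int.cast_zero, zero_smul]

theorem ghostNumber_cvac : (ghostNumber : Op 2 1 U) (cvac d U) = ((1 : ℤ) : ℂ) • cvac d U := by
  rw [ghostNumber_cGhost_vacuum, Int.cast_one, one_smul]

section Trace

variable {Ω : Wave 2 1 U} (hΩ : IsRef Ω)

theorem traceT_ten {r : ℕ} (Z : (Fin r → Fin d) → Wave 2 1 U) (T : Tensor r U) :
    (traceT 0 1 : Op 2 1 U) (ten Z T) = ten (fun I => (traceT 0 1 : Op 2 1 U) (Z I)) T :=
  map_ten (fun f Φ => LinearMap.congr_fun (commute_fn_traceT f 0 1).symm.eq Φ) Z T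

include hΩ

theorem traceT_ten_ketPP (T : Tensor 2 U) :
    (traceT 0 1 : Op 2 1 U) (ten (ketPP B Ω) T) = (-2 : ℂ) • fn (tr B T ![]) Ω := by
  have h : ∀ I, (traceT 0 1 : Op 2 1 U) (ketPP B Ω I) =
      (-2 : ℂ) • fn (B.invMetric (I 0) (I 1)) Ω := fun I =>
    traceT_ket (isTraceDual_psi B (I 0)) (isTraceDual_psi B (I 1)) hΩ
      (fun i => hΩ.psiBar B i (I 1)) fun i => by
        rw [psiBar_psi_apply, if_pos rfl, hΩ.psiBar, map_zero, sub_zero]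
  have e := ten_contract B (K := fun _ => Ω) T
  rw [traceT_ten]
  simp only [h]
  have e2 : ten (fun I => (-2 : ℂ) • fn (B.invMetric (I 0) (I 1)) Ω) T =
      (-2 : ℂ) • ten (fun I => fn (B.invMetric (I 0) (I 1)) Ω) T := by
    simp only [ten, map_smul, smul_sum]
  rw [e2, e, ten, sum_fin_zero_arrow]
  rfl

theorem traceT_ten_ketTT (f : Tensor 0 U) :
    (traceT 0 1 : Op 2 1 U) (ten (ketTT 0 Ω) f) = (-2 : ℂ) • fn (f ![]) Ω := by
  have h : ∀ I, (traceT 0 1 : Op 2 1 U) (ketTT 0 Ω I) = (-2 : ℂ) • Ω := fun I =>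
    traceT_ket (isTraceDual_theta 0) (isTraceDual_theta 0) hΩ
      (fun i => hΩ.thetaBar i 0) fun i => by
        have h1 := LinearMap.congr_fun (thetaBar_theta (U := U) (k := 1) i i 0 0) Ω
        rw [LinearMap.sub_apply, mul_apply, mul_apply, hΩ.thetaBar, map_zero,
          sub_zero, if_pos ⟨rfl, rfl⟩] at h1
        exact h1
  rw [traceT_ten, ten, sum_fin_zero_arrow, h, map_smul]

theorem traceT_ten_ketGB (f : Tensor 0 U) :
    (traceT 0 1 : Op 2 1 U) (ten (ketGB Ω) f) = (2 : ℂ) • fn (f ![]) Ω := by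
  have h : ∀ I, (traceT 0 1 : Op 2 1 U) (ketGB (d := d) Ω I) = (-2 : ℂ) • -Ω := fun I =>
    traceT_ket isTraceDual_gam isTraceDual_bet hΩ
      (fun i => hΩ.betBar i) fun i => by
        rw [gamBar_bet_apply, hΩ.gamBar, map_zero, if_pos rfl, zero_sub]
  rw [traceT_ten, ten, sum_fin_zero_arrow, h, map_smul, map_neg]
  module

theorem traceT_ten_ketTP (A : Tensor 1 U) :
    (traceT 0 1 : Op 2 1 U) (ten (ketTP B 0 Ω) A) = 0 := by
  rw [traceT_ten]
  refine ten_eq_zero (fun I => ?_) A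
  have h := traceT_ket (isTraceDual_theta (0 : Fin 1)) (isTraceDual_psi B (I 0)) hΩ
    (fun i => hΩ.psiBar B i (I 0)) (Φ := 0) fun i => by
      have h1 := LinearMap.congr_fun (thetaBar_psi (k := 1) B i i 0 (I 0)) Ω
      rw [LinearMap.neg_apply, mul_apply, mul_apply, hΩ.thetaBar, map_zero,
        neg_zero] at h1
      exact h1
  exact h.trans (smul_zero _)

theorem traceT_ten_ketPB (A : Tensor 1 U) :
    (traceT 0 1 : Op 2 1 U) (ten (ketPB B Ω) A) = 0 := by
  rw [traceT_ten]
  refine ten_eq_zero (fun I => ?_) A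
  have h := traceT_ket (isTraceDual_psi (k := 1) B (I 0)) isTraceDual_bet hΩ
    (fun i => hΩ.betBar i) (Φ := 0) fun i => by
      rw [psiBar_bet_apply, hΩ.psiBar, map_zero]
  exact h.trans (smul_zero _)

theorem traceT_ten_ketTB (f : Tensor 0 U) :
    (traceT 0 1 : Op 2 1 U) (ten (ketTB 0 Ω) f) = 0 := by
  rw [traceT_ten]
  refine ten_eq_zero (fun I => ?_) f
  have h := traceT_ket (isTraceDual_theta (0 : Fin 1)) isTraceDual_bet hΩ
    (fun i => hΩ.betBar i) (Φ := 0) fun i => by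
      have h1 := LinearMap.congr_fun (bet_comm (CommutesWithEven.thetaBar (U := U) i (0 : Fin 1)) i).eq Ω
      rw [mul_apply, mul_apply, hΩ.thetaBar, map_zero] at h1
      exact h1
  exact h.trans (smul_zero _)

end Trace

theorem gaugeState_mem_reducedGh (ε : Tensor 1 U) (Sg : Tensor 0 U) :
    gaugeState B ε Sg ∈ reducedGh 2 1 U (-1) := by
  rw [gaugeState_eq, mem_reducedGh_iff]
  refine ⟨Submodule.add_mem _ (Submodule.smul_mem _ _ ?_) ?_, ?_⟩
  · exact ten_mem_youngKerGh B isRef_vac ghostNumber_vac (A := fun I => .inl (I 0))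
      (C := fun _ => .inr 2) (fun _ => rfl) ε
  · exact ten_mem_youngKerGh B isRef_vac ghostNumber_vac (A := fun _ => .inr 0)
      (C := fun _ => .inr 2) (fun _ => rfl) Sg
  · rw [map_add, map_smul, traceT_ten_ketPB B isRef_vac, traceT_ten_ketTB isRef_vac, smul_zero,
      add_zero]

theorem stringField_mem_reducedGh {h : Tensor 2 U} (hs : IsSymm h) (v A : Tensor 1 U)
    (φ aux : Tensor 0 U) : stringField B h v A φ aux ∈ reducedGh 2 1 U 0 := by
  rw [stringField_eq B hs, mem_reducedGh_iff]
  refine ⟨Submodule.add_mem _ (Submodule.sub_mem _ (Submodule.sub_mem _ (Submodule.sub_mem _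
    (Submodule.add_mem _ (Submodule.smul_mem _ _ ?_) ?_) (Submodule.smul_mem _ _ ?_))
    (Submodule.smul_mem _ _ ?_)) ?_) ?_, ?_⟩
  · exact ten_mem_youngKerGh B isRef_vac ghostNumber_vac (A := fun I => .inl (I 0))
      (C := fun I => .inl (I 1)) (fun _ => rfl) h
  · exact ten_mem_youngKerGh B isRef_vac ghostNumber_vac (A := fun _ => .inr 1)
      (C := fun _ => .inr 2) (fun _ => rfl) _
  · exact ten_mem_youngKerGh B isRef_cvac ghostNumber_cvac (A := fun I => .inl (I 0))
      (C := fun _ => .inr 2) (fun _ => rfl) v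
  · exact ten_mem_youngKerGh B isRef_vac ghostNumber_vac (A := fun _ => .inr 0)
      (C := fun I => .inl (I 0)) (fun _ => rfl) A
  · exact ten_mem_youngKerGh B isRef_vac ghostNumber_vac (A := fun _ => .inr 0)
      (C := fun _ => .inr 0) (fun _ => rfl) φ
  · exact ten_mem_youngKerGh B isRef_cvac ghostNumber_cvac (A := fun _ => .inr 0)
      (C := fun _ => .inr 2) (fun _ => rfl) aux
  · simp only [map_add, map_sub, map_smul (traceT 0 1 : Op 2 1 U)]
    rw [traceT_ten_ketPP B isRef_vac, traceT_ten_ketGB isRef_vac, traceT_ten_ketPB B isRef_cvac,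
      traceT_ten_ketTP B isRef_vac, traceT_ten_ketTT isRef_vac, traceT_ten_ketTB isRef_cvac,
      Pi.sub_apply, Pi.smul_apply, fn_sub, fn_smul, LinearMap.sub_apply, LinearMap.smul_apply]
    module

section Terms

variable {Ψ : Wave 2 1 U} {s : ℤ} (h : Ψ ∈ reducedGh 2 1 U s)
include h

theorem slotTerm_eq_vac (A C : Slot d) (hs : s = slotCharge A + slotCharge C) :
    ∃ f, slotTerm B Ψ A C = slotSign A C • fn f (slotKet B A C (vac d U)) := by
  obtain ⟨f, g, e, -, hg⟩ := exists_slotCoef_eq_of_mem_reducedGh B h A C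
  exact ⟨f, by rw [slotTerm, e, hg (by omega), fn_zero, LinearMap.zero_apply, add_zero, slotKet_fn]⟩

theorem slotTerm_eq_cvac (A C : Slot d) (hs : s = slotCharge A + slotCharge C + 1) :
    ∃ f, slotTerm B Ψ A C = slotSign A C • fn f (slotKet B A C (cvac d U)) := by
  obtain ⟨f, g, e, hf, -⟩ := exists_slotCoef_eq_of_mem_reducedGh B h A C
  exact ⟨g, by rw [slotTerm, e, hf (by omega), fn_zero, LinearMap.zero_apply, zero_add, slotKet_fn]⟩

theorem slotTerm_eq_zero (A C : Slot d) (q : ℤ) (hq : slotCharge A + slotCharge C = q)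
    (hs : s ≠ q) (hs' : s ≠ q + 1) : slotTerm B Ψ A C = 0 := by
  subst hq
  obtain ⟨f, g, e, hf, hg⟩ := exists_slotCoef_eq_of_mem_reducedGh B h A C
  rw [slotTerm, e, hf hs, hg hs', fn_zero]
  simp [slotKet, ket]

end Terms

theorem mem_reducedGh_neg_one_iff {Λ : Wave 2 1 U} : Λ ∈ reducedGh 2 1 U (-1) ↔
    ∃ (ε : Tensor 1 U) (Sg : Tensor 0 U), Λ = gaugeState B ε Sg := by
  refine ⟨fun h => ?_, fun ⟨ε, Sg, e⟩ => e ▸ gaugeState_mem_reducedGh B ε Sg⟩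
  have hpb := fun μ => slotTerm_eq_vac B h (.inl μ) (.inr 2) rfl
  choose v hv using hpb
  obtain ⟨u, hu⟩ := slotTerm_eq_vac B h (.inr 0) (.inr 2) rfl
  obtain ⟨w, hw⟩ := slotTerm_eq_cvac B h (.inr 2) (.inr 2) rfl
  have hw' : slotKet B (.inr 2) (.inr 2) (cvac d U) = 0 := by
    simp only [slotKet, ket, slotRaise]
    exact sub_eq_zero.2 (LinearMap.congr_fun (evenMul_evenMul (Sum.inr 0) (Sum.inr 1)) _)
  refine ⟨(-Complex.I) • fun I => v (I 0), fun _ => u, ?_⟩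
  have e := slot_expansion B h.1
  have z := slotTerm_eq_zero B h
  rw [hw, hw', hu, z (.inr 0) (.inr 0) 0 rfl (by decide) (by decide),
    z (.inr 0) (.inr 1) 1 rfl (by decide) (by decide), z (.inr 1) (.inr 1) 2 rfl (by decide) (by decide),
    z (.inr 1) (.inr 2) 0 rfl (by decide) (by decide)] at e
  simp only [hv, fun μ ν => z (.inl μ) (.inl ν) 0 rfl (by decide) (by decide),
    fun μ => z (.inr 0) (.inl μ) 0 rfl (by decide) (by decide),
    fun μ => z (.inl μ) (.inr 1) 1 rfl (by decide) (by decide), sum_const_zero, smul_zero,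
    zero_add, add_zero, map_zero] at e
  rw [gaugeState_eq, ten_smul, e, ten, ten, sum_fin_zero_arrow, sum_fin_one_arrow]
  have s1 : ∀ μ, slotSign (.inl μ : Slot d) (.inr 2) = 1 := fun μ => rfl
  have s2 : slotSign (.inr 0 : Slot d) (.inr 2) = 1 := rfl
  simp only [s1, s2, one_smul]
  rw [smul_smul, mul_neg, Complex.I_mul_I, neg_neg, one_smul]
  rfl

theorem mem_reducedGh_zero_iff {Ψ : Wave 2 1 U} : Ψ ∈ reducedGh 2 1 U 0 ↔
    ∃ (h : Tensor 2 U) (v A : Tensor 1 U) (φ aux : Tensor 0 U),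
      IsSymm h ∧ Ψ = stringField B h v A φ aux := by
  refine ⟨fun h => ?_, fun ⟨h, v, A, φ, aux, hs, e⟩ => e ▸ stringField_mem_reducedGh B hs v A φ aux⟩
  have hpp := fun μ ν => slotTerm_eq_vac B h (.inl μ) (.inl ν) rfl
  choose a ha using hpp
  have htp := fun μ => slotTerm_eq_vac B h (.inr 0) (.inl μ) rfl
  choose A hA using htp
  have hpb := fun μ => slotTerm_eq_cvac B h (.inl μ) (.inr 2) rfl
  choose v hv using hpb
  obtain ⟨q, hq⟩ := slotTerm_eq_vac B h (.inr 0) (.inr 0) rfl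
  obtain ⟨p, hp⟩ := slotTerm_eq_vac B h (.inr 1) (.inr 2) rfl
  obtain ⟨u, hu⟩ := slotTerm_eq_cvac B h (.inr 0) (.inr 2) rfl
  have e := slot_expansion B h.1
  have z := slotTerm_eq_zero B h
  rw [hq, hp, hu, z (.inr 0) (.inr 1) 1 rfl (by decide) (by decide),
    z (.inr 1) (.inr 1) 2 rfl (by decide) (by decide), z (.inr 2) (.inr 2) (-2) rfl (by decide) (by decide)] at e
  simp only [ha, hA, hv, fun μ => z (.inl μ) (.inr 1) 1 rfl (by decide) (by decide),
    sum_const_zero, smul_zero, add_zero] at e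
  set a' : Tensor 2 U := fun I => a (I 0) (I 1) with ha'
  set A' : Tensor 1 U := fun I => A (I 0) with hA'
  set v' : Tensor 1 U := fun I => v (I 0) with hv'
  set q' : Tensor 0 U := fun _ => q with hq'
  set p' : Tensor 0 U := fun _ => p with hp'
  set u' : Tensor 0 U := fun _ => u with hu'
  have e2 : Ψ = (-1 / 2 : ℂ) • ten (ketPP B (vac d U)) a' - ten (ketTP B 0 (vac d U)) A'
      + ten (ketPB B (cvac d U)) v' - (1 / 2 : ℂ) • ten (ketTT 0 (vac d U)) q'
      + ten (ketTB 0 (cvac d U)) u' + ten (ketGB (vac d U)) p' := by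
    have s1 : ∀ μ, slotSign (.inl μ : Slot d) (.inr 2) = 1 := fun μ => rfl
    have s2 : slotSign (.inr 0 : Slot d) (.inr 2) = 1 := rfl
    have s3 : ∀ μ ν, slotSign (.inl μ : Slot d) (.inl ν) = -1 := fun μ ν => rfl
    have s4 : ∀ μ, slotSign (.inr 0 : Slot d) (.inl μ) = -1 := fun μ => rfl
    have s5 : slotSign (.inr 0 : Slot d) (.inr 0) = -1 := rfl
    have s6 : slotSign (.inr 1 : Slot d) (.inr 2) = 1 := rfl
    simp only [s1, s2, s3, s4, s5, s6, ← smul_sum] at e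
    have t1 : ten (ketPP B (vac d U)) a' =
        ∑ μ, ∑ ν, fn (a μ ν) (slotKet B (.inl μ) (.inl ν) (vac d U)) := sum_fin_two_arrow _
    have t2 : ten (ketTP B 0 (vac d U)) A' =
        ∑ μ, fn (A μ) (slotKet B (.inr 0) (.inl μ) (vac d U)) := sum_fin_one_arrow _
    have t3 : ten (ketPB B (cvac d U)) v' =
        ∑ μ, fn (v μ) (slotKet B (.inl μ) (.inr 2) (cvac d U)) := sum_fin_one_arrow _
    have t4 : ten (ketTT 0 (vac d U)) q' = fn q (slotKet B (.inr 0) (.inr 0) (vac d U)) :=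
      sum_fin_zero_arrow _
    have t5 : ten (ketTB 0 (cvac d U)) u' = fn u (slotKet B (.inr 0) (.inr 2) (cvac d U)) :=
      sum_fin_zero_arrow _
    have t6 : ten (ketGB (vac d U)) p' = fn p (slotKet B (.inr 1) (.inr 2) (vac d U)) :=
      sum_fin_zero_arrow _
    rw [t1, t2, t3, t4, t5, t6]
    refine e.trans ?_
    module
  have e3 : p' = (1 / 2 : ℂ) • tr B ((-1 / 2 : ℂ) • symm2 a') - (1 / 2 : ℂ) • q' := by
    have ht := (mem_reducedGh_iff.1 h).2
    rw [e2] at ht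
    simp only [map_add, map_sub, map_smul (traceT 0 1 : Op 2 1 U)] at ht
    rw [traceT_ten_ketPP B isRef_vac, traceT_ten_ketGB isRef_vac, traceT_ten_ketPB B isRef_cvac,
      traceT_ten_ketTP B isRef_vac, traceT_ten_ketTT isRef_vac, traceT_ten_ketTB isRef_cvac] at ht
    have h1 : (fn (p' ![] - ((1 / 2 : ℂ) • tr B ((-1 / 2 : ℂ) • symm2 a') - (1 / 2 : ℂ) • q') ![])
        : Op 2 1 U) vacuum = 0 := by
      rw [map_smul (tr B), tr_symm2, Pi.sub_apply, Pi.smul_apply, Pi.smul_apply, Pi.smul_apply,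
        Pi.smul_apply]
      simp only [fn_sub, fn_smul, LinearMap.sub_apply, LinearMap.smul_apply]
      have hc : contract B a' = tr B a' := rfl
      rw [hc]
      linear_combination (norm := module) (1 / 2 : ℂ) • ht
    have h2 := sub_eq_zero.1 (fn_vacuum_eq_zero h1)
    funext I
    rw [Subsingleton.elim I ![]]
    exact h2
  refine ⟨(-1 / 2 : ℂ) • symm2 a', (2 * Complex.I) • v', (-Complex.I) • A', (1 / 2 : ℂ) • q', u',
    fun μ ν => by rw [Pi.smul_apply, Pi.smul_apply, isSymm_symm2], ?_⟩
  rw [stringField_eq B (fun μ ν => by rw [Pi.smul_apply, Pi.smul_apply, isSymm_symm2]), e2, e3]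
  simp only [ten_sub, ten_smul, ten_ketPP_symm2]
  match_scalars <;> first | ring1 | linear_combination -Complex.I_sq | linear_combination Complex.I_sq

end Classification

section Independence

variable {d : ℕ} {U : Opens (Fin d → ℝ)} (B : Background U)

theorem slotLower_slotRaise_apply (A C : Slot d) (i j : Fin 2) (Φ : Wave 2 1 U) :
    slotLower B A i (slotRaise B C j Φ) =
      (if A = C ∧ i = j then Φ else 0) + slotSign A C • slotRaise B C j (slotLower B A i Φ) := by
  have h := LinearMap.congr_fun (slotLower_slotRaise B A C i j) Φ
  rw [LinearMap.add_apply, LinearMap.smul_apply, mul_apply, mul_apply] at h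
  rw [h]
  split_ifs <;> rfl

theorem IsRef.slotLower {Ω : Wave 2 1 U} (hΩ : IsRef Ω) (A : Slot d) (i : Fin 2) :
    slotLower B A i Ω = 0 := by
  rcases A with μ | a
  · simp only [SpinningParticle.slotLower, psiLow, LinearMap.sum_apply, mul_apply,
      hΩ.psiDer, map_zero, sum_const_zero]
  · fin_cases a
    · exact hΩ.thetaBar i 0
    · exact hΩ.evenDer _
    · exact hΩ.evenDer _

theorem map_ite_zero (X : Op 2 1 U) (c : Prop) [Decidable c] (Φ : Wave 2 1 U) :
    X (if c then Φ else 0) = if c then X Φ else 0 := by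
  split_ifs
  · rfl
  · exact map_zero _

theorem slotCoef_slotKet {Ω : Wave 2 1 U} (hΩ : IsRef Ω) (A C A' C' : Slot d) :
    slotCoef B (slotKet B A' C' Ω) A C =
      (if C = C' then if A = A' then slotSign C A' • Ω else 0 else 0)
        - if C = A' then if A = C' then Ω else 0 else 0 := by
  simp only [slotCoef, slotKet, ket, map_sub, slotLower_slotRaise_apply, hΩ.slotLower, map_zero,
    smul_zero, add_zero, and_true, one_ne_zero, and_false, if_false, zero_add, map_smul, map_ite_zero,
    smul_ite]

theorem slotCoef_fn (f : Fn U) (Φ : Wave 2 1 U) (A C : Slot d) :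
    slotCoef B (fn f Φ) A C = fn f (slotCoef B Φ A C) := by
  simp only [slotCoef, slotLower_fn]

theorem slotCoef_add (Φ Ψ : Wave 2 1 U) (A C : Slot d) :
    slotCoef B (Φ + Ψ) A C = slotCoef B Φ A C + slotCoef B Ψ A C := by
  simp only [slotCoef, map_add]

theorem slotCoef_sub (Φ Ψ : Wave 2 1 U) (A C : Slot d) :
    slotCoef B (Φ - Ψ) A C = slotCoef B Φ A C - slotCoef B Ψ A C := by
  simp only [slotCoef, map_sub]

theorem slotCoef_smul (z : ℂ) (Φ : Wave 2 1 U) (A C : Slot d) :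
    slotCoef B (z • Φ) A C = z • slotCoef B Φ A C := by
  simp only [slotCoef, map_smul]

theorem slotCoef_zero (A C : Slot d) : slotCoef B 0 A C = 0 := by
  simp only [slotCoef, map_zero]

section Ten

variable {Ω : Wave 2 1 U} (hΩ : IsRef Ω) (A C : Slot d)
include hΩ

theorem slotCoef_ketPP (T : Tensor 2 U) : slotCoef B (ten (ketPP B Ω) T) A C =
    ∑ μ, ∑ ν, fn (T ![μ, ν]) ((if C = .inl ν then if A = .inl μ then -Ω else 0 else 0)
      - if C = .inl μ then if A = .inl ν then Ω else 0 else 0) := by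
  rw [ten, sum_fin_two_arrow]
  simp only [slotCoef, map_sum, slotLower_fn]
  refine sum_congr rfl fun μ _ => sum_congr rfl fun ν _ => congrArg _ ?_
  refine (slotCoef_slotKet B hΩ A C (.inl μ) (.inl ν)).trans (congrArg₂ (· - ·) ?_ rfl)
  split_ifs with h1 h2
  · rw [h1]; exact neg_one_smul ℂ Ω
  · rfl
  · rfl

theorem slotCoef_ketTP (T : Tensor 1 U) : slotCoef B (ten (ketTP B 0 Ω) T) A C =
    ∑ μ, fn (T ![μ]) ((if C = .inl μ then if A = .inr 0 then -Ω else 0 else 0)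
      - if C = .inr 0 then if A = .inl μ then Ω else 0 else 0) := by
  rw [ten, sum_fin_one_arrow]
  simp only [slotCoef, map_sum, slotLower_fn]
  refine sum_congr rfl fun μ _ => congrArg _ ?_
  refine (slotCoef_slotKet B hΩ A C (.inr 0) (.inl μ)).trans (congrArg₂ (· - ·) ?_ rfl)
  split_ifs with h1 h2
  · rw [h1]; exact neg_one_smul ℂ Ω
  · rfl
  · rfl

theorem slotCoef_ketPB (T : Tensor 1 U) : slotCoef B (ten (ketPB B Ω) T) A C =
    ∑ μ, fn (T ![μ]) ((if C = .inr 2 then if A = .inl μ then Ω else 0 else 0)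
      - if C = .inl μ then if A = .inr 2 then Ω else 0 else 0) := by
  rw [ten, sum_fin_one_arrow]
  simp only [slotCoef, map_sum, slotLower_fn]
  refine sum_congr rfl fun μ _ => congrArg _ ?_
  refine (slotCoef_slotKet B hΩ A C (.inl μ) (.inr 2)).trans (congrArg₂ (· - ·) ?_ rfl)
  split_ifs with h1 h2
  · rw [h1]; exact one_smul ℂ Ω
  · rfl
  · rfl

theorem slotCoef_ketPG (T : Tensor 1 U) : slotCoef B (ten (ketPG B Ω) T) A C =
    ∑ μ, fn (T ![μ]) ((if C = .inr 1 then if A = .inl μ then Ω else 0 else 0)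
      - if C = .inl μ then if A = .inr 1 then Ω else 0 else 0) := by
  rw [ten, sum_fin_one_arrow]
  simp only [slotCoef, map_sum, slotLower_fn]
  refine sum_congr rfl fun μ _ => congrArg _ ?_
  refine (slotCoef_slotKet B hΩ A C (.inl μ) (.inr 1)).trans (congrArg₂ (· - ·) ?_ rfl)
  split_ifs with h1 h2
  · rw [h1]; exact one_smul ℂ Ω
  · rfl
  · rfl

theorem slotCoef_ketTT (f : Tensor 0 U) : slotCoef B (ten (ketTT 0 Ω) f) A C =
    fn (f ![]) ((if C = .inr 0 then if A = .inr 0 then -Ω else 0 else 0)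
      - if C = .inr 0 then if A = .inr 0 then Ω else 0 else 0) := by
  rw [ten, sum_fin_zero_arrow, slotCoef_fn]
  refine congrArg _ ?_
  refine (slotCoef_slotKet B hΩ A C (.inr 0) (.inr 0)).trans (congrArg₂ (· - ·) ?_ rfl)
  split_ifs with h1 h2
  · rw [h1]; exact neg_one_smul ℂ Ω
  · rfl
  · rfl

theorem slotCoef_ketTG (f : Tensor 0 U) : slotCoef B (ten (ketTG 0 Ω) f) A C =
    fn (f ![]) ((if C = .inr 1 then if A = .inr 0 then Ω else 0 else 0)
      - if C = .inr 0 then if A = .inr 1 then Ω else 0 else 0) := by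
  rw [ten, sum_fin_zero_arrow, slotCoef_fn]
  refine congrArg _ ?_
  refine (slotCoef_slotKet B hΩ A C (.inr 0) (.inr 1)).trans (congrArg₂ (· - ·) ?_ rfl)
  split_ifs with h1 h2
  · rw [h1]; exact one_smul ℂ Ω
  · rfl
  · rfl

theorem slotCoef_ketTB (f : Tensor 0 U) : slotCoef B (ten (ketTB 0 Ω) f) A C =
    fn (f ![]) ((if C = .inr 2 then if A = .inr 0 then Ω else 0 else 0)
      - if C = .inr 0 then if A = .inr 2 then Ω else 0 else 0) := by
  rw [ten, sum_fin_zero_arrow, slotCoef_fn]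
  refine congrArg _ ?_
  refine (slotCoef_slotKet B hΩ A C (.inr 0) (.inr 2)).trans (congrArg₂ (· - ·) ?_ rfl)
  split_ifs with h1 h2
  · rw [h1]; exact one_smul ℂ Ω
  · rfl
  · rfl

theorem slotCoef_ketGB (f : Tensor 0 U) : slotCoef B (ten (ketGB Ω) f) A C =
    fn (f ![]) ((if C = .inr 2 then if A = .inr 1 then Ω else 0 else 0)
      - if C = .inr 1 then if A = .inr 2 then Ω else 0 else 0) := by
  rw [ten, sum_fin_zero_arrow, slotCoef_fn]
  refine congrArg _ ?_
  refine (slotCoef_slotKet B hΩ A C (.inr 1) (.inr 2)).trans (congrArg₂ (· - ·) ?_ rfl)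
  split_ifs with h1 h2
  · rw [h1]; exact one_smul ℂ Ω
  · rfl
  · rfl

end Ten

theorem fn_vac_injective {f g : Fn U} (h : fn f (vac d U) = fn g (vac d U)) : f = g := by
  rw [← sub_eq_zero, ← LinearMap.sub_apply, ← fn_sub] at h
  exact sub_eq_zero.1 (fn_vacuum_eq_zero h)

theorem fn_cvac_injective {f g : Fn U} (h : fn f (cvac d U) = fn g (cvac d U)) : f = g := by
  have h1 := congrArg (bGhost : Op 2 1 U) h
  rw [bGhost_fn, bGhost_fn, bGhost_cvac] at h1
  exact fn_vac_injective h1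

theorem residual_eq_zero {a : Tensor 2 U} (ha : IsSymm a) {p q : Tensor 0 U} {e u : Tensor 1 U}
    {w : Tensor 0 U} (h : residual B a p q e u w = 0) :
    a = 0 ∧ p = 0 ∧ q = 0 ∧ e = 0 ∧ u = 0 ∧ w = 0 := by
  have hv : IsRef (vac d U) := isRef_vac
  have hc : IsRef (cvac d U) := isRef_cvac
  have key : ∀ A C, slotCoef B (residual B a p q e u w) A C = 0 := fun A C => by
    rw [h, slotCoef_zero]
  simp only [residual, slotCoef_add, slotCoef_ketPP B hc, slotCoef_ketGB B hc, slotCoef_ketTT B hc,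
    slotCoef_ketTP B hc, slotCoef_ketPG B hv, slotCoef_ketTG B hv] at key
  refine ⟨funext fun I => ?_, funext fun I => ?_, funext fun I => ?_, funext fun I => ?_,
    funext fun I => ?_, funext fun I => ?_⟩
  · have h1 := key (.inl (I 0)) (.inl (I 1))
    simp [map_ite_zero, ← ha (I 0) (I 1), fin_two_eta] at h1
    refine fn_cvac_injective (U := U) ?_
    rw [Pi.zero_apply, fn_zero, LinearMap.zero_apply]
    linear_combination (norm := module) (-1 / 2 : ℂ) • h1
  · have h1 := key (.inr 1) (.inr 2)
    simp at h1
    rw [Subsingleton.elim I ![]]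
    refine fn_cvac_injective (U := U) ?_
    rw [h1, Pi.zero_apply, fn_zero, LinearMap.zero_apply]
  · have h1 := key (.inr 0) (.inr 0)
    simp at h1
    rw [Subsingleton.elim I ![]]
    refine fn_cvac_injective (U := U) ?_
    rw [Pi.zero_apply, fn_zero, LinearMap.zero_apply]
    linear_combination (norm := module) (-1 / 2 : ℂ) • h1
  · have h1 := key (.inr 0) (.inl (I 0))
    simp [map_ite_zero, fin_one_eta] at h1
    refine fn_cvac_injective (U := U) ?_
    rw [h1, Pi.zero_apply, fn_zero, LinearMap.zero_apply]
  · have h1 := key (.inl (I 0)) (.inr 1)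
    simp [map_ite_zero, fin_one_eta] at h1
    refine fn_vac_injective (U := U) ?_
    rw [h1, Pi.zero_apply, fn_zero, LinearMap.zero_apply]
  · have h1 := key (.inr 0) (.inr 1)
    simp at h1
    rw [Subsingleton.elim I ![]]
    refine fn_vac_injective (U := U) ?_
    rw [h1, Pi.zero_apply, fn_zero, LinearMap.zero_apply]

theorem stringField_injective {h h' : Tensor 2 U} (hs : IsSymm h) (hs' : IsSymm h')
    {v v' A A' : Tensor 1 U} {φ φ' aux aux' : Tensor 0 U}
    (e : stringField B h v A φ aux = stringField B h' v' A' φ' aux') :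
    h = h' ∧ A = A' ∧ φ = φ' := by
  have hv : IsRef (vac d U) := isRef_vac
  have hc : IsRef (cvac d U) := isRef_cvac
  have key : ∀ A' C', slotCoef B (stringField B h v A φ aux) A' C' = _ := fun A' C' => by rw [e]
  simp only [stringField_eq B hs, stringField_eq B hs', slotCoef_add, slotCoef_sub, slotCoef_smul,
    slotCoef_ketPP B hv, slotCoef_ketGB B hv, slotCoef_ketTT B hv,
    slotCoef_ketTP B hv, slotCoef_ketPB B hc, slotCoef_ketTB B hc] at key
  refine ⟨funext fun I => ?_, funext fun I => ?_, funext fun I => ?_⟩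
  · have h1 := key (.inl (I 0)) (.inl (I 1))
    simp [map_ite_zero, ← hs (I 0) (I 1), ← hs' (I 0) (I 1), fin_two_eta] at h1
    refine fn_vac_injective (U := U) ?_
    linear_combination (norm := module) (-1 / 2 : ℂ) • h1
  · have h1 := key (.inr 0) (.inl (I 0))
    simp [map_ite_zero, fin_one_eta] at h1
    exact fn_vac_injective (U := U) h1
  · have h1 := key (.inr 0) (.inr 0)
    simp at h1
    rw [Subsingleton.elim I ![]]
    refine fn_vac_injective (U := U) ?_
    linear_combination (norm := module) (1 / 2 : ℂ) • h1

end Independence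

section System

variable {d : ℕ} {U : Opens (Fin d → ℝ)} (B : Background U)

theorem IsSymm.add {S T : Tensor 2 U} (hS : IsSymm S) (hT : IsSymm T) : IsSymm (S + T) :=
  fun μ ν => congrArg₂ (· + ·) (hS μ ν) (hT μ ν)

theorem IsSymm.smul {T : Tensor 2 U} (hT : IsSymm T) (z : ℂ) : IsSymm (z • T) :=
  fun μ ν => congrArg (z • ·) (hT μ ν)

theorem IsSymm.sub {S T : Tensor 2 U} (hS : IsSymm S) (hT : IsSymm T) : IsSymm (S - T) :=
  fun μ ν => congrArg₂ (· - ·) (hS μ ν) (hT μ ν)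

theorem cov_two (T : Tensor 2 U) (l μ ν : Fin d) : cov B T (Fin.cons l ![μ, ν]) =
    partialD l (T ![μ, ν]) - (∑ r, B.christoffel r l μ * T ![r, ν]
      + ∑ r, B.christoffel r l ν * T ![μ, r]) := by
  have e : cov B T (Fin.cons l ![μ, ν]) = partialD l (T ![μ, ν]) - ∑ j : Fin 2, ∑ r,
      B.christoffel r l (![μ, ν] j) * T (Function.update ![μ, ν] j r) := rfl
  have e0 : ∀ r, Function.update ![μ, ν] 0 r = ![r, ν] := fun r => by
    funext j; fin_cases j <;> rfl
  have e1 : ∀ r, Function.update ![μ, ν] 1 r = ![μ, r] := fun r => by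
    funext j; fin_cases j <;> rfl
  rw [e, Fin.sum_univ_two]
  simp only [e0, e1, cons_val_zero, cons_val_one]

theorem IsSymm.cov {T : Tensor 2 U} (hT : IsSymm T) (l : Fin d) :
    IsSymm fun J => SpinningParticle.cov B T (Fin.cons l J) := fun μ ν => by
  simp only [cov_two, hT μ ν, hT _ ν, hT μ]
  ring

theorem IsSymm.box {T : Tensor 2 U} (hT : IsSymm T) : IsSymm (SpinningParticle.box B T) :=
    fun μ ν => by
  have e : ∀ I, SpinningParticle.box B T I = ∑ α, ∑ β, B.invMetric α β *
      SpinningParticle.cov B (SpinningParticle.cov B T) (Fin.cons α (Fin.cons β I)) :=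
    fun I => rfl
  simp only [e, cov_cov_cons, ((hT.cov B _).cov B _) μ ν, (hT.cov B _) μ ν]

theorem IsSymm.riemannAct {T : Tensor 2 U} (hT : IsSymm T) :
    IsSymm (SpinningParticle.riemannAct B T) := fun μ ν => by
  have e : ∀ μ ν, SpinningParticle.riemannAct B T ![μ, ν] = ∑ α, ∑ β, ∑ α', ∑ β',
      B.riemann μ α ν β * B.invMetric α α' * B.invMetric β β' * T ![α', β'] := fun _ _ => rfl
  rw [e, e, sum_comm]
  refine sum_congr rfl fun α _ => sum_congr rfl fun β _ => ?_
  rw [sum_comm]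
  refine sum_congr rfl fun α' _ => sum_congr rfl fun β' _ => ?_
  rw [B.riemann_pair_symm, hT]
  ring

theorem symm2_hessian (f : Tensor 0 U) :
    symm2 (cov B (cov B f)) = (2 : ℂ) • cov B (cov B f) := by
  have e : ∀ I, cov B (cov B f) I = partialD (I 0) (partialD (I 1) (f ![]))
      - ∑ l, B.christoffel l (I 0) (I 1) * partialD l (f ![]) := fun I => by
    have e0 : ∀ J, cov B f J = partialD (J 0) (f ![]) := fun J => by
      have : cov B f J = partialD (J 0) (f (Fin.tail J)) - ∑ j : Fin 0, ∑ l,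
        B.christoffel l (J 0) (Fin.tail J j) * f (Function.update (Fin.tail J) j l) := rfl
      rw [this, Subsingleton.elim (Fin.tail J) ![], Fin.sum_univ_zero, sub_zero]
    have : cov B (cov B f) I = partialD (I 0) (cov B f (Fin.tail I)) - ∑ j : Fin 1, ∑ l,
        B.christoffel l (I 0) (Fin.tail I j) * cov B f (Function.update (Fin.tail I) j l) := rfl
    rw [this, Fin.sum_univ_one]
    simp only [e0]
    rfl
  funext I
  have e' : symm2 (cov B (cov B f)) I =
      cov B (cov B f) ![I 0, I 1] + cov B (cov B f) ![I 1, I 0] := rfl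
  have e2 : ((2 : ℂ) • cov B (cov B f)) I = cov B (cov B f) I + cov B (cov B f) I :=
    two_smul ℂ _
  rw [e', e2]
  simp only [e, cons_val_zero, cons_val_one, B.christoffel_symm _ (I 1) (I 0),
    partialD_comm (I 1) (I 0)]

variable (hB : B.IsRicciFlat) (m : ℝ)
include hB

theorem massiveQ_onShellField {h : Tensor 2 U} (hs : IsSymm h) (A : Tensor 1 U) (φ : Tensor 0 U) :
    massiveQ B m (onShellField B m (h, A, φ)) = residual B
      ((1 / 2 : ℂ) • (box B h - (m : ℂ) ^ 2 • h - symm2 (cov B (div B h)) + cov B (cov B (tr B h))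
        + (2 : ℂ) • riemannAct B h - ((m : ℂ) • symm2 (cov B A) + (2 : ℂ) • cov B (cov B φ))))
      (box B (tr B h) - (m : ℂ) ^ 2 • tr B h - div B (div B h)
        - ((2 * m : ℂ) • div B A + (2 : ℂ) • box B φ))
      (-(box B φ + ((m : ℂ) ^ 2 / 2) • tr B h + (m : ℂ) • div B A))
      ((-Complex.I) • (box B A - cov B (div B A) - (m : ℂ) • (cov B (tr B h) - div B h))) 0 0 := by
  have hd : ∀ f : Tensor 0 U, div B (cov B f) = box B f := fun f => rfl
  rw [onShellField, massiveQ_stringField B hB m hs]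
  simp only [auxVector, auxScalar, map_add, map_sub, map_smul, map_neg, hd]
  refine congr (congr (congr (congr (congr (congrArg _ ?_) ?_) ?_) ?_) ?_) ?_
  · simp only [symm2_hessian]
    module
  · module
  · module
  · module
  · module
  · module

end System

section Linear

variable {d : ℕ} {U : Opens (Fin d → ℝ)} (B : Background U)

theorem stringField_add {h h' : Tensor 2 U} (hs : IsSymm h) (hs' : IsSymm h')
    (v v' A A' : Tensor 1 U) (φ φ' aux aux' : Tensor 0 U) :
    stringField B (h + h') (v + v') (A + A') (φ + φ') (aux + aux') =
      stringField B h v A φ aux + stringField B h' v' A' φ' aux' := by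
  rw [stringField_eq B hs, stringField_eq B hs', stringField_eq B (hs.add hs'), map_add (tr B)]
  simp only [ten_add, ten_sub, ten_smul]
  module

theorem stringField_smul {h : Tensor 2 U} (hs : IsSymm h) (z : ℂ) (v A : Tensor 1 U)
    (φ aux : Tensor 0 U) : stringField B (z • h) (z • v) (z • A) (z • φ) (z • aux) =
      z • stringField B h v A φ aux := by
  rw [stringField_eq B hs, stringField_eq B (hs.smul z), map_smul (tr B)]
  simp only [ten_sub, ten_smul]
  module

variable (m : ℝ)

theorem onShellField_add {p q : Fields U} (hp : IsSymm p.1) (hq : IsSymm q.1) :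
    onShellField B m (p + q) = onShellField B m p + onShellField B m q := by
  have e1 : auxVector B m (p + q) = auxVector B m p + auxVector B m q := by
    simp only [auxVector, Prod.fst_add, Prod.snd_add, map_add]
    module
  have e2 : auxScalar B m (p + q) = auxScalar B m p + auxScalar B m q := by
    simp only [auxScalar, Prod.fst_add, Prod.snd_add, map_add]
    module
  rw [onShellField, e1, e2]
  exact stringField_add B hp hq _ _ _ _ _ _ _ _

theorem onShellField_smul {p : Fields U} (hp : IsSymm p.1) (z : ℂ) :
    onShellField B m (z • p) = z • onShellField B m p := by
  have e1 : auxVector B m (z • p) = z • auxVector B m p := by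
    simp only [auxVector, Prod.smul_fst, Prod.smul_snd, map_smul]
    module
  have e2 : auxScalar B m (z • p) = z • auxScalar B m p := by
    simp only [auxScalar, Prod.smul_fst, Prod.smul_snd, map_smul]
    module
  rw [onShellField, e1, e2]
  exact stringField_smul B hp z _ _ _ _

variable (hB : B.IsRicciFlat)
include hB

theorem massiveQ_stringField_eq_zero_iff_onShell {h : Tensor 2 U} (hs : IsSymm h)
    (v A : Tensor 1 U) (φ aux : Tensor 0 U) : massiveQ B m (stringField B h v A φ aux) = 0 ↔
      v = auxVector B m (h, A, φ) ∧ aux = auxScalar B m (h, A, φ) ∧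
        massiveQ B m (onShellField B m (h, A, φ)) = 0 := by
  refine ⟨fun e => ?_, fun ⟨e1, e2, e⟩ => by rwa [e1, e2]⟩
  have e' := e
  rw [massiveQ_stringField B hB m hs] at e'
  obtain ⟨-, -, -, -, hu, hw⟩ := residual_eq_zero B (((((hs.box B).sub (hs.smul _)).add
    ((hs.riemannAct B).smul _)).smul _).sub ((isSymm_symm2 _).smul _)) e'
  have hu' := (smul_eq_zero.1 hu).resolve_left Complex.I_ne_zero
  have h1 : v = auxVector B m (h, A, φ) := by
    simp only [map_sub, map_smul] at hu'
    simp only [auxVector]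
    linear_combination (norm := module) (-2 : ℂ) • hu'
  have h2 : aux = auxScalar B m (h, A, φ) := by
    simp only [auxScalar]
    linear_combination (norm := module) hw
  refine ⟨h1, h2, ?_⟩
  rw [h1, h2] at e
  exact e

theorem massiveQ_onShellField_eq_zero_iff {h : Tensor 2 U} (hs : IsSymm h) (A : Tensor 1 U)
    (φ : Tensor 0 U) :
    massiveQ B m (onShellField B m (h, A, φ)) = 0 ↔ StuckelbergSystem B m h A φ := by
  rw [massiveQ_onShellField B hB m hs]
  refine ⟨fun e => ?_, fun e => ?_⟩
  · have ha : IsSymm (box B h - (m : ℂ) ^ 2 • h - symm2 (cov B (div B h)) + cov B (cov B (tr B h))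
        + (2 : ℂ) • riemannAct B h
        - ((m : ℂ) • symm2 (cov B A) + (2 : ℂ) • cov B (cov B φ))) := by
      have hh : ∀ f : Tensor 0 U, cov B (cov B f) = (1 / 2 : ℂ) • symm2 (cov B (cov B f)) :=
        fun f => by rw [symm2_hessian]; module
      rw [hh (tr B h), hh φ]
      exact ((((((hs.box B).sub (hs.smul _)).sub (isSymm_symm2 _)).add
        ((isSymm_symm2 _).smul _)).add ((hs.riemannAct B).smul _))).sub
          (((isSymm_symm2 _).smul _).add (((isSymm_symm2 _).smul _).smul _))
    obtain ⟨ha, hp, hq, he, -, -⟩ := residual_eq_zero B (ha.smul _) e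
    exact ⟨sub_eq_zero.1 ((smul_eq_zero.1 ha).resolve_left (by norm_num)), sub_eq_zero.1 hp,
      sub_eq_zero.1 ((smul_eq_zero.1 he).resolve_left (neg_ne_zero.2 Complex.I_ne_zero)),
      neg_eq_zero.1 hq⟩
  · rw [e.graviton, e.trace, e.vector, e.scalar]
    simp only [sub_self, smul_zero, neg_zero, residual, ten_zero, add_zero]

theorem massiveQ_stringField_eq_zero_iff {h : Tensor 2 U} (hs : IsSymm h)
    (v A : Tensor 1 U) (φ aux : Tensor 0 U) : massiveQ B m (stringField B h v A φ aux) = 0 ↔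
      v = auxVector B m (h, A, φ) ∧ aux = auxScalar B m (h, A, φ) ∧
        StuckelbergSystem B m h A φ := by
  rw [massiveQ_stringField_eq_zero_iff_onShell B m hB hs, massiveQ_onShellField_eq_zero_iff B m hB hs]

/-- The trace of the graviton equation is a combination of the scalar ones, because `Q` commutes
with the trace constraint. -/
theorem tr_graviton {h : Tensor 2 U} (hs : IsSymm h) (A : Tensor 1 U) (φ : Tensor 0 U) :
    tr B (box B h - (m : ℂ) ^ 2 • h - symm2 (cov B (div B h)) + cov B (cov B (tr B h))
        + (2 : ℂ) • riemannAct B h - ((m : ℂ) • symm2 (cov B A) + (2 : ℂ) • cov B (cov B φ))) =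
      (2 : ℂ) • (box B (tr B h) - (m : ℂ) ^ 2 • tr B h - div B (div B h)
        - ((2 * m : ℂ) • div B A + (2 : ℂ) • box B φ)
        + (box B φ + ((m : ℂ) ^ 2 / 2) • tr B h + (m : ℂ) • div B A)) := by
  have h0 : (traceT 0 1 : Op 2 1 U) (massiveQ B m (onShellField B m (h, A, φ))) = 0 := by
    have e := LinearMap.congr_fun (commute_traceT_brst (n := 2) (k := 1) B 0 1 (1 / 2) m).eq
      (onShellField B m (h, A, φ))
    rw [mul_apply, mul_apply] at e
    refine e.trans ?_
    rw [(mem_reducedGh_iff.1 (stringField_mem_reducedGh B hs _ _ _ _) :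
      _ ∧ (traceT 0 1 : Op 2 1 U) (onShellField B m (h, A, φ)) = 0).2, map_zero]
  rw [massiveQ_onShellField B hB m hs] at h0
  generalize box B h - (m : ℂ) ^ 2 • h - symm2 (cov B (div B h)) + cov B (cov B (tr B h))
        + (2 : ℂ) • riemannAct B h
        - ((m : ℂ) • symm2 (cov B A) + (2 : ℂ) • cov B (cov B φ)) = a at h0 ⊢
  generalize box B (tr B h) - (m : ℂ) ^ 2 • tr B h - div B (div B h)
        - ((2 * m : ℂ) • div B A + (2 : ℂ) • box B φ) = p at h0 ⊢
  generalize box B φ + ((m : ℂ) ^ 2 / 2) • tr B h + (m : ℂ) • div B A = q at h0 ⊢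
  simp only [residual, map_add, traceT_ten_ketPP B isRef_cvac, traceT_ten_ketTT isRef_cvac,
    traceT_ten_ketGB isRef_cvac, traceT_ten_ketTP B isRef_cvac, ten_zero, map_zero] at h0
  have h1 : fn (tr B a ![]) (cvac d U) = fn (((2 : ℂ) • (p + q)) ![]) (cvac d U) := by
    rw [map_smul (tr B)] at h0
    simp only [Pi.smul_apply, Pi.add_apply, Pi.neg_apply, fn_smul, fn_add, fn_neg,
      LinearMap.smul_apply, LinearMap.add_apply, LinearMap.neg_apply] at h0 ⊢
    linear_combination (norm := module) (-1 : ℂ) • h0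
  funext I
  rw [Subsingleton.elim I ![]]
  exact fn_cvac_injective h1

theorem stuckelbergSystem_iff {h : Tensor 2 U} (hs : IsSymm h) (A : Tensor 1 U)
    (φ : Tensor 0 U) : StuckelbergSystem B m h A φ ↔ (h, A, φ) ∈ lmgSolutions B m := by
  refine ⟨fun e => ⟨hs, e.graviton, e.vector, ?_⟩, fun ⟨_, h1, h2, h3⟩ => ?_⟩
  · linear_combination (norm := module) e.trace + (2 : ℂ) • e.scalar
  · have ht := tr_graviton B m hB hs A φ
    rw [h1, sub_self, map_zero] at ht
    have h3 : box B (tr B h) - div B (div B h) = 0 := h3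
    have h4 : box B φ + ((m : ℂ) ^ 2 / 2) • tr B h + (m : ℂ) • div B A = 0 := by
      linear_combination (norm := module) h3 + (1 / 2 : ℂ) • ht
    exact ⟨h1, by linear_combination (norm := module) h3 - (2 : ℂ) • h4, h2, h4⟩

end Linear

section Cohomology

variable {U : Opens (Fin 4 → ℝ)} (B : Background U) (m : ℝ) (hB : B.IsRicciFlat)
include hB

theorem massiveQ_massiveQ_of_isRicciFlat {Ψ : Wave 2 1 U} (h : Ψ ∈ reduced 2 1 U) :
    massiveQ B m (massiveQ B m Ψ) = 0 := by
  have hE : B.IsEinstein := ⟨0, fun μ ν => by rw [hB, Complex.ofReal_zero, zero_smul]⟩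
  have hR : B.scalarCurvature = 0 := by simp [Background.scalarCurvature, hB _ _]
  have e := brst_brst_of_isEinstein' (k := 1) B hE (m := m) (by simp) h
  rw [hR, fn_zero, LinearMap.zero_apply, smul_zero] at e
  rw [massiveQ]
  convert e

theorem massiveQ_gaugeState_eq (ε : Tensor 1 U) (Sg : Tensor 0 U) :
    massiveQ B m (gaugeState B ε Sg) = onShellField B m (gauge B m (ε, Sg)) ∧
      gauge B m (ε, Sg) ∈ lmgSolutions B m := by
  have e := massiveQ_massiveQ_of_isRicciFlat B m hB (gaugeState_mem_reducedGh B ε Sg).1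
  rw [massiveQ_gaugeState B hB, massiveQ_stringField_eq_zero_iff B m hB (isSymm_symm2 _)] at e
  obtain ⟨e1, e2, e3⟩ := e
  refine ⟨?_, (stuckelbergSystem_iff B m hB (isSymm_symm2 _) _ _).1 e3⟩
  rw [massiveQ_gaugeState B hB, e1, e2]
  rfl

theorem onShellField_mem_cocycles {p : Fields U} (hp : p ∈ lmgSolutions B m) :
    onShellField B m p ∈ cocycles (massiveQ B m) 0 := by
  obtain ⟨h, A, φ⟩ := p
  have hs : IsSymm h := hp.1
  refine Submodule.mem_inf.2 ⟨?_, LinearMap.mem_ker.2 ?_⟩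
  · rw [onShellField]
    exact stringField_mem_reducedGh B hs _ _ _ _
  · rw [massiveQ_onShellField_eq_zero_iff B m hB hs, stuckelbergSystem_iff B m hB hs]
    exact hp

/-- The isomorphism between solutions modulo gauge transformations and the BRST cohomology. -/
theorem exists_cohomology_equiv :
    ∃ F : (lmgSolutions B m ⧸ (LinearMap.range (gauge B m)).submoduleOf (lmgSolutions B m))
        ≃ₗ[ℂ] Cohomology (massiveQ B m) 0,
      ∀ s : lmgSolutions B m, ∃ hs : onShellField B m s.1 ∈ cocycles (massiveQ B m) 0,
        F (Submodule.Quotient.mk s) = Submodule.Quotient.mk ⟨onShellField B m s.1, hs⟩ := by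
  let L : lmgSolutions B m →ₗ[ℂ] cocycles (massiveQ B m) 0 :=
    { toFun := fun s => ⟨onShellField B m s.1, onShellField_mem_cocycles B m hB s.2⟩
      map_add' := fun s t => Subtype.ext (onShellField_add B m s.2.1 t.2.1)
      map_smul' := fun z s => Subtype.ext (onShellField_smul B m s.2.1 z) }
  let G := ((coboundaries (massiveQ B m) 0).submoduleOf (cocycles (massiveQ B m) 0)).mkQ ∘ₗ L
  have hk : (LinearMap.range (gauge B m)).submoduleOf (lmgSolutions B m) = LinearMap.ker G := by
    ext s
    rw [LinearMap.mem_ker, LinearMap.comp_apply, Submodule.mkQ_apply,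
      Submodule.Quotient.mk_eq_zero, Submodule.submoduleOf, Submodule.submoduleOf, Submodule.mem_comap, Submodule.mem_comap]
    refine ⟨fun ⟨⟨ε, Sg⟩, h⟩ => ?_, fun ⟨Λ, h, e⟩ => ?_⟩
    · refine ⟨gaugeState B ε Sg, gaugeState_mem_reducedGh B ε Sg, ?_⟩
      exact (massiveQ_gaugeState_eq B m hB ε Sg).1.trans (congrArg _ h)
    · obtain ⟨ε, Sg, rfl⟩ := (mem_reducedGh_neg_one_iff B).1 h
      have e' := (massiveQ_gaugeState_eq B m hB ε Sg).1.symm.trans e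
      obtain ⟨h1, h2, h3⟩ := stringField_injective B (isSymm_symm2 _) s.2.1 e'
      exact ⟨(ε, Sg), Prod.ext h1 (Prod.ext h2 h3)⟩
  have hG : Function.Surjective G := by
    refine (Submodule.mkQ_surjective _).comp fun Ψ => ?_
    obtain ⟨h, v, A, φ, aux, hs, e⟩ := (mem_reducedGh_zero_iff B).1 Ψ.2.1
    have hQ : massiveQ B m (stringField B h v A φ aux) = 0 := e ▸ Ψ.2.2
    obtain ⟨e1, e2, e3⟩ := (massiveQ_stringField_eq_zero_iff B m hB hs v A φ aux).1 hQ
    refine ⟨⟨(h, A, φ), (stuckelbergSystem_iff B m hB hs A φ).1 e3⟩, Subtype.ext ?_⟩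
    rw [e, e1, e2]
    rfl
  exact ⟨(Submodule.quotEquivOfEq _ _ hk).trans (G.quotKerEquivOfSurjective hG),
    fun s => ⟨onShellField_mem_cocycles B m hB s.2, rfl⟩⟩

end Cohomology

section Obstruction

variable {U : Opens (Fin 4 → ℝ)} (B : Background U)

theorem massiveQ_massiveQ_stringField (hB : B.IsEinstein) (m : ℝ) {h : Tensor 2 U}
    (v A ζ : Tensor 1 U) (φ aux Φ : Tensor 0 U) (hs : IsSymm h) :
    massiveQ B m (massiveQ B m (stringField B h v A φ aux + gaugeState B ζ Φ)) =
      (-(1 / 2) : ℂ) • (fn (B.scalarCurvature * aux ![]) *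
          (theta 0 0 * gam 1 - theta 1 0 * gam 0) * cGhost
        + fn (B.scalarCurvature * Φ ![]) *
          (theta 0 0 * gam 1 - theta 1 0 * gam 0) : Op 2 1 U) vacuum := by
  have hm : stringField B h v A φ aux + gaugeState B ζ Φ ∈ reduced 2 1 U :=
    Submodule.add_mem _ (stringField_mem_reducedGh B hs v A φ aux).1
      (gaugeState_mem_reducedGh B ζ Φ).1
  have hξ : slotCoef B (stringField B h v A φ aux + gaugeState B ζ Φ) (.inr 0) (.inr 2) =
      fn (aux ![]) (cvac 4 U) + fn (Φ ![]) (vac 4 U) := by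
    have hv : IsRef (vac 4 U) := isRef_vac
    have hc : IsRef (cvac 4 U) := isRef_cvac
    simp [stringField_eq B hs, gaugeState_eq, slotCoef_add, slotCoef_sub, slotCoef_smul,
      slotCoef_ketPP B hv, slotCoef_ketGB B hv, slotCoef_ketPB B hv, slotCoef_ketPB B hc,
      slotCoef_ketTP B hv, slotCoef_ketTT B hv, slotCoef_ketTB B hc, slotCoef_ketTB B hv]
  have e := brst_brst_of_isEinstein' (k := 1) B hB (m := m) (by simp) hm
  generalize hΨ : stringField B h v A φ aux + gaugeState B ζ Φ = Ψ at e hm hξ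
  have hanti : ∀ i j, thetaBar i 0 (gamBar j Ψ) = -thetaBar j 0 (gamBar i Ψ) :=
    antisymm_of_mem_reduced hm (X := fun i => thetaBar i 0) (fun i j l => young_thetaBar i j l 0)
      young_gamBar
  have hzero : ∀ i, thetaBar i 0 (gamBar i Ψ) = 0 := fun i => by
    linear_combination (norm := module) (1 / 2 : ℂ) • hanti i i
  have h01 : thetaBar 0 0 (gamBar 1 Ψ) = -(fn (aux ![]) (cvac 4 U) + fn (Φ ![]) (vac 4 U)) := by
    rw [← hξ, gamBar, LinearMap.neg_apply, map_neg]
    rfl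
  simp only [Fin.sum_univ_two, Finset.univ_unique, Fin.default_eq_zero,
    Finset.sum_singleton, hzero, hanti 1 0, h01, map_zero, zero_add, add_zero, neg_neg, map_neg,
    map_add] at e
  have hg : ∀ (f : Fn U) (i j : Fin 2) (Ω : Wave 2 1 U), fn B.scalarCurvature
      (gam i (theta j 0 (fn f Ω))) = fn (B.scalarCurvature * f) (theta j 0 (gam i Ω)) := by
    intro f i j Ω
    rw [theta_fn, gam_fn, fn_fn_apply]
    exact congrArg _ (LinearMap.congr_fun (CommutesWithEven.theta j 0 _).1.eq Ω)
  simp only [hg] at e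
  rw [massiveQ]
  refine Eq.trans (by convert e) ?_
  simp only [LinearMap.add_apply, LinearMap.sub_apply, mul_apply,
    map_sub]
  module

end Obstruction

section Converse

variable {k d : ℕ} {U : Opens (Fin d → ℝ)} (B : Background U)

theorem obstruction_eq_zero {n : ℕ} {κ : ℂ} {m : ℝ} {Λ : Wave n k U} (hb : bGhost Λ = 0)
    (h : brst B κ m (brst B κ m Λ) = 0) :
    (boldNabla B m * boldNabla B m + gamBarGam * hamiltonianD B κ m : Op n k U) Λ = 0 := by
  have hbb : (bGhost * boldNabla B m : Op n k U) = -(boldNabla B m * bGhost) :=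
    psiOdd_bGhost.boldNabla B bGhost_rho
  have hc : Commute (bGhost : Op n k U)
      (boldNabla B m * boldNabla B m + gamBarGam * hamiltonianD B κ m) := by
    refine Commute.add_right ?_ (Commute.mul_right (CommutesWithEven.oddDer _).gamBarGam.symm
      (psiOdd_bGhost.hamiltonianD B κ m))
    rw [Commute, SemiconjBy, ← mul_assoc, hbb, neg_mul, mul_assoc, hbb, mul_neg, neg_neg, mul_assoc]
  have hc' := LinearMap.congr_fun hc.eq Λ
  have e := LinearMap.congr_fun (brst_mul_self (n := n) (k := k) B κ m) Λ
  generalize (boldNabla B m * boldNabla B m + gamBarGam * hamiltonianD B κ m : Op n k U) = Z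
    at hc' e ⊢
  rw [LinearMap.add_apply, mul_apply (cGhost : Op n k U), mul_apply, h] at e
  rw [mul_apply, mul_apply, hb, map_zero] at hc'
  have e1 : (cGhost : Op n k U) (Z Λ) = 0 := by
    have e2 := congrArg (cGhost : Op n k U) e
    rw [map_zero, map_add, cGhost_cGhost_apply, add_zero] at e2
    exact e2.symm
  have e2 := bGhost_cGhost_apply (Z Λ)
  rw [e1, map_zero, hc', map_zero, sub_zero] at e2
  exact e2.symm

theorem ketPB_mem_reduced {Ω : Wave 2 k U} (hΩ : IsRef Ω) (I) : ketPB B Ω I ∈ reduced 2 k U := by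
  have h := ket_mem_youngKer (isCreation_psi B (I 0)) isCreation_bet hΩ
  refine mem_reduced_two_iff.2 ⟨h.1, h.2, ?_⟩
  have h := traceT_ket (isTraceDual_psi B (I 0)) isTraceDual_bet hΩ
    (fun i => hΩ.betBar i) fun i => by
      rw [psiBar_bet_apply, hΩ.psiBar, map_zero]
  exact h.trans (smul_zero _)

theorem psiPsiBar_ketPB {Ω : Wave 2 k U} (hΩ : IsRef Ω) (a b τ : Fin d) :
    psiPsiBar B a b (ketPB B Ω ![τ]) = fn (B.invMetric b τ) (ketPB B Ω ![a]) := by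
  simp [psiPsiBar_apply, Fin.sum_univ_two, ketPB, ket, psiV, psiBar_psi_apply, psiBar_bet_apply,
    hΩ.psiBar, psi_fn]

theorem ketPG_sum_eq_zero {T : Fin d → Fn U}
    (h : ∑ a, fn (T a) (ketPG B (vacuum : Wave 2 k U) ![a]) = 0) (ν : Fin d) : T ν = 0 := by
  have hΩ : IsRef (vacuum : Wave 2 k U) := isRef_vacuum
  have hb : ∀ i j μ, betBar i (psi B j μ (vacuum : Wave 2 k U)) = 0 := fun i j μ => by
    have e := LinearMap.congr_fun (CommutesWithEven.psi (k := k) B j μ (Sum.inl i)).2.eq vacuum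
    exact e.trans (by rw [mul_apply]; erw [hΩ.betBar]; exact map_zero _)
  have e1 : ∀ a, betBar 1 (ketPG B (vacuum : Wave 2 k U) ![a]) = psi B 0 a vacuum := fun a => by
    simp [ketPG, ket, psiV, psi_gam_apply, betBar_gam_apply, hb]
  have hf : ∀ (f : Fn U) (Φ : Wave 2 k U), betBar 1 (fn f Φ) = fn f (betBar 1 Φ) := fun f Φ =>
    LinearMap.congr_fun ((CommutesWithEven.fn f) _).2.eq Φ
  have h2 := congrArg (fun Φ => psiLow B 0 ν (betBar 1 Φ)) h
  have hl : psiLow B 0 ν (vacuum : Wave 2 k U) = 0 := by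
    simp [psiLow, hΩ.psiDer]
  have e2 : ∀ a, psiLow B 0 ν (psi B 0 a (vacuum : Wave 2 k U)) =
      if ν = a then vacuum else 0 := fun a => by
    have e := LinearMap.congr_fun (psiLow_psi (k := k) B (0 : Fin 2) 0 ν a) vacuum
    rw [LinearMap.sub_apply, mul_apply, mul_apply, hl, map_zero, sub_zero]
      at e
    rw [e]
    split_ifs with h h' h' <;> first | rfl | simp_all
  have hp : ∀ (f : Fn U) (Φ : Wave 2 k U), psiLow B 0 ν (fn f Φ) = fn f (psiLow B 0 ν Φ) :=
    fun f Φ => LinearMap.congr_fun (commute_fn_psiLow B f _ _).symm.eq Φ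
  simp only [map_sum, hf, e1, hp, e2, map_zero] at h2
  refine fn_vacuum_eq_zero (n := 2) (k := k) (Eq.trans ?_ h2)
  rw [sum_eq_single ν]
  · rw [if_pos rfl]
  · intro b _ hb
    rw [if_neg hb.symm, map_zero]
  · simp

/-- On the vector states of ghost number `-1`, nilpotency forces an Einstein metric. -/
theorem ricci_eq_of_nilpotentOnReduced {m : ℝ} (hm : (m : ℂ) ^ 2 * k = (m : ℂ) ^ 2)
    (h : NilpotentOnReduced (brst B (1 / 2) m : Op 2 k U)) (a σ : Fin d) :
    B.ricci a σ = ((1 / 4 : ℂ) • B.scalarCurvature) * B.metric a σ := by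
  have hΩ : IsRef (vacuum : Wave 2 k U) := isRef_vacuum
  have key : ∀ τ a, (1 / 2 : ℂ) • (if a = τ then B.scalarCurvature else 0)
      - (2 : ℂ) • ∑ b, B.ricci a b * B.invMetric b τ = 0 := by
    intro τ
    refine ketPG_sum_eq_zero (k := k) B ?_
    have hr := ketPB_mem_reduced B hΩ ![τ]
    have hz := obstruction_eq_zero B (Λ := ketPB B (vacuum : Wave 2 k U) ![τ])
      (by rw [bGhost_ketPB, bGhost_vacuum, ketPB, ket_zero, neg_zero]) (h _ hr)
    rw [boldNabla_sq_add_apply B hm _ hr, bilOp_apply] at hz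
    simp only [psiPsiBar_ketPB B hΩ, map_sum, gamBarGam_fn, gamBarGam_ketPB B hΩ, fn_fn_apply,
      map_neg] at hz
    simp only [fn_sub, fn_smul, fn_sum, LinearMap.sub_apply, LinearMap.smul_apply,
      LinearMap.sum_apply, sum_sub_distrib, ← smul_sum]
    have e : ∑ a, fn (if a = τ then B.scalarCurvature else 0)
        (ketPG B (vacuum : Wave 2 k U) ![a]) = fn B.scalarCurvature (ketPG B vacuum ![τ]) := by
      rw [sum_eq_single τ]
      · rw [if_pos rfl]
      · intro b _ hb
        rw [if_neg hb, fn_zero, LinearMap.zero_apply]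
      · simp
    rw [e]
    simp only [sum_neg_distrib] at hz
    linear_combination (norm := module) (-1 : ℂ) • hz
  have e1 : ∑ τ, (∑ b, B.ricci a b * B.invMetric b τ) * B.metric τ σ = B.ricci a σ := by
    simp only [sum_mul, mul_assoc]
    rw [sum_comm]
    simp only [← mul_sum, B.sum_invMetric_mul_metric]
    simp
  have e2 : ∀ τ, ∑ b, B.ricci a b * B.invMetric b τ =
      (1 / 4 : ℂ) • if a = τ then B.scalarCurvature else 0 := fun τ => by
    linear_combination (norm := module) (-(1 / 2) : ℂ) • key τ a
  rw [← e1]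
  simp only [e2, smul_mul_assoc, ite_mul, zero_mul]
  rw [← smul_sum]
  simp

theorem isRicciFlat_of_nilpotentOnReduced {m : ℝ}
    (h : NilpotentOnReduced (massiveQ B m)) : B.IsRicciFlat := by
  have hm : (m : ℂ) ^ 2 * ((1 : ℕ) : ℂ) = (m : ℂ) ^ 2 := by simp
  have hΩ : IsRef (vac d U) := isRef_vac
  have hR : B.scalarCurvature = 0 := by
    have hr : ketTB 0 (vac d U) ![] ∈ reduced 2 1 U := by
      have h := gaugeState_mem_reducedGh B (0 : Tensor 1 U) 1
      rw [gaugeState_eq, ten_zero, smul_zero, zero_add, ten, sum_fin_zero_arrow, Pi.one_apply,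
        fn_one] at h
      exact h.1
    have hz := obstruction_eq_zero B (Λ := ketTB 0 (vac d U) ![])
      (by rw [bGhost_ketTB, bGhost_vacuum, ketTB, ket_zero, neg_zero]) (h _ hr)
    have hp : ∀ b i, psiBar B i b (ketTB 0 (vac d U) ![]) = 0 := fun b i => by
      simp [ketTB, ket, thetaV, psiBar_theta_apply, psiBar_bet_apply, hΩ.psiBar]
    rw [boldNabla_sq_add_apply B hm _ hr, bilOp_apply] at hz
    simp only [psiPsiBar_apply, hp, map_zero, sum_const_zero, smul_zero, sub_zero,
      gamBarGam_fn, gamBarGam_ketTB hΩ] at hz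
    have hz' : ten (ketTG 0 (vac d U)) (fun _ => B.scalarCurvature) = 0 := by
      rw [ten, sum_fin_zero_arrow]
      rw [map_neg] at hz
      linear_combination (norm := module) (-2 : ℂ) • hz
    have e := slotCoef_ketTG B hΩ (.inr 0) (.inr 1) fun _ => B.scalarCurvature
    rw [hz', slotCoef_zero] at e
    simp only [if_true] at e
    exact fn_vacuum_eq_zero (n := 2) (k := 1) (by simpa using e.symm)
  intro μ ν
  rw [ricci_eq_of_nilpotentOnReduced B hm h, hR, smul_zero, zero_mul]

end Converse

section Reality

variable {d : ℕ} {U : Opens (Fin d → ℝ)}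

variable (U) in
/-- The real smooth functions. -/
def realFn : Subring (Fn U) where
  carrier := {f | ∀ x, (f.1 x).im = 0}
  mul_mem' := fun {f g} hf hg x => by rw [Fn.coe_mul, Complex.mul_im, hf x, hg x]; ring
  one_mem' := fun _ => rfl
  add_mem' := fun {f g} hf hg x => by rw [Fn.coe_add, Complex.add_im, hf x, hg x]; ring
  zero_mem' := fun _ => rfl
  neg_mem' := fun {f} hf x => by
    have e : (-f).1 x = -f.1 x := rfl
    rw [e, Complex.neg_im, hf x, neg_zero]

theorem smul_mem_realFn {f : Fn U} (hf : f ∈ realFn U) {z : ℂ} (hz : z.im = 0) :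
    z • f ∈ realFn U := fun x => by
  have e : (z • f).1 x = z * f.1 x := rfl
  rw [e, Complex.mul_im, hz, hf x]
  ring

theorem partialD_mem_realFn {f : Fn U} (hf : f ∈ realFn U) (μ : Fin d) :
    partialD μ f ∈ realFn U := fun x => by
  have h := Complex.imCLM.hasFDerivAt.comp (x : Fin d → ℝ)
    (extendZero_differentiableAt f x).hasFDerivAt
  have e : (Complex.imCLM ∘ extendZero f.1 : (Fin d → ℝ) → ℝ) =ᶠ[nhds (x : Fin d → ℝ)]
      fun _ => (0 : ℝ) :=
    Filter.eventuallyEq_of_mem (U.isOpen.mem_nhds x.2) fun y hy => by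
      have := extendZero_apply f.1 ⟨y, hy⟩
      rw [Function.comp_apply, this]
      exact hf _
  have h0 := h.unique ((hasFDerivAt_const (0 : ℝ) (x : Fin d → ℝ)).congr_of_eventuallyEq e)
  rw [partialD_apply]
  exact congrArg (fun L : (Fin d → ℝ) →L[ℝ] ℝ => L (Pi.single μ 1)) h0

theorem eta_im (a : Fin d) : (eta a).im = 0 := by
  unfold eta
  split_ifs <;> simp

variable (B : Background U)

theorem coframe_mem_realFn (a μ : Fin d) : B.coframe a μ ∈ realFn U := B.real a μ

theorem frame_mem_realFn (μ a : Fin d) : B.frame μ a ∈ realFn U := fun x => by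
  let N : Matrix (Fin d) (Fin d) ℝ := fun a μ => ((B.coframe a μ).1 x).re
  let M : Matrix (Fin d) (Fin d) ℝ := fun μ a => ((B.frame μ a).1 x).re
  let P : Matrix (Fin d) (Fin d) ℝ := fun μ a => ((B.frame μ a).1 x).im
  let ev : Fn U →+ ℂ := ⟨⟨fun f => f.1 x, rfl⟩, fun _ _ => rfl⟩
  have h : ∀ μ ν, ∑ a, (B.frame μ a).1 x * (B.coframe a ν).1 x = if μ = ν then 1 else 0 :=
    fun μ ν => by
      have h := congrArg ev (congrFun (congrFun B.inverse μ) ν)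
      rw [Matrix.mul_apply, map_sum, Matrix.one_apply] at h
      refine h.trans ?_
      split_ifs <;> rfl
  have h1 : M * N = 1 := Matrix.ext fun μ ν => by
    have e := congrArg Complex.re (h μ ν)
    rw [Complex.re_sum] at e
    simp only [Complex.mul_re, B.real, mul_zero, sub_zero] at e
    rw [Matrix.mul_apply, Matrix.one_apply]
    refine e.trans ?_
    split_ifs <;> rfl
  have h2 : P * N = 0 := Matrix.ext fun μ ν => by
    have e := congrArg Complex.im (h μ ν)
    rw [Complex.im_sum] at e
    simp only [Complex.mul_im, B.real, mul_zero, zero_add] at e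
    rw [Matrix.mul_apply, Matrix.zero_apply]
    refine e.trans ?_
    split_ifs <;> rfl
  have h3 : P = 0 := by
    rw [← mul_one P, ← mul_eq_one_comm.1 h1, ← mul_assoc, h2, zero_mul]
  exact congrFun (congrFun h3 μ) a

theorem metric_mem_realFn (μ ν : Fin d) : B.metric μ ν ∈ realFn U :=
  sum_mem fun _ _ => smul_mem_realFn
    (mul_mem (coframe_mem_realFn B _ _) (coframe_mem_realFn B _ _)) (eta_im _)

theorem invMetric_mem_realFn (μ ν : Fin d) : B.invMetric μ ν ∈ realFn U :=
  sum_mem fun _ _ => smul_mem_realFn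
    (mul_mem (frame_mem_realFn B _ _) (frame_mem_realFn B _ _)) (eta_im _)

theorem christoffel_mem_realFn (ρ μ ν : Fin d) : B.christoffel ρ μ ν ∈ realFn U := by
  have h := fun a b c => partialD_mem_realFn (metric_mem_realFn B a b) c
  exact smul_mem_realFn (sum_mem fun _ _ => mul_mem (invMetric_mem_realFn B _ _)
    (sub_mem (add_mem (h _ _ _) (h _ _ _)) (h _ _ _))) (by simp)

theorem ricci_mem_realFn (μ ν : Fin d) : B.ricci μ ν ∈ realFn U := by
  have h := christoffel_mem_realFn B
  exact sum_mem fun _ _ => add_mem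
    (sub_mem (partialD_mem_realFn (h _ _ _) _) (partialD_mem_realFn (h _ _ _) _))
    (sum_mem fun _ _ => sub_mem (mul_mem (h _ _ _) (h _ _ _)) (mul_mem (h _ _ _) (h _ _ _)))

theorem scalarCurvature_mem_realFn : B.scalarCurvature ∈ realFn U :=
  sum_mem fun _ _ => sum_mem fun _ _ => mul_mem (invMetric_mem_realFn B _ _) (ricci_mem_realFn B _ _)

theorem exists_eq_smul_one_of_partialD_eq_zero (hU : IsPreconnected (U : Set (Fin d → ℝ)))
    {f : Fn U} (hf : f ∈ realFn U) (h : ∀ μ, partialD μ f = 0) :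
    ∃ c : ℝ, f = (c : ℂ) • (1 : Fn U) := by
  rcases (U : Set (Fin d → ℝ)).eq_empty_or_nonempty with hE | ⟨x₀, hx₀⟩
  · exact ⟨0, Fn.ext fun x => (hE ▸ x.2 : (x : Fin d → ℝ) ∈ (∅ : Set (Fin d → ℝ))).elim⟩
  · refine ⟨(f.1 ⟨x₀, hx₀⟩).re, Fn.ext fun x => ?_⟩
    have hc : f.1 x = f.1 ⟨x₀, hx₀⟩ := by
      rw [← extendZero_apply f.1 x, ← extendZero_apply f.1 ⟨x₀, hx₀⟩]
      refine U.isOpen.is_const_of_fderiv_eq_zero hU (fun y hy =>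
        (extendZero_differentiableAt f ⟨y, hy⟩).differentiableWithinAt) (fun y hy => ?_) x.2 hx₀
      refine ContinuousLinearMap.coe_injective (LinearMap.pi_ext' fun μ => LinearMap.ext_ring ?_)
      exact (partialD_apply μ f ⟨y, hy⟩).symm.trans (congrArg (fun g : Fn U => g.1 ⟨y, hy⟩) (h μ))
    have e : ((((f.1 ⟨x₀, hx₀⟩).re : ℝ) : ℂ) • (1 : Fn U)).1 x = ((f.1 ⟨x₀, hx₀⟩).re : ℂ) * 1 :=
      rfl
    rw [e, hc, mul_one]
    exact Complex.ext rfl (hf _)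

end Reality

theorem isEinstein_of_nilpotentOnReduced {U : Opens (Fin 4 → ℝ)} (B : Background U)
    (hU : IsPreconnected (U : Set (Fin 4 → ℝ))) (h : NilpotentOnReduced (masslessQ B)) :
    B.IsEinstein := by
  have hr := ricci_eq_of_nilpotentOnReduced (k := 0) B (m := 0) (by simp) h
  obtain ⟨c, hc⟩ := exists_eq_smul_one_of_partialD_eq_zero hU
    (smul_mem_realFn (scalarCurvature_mem_realFn B) (by simp))
    (B.partialD_eq_zero_of_ricci_eq (by norm_num) hr)
  exact ⟨c, fun μ ν => by rw [hr, hc, smul_mul_assoc, one_mul]⟩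

theorem massiveQ_mul_self_eq_zero_mass {d : ℕ} {U : Opens (Fin d → ℝ)} (B : Background U) (m : ℝ) :
    massiveQ B m * massiveQ B m = massiveQ B 0 * massiveQ B 0 := by
  rw [massiveQ, massiveQ, brst_mul_self, brst_mul_self, boldNabla_sq_add B (by simp),
    boldNabla_sq_add B (by simp), hamiltonianD_boldNabla_comm, hamiltonianD_boldNabla_comm B _ 0]

end

end SpinningParticle

open SpinningParticle in
theorem mainTheorem3 :
    -- the massive N = 4 model on an arbitrary background
    (∀ (U : Opens (Fin 4 → ℝ)) (B : Background U) (m : ℝ),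
      CommutesWithConstraints (massiveQ B m) ∧
      -- the general form of `Q²`, and its two obstructions, in which the mass drops out
      (massiveQ B m * massiveQ B m
        = boldNabla B m * boldNabla B m + gamBarGam * hamiltonianD B (1 / 2) m
          + cGhost * (hamiltonianD B (1 / 2) m * boldNabla B m
            - boldNabla B m * hamiltonianD B (1 / 2) m)) ∧
      ((boldNabla B m * boldNabla B m + gamBarGam * hamiltonianD B (1 / 2) m : Op 2 1 U)
        = (-(1 / 2) : ℂ) • (∑ μ, ∑ ν, superS B μ * superS B ν * curvOp B μ ν : Op 2 1 U)
          + gamBarGam * curvCoupling B (1 / 2)) ∧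
      ((hamiltonianD B (1 / 2) m * boldNabla B m
          - boldNabla B m * hamiltonianD B (1 / 2) m : Op 2 1 U)
        = hamiltonianD B (1 / 2) 0 * boldNabla B 0 - boldNabla B 0 * hamiltonianD B (1 / 2) 0) ∧
      (massiveQ B m * massiveQ B m = massiveQ B 0 * massiveQ B 0) ∧
      -- the leftover obstruction on Einstein backgrounds
      (B.IsEinstein →
        (∀ Ψ ∈ reduced 2 1 U,
          (boldNabla B m * boldNabla B m + gamBarGam * hamiltonianD B (1 / 2) m : Op 2 1 U) Ψ
            = (-(1 / 2) : ℂ) • (gamBarGam * (psiNumber B - 1) * fn B.scalarCurvature : Op 2 1 U) Ψ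
          ∧ (hamiltonianD B (1 / 2) m * boldNabla B m
              - boldNabla B m * hamiltonianD B (1 / 2) m : Op 2 1 U) Ψ = 0
          ∧ massiveQ B m (massiveQ B m Ψ)
            = (-(1 / 2) : ℂ) •
              (gamBarGam * (psiNumber B - 1) * fn B.scalarCurvature : Op 2 1 U) Ψ) ∧
        (∀ (h : Tensor 2 U) (v A ζ : Tensor 1 U) (φ aux Φ : Tensor 0 U), IsSymm h →
          massiveQ B m (massiveQ B m (stringField B h v A φ aux + gaugeState B ζ Φ))
            = (-(1 / 2) : ℂ) •
              (fn (B.scalarCurvature * aux ![]) *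
                  (theta 0 0 * gam 1 - theta 1 0 * gam 0) * cGhost
                + fn (B.scalarCurvature * Φ ![]) *
                  (theta 0 0 * gam 1 - theta 1 0 * gam 0) : Op 2 1 U) vacuum)) ∧
      -- nilpotency on the reduced space holds exactly on Ricci-flat backgrounds
      (NilpotentOnReduced (massiveQ B m) ↔ B.IsRicciFlat) ∧
      -- the string fields and the gauge parameters
      (∀ Ψ, Ψ ∈ reducedGh 2 1 U 0 ↔
        ∃ (h : Tensor 2 U) (v A : Tensor 1 U) (φ aux : Tensor 0 U),
          IsSymm h ∧ Ψ = stringField B h v A φ aux) ∧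
      (∀ Λ, Λ ∈ reducedGh 2 1 U (-1) ↔
        ∃ (ε : Tensor 1 U) (Sg : Tensor 0 U), Λ = gaugeState B ε Sg) ∧
      -- the BRST cohomology on Ricci-flat backgrounds
      (B.IsRicciFlat →
        (∀ (h : Tensor 2 U) (v A : Tensor 1 U) (φ aux : Tensor 0 U), IsSymm h →
          (massiveQ B m (stringField B h v A φ aux) = 0 ↔
            v = auxVector B m (h, A, φ) ∧ aux = auxScalar B m (h, A, φ) ∧
              StuckelbergSystem B m h A φ)) ∧
        (∀ (h : Tensor 2 U) (A : Tensor 1 U) (φ : Tensor 0 U), IsSymm h →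
          (StuckelbergSystem B m h A φ ↔ (h, A, φ) ∈ lmgSolutions B m)) ∧
        (∀ (ε : Tensor 1 U) (Sg : Tensor 0 U),
          massiveQ B m (gaugeState B ε Sg) = onShellField B m (gauge B m (ε, Sg))) ∧
        LinearMap.range (gauge B m) ≤ lmgSolutions B m ∧
        ∃ F : (lmgSolutions B m ⧸ (LinearMap.range (gauge B m)).submoduleOf (lmgSolutions B m))
            ≃ₗ[ℂ] Cohomology (massiveQ B m) 0,
          ∀ s : lmgSolutions B m, ∃ hs : onShellField B m s.1 ∈ cocycles (massiveQ B m) 0,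
            F (Submodule.Quotient.mk s) = Submodule.Quotient.mk ⟨onShellField B m s.1, hs⟩)) ∧
    -- the massless N = 4 model
    (∀ (U : Opens (Fin 4 → ℝ)) (B : Background U),
      (B.IsEinstein → IsConsistent (masslessQ B)) ∧
      (IsPreconnected (U : Set (Fin 4 → ℝ)) → NilpotentOnReduced (masslessQ B) → B.IsEinstein)) ∧
    -- the massive N = 2 model, in any dimension
    (∀ (d : ℕ), 1 ≤ d → ∀ (U : Opens (Fin d → ℝ)) (B : Background U) (m : ℝ),
      IsConsistent (massiveQ₂ B m)) := by
  refine ⟨fun U B m => ⟨brst_commutesWithConstraints B _ m,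
    by rw [massiveQ]; convert brst_mul_self (n := 2) (k := 1) B (1 / 2) m,
    boldNabla_sq_add B (by simp) _, ?_, massiveQ_mul_self_eq_zero_mass B m, fun hB => ⟨fun Ψ h =>
      ⟨boldNabla_sq_add_of_isEinstein B hB (by simp) h,
        hamiltonianD_boldNabla_comm_of_isEinstein B hB _ m h,
        by rw [massiveQ]; convert brst_brst_of_isEinstein (k := 1) B hB (m := m) (by simp) h⟩,
      fun h v A ζ φ aux Φ hs => massiveQ_massiveQ_stringField B hB m v A ζ φ aux Φ hs⟩,
    ⟨isRicciFlat_of_nilpotentOnReduced B,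
      fun hB Ψ h => massiveQ_massiveQ_of_isRicciFlat B m hB h⟩,
    fun Ψ => mem_reducedGh_zero_iff B, fun Λ => mem_reducedGh_neg_one_iff B, fun hB =>
    ⟨fun h v A φ aux hs => massiveQ_stringField_eq_zero_iff B m hB hs v A φ aux,
      fun h A φ hs => stuckelbergSystem_iff B m hB hs A φ,
      fun ε Sg => (massiveQ_gaugeState_eq B m hB ε Sg).1, ?_, exists_cohomology_equiv B m hB⟩⟩,
    fun U B => ⟨masslessQ_isConsistent B, isEinstein_of_nilpotentOnReduced B⟩,
    fun d _ U B m => massiveQ₂_isConsistent B m⟩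
  · rw [hamiltonianD_boldNabla_comm, hamiltonianD_boldNabla_comm B _ 0]
  · rintro _ ⟨⟨ε, Sg⟩, rfl⟩
    exact (massiveQ_gaugeState_eq B m hB ε Sg).2
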